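/- Let $T^k=(S^1)^k$, let $k\ge 0$, and let all manifolds be smooth, Hausdorff and second countable. **Standard actions.** A smooth $T^k$-action on an $n$-manifold $M$ is *standard* if every orbit has an invariant open neighbourhood which, after an automorphism of $T^k$ (written as $T^{k-l}\times T^l$), is equivariantly diffeomorphic to $T^{k-l}\times\mathbb{C}^l\times\mathbb{R}^m$, $k+l+m=n$, where $(s,u)\in T^{k-l}\times T^l$ acts by $(s,u)\cdot(\varphi,z,x)=(s\varphi,\,u_1z_1,\dots,u_lz_l,\,x)$. The quotient $\pi:M\to B=M/T^k$ carries the quotient topology and the smooth structure for which $f:B\to\mathbb{R}$ is smooth if and only if $f\circ\pi$ is smooth; with it $B$ is a manifold with corners. The *elliptic divisor* of the action is the ideal $I_{|D|}\subset C^\infty(M)$ of functions which in each such chart are smooth multiples of $|z_1|^2\cdots|z_l|^2$. The *elliptic tangent bundle* $\mathcal{A}_{|D|}\to M$ is the Lie algebroid whose sections are the vector fields $X$ with $X(I_{|D|})\subset I_{|D|}$. Write $\Omega^j(\mathcal{A}_{|D|})$ for its forms and $d$ for its Lie algebroid differential. **Correspondence space.** Let $M,\hat M$ carry standard $T^k$-actions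 with the same quotient $B$ (as a topological space with smooth functions), with quotient maps $\pi,\hat\pi$ and elliptic divisors $I_{|D|},I_{|\hat D|}$. Put $N=M\times_B\hat M\subset M\times\hat M$, and let $C^\infty(N)$ be the algebra of restrictions of smooth functions on $M\times\hat M$, and $I_N$ the ideal of smooth functions vanishing on $N$. Let $\mathcal{A}_{|D|}\boxtimes\mathcal{A}_{|\hat D|}$ be the Lie algebroid of vector fields on $M\times\hat M$ preserving the pull-backs of both divisors. The Lie algebroid $\mathcal{A}_{|D|}\times_B\mathcal{A}_{|\hat D|}\to N$ has as sections the restrictions to $N$ of those sections of $\mathcal{A}_{|D|}\boxtimes\mathcal{A}_{|\hat D|}$ that are tangent to $N$ (preserve $I_N$). It has projections $p,\hat p$ onto $\mathcal{A}_{|D|}$ and $\mathcal{A}_{|\hat D|}$. **$T$-duality.** Let $H\in\Omega^3(\mathcal{A}_{|D|})$ and $\hat H\in\Omega^3(\mathcal{A}_{|\hat D|})$ be closed and $T^k$-invariant. Then $(M,H)$ and $(\hat M,\hat H)$ are *$T$-dual* if there is a $T^{2k}$-invariant $F\in\Omega^2(\mathcal{A}_{|D|}\times_B\mathcal{A}_{|\hat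 D|})$ with $p^*H-\hat p^*\hat H=dF$ such that, at every point of $N$, $F$ restricts to a non-degenerate pairing between $\ker\hat p$ and $\ker p$. **The reduced Courant algebroid.** On $\mathcal{A}_{|D|}\oplus\mathcal{A}_{|D|}^*$ consider $$\langle X+\xi,Y+\eta\rangle=\tfrac12(\eta(X)+\xi(Y)),\qquad [\![X+\xi,Y+\eta]\!]_H=[X,Y]+\mathcal{L}_X\eta-\iota_Yd\xi+\iota_X\iota_YH.$$ The sections over $B$ of $(\mathcal{A}_{|D|}\oplus\mathcal{A}_{|D|}^*)/T^k$ are the $T^k$-invariant sections of $\mathcal{A}_{|D|}\oplus\mathcal{A}_{|D|}^*$, a $C^\infty(B)$-module on which these operations define a pairing with values in $C^\infty(B)$ and a bracket; the anchor to $TB$ is $a(X+\xi)f$ with $\pi^*(a(X+\xi)f)=X(\pi^*f)$ for $f\in C^\infty(B)$. Similarly for $\hat M$ and $\hat H$. **Theorem.** If $(M,H)$ and $(\hat M,\hat H)$ are $T$-dual, then there is an isomorphism of Courant algebroids over $B$ $$(\mathcal{A}_{|D|}\oplus\mathcal{A}_{|D|}^*)/T^k\;\xrightarrow{\ \simeq\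 }\;(\mathcal{A}_{|\hat D|}\oplus\mathcal{A}_{|\hat D|}^*)/T^k,$$ i.e. an isomorphism of the $C^\infty(B)$-modules of sections which preserves the pairings, the brackets $[\![\cdot,\cdot]\!]_H$, $[\![\cdot,\cdot]\!]_{\hat H}$ and the anchors. -/

import Mathlib

open scoped Manifold ContDiff

namespace EllipticTDuality

noncomputable section

/-! ## Smooth functions, vector fields, Lie algebroid forms -/

/-- `C^∞(M)` for a smooth manifold `M` of dimension `n`. -/
abbrev SmoothFn (n : ℕ) (M : Type*) [TopologicalSpace M]
    [ChartedSpace (EuclideanSpace ℝ (Fin n)) M] :=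
  C^∞⟮𝓡 n, M; 𝓘(ℝ, ℝ), ℝ⟯

/-- `C^∞(M × M')`. -/
abbrev ProdSmoothFn (n n' : ℕ) (M M' : Type*) [TopologicalSpace M]
    [ChartedSpace (EuclideanSpace ℝ (Fin n)) M] [TopologicalSpace M']
    [ChartedSpace (EuclideanSpace ℝ (Fin n')) M'] :=
  C^∞⟮(𝓡 n).prod (𝓡 n'), M × M'; 𝓘(ℝ, ℝ), ℝ⟯

/-- Pull-back of smooth functions along a smooth map. -/
def pullback {E H E' H' : Type*} [NormedAddCommGroup E] [NormedSpace ℝ E] [TopologicalSpace H]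
    [NormedAddCommGroup E'] [NormedSpace ℝ E'] [TopologicalSpace H']
    {I : ModelWithCorners ℝ E H} {I' : ModelWithCorners ℝ E' H'}
    {M M' : Type*} [TopologicalSpace M] [ChartedSpace H M] [TopologicalSpace M']
    [ChartedSpace H' M'] (φ : M → M') (hφ : ContMDiff I I' ∞ φ) :
    C^∞⟮I', M'; 𝓘(ℝ, ℝ), ℝ⟯ →ₐ[ℝ] C^∞⟮I, M; 𝓘(ℝ, ℝ), ℝ⟯ where
  toFun f := ⟨fun x => f (φ x), f.contMDiff.comp hφ⟩
  map_one' := rfl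
  map_mul' _ _ := rfl
  map_zero' := rfl
  map_add' _ _ := rfl
  commutes' _ := rfl

section Algebra

variable {R : Type*} [CommRing R] [Algebra ℝ R]

/-- The Lie algebroid (as a Lie-Rinehart algebra) of the vector fields, i.e. derivations of the
algebra `R` of smooth functions, which preserve each ideal in a given set of ideals. -/
def derivationsPreserving (s : Set (Ideal R)) : LieRinehartSubalgebra R (Derivation ℝ R R) where
  carrier := {X | ∀ I ∈ s, ∀ f ∈ I, X f ∈ I}
  add_mem' := by
    intro X Y hX hY I hI f hf
    simpa using I.add_mem (hX I hI f hf) (hY I hI f hf)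
  zero_mem' := by
    intro I _ f _
    simp
  smul_mem' := by
    intro c X hX I hI f hf
    simpa using I.mul_mem_left c (hX I hI f hf)
  lie_mem' := by
    intro X Y hX hY I hI f hf
    rw [Derivation.commutator_apply]
    exact I.sub_mem (hX I hI _ (hY I hI f hf)) (hY I hI _ (hX I hI f hf))

variable {L V : Type*} [LieRing L] [AddCommGroup V] [LieRingModule L V]

/-- Lie algebroid differential of a one-form:
`dξ(X,Y) = X(ξ(Y)) - Y(ξ(X)) - ξ([X,Y])`. -/
def extD1 (ξ : L → V) (X Y : L) : V :=
  ⁅X, ξ Y⁆ - ⁅Y, ξ X⁆ - ξ ⁅X, Y⁆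

/-- Lie algebroid differential of a two-form. -/
def extD2 (F : L → L → V) (X Y Z : L) : V :=
  ⁅X, F Y Z⁆ - ⁅Y, F X Z⁆ + ⁅Z, F X Y⁆ - F ⁅X, Y⁆ Z + F ⁅X, Z⁆ Y - F ⁅Y, Z⁆ X

/-- Lie algebroid differential of a three-form. -/
def extD3 (H : L → L → L → V) (W X Y Z : L) : V :=
  ⁅W, H X Y Z⁆ - ⁅X, H W Y Z⁆ + ⁅Y, H W X Z⁆ - ⁅Z, H W X Y⁆
    - H ⁅W, X⁆ Y Z + H ⁅W, Y⁆ X Z - H ⁅W, Z⁆ X Y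
    - H ⁅X, Y⁆ W Z + H ⁅X, Z⁆ W Y - H ⁅Y, Z⁆ W X

end Algebra

/-! ## Standard torus actions -/

/-- The torus `T^k`. -/
abbrev Torus (k : ℕ) := Fin k → Circle

/-- The covering `ℝ^k → T^k`, `θ ↦ (e^{iθ_1}, …, e^{iθ_k})`. As it is a surjective local
diffeomorphism, maps out of `T^k` are smooth when they are smooth after composition with it. -/
def torusExp {k : ℕ} (θ : Fin k → ℝ) : Torus k := fun i => Circle.exp (θ i)

/-- Smoothness of an action `T^k × M → M`. -/
class SmoothTorusAction (k n : ℕ) (M : Type*) [TopologicalSpace M]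
    [ChartedSpace (EuclideanSpace ℝ (Fin n)) M] [MulAction (Torus k) M] : Prop where
  contMDiff_smul : ContMDiff (𝓘(ℝ, Fin k → ℝ).prod (𝓡 n)) (𝓡 n) ∞
    (fun p : (Fin k → ℝ) × M => torusExp p.1 • p.2)

/-- An equivariant diffeomorphism from an invariant open subset of `M` onto
`T^a × ℂ^l × ℝ^m`, `a = k - l`, on which `T^k`, after the change of generators
`gens : T^k ≃ T^a × T^l`, acts by
`(s, u) · (φ, z, x) = (s φ, u z, x)`. -/
structure StandardChart (k n : ℕ) (M : Type*) [TopologicalSpace M]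
    [ChartedSpace (EuclideanSpace ℝ (Fin n)) M] [MulAction (Torus k) M] where
  a : ℕ
  l : ℕ
  m : ℕ
  rank_eq : a + l = k
  dim_eq : k + l + m = n
  gens : Torus k ≃ₜ* Torus a × Torus l
  chart : OpenPartialHomeomorph M (Torus a × (Fin l → ℂ) × (Fin m → ℝ))
  target_eq : chart.target = Set.univ
  smul_mem : ∀ t : Torus k, ∀ x ∈ chart.source, t • x ∈ chart.source
  map_smul : ∀ t : Torus k, ∀ x ∈ chart.source, chart (t • x) =
    ((gens t).1 * (chart x).1, (fun i => ((gens t).2 i : ℂ) * (chart x).2.1 i), (chart x).2.2)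
  smooth_circle : ∀ i, ContMDiffOn (𝓡 n) 𝓘(ℝ, ℂ) ∞ (fun x => ((chart x).1 i : ℂ)) chart.source
  smooth_complex : ContMDiffOn (𝓡 n) 𝓘(ℝ, Fin l → ℂ) ∞ (fun x => (chart x).2.1) chart.source
  smooth_real : ContMDiffOn (𝓡 n) 𝓘(ℝ, Fin m → ℝ) ∞ (fun x => (chart x).2.2) chart.source
  smooth_symm : ContMDiff 𝓘(ℝ, (Fin a → ℝ) × (Fin l → ℂ) × (Fin m → ℝ)) (𝓡 n) ∞
    (fun p : (Fin a → ℝ) × (Fin l → ℂ) × (Fin m → ℝ) => chart.symm (torusExp p.1, p.2))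

/-- The function `|z_1|^2 ⋯ |z_l|^2` in a standard chart. Here `t_i = |z_i|^2` are the boundary
defining functions of the quotient `[0,∞)^l × ℝ^m`. -/
def StandardChart.radialProduct {k n : ℕ} {M : Type*} [TopologicalSpace M]
    [ChartedSpace (EuclideanSpace ℝ (Fin n)) M] [MulAction (Torus k) M]
    (c : StandardChart k n M) (x : M) : ℝ :=
  ∏ i, ‖(c.chart x).2.1 i‖ ^ 2

/-- `π : M → B` exhibits the topological space `B`, with algebra of smooth functions `CB`, as the
quotient of `M` by a standard `T^k`-action: every orbit has a neighbourhood in standard form, `π`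
is a quotient map whose fibres are the orbits, and a function on `B` is smooth if and only if
its pull-back to `M` is smooth. (This algebra is the one of the manifold with corners
`M / T^k`, whose charts are `(|z_1|^2, …, |z_l|^2, x) ∈ [0,∞)^l × ℝ^m`.) -/
structure IsStandardQuotient (k n : ℕ) {M B : Type*} [TopologicalSpace M]
    [ChartedSpace (EuclideanSpace ℝ (Fin n)) M] [MulAction (Torus k) M] [TopologicalSpace B]
    (CB : Subalgebra ℝ (B → ℝ)) (π : M → B) : Prop where
  exists_chart : ∀ x : M, ∃ c : StandardChart k n M, x ∈ c.chart.source
  isQuotientMap : Topology.IsQuotientMap π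
  eq_iff_orbit : ∀ x y : M, π x = π y ↔ ∃ t : Torus k, t • x = y
  mem_iff_smooth : ∀ f : B → ℝ, f ∈ CB ↔ ContMDiff (𝓡 n) 𝓘(ℝ, ℝ) ∞ (f ∘ π)

section Action

variable (k n : ℕ) (M : Type*) [TopologicalSpace M] [ChartedSpace (EuclideanSpace ℝ (Fin n)) M]
  [MulAction (Torus k) M]

/-- The elliptic divisor `I_{|D|} = π^* I_{∂B}` of a standard action: the ideal of the functions
which in each standard chart are smooth multiples of `|z_1|^2 ⋯ |z_l|^2`. -/
def ellipticDivisor : Ideal (SmoothFn n M) where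
  carrier := {f | ∀ c : StandardChart k n M, ∃ g : M → ℝ,
    ContMDiffOn (𝓡 n) 𝓘(ℝ, ℝ) ∞ g c.chart.source ∧
      ∀ x ∈ c.chart.source, f x = c.radialProduct x * g x}
  zero_mem' := fun _ => ⟨fun _ => 0, contMDiffOn_const, fun _ _ => by simp⟩
  add_mem' := by
    intro f f' hf hf' c
    obtain ⟨g, hg, h⟩ := hf c
    obtain ⟨g', hg', h'⟩ := hf' c
    refine ⟨fun x => g x + g' x, hg.add hg', fun x hx => ?_⟩
    rw [ContMDiffMap.coe_add, Pi.add_apply, h x hx, h' x hx]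
    ring
  smul_mem' := by
    intro f f' hf' c
    obtain ⟨g', hg', h'⟩ := hf' c
    refine ⟨fun x => f x * g' x, f.contMDiff.contMDiffOn.mul hg', fun x hx => ?_⟩
    rw [smul_eq_mul, ContMDiffMap.coe_mul, Pi.mul_apply, h' x hx]
    ring

/-- The elliptic tangent bundle `𝒜_{|D|}`, through its Lie-Rinehart algebra of sections: the
vector fields preserving the elliptic divisor. -/
def ellipticTangent : LieRinehartSubalgebra (SmoothFn n M)
    (Derivation ℝ (SmoothFn n M) (SmoothFn n M)) :=
  derivationsPreserving {ellipticDivisor k n M}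

instance : LieRing (ellipticTangent k n M) := inferInstance

instance : AddCommGroup (ellipticTangent k n M) := inferInstance

instance : Module (SmoothFn n M) (ellipticTangent k n M) := inferInstance

instance : LieRingModule (ellipticTangent k n M) (SmoothFn n M) := inferInstance

instance : LieRinehartRing (SmoothFn n M) (ellipticTangent k n M) := inferInstance

/-- `Ω^j(𝒜_{|D|})`. -/
abbrev EllipticForm (j : ℕ) :=
  (ellipticTangent k n M) [⋀^Fin j]→ₗ[SmoothFn n M] (SmoothFn n M)

/-- `Γ(𝒜_{|D|}^*)`. -/
abbrev EllipticDual := Module.Dual (SmoothFn n M) (ellipticTangent k n M)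

instance : AddCommGroup (EllipticDual k n M) := inferInstance

instance : Module (SmoothFn n M) (EllipticDual k n M) := inferInstance

instance : Module (SmoothFn n M) (ellipticTangent k n M × EllipticDual k n M) := inferInstance

variable {k n M}

/-- `d_𝒜 H = 0`. -/
def IsClosedForm (H : EllipticForm k n M 3) : Prop :=
  ∀ W X Y Z, extD3 (fun X Y Z => H ![X, Y, Z]) W X Y Z = 0

/-- A section of `𝒜_{|D|}` vanishes at `x`, i.e. is zero in the fibre
`(𝒜_{|D|})_x = Γ(𝒜_{|D|}) / 𝔪_x Γ(𝒜_{|D|})`. -/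
def VanishesAt (X : ellipticTangent k n M) (x : M) : Prop :=
  X ∈ (RingHom.ker (ContMDiffMap.evalRingHom x : SmoothFn n M →+* ℝ) •
    (⊤ : Submodule (SmoothFn n M) (ellipticTangent k n M)))

variable [SmoothTorusAction k n M]

theorem contMDiff_torus_smul (t : Torus k) : ContMDiff (𝓡 n) (𝓡 n) ∞ (fun x : M => t • x) := by
  have ht : torusExp (fun i => Complex.arg (t i : ℂ)) = t := by
    funext i
    exact Circle.exp_arg (t i)
  have h := (SmoothTorusAction.contMDiff_smul (k := k) (n := n) (M := M)).comp
    (contMDiff_const (c := fun i => Complex.arg (t i : ℂ)) |>.prodMk contMDiff_id)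
  simpa [Function.comp_def, ht] using h

/-- `(t^* f)(x) = f (t • x)`. -/
def translate (t : Torus k) : SmoothFn n M →ₐ[ℝ] SmoothFn n M :=
  pullback (fun x => t • x) (contMDiff_torus_smul t)

/-- `X` is the push-forward `t_* X'` of `X'` under the action of `t`. -/
def IsTranslate (t : Torus k) (X' X : ellipticTangent k n M) : Prop :=
  ∀ f : SmoothFn n M, X'.1 (translate t f) = translate t (X.1 f)

/-- `t_* X = X` for all `t ∈ T^k`. -/
def IsInvariantSection (X : ellipticTangent k n M) : Prop :=
  ∀ t : Torus k, IsTranslate t X X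

/-- `t^* ξ = ξ` for all `t ∈ T^k`. -/
def IsInvariantDual (ξ : EllipticDual k n M) : Prop :=
  ∀ (t : Torus k) (X' X : ellipticTangent k n M), IsTranslate t X' X → ξ X' = translate t (ξ X)

/-- `t^* H = H` for all `t ∈ T^k`. -/
def IsInvariantForm (H : EllipticForm k n M 3) : Prop :=
  ∀ (t : Torus k) (X' Y' Z' X Y Z : ellipticTangent k n M), IsTranslate t X' X →
    IsTranslate t Y' Y → IsTranslate t Z' Z → H ![X', Y', Z'] = translate t (H ![X, Y, Z])

end Action

/-! ## The standard Courant algebroid `𝒜_{|D|} ⊕ 𝒜_{|D|}^*` -/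

section Dorfman

variable {k n : ℕ} {M : Type*} [TopologicalSpace M] [ChartedSpace (EuclideanSpace ℝ (Fin n)) M]
  [MulAction (Torus k) M]

theorem form_cons_add (H : EllipticForm k n M 3) (X Y Z Z' : ellipticTangent k n M) :
    H ![X, Y, Z + Z'] = H ![X, Y, Z] + H ![X, Y, Z'] := by
  have h := H.map_update_add ![X, Y, Z] 2 Z Z'
  have e : ∀ W, Function.update ![X, Y, Z] 2 W = ![X, Y, W] := by
    intro W; funext i; fin_cases i <;> rfl
  simpa only [e] using h

theorem form_cons_smul (H : EllipticForm k n M 3) (f : SmoothFn n M)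
    (X Y Z : ellipticTangent k n M) : H ![X, Y, f • Z] = f * H ![X, Y, Z] := by
  have h := H.map_update_smul ![X, Y, Z] 2 f Z
  have e : ∀ W, Function.update ![X, Y, Z] 2 W = ![X, Y, W] := by
    intro W; funext i; fin_cases i <;> rfl
  simpa only [e, smul_eq_mul] using h

/-- The `𝒜_{|D|}^*`-component of the Dorfman bracket:
`(L_X η - ι_Y dξ + ι_X ι_Y H)(Z)`, where `(L_X η)(Z) = X(η(Z)) - η([X,Z])` and
`(ι_X ι_Y H)(Z) = H(Y,X,Z)`. -/
def dorfmanForm (H : EllipticForm k n M 3) (X : ellipticTangent k n M) (ξ : EllipticDual k n M)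
    (Y : ellipticTangent k n M) (η : EllipticDual k n M) : EllipticDual k n M where
  toFun Z := (⁅X, η Z⁆ - η ⁅X, Z⁆) - extD1 (fun W => ξ W) Y Z + H ![Y, X, Z]
  map_add' Z Z' := by
    simp only [extD1, map_add, lie_add, add_lie, form_cons_add]
    ring
  map_smul' f Z := by
    simp only [extD1, map_smul, smul_eq_mul, LieRinehartRing.leibniz_mul_right,
      LieRinehartRing.leibniz_smul_right, LieRinehartRing.lie_smul_eq_mul, map_add,
      form_cons_smul, RingHom.id_apply]
    ring

/-- `⟦X + ξ, Y + η⟧_H = [X,Y] + L_X η - ι_Y dξ + ι_X ι_Y H`. -/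
def dorfman (H : EllipticForm k n M 3) (e e' : ellipticTangent k n M × EllipticDual k n M) :
    ellipticTangent k n M × EllipticDual k n M :=
  (⁅e.1, e'.1⁆, dorfmanForm H e.1 e.2 e'.1 e'.2)

/-- `⟨X + ξ, Y + η⟩ = (η(X) + ξ(Y)) / 2`. -/
def courantPairing (e e' : ellipticTangent k n M × EllipticDual k n M) : SmoothFn n M :=
  (1 / 2 : ℝ) • (e'.2 e.1 + e.2 e'.1)

end Dorfman

/-! ## The reduced Courant algebroid `(𝒜_{|D|} ⊕ 𝒜_{|D|}^*) / T^k → B` -/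

/-- The operations of a Courant algebroid, on the module `E` of sections over the algebra `R` of
smooth functions of the base. -/
structure CourantOperations (R E : Type*) [CommRing R] [Algebra ℝ R] where
  pairing : E → E → R
  bracket : E → E → E
  anchor : E → Derivation ℝ R R

/-- An isomorphism of Courant algebroids over the identity of the base: a vector bundle
isomorphism preserving pairings, brackets and anchors. -/
structure CourantIso {R E E' : Type*} [CommRing R] [Algebra ℝ R] [AddCommGroup E] [Module R E]
    [AddCommGroup E'] [Module R E'] (𝒞 : CourantOperations R E) (𝒞' : CourantOperations R E')
    extends E ≃ₗ[R] E' where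
  map_pairing : ∀ e₁ e₂, 𝒞'.pairing (toFun e₁) (toFun e₂) = 𝒞.pairing e₁ e₂
  map_bracket : ∀ e₁ e₂, toFun (𝒞.bracket e₁ e₂) = 𝒞'.bracket (toFun e₁) (toFun e₂)
  map_anchor : ∀ e, 𝒞'.anchor (toFun e) = 𝒞.anchor e

section Reduction

variable {k n : ℕ} {M : Type*} [TopologicalSpace M] [ChartedSpace (EuclideanSpace ℝ (Fin n)) M]
  [MulAction (Torus k) M] [SmoothTorusAction k n M]

theorem IsTranslate.lie {t : Torus k} {X' X Y' Y : ellipticTangent k n M}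
    (hX : IsTranslate t X' X) (hY : IsTranslate t Y' Y) : IsTranslate t ⁅X', Y'⁆ ⁅X, Y⁆ := by
  intro f
  have hX' : ∀ f : SmoothFn n M, X'.1 (translate t f) = translate t (X.1 f) := hX
  have hY' : ∀ f : SmoothFn n M, Y'.1 (translate t f) = translate t (Y.1 f) := hY
  simp only [LieRinehartSubalgebra.coe_bracket, Derivation.commutator_apply, hX', hY', map_sub]

variable (k n M) in
/-- The `T^k`-invariant sections of `𝒜_{|D|} ⊕ 𝒜_{|D|}^*`. -/
def invariantSections : AddSubgroup (ellipticTangent k n M × EllipticDual k n M) where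
  carrier := {e | IsInvariantSection e.1 ∧ IsInvariantDual e.2}
  zero_mem' := ⟨fun t f => by simp, fun t X' X _ => by simp⟩
  add_mem' := by
    rintro e e' ⟨h1, h2⟩ ⟨h1', h2'⟩
    refine ⟨fun t f => ?_, fun t X' X h => ?_⟩
    · have a := h1 t f
      have b := h1' t f
      simp only [Prod.fst_add]
      change e.1.1 (translate t f) + e'.1.1 (translate t f)
        = translate t (e.1.1 f + e'.1.1 f)
      rw [a, b, map_add]
    · simp [h2 t X' X h, h2' t X' X h]
  neg_mem' := by
    rintro e ⟨h1, h2⟩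
    refine ⟨fun t f => ?_, fun t X' X h => ?_⟩
    · have a := h1 t f
      simp only [Prod.fst_neg]
      change -(e.1.1 (translate t f)) = translate t (-(e.1.1 f))
      rw [a, map_neg]
    · simp [h2 t X' X h]

theorem dorfman_mem {H : EllipticForm k n M 3} (hH : IsInvariantForm H)
    {e e' : ellipticTangent k n M × EllipticDual k n M} (he : e ∈ invariantSections k n M)
    (he' : e' ∈ invariantSections k n M) : dorfman H e e' ∈ invariantSections k n M := by
  obtain ⟨hX, hξ⟩ := he
  obtain ⟨hY, hη⟩ := he'
  refine ⟨fun t => (hX t).lie (hY t), fun t Z' Z hZ => ?_⟩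
  have key : ∀ {X' X : ellipticTangent k n M} (h : IsTranslate t X' X) (f : SmoothFn n M),
      ⁅X', translate t f⁆ = translate t ⁅X, f⁆ := fun h f => h f
  change (⁅e.1, e'.2 Z'⁆ - e'.2 ⁅e.1, Z'⁆) - extD1 (fun W => e.2 W) e'.1 Z' + H ![e'.1, e.1, Z']
    = translate t ((⁅e.1, e'.2 Z⁆ - e'.2 ⁅e.1, Z⁆) - extD1 (fun W => e.2 W) e'.1 Z
      + H ![e'.1, e.1, Z])
  have hZY : ⁅Z', e.2 e'.1⁆ = translate t ⁅Z, e.2 e'.1⁆ := by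
    have h := key hZ (e.2 e'.1)
    rwa [← hξ t _ _ (hY t)] at h
  simp only [extD1, map_sub, map_add]
  rw [hη t _ _ hZ, key (hX t), hη t _ _ ((hX t).lie hZ), hξ t _ _ hZ, key (hY t),
    hZY, hξ t _ _ ((hY t).lie hZ), hH t _ _ _ _ _ _ (hY t) (hX t) hZ]

theorem courantPairing_invariant {e e' : ellipticTangent k n M × EllipticDual k n M}
    (he : e ∈ invariantSections k n M) (he' : e' ∈ invariantSections k n M) (t : Torus k) :
    translate t (courantPairing e e') = courantPairing e e' := by
  simp only [courantPairing, map_smul, map_add]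
  rw [← he'.2 t _ _ (he.1 t), ← he.2 t _ _ (he'.1 t)]

variable {B : Type*} [TopologicalSpace B] {CB : Subalgebra ℝ (B → ℝ)} {π : M → B}

/-- `π^* : C^∞(B) → C^∞(M)`. -/
def basePullback (h : IsStandardQuotient k n CB π) : CB →ₐ[ℝ] SmoothFn n M where
  toFun f := ⟨f.1 ∘ π, (h.mem_iff_smooth f.1).1 f.2⟩
  map_one' := rfl
  map_mul' _ _ := rfl
  map_zero' := rfl
  map_add' _ _ := rfl
  commutes' _ := rfl

theorem basePullback_injective (h : IsStandardQuotient k n CB π) :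
    Function.Injective (basePullback h) := by
  intro f g hfg
  apply Subtype.ext
  funext b
  obtain ⟨x, rfl⟩ := h.isQuotientMap.surjective b
  exact congrArg (fun F : SmoothFn n M => F x) hfg

theorem translate_basePullback (h : IsStandardQuotient k n CB π) (t : Torus k) (f : CB) :
    translate t (basePullback h f) = basePullback h f := by
  ext x
  change f.1 (π (t • x)) = f.1 (π x)
  rw [(h.eq_iff_orbit x (t • x)).2 ⟨t, rfl⟩]

theorem exists_descend (h : IsStandardQuotient k n CB π) (g : SmoothFn n M)
    (hg : ∀ t : Torus k, translate t g = g) : ∃ f : CB, basePullback h f = g := by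
  have hs := h.isQuotientMap.surjective
  have e : (fun b => g (Function.surjInv hs b)) ∘ π = g := by
    funext x
    obtain ⟨t, ht⟩ := (h.eq_iff_orbit _ _).1 (Function.surjInv_eq hs (π x)).symm
    have := congrArg (fun F : SmoothFn n M => F x) (hg t)
    change g (t • x) = g x at this
    simp only [Function.comp_apply, ← ht, this]
  refine ⟨⟨fun b => g (Function.surjInv hs b), (h.mem_iff_smooth _).2 ?_⟩, ?_⟩
  · rw [e]; exact g.contMDiff
  · ext x; exact congrFun e x

/-- The function on `B` whose pull-back to `M` is a given invariant function. -/
def descend (h : IsStandardQuotient k n CB π) (g : SmoothFn n M)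
    (hg : ∀ t : Torus k, translate t g = g) : CB :=
  (exists_descend h g hg).choose

theorem basePullback_descend (h : IsStandardQuotient k n CB π) (g : SmoothFn n M)
    (hg : ∀ t : Torus k, translate t g = g) : basePullback h (descend h g hg) = g :=
  (exists_descend h g hg).choose_spec

/-- The sections over `B` of `(𝒜_{|D|} ⊕ 𝒜_{|D|}^*) / T^k`: the invariant sections of
`𝒜_{|D|} ⊕ 𝒜_{|D|}^*`, as a module over `C^∞(B)`. -/
def ReducedSections (_h : IsStandardQuotient k n CB π) : Type _ := invariantSections k n M

instance (h : IsStandardQuotient k n CB π) : AddCommGroup (ReducedSections h) :=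
  inferInstanceAs (AddCommGroup (invariantSections k n M))

theorem smul_mem_invariantSections (h : IsStandardQuotient k n CB π) (f : CB)
    {e : ellipticTangent k n M × EllipticDual k n M} (he : e ∈ invariantSections k n M) :
    basePullback h f • e ∈ invariantSections k n M := by
  refine ⟨fun t g => ?_, fun t X' X hX => ?_⟩
  · have a := he.1 t g
    change basePullback h f * e.1.1 (translate t g) = translate t (basePullback h f * e.1.1 g)
    rw [a, map_mul, translate_basePullback]
  · change basePullback h f * e.2 X' = translate t (basePullback h f * e.2 X)
    rw [he.2 t X' X hX, map_mul, translate_basePullback]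

instance (h : IsStandardQuotient k n CB π) : SMul CB (ReducedSections h) where
  smul f e := ⟨basePullback h f • e.1, smul_mem_invariantSections h f e.2⟩

instance (h : IsStandardQuotient k n CB π) : Module CB (ReducedSections h) where
  one_smul e := Subtype.ext (by
    change basePullback h 1 • e.1 = e.1
    rw [map_one, one_smul])
  mul_smul f g e := Subtype.ext (by
    change basePullback h (f * g) • e.1 = basePullback h f • basePullback h g • e.1
    rw [map_mul, mul_smul])
  smul_zero f := Subtype.ext (smul_zero (basePullback h f))
  smul_add f e e' := Subtype.ext (smul_add (basePullback h f) e.1 e'.1)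
  add_smul f g e := Subtype.ext (by
    change basePullback h (f + g) • e.1 = basePullback h f • e.1 + basePullback h g • e.1
    rw [map_add, add_smul])
  zero_smul e := Subtype.ext (by
    change basePullback h 0 • e.1 = 0
    rw [map_zero, zero_smul])

theorem anchor_invariant (h : IsStandardQuotient k n CB π) (e : ReducedSections h) (f : CB)
    (t : Torus k) :
    translate t (e.1.1.1 (basePullback h f)) = e.1.1.1 (basePullback h f) := by
  have a := e.2.1 t (basePullback h f)
  rw [translate_basePullback] at a
  exact a.symm

/-- The anchor `(𝒜_{|D|} ⊕ 𝒜_{|D|}^*) / T^k → TB`: an invariant section `X + ξ` acts on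
`f ∈ C^∞(B)` by `π^* (a(X + ξ) f) = X (π^* f)`. -/
def reducedAnchor (h : IsStandardQuotient k n CB π) (e : ReducedSections h) :
    Derivation ℝ CB CB :=
  Derivation.mk'
    { toFun := fun f => descend h (e.1.1.1 (basePullback h f)) (anchor_invariant h e f)
      map_add' := fun f g => basePullback_injective h (by
        simp only [map_add, basePullback_descend])
      map_smul' := fun c f => basePullback_injective h (by
        simp only [map_smul, Derivation.map_smul, basePullback_descend, RingHom.id_apply]) }
    (fun f g => basePullback_injective h (by
      simp only [LinearMap.coe_mk, AddHom.coe_mk, smul_eq_mul, map_add, map_mul,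
        basePullback_descend, Derivation.leibniz]))

/-- The Courant algebroid `(𝒜_{|D|} ⊕ 𝒜_{|D|}^*) / T^k → B` with the `H`-twisted bracket. -/
def reducedCourant (h : IsStandardQuotient k n CB π) (H : EllipticForm k n M 3)
    (hH : IsInvariantForm H) : CourantOperations CB (ReducedSections h) where
  pairing e e' := descend h (courantPairing e.1 e'.1) (courantPairing_invariant e.2 e'.2)
  bracket e e' := ⟨dorfman H e.1 e'.1, dorfman_mem hH e.2 e'.2⟩
  anchor := reducedAnchor h

end Reduction

/-! ## The Lie algebroid on the correspondence space `N = M ×_B M'` -/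

section Correspondence

variable {k n n' : ℕ} {M M' B : Type*} [TopologicalSpace M]
  [ChartedSpace (EuclideanSpace ℝ (Fin n)) M] [TopologicalSpace M']
  [ChartedSpace (EuclideanSpace ℝ (Fin n')) M'] [MulAction (Torus k) M] [MulAction (Torus k) M']

/-- `p^* : C^∞(M) → C^∞(M × M')`. -/
def pullFst : SmoothFn n M →ₐ[ℝ] ProdSmoothFn n n' M M' :=
  pullback Prod.fst contMDiff_fst

/-- `p'^* : C^∞(M') → C^∞(M × M')`. -/
def pullSnd : SmoothFn n' M' →ₐ[ℝ] ProdSmoothFn n n' M M' :=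
  pullback Prod.snd contMDiff_snd

/-- Restriction of functions to the slice `M × {y}`. -/
def restrictFst (y : M') : ProdSmoothFn n n' M M' →ₐ[ℝ] SmoothFn n M :=
  pullback (fun x => (x, y)) (contMDiff_id.prodMk contMDiff_const)

/-- Restriction of functions to the slice `{x} × M'`. -/
def restrictSnd (x : M) : ProdSmoothFn n n' M M' →ₐ[ℝ] SmoothFn n' M' :=
  pullback (fun y => (x, y)) (contMDiff_const.prodMk contMDiff_id)

/-- The correspondence space `M ×_B M'`. -/
abbrev Corr (π : M → B) (π' : M' → B) := {q : M × M' // π q.1 = π' q.2}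

variable (k n n')

/-- The sections of `𝒜_{|D|} ⊠ 𝒜_{|D'|}` over `M × M'`: the vector fields on `M × M'` which
preserve the pull-backs of both elliptic divisors. -/
def boxTangent (M M' : Type*) [TopologicalSpace M]
    [ChartedSpace (EuclideanSpace ℝ (Fin n)) M] [TopologicalSpace M']
    [ChartedSpace (EuclideanSpace ℝ (Fin n')) M'] [MulAction (Torus k) M]
    [MulAction (Torus k) M'] :
    LieRinehartSubalgebra (ProdSmoothFn n n' M M')
      (Derivation ℝ (ProdSmoothFn n n' M M') (ProdSmoothFn n n' M M')) :=
  derivationsPreserving {(ellipticDivisor k n M).map pullFst, (ellipticDivisor k n' M').map pullSnd}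

/-- The ideal of the smooth functions on `M × M'` which vanish on `N`. -/
def corrIdeal (π : M → B) (π' : M' → B) : Ideal (ProdSmoothFn n n' M M') where
  carrier := {f | ∀ q : Corr π π', f q.1 = 0}
  zero_mem' := fun _ => rfl
  add_mem' := by
    intro f g hf hg q
    rw [ContMDiffMap.coe_add, Pi.add_apply, hf q, hg q, add_zero]
  smul_mem' := by
    intro f g hg q
    rw [smul_eq_mul, ContMDiffMap.coe_mul, Pi.mul_apply, hg q, mul_zero]

/-- `C^∞(N)`: the functions on `N` which are restrictions of smooth functions on `M × M'`. -/
abbrev CorrFn (π : M → B) (π' : M' → B) := ProdSmoothFn n n' M M' ⧸ corrIdeal n n' π π'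

/-- The sections of `𝒜_{|D|} ⊠ 𝒜_{|D'|}` which are tangent to `N`, i.e. preserve the ideal of `N`.
The sections of the Lie algebroid `𝒜_{|D|} ×_B 𝒜_{|D'|} → N` are the restrictions to `N` of these,
that is, this module modulo `I_N · Γ(𝒜_{|D|} ⊠ 𝒜_{|D'|})`. -/
def corrTangent (π : M → B) (π' : M' → B) : LieRinehartSubalgebra (ProdSmoothFn n n' M M')
    (Derivation ℝ (ProdSmoothFn n n' M M') (ProdSmoothFn n n' M M')) :=
  derivationsPreserving {(ellipticDivisor k n M).map pullFst,
    (ellipticDivisor k n' M').map pullSnd, corrIdeal n n' π π'}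

instance (π : M → B) (π' : M' → B) : LieRing (corrTangent k n n' π π') := inferInstance

instance (π : M → B) (π' : M' → B) :
    Module (ProdSmoothFn n n' M M') (corrTangent k n n' π π') := inferInstance

instance (π : M → B) (π' : M' → B) :
    Module (ProdSmoothFn n n' M M') (CorrFn n n' π π') := inferInstance

variable {k n n'} {π : M → B} {π' : M' → B}

/-- A section tangent to `N` acts on `C^∞(N)`. -/
def corrAnchor (X : corrTangent k n n' π π') : CorrFn n n' π π' →+ CorrFn n n' π π' :=
  QuotientAddGroup.lift (corrIdeal n n' π π').toAddSubgroup
    ((Ideal.Quotient.mk (corrIdeal n n' π π')).toAddMonoidHom.comp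
      X.1.toLinearMap.toAddMonoidHom)
    (fun f hf => Ideal.Quotient.eq_zero_iff_mem.2 (X.2 _ (by simp) f hf))

instance : LieRingModule (corrTangent k n n' π π') (CorrFn n n' π π') where
  bracket X f := corrAnchor X f
  add_lie X Y f := by
    obtain ⟨f, rfl⟩ := Ideal.Quotient.mk_surjective f
    rfl
  lie_add X f g := map_add _ _ _
  leibniz_lie X Y f := by
    obtain ⟨f, rfl⟩ := Ideal.Quotient.mk_surjective f
    change Ideal.Quotient.mk _ (X.1 (Y.1 f)) =
      Ideal.Quotient.mk _ (⁅X.1, Y.1⁆ f) + Ideal.Quotient.mk _ (Y.1 (X.1 f))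
    rw [← map_add, Derivation.commutator_apply, sub_add_cancel]

/-- The value at `q ∈ N` of a function in `C^∞(N)`. -/
def corrEval (q : Corr π π') : CorrFn n n' π π' →+* ℝ :=
  Ideal.Quotient.lift _
    (ContMDiffMap.evalRingHom q.1 : ProdSmoothFn n n' M M' →+* ℝ) (fun _ hf => hf q)

/-- The component along `A` of a derivation of `P`, for an algebra map `p : A → P` with a left
inverse `s`. -/
def sliceDerivation {A P : Type*} [CommRing A] [Algebra ℝ A] [CommRing P] [Algebra ℝ P]
    (p : A →ₐ[ℝ] P) (s : P →ₐ[ℝ] A) (hs : ∀ a, s (p a) = a) (X : Derivation ℝ P P) :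
    Derivation ℝ A A :=
  Derivation.mk' (s.toLinearMap ∘ₗ X.toLinearMap ∘ₗ p.toLinearMap) (fun a b => by
    simp [hs])

theorem sliceDerivation_mem {A P : Type*} [CommRing A] [Algebra ℝ A] [CommRing P] [Algebra ℝ P]
    (p : A →ₐ[ℝ] P) (s : P →ₐ[ℝ] A) (hs : ∀ a, s (p a) = a) (X : Derivation ℝ P P) (I : Ideal A)
    (hX : ∀ f ∈ I.map p, X f ∈ I.map p) :
    sliceDerivation p s hs X ∈ derivationsPreserving ({I} : Set (Ideal A)) := by
  intro J hJ f hf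
  obtain rfl : J = I := hJ
  have h1 : J.map p ≤ J.comap s := Ideal.map_le_iff_le_comap.2 (fun a ha => by
    simpa [Ideal.mem_comap, hs] using ha)
  exact h1 (hX _ (Ideal.mem_map_of_mem p hf))

/-- The `M`-component along `M × {y}` of a section of `𝒜_{|D|} ×_B 𝒜_{|D'|}`: a section of
`𝒜_{|D|}`, whose value at `x`, for `q = (x, y) ∈ N`, is the image of the given section under
`p : (𝒜_{|D|} ×_B 𝒜_{|D'|})_q → (𝒜_{|D|})_x`. -/
def pushFst (y : M') (X : corrTangent k n n' π π') : ellipticTangent k n M :=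
  ⟨sliceDerivation pullFst (restrictFst y) (fun _ => rfl) X.1,
    sliceDerivation_mem _ _ _ _ _ (X.2 _ (by simp))⟩

/-- The `M'`-component along `{x} × M'` of a section of `𝒜_{|D|} ×_B 𝒜_{|D'|}`. -/
def pushSnd (x : M) (X : corrTangent k n n' π π') : ellipticTangent k n' M' :=
  ⟨sliceDerivation pullSnd (restrictSnd x) (fun _ => rfl) X.1,
    sliceDerivation_mem _ _ _ _ _ (X.2 _ (by simp))⟩

variable (k n n' π π') in
/-- `Ω^2(𝒜_{|D|} ×_B 𝒜_{|D'|})`: alternating forms on the sections tangent to `N`, with values in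
`C^∞(N)`, which only depend on the restrictions of these sections to `N`. -/
structure CorrTwoForm where
  toForm : (corrTangent k n n' π π') [⋀^Fin 2]→ₗ[ProdSmoothFn n n' M M'] (CorrFn n n' π π')
  eq_zero : ∀ X Y : corrTangent k n n' π π',
    X.1 ∈ corrIdeal n n' π π' • (boxTangent k n n' M M').toSubmodule → toForm ![X, Y] = 0

/-- `p^* H - p'^* H' = dF` in `Ω^3(𝒜_{|D|} ×_B 𝒜_{|D'|})`, where `p^* H` is the form
`(X, Y, Z) ↦ H (p X, p Y, p Z)`. -/
def CorrTwoForm.IsPrimitive (F : CorrTwoForm k n n' π π') (H : EllipticForm k n M 3)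
    (H' : EllipticForm k n' M' 3) : Prop :=
  ∀ (X Y Z : corrTangent k n n' π π') (q : Corr π π'),
    H ![pushFst q.1.2 X, pushFst q.1.2 Y, pushFst q.1.2 Z] q.1.1
      - H' ![pushSnd q.1.1 X, pushSnd q.1.1 Y, pushSnd q.1.1 Z] q.1.2
    = corrEval q (extD2 (fun X Y => F.toForm ![X, Y]) X Y Z)

/-- At each `q = (x, y) ∈ N`, the form `F` restricts to a non-degenerate pairing between the
kernels of `p : (𝒜_{|D|} ×_B 𝒜_{|D'|})_q → (𝒜_{|D|})_x` and
`p' : (𝒜_{|D|} ×_B 𝒜_{|D'|})_q → (𝒜_{|D'|})_y`. An element of one of these kernels is zero if and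
only if it also lies in the other one, as `(𝒜_{|D|} ×_B 𝒜_{|D'|})_q ⊆ (𝒜_{|D|})_x ⊕ (𝒜_{|D'|})_y`. -/
def CorrTwoForm.IsNondegenerate (F : CorrTwoForm k n n' π π') : Prop :=
  ∀ q : Corr π π',
    (∀ X : corrTangent k n n' π π', VanishesAt (pushSnd q.1.1 X) q.1.2 →
      (∀ Y : corrTangent k n n' π π', VanishesAt (pushFst q.1.2 Y) q.1.1 →
        corrEval q (F.toForm ![X, Y]) = 0) →
      VanishesAt (pushFst q.1.2 X) q.1.1) ∧
    (∀ Y : corrTangent k n n' π π', VanishesAt (pushFst q.1.2 Y) q.1.1 →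
      (∀ X : corrTangent k n n' π π', VanishesAt (pushSnd q.1.1 X) q.1.2 →
        corrEval q (F.toForm ![X, Y]) = 0) →
      VanishesAt (pushSnd q.1.1 Y) q.1.2)

variable [SmoothTorusAction k n M] [SmoothTorusAction k n' M']

/-- Pull-back of functions along `(x, y) ↦ (s • x, t • y)`. -/
def prodTranslate (s t : Torus k) : ProdSmoothFn n n' M M' →ₐ[ℝ] ProdSmoothFn n n' M M' :=
  pullback (fun q => (s • q.1, t • q.2))
    ((contMDiff_torus_smul s |>.comp contMDiff_fst).prodMk
      (contMDiff_torus_smul t |>.comp contMDiff_snd))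

/-- `X` is the push-forward of `X'` under the action of `(s, t) ∈ T^{2k}`. -/
def IsProdTranslate (s t : Torus k) (X' X : corrTangent k n n' π π') : Prop :=
  ∀ f : ProdSmoothFn n n' M M', X'.1 (prodTranslate s t f) = prodTranslate s t (X.1 f)

/-- `T^{2k}`-invariance: `(s, t)^* F = F` for all `s, t ∈ T^k`. -/
def CorrTwoForm.IsInvariant (F : CorrTwoForm k n n' π π') : Prop :=
  ∀ (s t : Torus k) (X' Y' X Y : corrTangent k n n' π π'),
    IsProdTranslate s t X' X → IsProdTranslate s t Y' Y →
    ∀ q r : Corr π π', r.1 = (s • q.1.1, t • q.1.2) →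
      corrEval q (F.toForm ![X', Y']) = corrEval r (F.toForm ![X, Y])

variable (π π') in
/-- `(M, H)` and `(M', H')` are `T`-dual. -/
def IsTDual (H : EllipticForm k n M 3) (H' : EllipticForm k n' M' 3) : Prop :=
  ∃ F : CorrTwoForm k n n' π π', F.IsInvariant ∧ F.IsPrimitive H H' ∧ F.IsNondegenerate

end Correspondence

end

end EllipticTDuality

open EllipticTDuality

namespace EllipticTDuality

open Set Filter Topology ComplexConjugate

set_option linter.unusedSectionVars false

noncomputable section

/-! ## Calculus in normed spaces -/

section ParametricIntegral

universe u

variable {E F : Type u} [NormedAddCommGroup E] [NormedSpace ℝ E] [NormedAddCommGroup F]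
  [NormedSpace ℝ F]

/-! The two Courant algebroids are compared on the correspondence space by means of F. Call X + ξ on
M and X' + ξ' on M' related when X and X' have the same anchor, so that (X, X') is a section of the
algebroid over N, and p^*ξ − p'^*ξ' = ι_{(X,X')}F; this is `RelPairing.Rel`. Since all data are
invariant, everything takes place in the C^∞(B)-module `relPairs` of pairs of invariant sections
with equal anchor, on which F becomes an alternating C^∞(B)-bilinear form φ.

Given X + ξ, a lift X' of the anchor of X is determined up to sections of ker p, that is, up to
vertical fields of M'. Non-degeneracy of F between ker p' and ker p says that exactly one lift makes
ξ − φ((X, X'), ·) vanish on the vertical fields of M, and what is left is then the pull-back of a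
unique ξ'. Hence the relation is the graph of a bijection (`RelPairing.exists_rel`,
`RelPairing.Rel.unique`), linear over C^∞(B). Anchors agree by construction, pairings agree because
φ is alternating, and the discrepancy between the two Dorfman brackets is dF − (p^*H − p'^*H') = 0
(`RelPairing.Rel.bracket`).

The rest is analysis around the points where the action is not free. Sections are derivations of
global functions, so four facts have to be proved. First, derivations preserving the elliptic
divisor are locally combinations of the k fundamental fields, the l radial fields r∂_r and the m
coordinate fields (`StandardChart.exists_coeff`); the heart of this is a division theorem,
`exists_eq_coord_mul_of_sum`: if Σ Re(w_i/z_i) is smooth, then every w_i/z_i is. Second, the anchor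
of a section over M' lifts locally to M (`StandardChart.exists_lift`), because a derivation of
C^∞(B) coming from a manifold kills a non-negative function at its zeros and is therefore tangent to
the boundary of B. Third, invariant functions on N are smooth functions on B
(`exists_descend_corr`), by Whitney's theorem on even functions. Fourth, a pair (X, X') with equal
anchors is tangent to N (`boxSum_apply_eq_zero`); as in most of the identities, this is checked over
free points and extended by density. -/

theorem hasFDerivAt_integral_unitInterval [CompleteSpace F] {f : E → ℝ → F}
    (hf : ContDiff ℝ ∞ (Function.uncurry f)) (e : E) :
    HasFDerivAt (fun e => ∫ s in (0 : ℝ)..1, f e s)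
      (∫ s in (0 : ℝ)..1, (fderiv ℝ (Function.uncurry f) (e, s)).comp
        (ContinuousLinearMap.inl ℝ E ℝ)) e := by
  have hD : Continuous fun p : E × ℝ => (fderiv ℝ (Function.uncurry f) p).comp
      (ContinuousLinearMap.inl ℝ E ℝ) :=
    (hf.continuous_fderiv (by simp)).clm_comp continuous_const
  -- E need not be locally compact, so a bound for the derivative that is uniform near e comes from
  -- compactness of {e} × [0,1] and the tube lemma.
  obtain ⟨C, hC⟩ : ∃ C, ∀ p ∈ ({e} ×ˢ Icc (0 : ℝ) 1 : Set (E × ℝ)),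
      ‖(fderiv ℝ (Function.uncurry f) p).comp (ContinuousLinearMap.inl ℝ E ℝ)‖ ≤ C :=
    (isCompact_singleton.prod isCompact_Icc).exists_bound_of_continuousOn hD.continuousOn
  have hopen : IsOpen {p : E × ℝ | ‖(fderiv ℝ (Function.uncurry f) p).comp
      (ContinuousLinearMap.inl ℝ E ℝ)‖ < C + 1} := isOpen_lt hD.norm continuous_const
  obtain ⟨U, V, hU, -, heU, hV, hUV⟩ := generalized_tube_lemma isCompact_singleton
    (isCompact_Icc (a := (0 : ℝ)) (b := 1)) hopen (fun p hp => (hC p hp).trans_lt (lt_add_one C))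
  have hcont : ∀ e, Continuous (f e) := fun e =>
    hf.continuous.comp (continuous_const.prodMk continuous_id)
  refine intervalIntegral.hasFDerivAt_integral_of_dominated_of_fderiv_le (bound := fun _ => C + 1)
    (F' := fun e s => (fderiv ℝ (Function.uncurry f) (e, s)).comp
        (ContinuousLinearMap.inl ℝ E ℝ)) (s := U)
    (hU.mem_nhds (heU rfl)) (Eventually.of_forall fun e => (hcont e).aestronglyMeasurable)
    ((hcont e).intervalIntegrable _ _)
    (hD.comp (continuous_const.prodMk continuous_id)).aestronglyMeasurable
    (Eventually.of_forall fun s hs x hx => ?_) intervalIntegrable_const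
    (Eventually.of_forall fun s _ x _ => ?_)
  · rw [uIoc_of_le zero_le_one] at hs
    exact (hUV (show (x, s) ∈ U ×ˢ V from ⟨hx, hV ⟨hs.1.le, hs.2⟩⟩)).le
  · exact HasFDerivAt.comp (g := Function.uncurry f) (f := fun e => (e, s)) x
      ((hf.differentiable (by simp)) (x, s)).hasFDerivAt (hasFDerivAt_prodMk_left x s)

/-- The derivative is an integral of the same kind with values in `E →L[ℝ] F`, so the induction on
the order runs over all targets at once. This is why E and F lie in one universe. -/
theorem contDiff_integral_unitInterval [CompleteSpace F] {f : E → ℝ → F}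
    (hf : ContDiff ℝ ∞ (Function.uncurry f)) :
    ContDiff ℝ ∞ fun e => ∫ s in (0 : ℝ)..1, f e s := by
  rw [contDiff_infty]
  intro n
  induction n generalizing F with
  | zero =>
    rw [Nat.cast_zero, contDiff_zero]
    exact intervalIntegral.continuous_parametric_intervalIntegral_of_continuous' hf.continuous 0 1
  | succ n ih =>
    rw [Nat.cast_succ, contDiff_succ_iff_hasFDerivAt]
    refine ⟨_, ih (f := fun e s => (fderiv ℝ (Function.uncurry f) (e, s)).comp
        (ContinuousLinearMap.inl ℝ E ℝ)) ?_, fun e => hasFDerivAt_integral_unitInterval hf e⟩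
    exact (hf.fderiv_right (m := ∞) (by simp)).clm_comp contDiff_const

/-- Hadamard's lemma. -/
theorem exists_contDiff_sub_eq_apply [CompleteSpace F] {f : E → F} (hf : ContDiff ℝ ∞ f) :
    ∃ K : E × E → E →L[ℝ] F, ContDiff ℝ ∞ K ∧ (∀ a v, f (a + v) - f a = K (a, v) v) ∧
      ∀ a, K (a, 0) = fderiv ℝ f a := by
  have hD : ContDiff ℝ ∞ (fderiv ℝ f) := hf.fderiv_right (by simp)
  refine ⟨fun p => ∫ s in (0 : ℝ)..1, fderiv ℝ f (p.1 + s • p.2),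
    contDiff_integral_unitInterval (f := fun (p : E × E) (s : ℝ) => fderiv ℝ f (p.1 + s • p.2))
      ?_, fun a v => ?_, fun a => by simp⟩
  · exact hD.comp (by fun_prop)
  · have h1 : ∀ s : ℝ, HasDerivAt (fun s : ℝ => f (a + s • v)) (fderiv ℝ f (a + s • v) v) s := by
      intro s
      have h2 : HasDerivAt (fun s : ℝ => a + s • v) v s := by
        simpa using ((hasDerivAt_id s).smul_const v).const_add a
      exact ((hf.differentiable (by simp)) _).hasFDerivAt.comp_hasDerivAt s h2
    have hc : Continuous fun s : ℝ => fderiv ℝ f (a + s • v) :=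
      hD.continuous.comp (by fun_prop)
    have h3 := intervalIntegral.integral_eq_sub_of_hasDerivAt (fun s _ => h1 s)
      ((hc.clm_apply continuous_const).intervalIntegrable 0 1)
    simp only [one_smul, zero_smul, add_zero] at h3
    rw [← h3, ContinuousLinearMap.intervalIntegral_apply (hc.intervalIntegrable 0 1)]

/-- Division by a real coordinate. -/
theorem exists_contDiff_eq_smul [CompleteSpace F] {f : E × ℝ → F} (hf : ContDiff ℝ ∞ f)
    (h0 : ∀ e, f (e, 0) = 0) :
    ∃ g : E × ℝ → F, ContDiff ℝ ∞ g ∧ ∀ p, f p = p.2 • g p := by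
  obtain ⟨K, hK, hKf, -⟩ := exists_contDiff_sub_eq_apply hf
  refine ⟨fun p => K ((p.1, 0), (0, p.2)) (0, 1),
    (hK.comp (by fun_prop)).clm_apply contDiff_const, fun p => ?_⟩
  have h := hKf (p.1, 0) (0, p.2)
  rw [h0, sub_zero] at h
  simp only [Prod.mk_add_mk, add_zero, zero_add, Prod.mk.eta] at h
  rw [h, ← map_smul]
  simp

end ParametricIntegral

/-! ### Whitney's theorem: even functions are smooth functions of the square -/

section Whitney

universe u

variable {E F : Type u} [NormedAddCommGroup E] [NormedSpace ℝ E] [NormedAddCommGroup F]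
  [NormedSpace ℝ F]

theorem eq_zero_of_eq_neg {x : F} (h : x = -x) : x = 0 := by
  have h2 : (2 : ℝ) • x = 0 := by
    rw [two_smul]; nth_rw 1 [h]; simp
  simpa using h2

/-- An even smooth function has a derivative which is a multiple of the coordinate. -/
theorem exists_contDiff_deriv_eq_smul [CompleteSpace F] {f : E × ℝ → F} (hf : ContDiff ℝ ∞ f)
    (heven : ∀ e r, f (e, -r) = f (e, r)) :
    ∃ g : E × ℝ → F, ContDiff ℝ ∞ g ∧ (∀ p, fderiv ℝ f p (0, 1) = p.2 • g p) ∧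
      ∀ e r, g (e, -r) = g (e, r) := by
  have hd : ContDiff ℝ ∞ fun p => fderiv ℝ f p ((0, 1) : E × ℝ) :=
    (hf.fderiv_right (m := ∞) (by simp)).clm_apply contDiff_const
  have hodd : ∀ e r, fderiv ℝ f (e, -r) ((0, 1) : E × ℝ) = -fderiv ℝ f (e, r) ((0, 1) : E × ℝ) := by
    intro e r
    have h1 : ∀ r, HasDerivAt (fun r => f (e, r)) (fderiv ℝ f (e, r) ((0, 1) : E × ℝ)) r := by
      intro r
      exact ((hf.differentiable (by simp)) (e, r)).hasFDerivAt.comp_hasDerivAt r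
        ((hasDerivAt_const r e).prodMk (hasDerivAt_id r))
    have h2 := (h1 (-r)).scomp r (hasDerivAt_neg r)
    have h3 : ((fun r => f (e, r)) ∘ Neg.neg) = fun r => f (e, r) := by
      funext r; exact heven e r
    rw [h3] at h2
    have h4 := h2.unique (h1 r)
    rw [← h4]; simp
  have hzero : ∀ e, fderiv ℝ f (e, 0) ((0, 1) : E × ℝ) = 0 := by
    intro e
    have := hodd e 0
    rw [neg_zero] at this
    exact eq_zero_of_eq_neg this
  obtain ⟨g, hg, hfg⟩ := exists_contDiff_eq_smul hd hzero
  refine ⟨g, hg, hfg, fun e => ?_⟩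
  -- Oddness of r g(e, r) gives evenness of g after cancelling r, which is possible for r ≠ 0;
  -- continuity supplies r = 0.
  have h1 : (fun r => g (e, -r)) = fun r => g (e, r) := by
    refine Continuous.ext_on (dense_compl_singleton (0 : ℝ))
      (hg.continuous.comp (by fun_prop)) (hg.continuous.comp (by fun_prop)) fun r hr => ?_
    have h2 := hodd e r
    rw [hfg, hfg] at h2
    simp only [neg_smul, neg_inj] at h2
    exact smul_right_injective F hr h2
  exact fun r => congrFun h1 r

/-- Divide f(e, r) − f(e, 0) by r twice: the first quotient is odd, so it vanishes at r = 0 and can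
be divided again, and the second quotient is even. -/
theorem exists_contDiff_eq_add_sq_smul [CompleteSpace F] {f : E × ℝ → F} (hf : ContDiff ℝ ∞ f)
    (heven : ∀ e r, f (e, -r) = f (e, r)) :
    ∃ g : E × ℝ → F, ContDiff ℝ ∞ g ∧ (∀ e r, f (e, r) = f (e, 0) + (r * r) • g (e, r)) ∧
      ∀ e r, g (e, -r) = g (e, r) := by
  obtain ⟨f₁, hf₁, hff₁⟩ := exists_contDiff_eq_smul (f := fun p : E × ℝ => f p - f (p.1, 0))
    (hf.sub (hf.comp (by fun_prop))) (fun e => sub_self _)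
  have hf₁0 : ∀ e, f₁ (e, 0) = 0 := by
    intro e
    have h1 : (fun r => f₁ (e, -r)) = fun r => - f₁ (e, r) := by
      refine Continuous.ext_on (dense_compl_singleton (0 : ℝ))
        (hf₁.continuous.comp (by fun_prop)) (hf₁.continuous.comp (by fun_prop)).neg
        fun r hr => ?_
      have h2 := hff₁ (e, -r)
      have h3 := hff₁ (e, r)
      simp only [heven] at h2 h3
      rw [h2] at h3
      refine smul_right_injective F hr ?_
      simp only [neg_smul, smul_neg] at h3 ⊢
      rw [← h3, neg_neg]
    have := congrFun h1 0
    simp only [neg_zero] at this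
    exact eq_zero_of_eq_neg this
  obtain ⟨f₂, hf₂, hff₂⟩ := exists_contDiff_eq_smul hf₁ hf₁0
  have hrepr : ∀ e r, f (e, r) = f (e, 0) + (r * r) • f₂ (e, r) := by
    intro e r
    rw [← smul_smul, ← hff₂ (e, r), ← hff₁ (e, r)]; simp
  refine ⟨f₂, hf₂, hrepr, fun e => ?_⟩
  have h1 : (fun r => f₂ (e, -r)) = fun r => f₂ (e, r) := by
    refine Continuous.ext_on (dense_compl_singleton (0 : ℝ))
      (hf₂.continuous.comp (by fun_prop)) (hf₂.continuous.comp (by fun_prop)) fun r hr => ?_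
    have h2 := hrepr e (-r)
    rw [heven, hrepr e r, neg_mul_neg, add_right_inj] at h2
    exact (smul_right_injective F (mul_ne_zero hr hr) h2).symm
  exact fun r => congrFun h1 r

/-- The singular factor 1/(2√t) in the derivative of √t is absorbed by ∂f/∂r = r g, which leaves g/2
· dt. Where t vanishes, t has a minimum, so dt = 0; there f(x, √t) = f(x, 0) + t f₂ with f₂ bounded
and t = o(‖x − e‖), so the same formula holds. -/
theorem hasFDerivAt_comp_sqrt [CompleteSpace F] {f g : E × ℝ → F} (hf : ContDiff ℝ ∞ f)
    (heven : ∀ e r, f (e, -r) = f (e, r)) (hfg : ∀ p, fderiv ℝ f p (0, 1) = p.2 • g p)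
    {t : E → ℝ} (ht : ContDiff ℝ ∞ t) (ht0 : ∀ e, 0 ≤ t e) (e : E) :
    HasFDerivAt (fun e => f (e, √(t e)))
      ((fderiv ℝ f (e, √(t e))).comp (ContinuousLinearMap.inl ℝ E ℝ) +
        (1 / 2 : ℝ) • (fderiv ℝ t e).smulRight (g (e, √(t e)))) e := by
  have htd := ((ht.differentiable (by simp)) e).hasFDerivAt
  rcases (ht0 e).lt_or_eq with hpos | hzero
  · have h1 := htd.sqrt hpos.ne'
    have h2 := HasFDerivAt.comp (g := f) (f := fun e => (e, √(t e))) e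
      ((hf.differentiable (by simp)) (e, √(t e))).hasFDerivAt ((hasFDerivAt_id e).prodMk h1)
    refine h2.congr_fderiv ?_
    ext v
    have h3 : ((v, (1 / (2 * √(t e))) * fderiv ℝ t e v) : E × ℝ) =
        (v, 0) + ((1 / (2 * √(t e))) * fderiv ℝ t e v) • (0, 1) := by simp
    have h4 : √(t e) ≠ 0 := (Real.sqrt_pos.2 hpos).ne'
    simp only [ContinuousLinearMap.comp_apply, ContinuousLinearMap.prod_apply,
      ContinuousLinearMap.id_apply, smul_apply, smul_eq_mul,
      add_apply, ContinuousLinearMap.inl_apply,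
      ContinuousLinearMap.smulRight_apply]
    rw [h3, map_add, map_smul, hfg, smul_smul, smul_smul]
    congr 2
    field_simp
  · have hmin : fderiv ℝ t e = 0 := by
      refine IsLocalMin.fderiv_eq_zero (Eventually.of_forall fun x => ?_)
      rw [← hzero]; exact ht0 x
    rw [hmin] at htd
    obtain ⟨f₂, hf₂, hff₂, -⟩ := exists_contDiff_eq_add_sq_smul hf heven
    have hrepr : ∀ x, f (x, √(t x)) = f (x, 0) + t x • f₂ (x, √(t x)) := by
      intro x
      have h1 := hff₂ x (√(t x))
      rwa [Real.mul_self_sqrt (ht0 x)] at h1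
    have h1 : HasFDerivAt (fun x => f (x, (0 : ℝ)))
        ((fderiv ℝ f (e, 0)).comp (ContinuousLinearMap.inl ℝ E ℝ)) e :=
      HasFDerivAt.comp (g := f) (f := fun x => (x, (0 : ℝ))) e
        ((hf.differentiable (by simp)) (e, 0)).hasFDerivAt (hasFDerivAt_prodMk_left e 0)
    have h2 : HasFDerivAt (fun x => t x • f₂ (x, √(t x))) (0 : E →L[ℝ] F) e := by
      have hO : (fun x => f₂ (x, √(t x))) =O[𝓝 e] fun _ => (1 : ℝ) := by
        have := ht.continuous
        exact Tendsto.isBigO_one ℝ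
          (hf₂.continuous.comp (show Continuous fun x => (x, √(t x)) by fun_prop)).continuousAt
      have ho : (fun x => t x) =o[𝓝 e] fun x => ‖x - e‖ := by
        have := htd.isLittleO.norm_right
        simpa [← hzero] using this
      rw [hasFDerivAt_iff_isLittleO]
      have h3 := ho.smul_isBigO hO
      simp only [smul_eq_mul, mul_one] at h3
      simpa [← hzero] using h3.of_norm_right
    have h3 := h1.add h2
    rw [← hzero, Real.sqrt_zero, hmin]
    refine (h3.congr_of_eventuallyEq (Eventually.of_forall hrepr)).congr_fderiv ?_
    ext v; simp

/-- A version of Whitney's theorem on even functions. -/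
theorem contDiff_comp_sqrt [CompleteSpace F] {f : E × ℝ → F} (hf : ContDiff ℝ ∞ f)
    (heven : ∀ e r, f (e, -r) = f (e, r)) {t : E → ℝ} (ht : ContDiff ℝ ∞ t)
    (ht0 : ∀ e, 0 ≤ t e) : ContDiff ℝ ∞ fun e => f (e, √(t e)) := by
  rw [contDiff_infty]
  intro n
  induction n generalizing F with
  | zero =>
    rw [Nat.cast_zero, contDiff_zero]
    have := ht.continuous
    exact hf.continuous.comp (by fun_prop)
  | succ n ih =>
    obtain ⟨g, hg, hfg, hgeven⟩ := exists_contDiff_deriv_eq_smul hf heven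
    rw [Nat.cast_succ, contDiff_succ_iff_hasFDerivAt]
    refine ⟨_, ?_, fun e => hasFDerivAt_comp_sqrt hf heven hfg ht ht0 e⟩
    -- Both functions composed with √t in the derivative, g and the partial derivative of f along E,
    -- are again even, so the induction hypothesis applies to each of them.
    have h1 : ContDiff ℝ n fun e => g (e, √(t e)) := ih hg hgeven
    have h2 : ContDiff ℝ n fun e =>
        (fderiv ℝ f (e, √(t e))).comp (ContinuousLinearMap.inl ℝ E ℝ) := by
      refine ih (f := fun p => (fderiv ℝ f p).comp (ContinuousLinearMap.inl ℝ E ℝ))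
        ((hf.fderiv_right (m := ∞) (by simp)).clm_comp contDiff_const) fun e r => ?_
      -- Evenness of the partial derivative along E is obtained by differentiating the identity f ∘
      -- (id × −id) = f.
      have h3 : (fun p : E × ℝ => f ((ContinuousLinearMap.id ℝ E).prodMap (-ContinuousLinearMap.id ℝ ℝ) p)) = f := by
        funext p; exact heven p.1 p.2
      have h4 := HasFDerivAt.comp (g := f) (e, r)
        ((hf.differentiable (by simp)) _).hasFDerivAt
        ((ContinuousLinearMap.id ℝ E).prodMap (-ContinuousLinearMap.id ℝ ℝ)).hasFDerivAt
      have h5 := h4.fderiv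
      change fderiv ℝ (fun p : E × ℝ => f ((ContinuousLinearMap.id ℝ E).prodMap (-ContinuousLinearMap.id ℝ ℝ) p)) _ = _ at h5
      rw [h3] at h5
      rw [h5]
      ext v
      simp
    have h3 : ContDiff ℝ n (fderiv ℝ t) := ht.fderiv_right (by exact_mod_cast le_top)
    exact h2.add ((h3.smulRight h1).const_smul _)

end Whitney

/-! ### Functions of complex variables depending only on the moduli -/

section Radial

variable {ι : Type} [Fintype ι] {E F : Type} [NormedAddCommGroup E] [NormedSpace ℝ E]
  [NormedAddCommGroup F] [NormedSpace ℝ F]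

/-- The symmetrization over all signs of a smooth function of real variables is a smooth function
of their squares. -/
theorem contDiff_sum_signs_sqrt [DecidableEq ι] [CompleteSpace F] {f : E × (ι → ℝ) → F} (hf : ContDiff ℝ ∞ f)
    {t : ι → E → ℝ} (ht : ∀ i, ContDiff ℝ ∞ (t i)) (ht0 : ∀ i e, 0 ≤ t i e) :
    ContDiff ℝ ∞ fun e => ∑ ε : ι → ℤˣ, f (e, fun i => ((ε i : ℤ) : ℝ) * √(t i e)) := by
  set fs : E × (ι → ℝ) → F := fun p => ∑ ε : ι → ℤˣ, f (p.1, fun i => ((ε i : ℤ) : ℝ) * p.2 i)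
    with hfs_def
  have hfs : ContDiff ℝ ∞ fs := by
    refine ContDiff.sum fun ε _ => hf.comp (contDiff_fst.prodMk (contDiff_pi.2 fun i => ?_))
    exact contDiff_const.mul ((contDiff_apply ℝ ℝ i).comp contDiff_snd)
  -- A sign change of one variable only permutes the summands, by multiplying all sign vectors with
  -- −1 in place i.
  have hflip : ∀ e r i ρ, fs (e, Function.update r i (-ρ)) = fs (e, Function.update r i ρ) := by
    intro e r i ρ
    refine Fintype.sum_equiv (Equiv.mulLeft (Pi.mulSingle i (-1))) _ _ fun ε => ?_
    congr 2
    funext j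
    rcases eq_or_ne j i with rfl | hj
    · simp
    · simp [hj]
  -- The roots are substituted one variable at a time; the sum stays even in the variables not yet
  -- replaced, so Whitney's theorem can be used at each step.
  have key : ∀ s : Finset ι, ContDiff ℝ ∞ fun p : E × (ι → ℝ) =>
      fs (p.1, fun i => if i ∈ s then √(t i p.1) else p.2 i) := by
    intro s
    induction s using Finset.induction_on with
    | empty => simpa using hfs
    | insert i s hi ih =>
      have h1 := contDiff_comp_sqrt (E := E × (ι → ℝ))
        (f := fun q : (E × (ι → ℝ)) × ℝ => fs (q.1.1, fun j => if j ∈ s then √(t j q.1.1)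
          else Function.update q.1.2 i q.2 j)) (t := fun p => t i p.1)
        (ih.comp (f := fun q : (E × (ι → ℝ)) × ℝ => (q.1.1, Function.update q.1.2 i q.2)) (by
          refine (contDiff_fst.comp contDiff_fst).prodMk (contDiff_pi.2 fun j => ?_)
          rcases eq_or_ne j i with rfl | hj
          · simpa using contDiff_snd
          · simp only [Function.update_of_ne hj]
            exact (contDiff_apply ℝ ℝ j).comp (contDiff_snd.comp contDiff_fst)))
        (fun p ρ => by
          have h2 : ∀ ρ, (fun j => if j ∈ s then √(t j p.1) else Function.update p.2 i ρ j) =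
              Function.update (fun j => if j ∈ s then √(t j p.1) else p.2 j) i ρ := by
            intro ρ
            funext j
            rcases eq_or_ne j i with rfl | hj
            · simp [hi]
            · simp [hj]
          simp only [h2, hflip])
        ((ht i).comp contDiff_fst) (fun p => ht0 i p.1)
      convert h1 using 4 with p
      funext j
      rcases eq_or_ne j i with rfl | hj
      · simp [hi]
      · simp [hj]
  have h := (key Finset.univ).comp (contDiff_id.prodMk (contDiff_const (c := (0 : ι → ℝ))))
  simpa [hfs_def, Function.comp_def] using h

/-- Smooth functions on `ℂ^ι × E` which are invariant under rotations of the complex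
coordinates. -/
structure IsRadial (u : (ι → ℂ) × E → ℝ) : Prop where
  contDiff : ContDiff ℝ ∞ u
  eq_norm : ∀ z e, u (z, e) = u (fun i => (‖z i‖ : ℂ), e)

theorem IsRadial.congr_norm {u : (ι → ℂ) × E → ℝ} (hu : IsRadial u) {z z' : ι → ℂ}
    (h : ∀ i, ‖z i‖ = ‖z' i‖) (e : E) : u (z, e) = u (z', e) := by
  rw [hu.eq_norm z, hu.eq_norm z']
  simp only [h]

/-- Tool for density arguments: along a suitable real line the locus where a factor cannot be
cancelled consists of finitely many parameters. -/
theorem eq_of_finite_compl {G : Type*} [TopologicalSpace G] [T2Space G] {f g : ℝ → G}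
    (hf : Continuous f) (hg : Continuous g) {s : Set ℝ} (hs : s.Finite)
    (h : ∀ x ∉ s, f x = g x) (x : ℝ) : f x = g x :=
  congrFun (Continuous.ext_on (hs.countable.dense_compl ℝ) hf hg h) x

theorem contDiff_norm_sq_complex : ContDiff ℝ ∞ fun z : ℂ => ‖z‖ ^ 2 := contDiff_norm_sq ℝ

/-- For real values r of the i-th coordinate, u is even in r and vanishes at r = 0, hence equals r²
g'. By Whitney's theorem g' evaluated at r = |z_i| is smooth, being a function of |z_i|². -/
theorem IsRadial.exists_eq_norm_sq_mul {u : (ι → ℂ) × E → ℝ} (hu : IsRadial u) (i : ι)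
    (h0 : ∀ z e, z i = 0 → u (z, e) = 0) :
    ∃ g : (ι → ℂ) × E → ℝ, IsRadial g ∧ ∀ z e, u (z, e) = ‖z i‖ ^ 2 * g (z, e) := by
  classical
  obtain ⟨g', hg', hfg, hg'_even⟩ := exists_contDiff_eq_add_sq_smul
    (f := fun q : ((ι → ℂ) × E) × ℝ => u (Function.update q.1.1 i (q.2 : ℂ), q.1.2))
    (hu.contDiff.comp (by
      refine ContDiff.prodMk (contDiff_pi.2 fun j => ?_) (contDiff_snd.comp contDiff_fst)
      rcases eq_or_ne j i with rfl | hj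
      · simpa [Function.comp_def] using Complex.ofRealCLM.contDiff.comp contDiff_snd
      · simp only [Function.update_of_ne hj]
        exact (contDiff_apply ℝ ℂ j).comp (contDiff_fst.comp contDiff_fst)))
    (fun p r => by
      refine hu.congr_norm (fun j => ?_) _
      rcases eq_or_ne j i with rfl | hj
      · simp
      · simp [hj])
  have ht : ContDiff ℝ ∞ fun p : (ι → ℂ) × E => ‖p.1 i‖ ^ 2 :=
    contDiff_norm_sq_complex.comp ((contDiff_apply ℝ ℂ i).comp contDiff_fst)
  have hug : ∀ z e, u (z, e) = ‖z i‖ ^ 2 * g' ((z, e), ‖z i‖) := by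
    intro z e
    have h2 := hfg (z, e) ‖z i‖
    simp only [smul_eq_mul] at h2
    rw [h0 (Function.update z i ((0 : ℝ) : ℂ)) e (by simp), zero_add, ← sq] at h2
    rw [← h2]
    refine hu.congr_norm (fun j => ?_) _
    rcases eq_or_ne j i with rfl | hj
    · simp
    · simp [hj]
  have hsm := contDiff_comp_sqrt hg' hg'_even ht (fun p => by positivity)
  simp only [Real.sqrt_sq (norm_nonneg _)] at hsm
  refine ⟨_, ⟨hsm, fun z e => ?_⟩, hug⟩
  have hne : ∀ z e, z i ≠ 0 → g' ((z, e), ‖z i‖) =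
      g' ((fun j => (‖z j‖ : ℂ), e), ‖(‖z i‖ : ℂ)‖) := by
    intro z e hz
    have h1 := hug z e
    have h2 := hug (fun j => (‖z j‖ : ℂ)) e
    rw [← hu.eq_norm, h1] at h2
    simp only [Complex.norm_real, norm_norm] at h2 ⊢
    exact mul_left_cancel₀ (by simpa using hz) h2
  -- At z_i = 0 the factor |z_i|² cannot be cancelled; radiality of the quotient follows there as a
  -- limit along real values z_i = ε.
  by_cases hz : z i = 0
  · have h1 := eq_of_finite_compl (f := fun ε : ℝ => g' ((Function.update z i (ε : ℂ), e), ‖(ε : ℂ)‖))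
      (g := fun ε : ℝ => g' ((fun j => (‖Function.update z i (ε : ℂ) j‖ : ℂ), e), ‖(‖(ε : ℂ)‖ : ℂ)‖))
      (hg'.continuous.comp (by
        have : Continuous fun ε : ℝ => Function.update z i (ε : ℂ) :=
          continuous_const.update i Complex.continuous_ofReal
        fun_prop))
      (hg'.continuous.comp (by
        have : Continuous fun ε : ℝ => Function.update z i (ε : ℂ) :=
          continuous_const.update i Complex.continuous_ofReal
        have h : ∀ j, Continuous fun ε : ℝ => Function.update z i (ε : ℂ) j := fun j =>
          (continuous_apply j).comp this
        fun_prop)) (finite_singleton 0) (fun ε hε => by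
          have := hne (Function.update z i (ε : ℂ)) e (by simpa using hε)
          simpa using this) 0
    have hup : Function.update z i ((0 : ℝ) : ℂ) = z := by
      rw [Complex.ofReal_zero, ← hz, Function.update_eq_self]
    rw [hup] at h1
    simpa [hz] using h1
  · exact hne z e hz

/-- One factor |z_i|² is divided out at a time. The point is that the quotient by the earlier
factors still vanishes on z_i = 0. -/
theorem IsRadial.exists_eq_prod_mul {u : (ι → ℂ) × E → ℝ} (hu : IsRadial u)
    (h0 : ∀ z e, (∃ i, z i = 0) → u (z, e) = 0) :
    ∃ g : (ι → ℂ) × E → ℝ, IsRadial g ∧ ∀ z e, u (z, e) = (∏ i, ‖z i‖ ^ 2) * g (z, e) := by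
  classical
  suffices h : ∀ s : Finset ι, ∃ g : (ι → ℂ) × E → ℝ, IsRadial g ∧
      ∀ z e, u (z, e) = (∏ i ∈ s, ‖z i‖ ^ 2) * g (z, e) from h Finset.univ
  intro s
  induction s using Finset.induction_on with
  | empty => exact ⟨u, hu, by simp⟩
  | insert i s hi ih =>
    obtain ⟨g, hg, hug⟩ := ih
    obtain ⟨g', hg', hgg⟩ := hg.exists_eq_norm_sq_mul i (fun z e hz => by
      -- Shifting the coordinates in `s` by a real ε keeps z_i = 0 and makes the earlier factors
      -- non-zero for all but finitely many ε, so they can be cancelled before letting ε tend to 0.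
      set c : ℝ → ι → ℂ := fun ε j => if j ∈ s then z j + ε else z j with hc
      have hcont : Continuous c := by
        refine continuous_pi fun j => ?_
        by_cases hj : j ∈ s
        · simp only [hc, hj, if_true]; fun_prop
        · simp only [hc, hj, if_false]; fun_prop
      have h1 := eq_of_finite_compl (f := fun ε : ℝ => g (c ε, e)) (g := fun _ => 0)
        (s := ((s.image fun j => -(z j).re : Finset ℝ) : Set ℝ))
        (hg.contDiff.continuous.comp (by fun_prop)) continuous_const (Finset.finite_toSet _)
        (fun ε hε => by
          have h2 := hug (c ε) e
          rw [h0 _ _ ⟨i, by simp [hc, hi, hz]⟩] at h2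
          refine (mul_eq_zero.1 h2.symm).resolve_left (Finset.prod_ne_zero_iff.2 fun j hj => ?_)
          simp only [hc, hj, if_true]
          refine pow_ne_zero 2 (norm_ne_zero_iff.2 fun h => hε ?_)
          simp only [Finset.coe_image, Set.mem_image, Finset.mem_coe]
          refine ⟨j, hj, ?_⟩
          have h3 := congrArg Complex.re h
          simp at h3
          linarith) 0
      simpa [hc] using h1)
    refine ⟨g', hg', fun z e => ?_⟩
    rw [Finset.prod_insert hi, hug, hgg]
    ring

end Radial

/-! ### Smooth division by a complex coordinate -/

section Division

variable {E : Type} [NormedAddCommGroup E] [NormedSpace ℝ E]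

theorem norm_conj_pow_div_pow (N j : ℕ) (z : ℂ) : ‖conj z ^ N / z ^ j‖ = ‖z‖ ^ N / ‖z‖ ^ j := by
  simp

/-- Away from the origin this is the quotient rule. At the origin the function is O(|z|^{N−j}) with
N − j ≥ 2, so its derivative is zero, and the formula also gives zero there because positive powers
of 0 stand in its numerators. -/
theorem hasFDerivAt_conj_pow_div_pow {N j : ℕ} (h : j + 2 ≤ N) (z : ℂ) :
    HasFDerivAt (fun z : ℂ => conj z ^ N / z ^ j)
      (((N : ℂ) * (conj z ^ (N - 1) / z ^ j)) • (Complex.conjCLE : ℂ →L[ℝ] ℂ) -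
        ((j : ℂ) * (conj z ^ N / z ^ (j + 1))) • ContinuousLinearMap.id ℝ ℂ) z := by
  by_cases hz : z = 0
  · subst hz
    have h1 : N - 1 ≠ 0 := by omega
    have h2 : N ≠ 0 := by omega
    refine HasFDerivAt.congr_fderiv (f' := 0) ?_ (by ext v; simp [zero_pow h1, zero_pow h2])
    rw [hasFDerivAt_iff_isLittleO_nhds_zero]
    simp only [map_zero, zero_pow h2, zero_div, sub_zero, zero_add, zero_apply]
    obtain ⟨d, rfl⟩ : ∃ d, N = j + 2 + d := ⟨N - (j + 2), by omega⟩
    have h3 : (fun z : ℂ => conj z ^ (j + 2 + d) / z ^ j) =O[𝓝 0] fun z : ℂ => ‖z‖ ^ (2 + d) := by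
      refine Asymptotics.IsBigO.of_bound 1 (Eventually.of_forall fun z => ?_)
      rw [norm_conj_pow_div_pow, norm_pow, norm_norm, add_assoc, pow_add, one_mul]
      by_cases hz : ‖z‖ = 0
      · simp [hz]
      · rw [mul_div_cancel_left₀ _ (pow_ne_zero _ hz)]
    refine Asymptotics.IsLittleO.of_norm_right (g' := fun z : ℂ => z) (h3.trans_isLittleO ?_)
    have h4 := (Asymptotics.isLittleO_pow_pow (𝕜 := ℝ) (m := 1) (n := 2 + d) (by omega)).comp_tendsto
      (tendsto_norm_zero (E := ℂ))
    simpa [Function.comp_def] using h4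
  · have h1 : HasFDerivAt (fun z : ℂ => conj z ^ N)
        (((N : ℂ) * conj z ^ (N - 1)) • (Complex.conjCLE : ℂ →L[ℝ] ℂ)) z := by
      have h := ((hasDerivAt_pow N (conj z)).hasFDerivAt.restrictScalars ℝ).comp z
        (Complex.conjCLE : ℂ →L[ℝ] ℂ).hasFDerivAt
      refine h.congr_fderiv ?_
      ext v; simp [mul_comm]
    have h2 : HasFDerivAt (fun z : ℂ => (z ^ j)⁻¹)
        ((-((j : ℂ) / z ^ (j + 1))) • ContinuousLinearMap.id ℝ ℂ) z := by
      have h := (((hasDerivAt_pow j z).inv (pow_ne_zero j hz)).hasFDerivAt.restrictScalars ℝ)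
      refine h.congr_fderiv ?_
      have h3 : -((j : ℂ) * z ^ (j - 1)) / (z ^ j) ^ 2 = -((j : ℂ) / z ^ (j + 1)) := by
        rcases j with _ | j
        · simp
        · rw [Nat.add_sub_cancel]
          field_simp
          ring
      ext v; simp [h3, mul_comm]
    have h3 := h1.mul h2
    simp only [div_eq_mul_inv]
    refine h3.congr_fderiv ?_
    ext v; simp [div_eq_mul_inv]; ring

/-- Each differentiation lowers N − j by exactly one, so a gap of m + 2 suffices for m derivatives.
-/
theorem contDiff_conj_pow_div_pow (m : ℕ) {N j : ℕ} (h : j + m + 2 ≤ N) :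
    ContDiff ℝ m fun z : ℂ => conj z ^ N / z ^ j := by
  induction m generalizing N j with
  | zero =>
    rw [Nat.cast_zero, contDiff_zero, continuous_iff_continuousAt]
    exact fun z => (hasFDerivAt_conj_pow_div_pow (by omega) z).continuousAt
  | succ m ih =>
    rw [Nat.cast_succ, contDiff_succ_iff_hasFDerivAt]
    refine ⟨_, ?_, fun z => hasFDerivAt_conj_pow_div_pow (by omega) z⟩
    exact ((contDiff_const.mul (ih (by omega))).smul contDiff_const).sub
      ((contDiff_const.mul (ih (by omega))).smul contDiff_const)

/-- The antiholomorphic derivative in the direction of a complex line. -/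
def dbar (j : ℂ →L[ℝ] E) (w : E → ℂ) (e : E) : ℂ :=
  (1 / 2) * (fderiv ℝ w e (j 1) + Complex.I * fderiv ℝ w e (j Complex.I))

variable {ζ : E →L[ℝ] ℂ} {j : ℂ →L[ℝ] E} {v w : E → ℂ}

theorem ContDiff.dbar (hw : ContDiff ℝ ∞ w) : ContDiff ℝ ∞ (dbar j w) := by
  have h : ∀ v, ContDiff ℝ ∞ fun e => fderiv ℝ w e v := fun v =>
    (hw.fderiv_right (m := ∞) (by simp)).clm_apply contDiff_const
  exact contDiff_const.mul ((h _).add (contDiff_const.mul (h _)))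

theorem ContDiff.iterate_dbar (hw : ContDiff ℝ ∞ w) (q : ℕ) :
    ContDiff ℝ ∞ ((EllipticTDuality.dbar j)^[q] w) := by
  induction q with
  | zero => exact hw
  | succ q ih =>
    rw [Function.iterate_succ_apply']
    exact ContDiff.dbar ih

theorem dbar_add (hv : ContDiff ℝ ∞ v) (hw : ContDiff ℝ ∞ w) :
    dbar j (fun e => v e + w e) = fun e => dbar j v e + dbar j w e := by
  funext e
  simp only [dbar]
  rw [fderiv_fun_add (hv.differentiable (by simp) e) (hw.differentiable (by simp) e)]
  simp only [add_apply]
  ring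

theorem dbar_mul (hv : ContDiff ℝ ∞ v) (hw : ContDiff ℝ ∞ w) :
    dbar j (fun e => v e * w e) = fun e => v e * dbar j w e + w e * dbar j v e := by
  funext e
  simp only [dbar]
  rw [fderiv_fun_mul (hv.differentiable (by simp) e) (hw.differentiable (by simp) e)]
  simp only [add_apply, smul_apply, smul_eq_mul]
  ring

theorem iterate_dbar_add (hv : ContDiff ℝ ∞ v) (hw : ContDiff ℝ ∞ w) (q : ℕ) :
    (dbar j)^[q] (fun e => v e + w e) = fun e => (dbar j)^[q] v e + (dbar j)^[q] w e := by
  induction q with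
  | zero => rfl
  | succ q ih =>
    simp only [Function.iterate_succ_apply', ih]
    exact dbar_add (ContDiff.iterate_dbar hv q) (ContDiff.iterate_dbar hw q)

theorem iterate_dbar_mul_of_dbar_eq_zero (hv : ContDiff ℝ ∞ v) (hw : ContDiff ℝ ∞ w)
    (h0 : ∀ e, dbar j v e = 0) (q : ℕ) :
    (dbar j)^[q] (fun e => v e * w e) = fun e => v e * (dbar j)^[q] w e := by
  induction q with
  | zero => rfl
  | succ q ih =>
    simp only [Function.iterate_succ_apply', ih]
    rw [dbar_mul hv (ContDiff.iterate_dbar hw q)]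
    funext e
    simp [h0]

variable (hζ : ∀ c, ζ (j c) = c)

theorem contDiff_conj_comp : ContDiff ℝ ∞ fun e => conj (ζ e) :=
  (Complex.conjCLE : ℂ →L[ℝ] ℂ).contDiff.comp ζ.contDiff

include hζ in
theorem dbar_coord (e : E) : dbar j (fun e => ζ e) e = 0 := by
  simp only [dbar]
  rw [show (fun e => ζ e) = ζ from rfl, ζ.fderiv, hζ, hζ]
  simp

include hζ in
theorem dbar_conj_coord (e : E) : dbar j (fun e => conj (ζ e)) e = 1 := by
  simp only [dbar]
  have h : fderiv ℝ (fun e => conj (ζ e)) e = (Complex.conjCLE : ℂ →L[ℝ] ℂ).comp ζ :=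
    ((Complex.conjCLE : ℂ →L[ℝ] ℂ).comp ζ).fderiv
  rw [h]
  simp [hζ]
  norm_num

include hζ in
theorem iterate_dbar_coord_mul (hw : ContDiff ℝ ∞ w) (q : ℕ) :
    (dbar j)^[q] (fun e => ζ e * w e) = fun e => ζ e * (dbar j)^[q] w e :=
  iterate_dbar_mul_of_dbar_eq_zero ζ.contDiff hw (dbar_coord hζ) q

include hζ in
-- Leibniz rule with ∂̄ of the conjugate coordinate equal to 1. On ζ = 0 only (q + 1) ∂̄^q w
-- survives, which is how vanishing of the derivatives of w is read off below.
theorem iterate_dbar_conj_coord_mul (hw : ContDiff ℝ ∞ w) (q : ℕ) :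
    (dbar j)^[q + 1] (fun e => conj (ζ e) * w e) = fun e =>
      conj (ζ e) * (dbar j)^[q + 1] w e + (q + 1) * (dbar j)^[q] w e := by
  induction q with
  | zero =>
    simp only [zero_add, Function.iterate_one, Function.iterate_zero, id]
    rw [dbar_mul contDiff_conj_comp hw]
    funext e
    simp [dbar_conj_coord hζ]
  | succ q ih =>
    rw [Function.iterate_succ_apply', ih,
      dbar_add (contDiff_conj_comp.mul (ContDiff.iterate_dbar hw _))
        (contDiff_const.mul (ContDiff.iterate_dbar hw _)),
      dbar_mul contDiff_conj_comp (ContDiff.iterate_dbar hw _),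
      dbar_mul contDiff_const (ContDiff.iterate_dbar hw _)]
    funext e
    have hc : dbar j (fun _ : E => ((q : ℂ) + 1)) e = 0 := by simp [dbar]
    simp only [dbar_conj_coord hζ, hc, ← Function.iterate_succ_apply' (dbar j)]
    push_cast
    ring

include hζ in
-- Hadamard's lemma along the complex line through e, starting from the point e − j(ζ e) where w
-- vanishes. The resulting real-linear expression in ζ(e) splits into a complex-linear part A and an
-- antilinear part B.
theorem exists_eq_coord_mul_add_conj (hw : ContDiff ℝ ∞ w) (h0 : ∀ e, ζ e = 0 → w e = 0) :
    ∃ A B : E → ℂ, ContDiff ℝ ∞ A ∧ ContDiff ℝ ∞ B ∧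
      ∀ e, w e = ζ e * A e + conj (ζ e) * B e := by
  obtain ⟨K, hK, hKw, -⟩ := exists_contDiff_sub_eq_apply hw
  have hK' : ∀ v, ContDiff ℝ ∞ fun e => K (e - j (ζ e), j (ζ e)) v := fun v =>
    (hK.comp ((contDiff_id.sub (j.contDiff.comp ζ.contDiff)).prodMk
      (j.contDiff.comp ζ.contDiff))).clm_apply contDiff_const
  refine ⟨fun e => (1 / 2) * (K (e - j (ζ e), j (ζ e)) (j 1) -
      Complex.I * K (e - j (ζ e), j (ζ e)) (j Complex.I)),
    fun e => (1 / 2) * (K (e - j (ζ e), j (ζ e)) (j 1) +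
      Complex.I * K (e - j (ζ e), j (ζ e)) (j Complex.I)),
    contDiff_const.mul ((hK' _).sub (contDiff_const.mul (hK' _))),
    contDiff_const.mul ((hK' _).add (contDiff_const.mul (hK' _))), fun e => ?_⟩
  have h1 := hKw (e - j (ζ e)) (j (ζ e))
  rw [h0 (e - j (ζ e)) (by simp [hζ]), sub_add_cancel, sub_zero] at h1
  have h2 : j (ζ e) = (ζ e).re • j 1 + (ζ e).im • j Complex.I := by
    rw [← map_smul, ← map_smul, ← map_add]
    congr 1
    apply Complex.ext <;> simp
  beta_reduce
  rw [h1]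
  conv_lhs => rw [h2, map_add, map_smul, map_smul]
  rw [← h2]
  generalize K (e - j (ζ e), j (ζ e)) (j 1) = k1
  generalize K (e - j (ζ e), j (ζ e)) (j Complex.I) = k2
  have h3 := Complex.re_add_im (ζ e)
  have h4 : conj (ζ e) = (ζ e).re - (ζ e).im * Complex.I := by
    apply Complex.ext <;> simp
  rw [h4]
  nth_rw 3 [← h3]
  simp only [Complex.real_smul]
  linear_combination ((ζ e).im * k2 : ℂ) * Complex.I_sq

/-- All antiholomorphic derivatives of `w` vanish where the coordinate `ζ` vanishes. -/
def IsDbarFlat (ζ : E →L[ℝ] ℂ) (j : ℂ →L[ℝ] E) (w : E → ℂ) : Prop :=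
  ∀ (q : ℕ) (e : E), ζ e = 0 → (dbar j)^[q] w e = 0

include hζ in
-- Apply ∂̄^{q+1} to both sides and restrict to ζ = 0: the right side vanishes since ζ is
-- holomorphic, the left side is (q + 1) ∂̄^q w.
theorem isDbarFlat_of_conj_mul_eq (hv : ContDiff ℝ ∞ v) (hw : ContDiff ℝ ∞ w)
    (h : ∀ e, conj (ζ e) * w e = ζ e * v e) : IsDbarFlat ζ j w := by
  intro q e he
  have h1 := congrFun (iterate_dbar_conj_coord_mul hζ hw q) e
  rw [show (fun e => conj (ζ e) * w e) = fun e => ζ e * v e from funext h,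
    iterate_dbar_coord_mul hζ hv] at h1
  simp only [he, zero_mul, map_zero, zero_add] at h1
  exact (mul_eq_zero.1 h1.symm).resolve_left (by exact_mod_cast Nat.succ_ne_zero q)

include hζ in
-- The remainder B vanishes on ζ = 0, so it splits as ζA' + ζ̄B', and ζA' is absorbed into A. The
-- new remainder is flat again because ∂̄^{q+1}B restricted to ζ = 0 is (q + 1) ∂̄^q B'.
theorem IsDbarFlat.exists_eq_add (hw : ContDiff ℝ ∞ w) (hflat : IsDbarFlat ζ j w) (N : ℕ) :
    ∃ A B : E → ℂ, ContDiff ℝ ∞ A ∧ ContDiff ℝ ∞ B ∧ IsDbarFlat ζ j B ∧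
      ∀ e, w e = ζ e * A e + conj (ζ e) ^ N * B e := by
  induction N with
  | zero => exact ⟨0, w, contDiff_const, hw, hflat, by simp⟩
  | succ N ih =>
    obtain ⟨A, B, hA, hB, hBf, hwAB⟩ := ih
    obtain ⟨A', B', hA', hB', hBAB⟩ := exists_eq_coord_mul_add_conj hζ hB (fun e he => hBf 0 e he)
    refine ⟨fun e => A e + conj (ζ e) ^ N * A' e, B',
      hA.add ((contDiff_conj_comp.pow N).mul hA'), hB', fun q e he => ?_, fun e => ?_⟩
    · have h1 := hBf (q + 1) e he
      rw [show B = fun e => ζ e * A' e + conj (ζ e) * B' e from funext hBAB,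
        iterate_dbar_add (ζ.contDiff.mul hA') (contDiff_conj_comp.mul hB'),
        iterate_dbar_coord_mul hζ hA', iterate_dbar_conj_coord_mul hζ hB'] at h1
      simp only [he, zero_mul, map_zero, zero_add] at h1
      exact (mul_eq_zero.1 h1).resolve_left (by exact_mod_cast Nat.succ_ne_zero q)
    · rw [hwAB, hBAB]; ring

include hζ in
theorem eq_of_coord_mul_eq {G : Type*} [TopologicalSpace G] [T2Space G] {v w : E → G}
    (hv : Continuous v) (hw : Continuous w) (h : ∀ e, ζ e ≠ 0 → v e = w e) (e : E) :
    v e = w e := by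
  have h1 := eq_of_finite_compl (f := fun ε : ℝ => v (e + ε • j 1))
    (g := fun ε : ℝ => w (e + ε • j 1)) (s := {-(ζ e).re}) (by fun_prop) (by fun_prop)
    (finite_singleton _) (fun ε hε => h _ fun h0 => hε (by
      have := congrArg Complex.re h0
      simp [hζ] at this
      simp; linarith)) 0
  simpa using h1

include hζ in
/-- Smooth division by a complex coordinate. -/
theorem IsDbarFlat.exists_eq_coord_mul (hw : ContDiff ℝ ∞ w) (hflat : IsDbarFlat ζ j w) :
    ∃ γ : E → ℂ, ContDiff ℝ ∞ γ ∧ ∀ e, w e = ζ e * γ e := by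
  -- With the power N = m + 3 of the conjugate coordinate in the remainder, the quotient A +
  -- (ζ̄^N/ζ)B is of class C^m. Continuous quotients are unique by density of ζ ≠ 0, so the one
  -- obtained for m = 0 is of class C^m for every m.
  have key : ∀ m : ℕ, ∃ γ : E → ℂ, ContDiff ℝ m γ ∧ ∀ e, w e = ζ e * γ e := by
    intro m
    obtain ⟨A, B, hA, hB, -, hwAB⟩ := hflat.exists_eq_add hζ hw (1 + m + 2)
    refine ⟨fun e => A e + conj (ζ e) ^ (1 + m + 2) / ζ e ^ 1 * B e,
      (hA.of_le (by exact_mod_cast le_top)).add (ContDiff.mul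
        ((contDiff_conj_pow_div_pow m le_rfl).comp ζ.contDiff)
        (hB.of_le (by exact_mod_cast le_top))), fun e => ?_⟩
    rw [hwAB]
    by_cases he : ζ e = 0
    · simp [he]
    · field_simp
  obtain ⟨γ, hγ, hwγ⟩ := key 0
  refine ⟨γ, contDiff_infty.2 fun m => ?_, hwγ⟩
  obtain ⟨γ', hγ', hwγ'⟩ := key m
  have h : γ = γ' := funext (eq_of_coord_mul_eq hζ hγ.continuous hγ'.continuous
    fun e he => mul_left_cancel₀ he ((hwγ e).symm.trans (hwγ' e)))
  rw [h]; exact hγ'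

end Division

/-! ### Division when only a sum of logarithmic derivatives is smooth -/

section DivisionProduct

variable {E : Type} [NormedAddCommGroup E] [NormedSpace ℝ E] {ι : Type} [Fintype ι]
  [DecidableEq ι] {ζ : ι → E →L[ℝ] ℂ} {j : ι → ℂ →L[ℝ] E}

/-- If `∑ Re(w_i / ζ_i)` is smooth then each `w_i / ζ_i` is smooth. -/
theorem exists_eq_coord_mul_of_sum (hζ : ∀ i i' c, ζ i (j i' c) = if i = i' then c else 0)
    {w : ι → E → ℂ} (hw : ∀ i, ContDiff ℝ ∞ (w i)) {h : E → ℝ} (hh : ContDiff ℝ ∞ h)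
    (hsum : ∀ e, ∑ i, (conj (ζ i e) * w i e).re * ∏ k ∈ Finset.univ.erase i, ‖ζ k e‖ ^ 2 =
      h e * ∏ k, ‖ζ k e‖ ^ 2) (i : ι) :
    ∃ γ : E → ℂ, ContDiff ℝ ∞ γ ∧ ∀ e, w i e = ζ i e * γ e := by
  have hn : ∀ k, ContDiff ℝ ∞ fun e => ‖ζ k e‖ ^ 2 := fun k =>
    contDiff_norm_sq_complex.comp (ζ k).contDiff
  have hp : ∀ s : Finset ι, ContDiff ℝ ∞ fun e => ∏ k ∈ s, ‖ζ k e‖ ^ 2 := fun s =>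
    contDiff_prod fun k _ => hn k
  have hre : ∀ k, ContDiff ℝ ∞ fun e => (conj (ζ k e) * w k e).re := fun k =>
    Complex.reCLM.contDiff.comp (contDiff_conj_comp.mul (hw k))
  have hofR : ∀ {f : E → ℝ}, ContDiff ℝ ∞ f → ContDiff ℝ ∞ fun e => (f e : ℂ) := fun hf =>
    Complex.ofRealCLM.contDiff.comp hf
  set P : E → ℝ := fun e => ∏ k ∈ Finset.univ.erase i, ‖ζ k e‖ ^ 2 with hP
  set R : E → ℝ := fun e => h e * P e - ∑ l ∈ Finset.univ.erase i, (conj (ζ l e) * w l e).re *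
    ∏ k ∈ (Finset.univ.erase i).erase l, ‖ζ k e‖ ^ 2 with hR
  have hRs : ContDiff ℝ ∞ R :=
    (hh.mul (hp _)).sub (ContDiff.sum fun l _ => (hre l).mul (hp _))
  -- All summands of index different from i contain |ζ_i|²; moving them to the right isolates the
  -- real part belonging to i.
  have hkey : ∀ e, (conj (ζ i e) * w i e).re * P e = ‖ζ i e‖ ^ 2 * R e := by
    intro e
    have h1 := hsum e
    rw [← Finset.add_sum_erase _ _ (Finset.mem_univ i), ← Finset.mul_prod_erase _ _
      (Finset.mem_univ i)] at h1
    have h2 : ∑ l ∈ Finset.univ.erase i, (conj (ζ l e) * w l e).re *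
        ∏ k ∈ Finset.univ.erase l, ‖ζ k e‖ ^ 2 = ‖ζ i e‖ ^ 2 *
        ∑ l ∈ Finset.univ.erase i, (conj (ζ l e) * w l e).re *
          ∏ k ∈ (Finset.univ.erase i).erase l, ‖ζ k e‖ ^ 2 := by
      rw [Finset.mul_sum]
      refine Finset.sum_congr rfl fun l hl => ?_
      have hil : i ∈ Finset.univ.erase l :=
        Finset.mem_erase.2 ⟨(Finset.ne_of_mem_erase hl).symm, Finset.mem_univ _⟩
      rw [← Finset.mul_prod_erase _ _ hil, Finset.erase_right_comm]
      ring
    rw [h2] at h1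
    simp only [hR]
    linear_combination h1
  -- Writing twice the real part as ζ̄w + ζw̄ turns `hkey` into ζ̄_i (P w_i) = ζ_i (2 ζ̄_i R − P
  -- w̄_i), so P w_i is flat.
  have hPw : IsDbarFlat (ζ i) (j i) fun e => (P e : ℂ) * w i e := by
    refine isDbarFlat_of_conj_mul_eq (v := fun e => 2 * conj (ζ i e) * R e - conj (w i e) * P e)
      (fun c => by simp [hζ]) ?_ ((hofR (hp _)).mul (hw i)) fun e => ?_
    · exact ((contDiff_const.mul contDiff_conj_comp).mul (hofR hRs)).sub
        (((Complex.conjCLE : ℂ →L[ℝ] ℂ).contDiff.comp (hw i)).mul (hofR (hp _)))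
    · have h1 := congrArg (fun x : ℝ => (x : ℂ)) (hkey e)
      simp only [Complex.ofReal_mul, Complex.ofReal_pow] at h1
      rw [Complex.re_eq_add_conj, ← Complex.mul_conj'] at h1
      simp only [map_mul, Complex.conj_conj] at h1
      linear_combination 2 * h1
  -- P does not involve ζ_i, so it is constant along the line `j i` and passes through the iterated
  -- ∂̄.
  have hPdbar : ∀ e, dbar (j i) (fun e => (P e : ℂ)) e = 0 := by
    intro e
    have h1 : ∀ c, fderiv ℝ (fun e => (P e : ℂ)) e (j i c) = 0 := by
      intro c
      have h2 : HasDerivAt (fun s : ℝ => (P (e + s • j i c) : ℂ))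
          (fderiv ℝ (fun e => (P e : ℂ)) e (j i c)) 0 := by
        have h3 : HasDerivAt (fun s : ℝ => e + s • j i c) (j i c) 0 := by
          simpa using ((hasDerivAt_id (0 : ℝ)).smul_const (j i c)).const_add e
        refine HasFDerivAt.comp_hasDerivAt (l := fun e => (P e : ℂ)) 0 ?_ h3
        rw [zero_smul, add_zero]
        exact (((hofR (hp _)).differentiable (by simp)) e).hasFDerivAt
      have h4 : (fun s : ℝ => (P (e + s • j i c) : ℂ)) = fun _ => (P e : ℂ) := by
        funext s
        congr 1
        refine Finset.prod_congr rfl fun k hk => ?_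
        rw [map_add, map_smul, hζ, if_neg (Finset.ne_of_mem_erase hk), smul_zero, add_zero]
      rw [h4] at h2
      exact h2.unique (hasDerivAt_const _ _)
    simp [dbar, h1]
  refine IsDbarFlat.exists_eq_coord_mul (ζ := ζ i) (j := j i) (fun c => by simp [hζ]) (hw i) fun q e he => ?_
  -- Moving along d keeps ζ_i = 0 and moves all the other coordinates off zero, except for finitely
  -- many parameters. There P ≠ 0 can be cancelled, and continuity gives flatness of w_i itself.
  set d : E := ∑ k ∈ Finset.univ.erase i, j k 1 with hd
  have hd_i : ζ i d = 0 := by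
    rw [hd, map_sum]
    exact Finset.sum_eq_zero fun k hk => by
      rw [hζ, if_neg (Finset.ne_of_mem_erase hk).symm]
  have hd_k : ∀ k ≠ i, ζ k d = 1 := by
    intro k hk
    rw [hd, map_sum, Finset.sum_eq_single k]
    · simp [hζ]
    · intro b _ hb; rw [hζ, if_neg hb.symm]
    · intro h; exact absurd (Finset.mem_erase.2 ⟨hk, Finset.mem_univ _⟩) h
  have h1 := eq_of_finite_compl (f := fun ε : ℝ => (dbar (j i))^[q] (w i) (e + ε • d))
    (g := fun _ => 0) (s := ((Finset.univ.image fun k => -(ζ k e).re : Finset ℝ) : Set ℝ))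
    ((ContDiff.iterate_dbar (hw i) q).continuous.comp (by fun_prop)) continuous_const
    (Finset.finite_toSet _) (fun ε hε => by
      have h2 := hPw q (e + ε • d) (by rw [map_add, map_smul, he, hd_i]; simp)
      rw [iterate_dbar_mul_of_dbar_eq_zero (hofR (hp _)) (hw i) hPdbar] at h2
      refine (mul_eq_zero.1 h2).resolve_left ?_
      rw [Complex.ofReal_eq_zero]
      refine Finset.prod_ne_zero_iff.2 fun k hk => pow_ne_zero 2 (norm_ne_zero_iff.2 fun h3 => hε ?_)
      rw [map_add, map_smul, hd_k k (Finset.ne_of_mem_erase hk)] at h3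
      have h4 := congrArg Complex.re h3
      simp only [Finset.coe_image, Finset.coe_univ, image_univ, mem_range]
      refine ⟨k, ?_⟩
      simp at h4
      linarith) 0
  simpa using h1

end DivisionProduct

/-! ## Derivations of the algebra of smooth functions -/

section PointDerivations

variable {E H : Type*} [NormedAddCommGroup E] [NormedSpace ℝ E] [TopologicalSpace H]
  {I : ModelWithCorners ℝ E H} {Q : Type*} [TopologicalSpace Q] [ChartedSpace H Q]

section Bump

variable [FiniteDimensional ℝ E] [T2Space Q] [IsManifold I ∞ Q]

variable (I) in
theorem exists_smooth_bump {q : Q} {O : Set Q} (hO : O ∈ 𝓝 q) :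
    ∃ χ : C^∞⟮I, Q; 𝓘(ℝ, ℝ), ℝ⟯, (∀ᶠ p in 𝓝 q, χ p = 1) ∧ tsupport χ ⊆ O := by
  obtain ⟨f, -, hf⟩ := (SmoothBumpFunction.nhds_basis_tsupport (I := I) q).mem_iff.1 hO
  exact ⟨⟨f, f.contMDiff⟩, f.eventuallyEq_one, hf⟩

theorem exists_smooth_extension {q : Q} {O : Set Q} (hO : IsOpen O) (hq : q ∈ O) {g : Q → ℝ}
    (hg : ContMDiffOn I 𝓘(ℝ, ℝ) ∞ g O) :
    ∃ f : C^∞⟮I, Q; 𝓘(ℝ, ℝ), ℝ⟯, ∀ᶠ p in 𝓝 q, f p = g p := by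
  obtain ⟨χ, h1, h2⟩ := exists_smooth_bump I (hO.mem_nhds hq)
  refine ⟨⟨fun p => χ p * g p, contMDiff_of_tsupport fun p hp => ?_⟩, ?_⟩
  · have hpO : p ∈ O := h2 (tsupport_mul_subset_left hp)
    exact χ.contMDiff.contMDiffAt.mul (hg.contMDiffAt (hO.mem_nhds hpO))
  · filter_upwards [h1] with p hp
    simp [hp]

end Bump

/-- A derivation at a point of the algebra of smooth functions. -/
def IsPointDerivation (q : Q) (δ : C^∞⟮I, Q; 𝓘(ℝ, ℝ), ℝ⟯ →ₗ[ℝ] ℝ) : Prop :=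
  ∀ f g, δ (f * g) = f q * δ g + g q * δ f

/-- The point derivation given by a derivation along a map. -/
def evalDerivation {E' H' Q' : Type*} [NormedAddCommGroup E'] [NormedSpace ℝ E']
    [TopologicalSpace H'] {I' : ModelWithCorners ℝ E' H'} [TopologicalSpace Q']
    [ChartedSpace H' Q'] (q : Q')
    (X : C^∞⟮I, Q; 𝓘(ℝ, ℝ), ℝ⟯ →ₗ[ℝ] C^∞⟮I', Q'; 𝓘(ℝ, ℝ), ℝ⟯) :
    C^∞⟮I, Q; 𝓘(ℝ, ℝ), ℝ⟯ →ₗ[ℝ] ℝ where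
  toFun f := X f q
  map_add' f g := by rw [map_add]; rfl
  map_smul' c f := by rw [map_smul]; rfl

@[simp]
theorem evalDerivation_apply {E' H' Q' : Type*} [NormedAddCommGroup E'] [NormedSpace ℝ E']
    [TopologicalSpace H'] {I' : ModelWithCorners ℝ E' H'} [TopologicalSpace Q']
    [ChartedSpace H' Q'] (q : Q')
    (X : C^∞⟮I, Q; 𝓘(ℝ, ℝ), ℝ⟯ →ₗ[ℝ] C^∞⟮I', Q'; 𝓘(ℝ, ℝ), ℝ⟯) (f) :
    evalDerivation q X f = X f q := rfl

theorem isPointDerivation_eval (q : Q)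
    (X : Derivation ℝ C^∞⟮I, Q; 𝓘(ℝ, ℝ), ℝ⟯ C^∞⟮I, Q; 𝓘(ℝ, ℝ), ℝ⟯) :
    IsPointDerivation q (evalDerivation q X.toLinearMap) := by
  intro f g
  change X (f * g) q = f q * X g q + g q * X f q
  rw [X.leibniz]
  rfl

namespace IsPointDerivation

variable {q : Q} {δ : C^∞⟮I, Q; 𝓘(ℝ, ℝ), ℝ⟯ →ₗ[ℝ] ℝ} (hδ : IsPointDerivation q δ)

include hδ

theorem map_one : δ 1 = 0 := by
  have h := hδ 1 1
  simp only [mul_one, ContMDiffMap.coe_one, Pi.one_apply, one_mul] at h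
  linarith

theorem map_algebraMap (c : ℝ) : δ (algebraMap ℝ _ c) = 0 := by
  rw [Algebra.algebraMap_eq_smul_one, map_smul, hδ.map_one, smul_zero]

theorem map_pow (f : C^∞⟮I, Q; 𝓘(ℝ, ℝ), ℝ⟯) : δ (f ^ 2) = 2 * f q * δ f := by
  rw [sq, hδ]; ring

theorem map_prod {ι : Type*} [DecidableEq ι] (s : Finset ι)
    (f : ι → C^∞⟮I, Q; 𝓘(ℝ, ℝ), ℝ⟯) :
    δ (∏ i ∈ s, f i) = ∑ i ∈ s, δ (f i) * ∏ j ∈ s.erase i, f j q := by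
  induction s using Finset.induction_on with
  | empty => simpa using hδ.map_one
  | insert i s hi ih =>
    rw [Finset.prod_insert hi, hδ, ih, Finset.sum_insert hi, Finset.erase_insert hi, Finset.mul_sum,
      add_comm]
    have hev : (∏ i ∈ s, f i) q = ∏ i ∈ s, f i q :=
      _root_.map_prod (ContMDiffMap.evalRingHom q : C^∞⟮I, Q; 𝓘(ℝ, ℝ), ℝ⟯ →+* ℝ) f s
    rw [hev, mul_comm]
    congr 1
    refine Finset.sum_congr rfl fun j hj => ?_
    have hij : i ≠ j := fun h => hi (h ▸ hj)
    rw [Finset.erase_insert_of_ne hij, Finset.prod_insert (fun h => hi (Finset.mem_of_mem_erase h))]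
    ring

variable [FiniteDimensional ℝ E] [T2Space Q] [IsManifold I ∞ Q]

/-- For χ equal to 1 near q and supported where f = 0, the product χ f is zero and the Leibniz rule
at q reduces to δ f = 0. -/
theorem eq_zero_of_eventually {f : C^∞⟮I, Q; 𝓘(ℝ, ℝ), ℝ⟯} (hf : ∀ᶠ p in 𝓝 q, f p = 0) :
    δ f = 0 := by
  obtain ⟨χ, h1, h2⟩ := exists_smooth_bump I hf
  have h3 : χ * f = 0 := by
    ext p
    by_cases hp : p ∈ tsupport χ
    · have : f p = 0 := h2 hp
      simp [this]
    · simp [image_eq_zero_of_notMem_tsupport hp]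
  have h4 := hδ χ f
  rw [h3, map_zero, h1.self_of_nhds, hf.self_of_nhds] at h4
  linarith

theorem congr {f g : C^∞⟮I, Q; 𝓘(ℝ, ℝ), ℝ⟯} (h : ∀ᶠ p in 𝓝 q, f p = g p) : δ f = δ g := by
  rw [← sub_eq_zero, ← map_sub]
  refine hδ.eq_zero_of_eventually ?_
  filter_upwards [h] with p hp
  simp [hp]

/-- The chain rule. -/
theorem chain {V : Type} [NormedAddCommGroup V] [NormedSpace ℝ V] {κ : Type*} [Fintype κ]
    {ℓ : κ → V →L[ℝ] ℝ} {b : κ → V} (hb : ∀ v, v = ∑ i, ℓ i v • b i) {u : V → ℝ}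
    (hu : ContDiff ℝ ∞ u) {G : Q → V} {O : Set Q} (hO : IsOpen O) (hq : q ∈ O)
    (hG : ContMDiffOn I 𝓘(ℝ, V) ∞ G O) {f : C^∞⟮I, Q; 𝓘(ℝ, ℝ), ℝ⟯}
    (hf : ∀ᶠ p in 𝓝 q, f p = u (G p)) {g : κ → C^∞⟮I, Q; 𝓘(ℝ, ℝ), ℝ⟯}
    (hg : ∀ i, ∀ᶠ p in 𝓝 q, g i p = ℓ i (G p)) :
    δ f = ∑ i, fderiv ℝ u (G q) (b i) * δ (g i) := by
  obtain ⟨K, hK, hKu, hK0⟩ := exists_contDiff_sub_eq_apply hu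
  have hk : ∀ i, ∃ k : C^∞⟮I, Q; 𝓘(ℝ, ℝ), ℝ⟯, ∀ᶠ p in 𝓝 q, k p = K (G q, G p - G q) (b i) := by
    intro i
    refine exists_smooth_extension hO hq ?_
    have h1 : ContDiff ℝ ∞ fun v => K (G q, v - G q) (b i) :=
      (hK.comp (contDiff_const.prodMk (contDiff_id.sub contDiff_const))).clm_apply contDiff_const
    exact h1.contMDiff.comp_contMDiffOn hG
  choose k hk using hk
  -- Hadamard's lemma expresses f near q as f(q) + Σ (g_i − g_i(q)) k_i. In the Leibniz rule at q
  -- only k_i(q) δ(g_i) survives, and k_i(q) is the partial derivative of u.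
  have h1 : δ f = δ (algebraMap ℝ _ (f q) + ∑ i, (g i - algebraMap ℝ _ (g i q)) * k i) := by
    refine hδ.congr ?_
    have hall : ∀ᶠ p in 𝓝 q, ∀ i, g i p = ℓ i (G p) ∧ k i p = K (G q, G p - G q) (b i) :=
      eventually_all.2 fun i => (hg i).and (hk i)
    filter_upwards [hf, hall] with p hp hp'
    have hev : (∑ i, (g i - algebraMap ℝ _ (g i q)) * k i) p =
        ∑ i, (g i p - g i q) * k i p :=
      _root_.map_sum (ContMDiffMap.evalRingHom p : C^∞⟮I, Q; 𝓘(ℝ, ℝ), ℝ⟯ →+* ℝ) _ _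
    have h2 := hKu (G q) (G p - G q)
    rw [add_sub_cancel, ← hp, ← hf.self_of_nhds] at h2
    change f p = f q + (∑ i, (g i - algebraMap ℝ _ (g i q)) * k i) p
    rw [hev, ← sub_eq_iff_eq_add', h2]
    conv_lhs => rw [hb (G p - G q), _root_.map_sum, ← hb]
    refine Finset.sum_congr rfl fun i _ => ?_
    rw [map_smul, smul_eq_mul, (hp' i).1, (hp' i).2, (hg i).self_of_nhds, map_sub]
  rw [h1, map_add, hδ.map_algebraMap, zero_add, _root_.map_sum]
  refine Finset.sum_congr rfl fun i _ => ?_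
  rw [hδ, map_sub, hδ.map_algebraMap, (hk i).self_of_nhds, sub_self, hK0]
  have h3 : (g i - algebraMap ℝ C^∞⟮I, Q; 𝓘(ℝ, ℝ), ℝ⟯ (g i q)) q = 0 := sub_self _
  rw [h3]
  ring

end IsPointDerivation

end PointDerivations

/-! ## Local parametrizations -/

/-- A smooth map from a normed space with a smooth local section around a given point. -/
structure LocalParam {E H : Type*} [NormedAddCommGroup E] [NormedSpace ℝ E] [TopologicalSpace H]
    (I : ModelWithCorners ℝ E H) {Q : Type*} [TopologicalSpace Q] [ChartedSpace H Q] (q : Q) where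
  V : Type
  [normed : NormedAddCommGroup V]
  [space : NormedSpace ℝ V]
  [finDim : FiniteDimensional ℝ V]
  r : V → Q
  s : Q → V
  O : Set Q
  isOpen : IsOpen O
  mem : q ∈ O
  r_smooth : ContMDiff 𝓘(ℝ, V) I ∞ r
  s_smooth : ContMDiffOn I 𝓘(ℝ, V) ∞ s O
  r_s : ∀ p ∈ O, r (s p) = p

attribute [instance] LocalParam.normed LocalParam.space LocalParam.finDim

/-! ### Coordinates and angles of a standard chart -/

section StandardChart

variable {k n : ℕ} {M : Type*} [TopologicalSpace M] [ChartedSpace (EuclideanSpace ℝ (Fin n)) M]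
  [MulAction (Torus k) M]

namespace StandardChart

variable (c : StandardChart k n M)

/-- The angular coordinates, as complex numbers of modulus one. -/
def phi (x : M) (i : Fin c.a) : ℂ := ((c.chart x).1 i : ℂ)

/-- The complex coordinates. -/
def z (x : M) : Fin c.l → ℂ := (c.chart x).2.1

/-- The real coordinates. -/
def y (x : M) : Fin c.m → ℝ := (c.chart x).2.2

/-- The universal cover of the model space. -/
abbrev Cover := (Fin c.a → ℝ) × (Fin c.l → ℂ) × (Fin c.m → ℝ)

/-- The parametrization of the domain of the chart by the universal cover of the model space. -/
def param (p : c.Cover) : M := c.chart.symm (torusExp p.1, p.2)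

theorem contMDiff_param : ContMDiff 𝓘(ℝ, c.Cover) (𝓡 n) ∞ c.param := c.smooth_symm

theorem param_mem (p : c.Cover) : c.param p ∈ c.chart.source :=
  c.chart.map_target (by rw [c.target_eq]; trivial)

theorem chart_param (p : c.Cover) : c.chart (c.param p) = (torusExp p.1, p.2) :=
  c.chart.right_inv (by rw [c.target_eq]; trivial)

@[simp]
theorem z_param (p : c.Cover) : c.z (c.param p) = p.2.1 := by rw [z, chart_param]

@[simp]
theorem y_param (p : c.Cover) : c.y (c.param p) = p.2.2 := by rw [y, chart_param]

theorem phi_param (p : c.Cover) (i : Fin c.a) :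
    c.phi (c.param p) i = Complex.exp (p.1 i * Complex.I) := by
  rw [phi, chart_param]
  simp [torusExp, Circle.coe_exp]

theorem norm_phi (x : M) (i : Fin c.a) : ‖c.phi x i‖ = 1 := Circle.norm_coe _

theorem phi_ne_zero (x : M) (i : Fin c.a) : c.phi x i ≠ 0 := Circle.coe_ne_zero _

theorem isOpen_source : IsOpen c.chart.source := c.chart.open_source

theorem contMDiffOn_phi (i : Fin c.a) :
    ContMDiffOn (𝓡 n) 𝓘(ℝ, ℂ) ∞ (fun x => c.phi x i) c.chart.source := c.smooth_circle i

theorem contMDiffOn_z : ContMDiffOn (𝓡 n) 𝓘(ℝ, Fin c.l → ℂ) ∞ c.z c.chart.source :=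
  c.smooth_complex

theorem contMDiffOn_z_apply (i : Fin c.l) :
    ContMDiffOn (𝓡 n) 𝓘(ℝ, ℂ) ∞ (fun x => c.z x i) c.chart.source :=
  (contDiff_apply ℝ ℂ i).contMDiff.comp_contMDiffOn c.contMDiffOn_z

theorem contMDiffOn_y : ContMDiffOn (𝓡 n) 𝓘(ℝ, Fin c.m → ℝ) ∞ c.y c.chart.source :=
  c.smooth_real

theorem contMDiffOn_y_apply (i : Fin c.m) :
    ContMDiffOn (𝓡 n) 𝓘(ℝ, ℝ) ∞ (fun x => c.y x i) c.chart.source :=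
  (contDiff_apply ℝ ℝ i).contMDiff.comp_contMDiffOn c.contMDiffOn_y

/-- The angles of a point relative to those of a base point. -/
def angle (x₀ x : M) (i : Fin c.a) : ℝ :=
  Complex.arg (c.phi x i / c.phi x₀ i) + Complex.arg (c.phi x₀ i)

/-- The domain on which the angles relative to a base point are smooth. -/
def angleDomain (x₀ : M) : Set M :=
  c.chart.source ∩ {x | ∀ i, c.phi x i / c.phi x₀ i ∈ Complex.slitPlane}

theorem isOpen_angleDomain (x₀ : M) : IsOpen (c.angleDomain x₀) := by
  have h : c.angleDomain x₀ = ⋂ i : Option (Fin c.a), c.chart.source ∩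
      {x | ∀ j, i = some j → c.phi x j / c.phi x₀ j ∈ Complex.slitPlane} := by
    ext x
    simp only [angleDomain, mem_inter_iff, mem_ofPred_eq, mem_iInter]
    exact ⟨fun h i => ⟨h.1, fun j _ => h.2 j⟩, fun h => ⟨(h none).1, fun j => (h (some j)).2 j rfl⟩⟩
  rw [h]
  refine isOpen_iInter_of_finite fun i => ?_
  rcases i with _ | i
  · simpa using c.isOpen_source
  · have h1 : c.chart.source ∩ {x | ∀ j, some i = some j → c.phi x j / c.phi x₀ j ∈
        Complex.slitPlane} = c.chart.source ∩ (fun x => c.phi x i / c.phi x₀ i) ⁻¹'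
        Complex.slitPlane := by
      ext x; simp
    rw [h1]
    exact ((c.contMDiffOn_phi i).continuousOn.div_const _).isOpen_inter_preimage c.isOpen_source
      Complex.isOpen_slitPlane

theorem mem_angleDomain {x₀ : M} (h : x₀ ∈ c.chart.source) : x₀ ∈ c.angleDomain x₀ :=
  ⟨h, fun i => by simp [div_self (c.phi_ne_zero x₀ i)]⟩

theorem torusExp_angle (x₀ x : M) : torusExp (c.angle x₀ x) = (c.chart x).1 := by
  funext i
  rw [torusExp, angle, Circle.exp_add]
  have h1 : c.phi x i / c.phi x₀ i = (((c.chart x).1 i / (c.chart x₀).1 i : Circle) : ℂ) := by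
    simp [phi]
  rw [h1, Circle.exp_arg, phi, Circle.exp_arg, div_mul_cancel]

theorem contMDiffOn_angle (x₀ : M) :
    ContMDiffOn (𝓡 n) 𝓘(ℝ, Fin c.a → ℝ) ∞ (c.angle x₀) (c.angleDomain x₀) := by
  rw [contMDiffOn_pi_space]
  intro i
  have h1 : ContMDiffOn (𝓡 n) 𝓘(ℝ, ℂ) ∞ (fun x => c.phi x i / c.phi x₀ i) (c.angleDomain x₀) := by
    have h2 : ContDiff ℝ ∞ fun w : ℂ => w / c.phi x₀ i := contDiff_id.div_const _
    exact h2.contMDiff.comp_contMDiffOn ((c.contMDiffOn_phi i).mono inter_subset_left)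
  have h2 : ContDiffOn ℝ ∞ (fun w : ℂ => Complex.arg w + Complex.arg (c.phi x₀ i))
      Complex.slitPlane := by
    refine ContDiffOn.add (fun w hw => ContDiffAt.contDiffWithinAt ?_) contDiffOn_const
    have h3 : ContDiffAt ℝ ∞ Complex.log w := (Complex.contDiffAt_log hw).restrict_scalars ℝ
    have h4 : Complex.arg = fun w => Complex.imCLM (Complex.log w) := by
      funext w; simp [Complex.log_im]
    rw [h4]
    exact Complex.imCLM.contDiff.contDiffAt.comp w h3
  exact h2.contMDiffOn.comp h1 fun x hx => hx.2 i

theorem param_angle {x : M} (x₀ : M) (hx : x ∈ c.chart.source) :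
    c.param (c.angle x₀ x, c.z x, c.y x) = x := by
  rw [param, torusExp_angle]
  exact c.chart.left_inv hx

/-- The local parametrization given by a standard chart. -/
def localParam {x₀ : M} (h : x₀ ∈ c.chart.source) : LocalParam (𝓡 n) x₀ where
  V := c.Cover
  r := c.param
  s x := (c.angle x₀ x, c.z x, c.y x)
  O := c.angleDomain x₀
  isOpen := c.isOpen_angleDomain x₀
  mem := c.mem_angleDomain h
  r_smooth := c.contMDiff_param
  s_smooth := (c.contMDiffOn_angle x₀).prodMk_space
    ((c.contMDiffOn_z.mono inter_subset_left).prodMk_space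
      (c.contMDiffOn_y.mono inter_subset_left))
  r_s _ hx := c.param_angle x₀ hx.1

end StandardChart

end StandardChart

/-! ### Derivations acting on one variable of a function on a product -/

section Product

variable {n n' : ℕ} {M M' : Type*} [TopologicalSpace M]
  [ChartedSpace (EuclideanSpace ℝ (Fin n)) M] [TopologicalSpace M']
  [ChartedSpace (EuclideanSpace ℝ (Fin n')) M']

/-- The chain rule writes the function near a point as a finite sum of partial derivatives of f,
smooth in both variables, times X(g_i) for finitely many fixed functions g_i on M. This is what
makes the vector field (X, 0) on M × M' well defined. -/
theorem contMDiff_derivation_slice [T2Space M] [IsManifold (𝓡 n) ∞ M]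
    (hM : ∀ x : M, Nonempty (LocalParam (𝓡 n) x))
    (hM' : ∀ x : M', Nonempty (LocalParam (𝓡 n') x))
    (X : Derivation ℝ (SmoothFn n M) (SmoothFn n M)) (f : ProdSmoothFn n n' M M') :
    ContMDiff ((𝓡 n).prod (𝓡 n')) 𝓘(ℝ, ℝ) ∞ fun q : M × M' => X (restrictFst q.2 f) q.1 := by
  rintro ⟨x₀, y₀⟩
  obtain ⟨p⟩ := hM x₀
  obtain ⟨p'⟩ := hM' y₀
  set b := Module.finBasis ℝ p.V
  have hb : ∀ v, v = ∑ i, (b.coord i).toContinuousLinearMap v • b i := fun v => (b.sum_repr v).symm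
  have hs : ∀ i, ∃ g : SmoothFn n M, ∀ᶠ x in 𝓝 x₀, g x = (b.coord i).toContinuousLinearMap (p.s x) :=
    fun i => exists_smooth_extension p.isOpen p.mem
      ((b.coord i).toContinuousLinearMap.contDiff.contMDiff.comp_contMDiffOn p.s_smooth)
  choose g hg using hs
  have hΦ : ContDiff ℝ ∞ fun w : p.V × p'.V => f (p.r w.1, p'.r w.2) := by
    rw [← contMDiff_iff_contDiff]
    exact f.contMDiff.comp ((p.r_smooth.comp contDiff_fst.contMDiff).prodMk
      (p'.r_smooth.comp contDiff_snd.contMDiff))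
  have hD : ∀ i, ContDiff ℝ ∞ fun w : p.V × p'.V =>
      fderiv ℝ (fun w : p.V × p'.V => f (p.r w.1, p'.r w.2)) w (b i, 0) := fun i =>
    (hΦ.fderiv_right (m := ∞) (by simp)).clm_apply contDiff_const
  have hall : ∀ᶠ x in 𝓝 x₀, x ∈ p.O ∧ ∀ i, ∀ᶠ x' in 𝓝 x,
      g i x' = (b.coord i).toContinuousLinearMap (p.s x') :=
    (p.isOpen.eventually_mem p.mem).and (eventually_all.2 fun i => (hg i).eventually_nhds)
  have hO : ∀ᶠ q : M × M' in 𝓝 (x₀, y₀), X (restrictFst q.2 f) q.1 =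
      ∑ i, fderiv ℝ (fun w : p.V × p'.V => f (p.r w.1, p'.r w.2)) (p.s q.1, p'.s q.2) (b i, 0) *
        X (g i) q.1 := by
    rw [nhds_prod_eq]
    filter_upwards [hall.prod_mk (p'.isOpen.eventually_mem p'.mem)] with q hq
    obtain ⟨⟨hq1, hq2⟩, hq3⟩ := hq
    have hu : ContDiff ℝ ∞ fun v => f (p.r v, q.2) := by
      rw [← contMDiff_iff_contDiff]
      exact f.contMDiff.comp (p.r_smooth.prodMk contMDiff_const)
    have h1 := (isPointDerivation_eval q.1 X).chain hb hu p.isOpen hq1 p.s_smooth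
      (f := restrictFst q.2 f) (g := g)
      (by
        filter_upwards [p.isOpen.mem_nhds hq1] with x hx
        rw [p.r_s x hx]; rfl) hq2
    refine h1.trans (Finset.sum_congr rfl fun i _ => ?_)
    congr 1
    have h2 : (fun v => f (p.r v, q.2)) = (fun w : p.V × p'.V => f (p.r w.1, p'.r w.2)) ∘
        fun v => (v, p'.s q.2) := by
      funext v
      simp [p'.r_s q.2 hq3]
    rw [h2, fderiv_comp _ ((hΦ.differentiable (by simp)) _)
      (hasFDerivAt_prodMk_left (p.s q.1) (p'.s q.2)).differentiableAt,
      (hasFDerivAt_prodMk_left (p.s q.1) (p'.s q.2)).fderiv]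
    rfl
  refine ContMDiffAt.congr_of_eventuallyEq ?_ hO
  have hpair : ContMDiffAt ((𝓡 n).prod (𝓡 n')) 𝓘(ℝ, p.V × p'.V) ∞
      (fun q : M × M' => (p.s q.1, p'.s q.2)) (x₀, y₀) :=
    ((p.s_smooth.contMDiffAt (p.isOpen.mem_nhds p.mem)).comp (x₀, y₀) contMDiffAt_fst).prodMk_space
      ((p'.s_smooth.contMDiffAt (p'.isOpen.mem_nhds p'.mem)).comp (x₀, y₀) contMDiffAt_snd)
  refine contMDiffAt_finsetSum fun i _ => ?_
  exact ((hD i).contMDiff.contMDiffAt.comp (x₀, y₀) hpair).mul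
    ((X (g i)).contMDiff.contMDiffAt.comp (x₀, y₀) contMDiffAt_fst)

end Product

/-! ## The torus action in a standard chart -/

section ChartAction

variable {k n : ℕ} {M : Type*} [TopologicalSpace M] [ChartedSpace (EuclideanSpace ℝ (Fin n)) M]
  [MulAction (Torus k) M]

variable (k) in
/-- A point with trivial stabilizer. -/
def IsFreePoint (x : M) : Prop := ∀ t : Torus k, t • x = x → t = 1

namespace StandardChart

variable (c : StandardChart k n M)

theorem smul_mem_iff (t : Torus k) (x : M) : t • x ∈ c.chart.source ↔ x ∈ c.chart.source :=
  ⟨fun h => by simpa using c.smul_mem t⁻¹ _ h, c.smul_mem t x⟩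

theorem phi_smul (t : Torus k) {x : M} (hx : x ∈ c.chart.source) (i : Fin c.a) :
    c.phi (t • x) i = ((c.gens t).1 i : ℂ) * c.phi x i := by
  rw [phi, c.map_smul t x hx]; simp [phi]

theorem z_smul (t : Torus k) {x : M} (hx : x ∈ c.chart.source) (i : Fin c.l) :
    c.z (t • x) i = ((c.gens t).2 i : ℂ) * c.z x i := by
  rw [z, c.map_smul t x hx]; rfl

theorem y_smul (t : Torus k) {x : M} (hx : x ∈ c.chart.source) : c.y (t • x) = c.y x := by
  rw [y, c.map_smul t x hx]; rfl

theorem norm_z_smul (t : Torus k) {x : M} (hx : x ∈ c.chart.source) (i : Fin c.l) :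
    ‖c.z (t • x) i‖ = ‖c.z x i‖ := by
  rw [z_smul c t hx, norm_mul, Circle.norm_coe, one_mul]

theorem ext_of_mem {x x' : M} (hx : x ∈ c.chart.source) (hx' : x' ∈ c.chart.source)
    (h1 : ∀ i, c.phi x i = c.phi x' i) (h2 : ∀ i, c.z x i = c.z x' i) (h3 : c.y x = c.y x') :
    x = x' := by
  refine c.chart.injOn hx hx' (Prod.ext (funext fun i => Circle.ext (h1 i))
    (Prod.ext (funext h2) h3))

theorem exists_circle_mul {w w' : ℂ} (h : ‖w‖ = ‖w'‖) : ∃ u : Circle, (u : ℂ) * w = w' := by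
  by_cases hw : w = 0
  · subst hw
    refine ⟨1, ?_⟩
    rw [norm_zero, eq_comm, norm_eq_zero] at h
    simp [h]
  · refine ⟨⟨w' / w, mem_sphere_zero_iff_norm.2 ?_⟩, div_mul_cancel₀ _ hw⟩
    rw [norm_div, ← h, div_self (norm_ne_zero_iff.2 hw)]

/-- Phases of the z_i and angles can be adjusted independently, through the inverse of `gens`. So
the moduli |z_i| and the real coordinates separate the orbits inside a chart. -/
theorem exists_smul_eq {x x' : M} (hx : x ∈ c.chart.source) (hx' : x' ∈ c.chart.source)
    (h2 : ∀ i, ‖c.z x i‖ = ‖c.z x' i‖) (h3 : c.y x = c.y x') : ∃ t : Torus k, t • x = x' := by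
  choose u hu using fun i => exists_circle_mul (h2 i)
  set t := c.gens.symm ((c.chart x').1 * ((c.chart x).1)⁻¹, u) with ht
  have hg : c.gens t = ((c.chart x').1 * ((c.chart x).1)⁻¹, u) := c.gens.apply_symm_apply _
  refine ⟨t, c.ext_of_mem (c.smul_mem t x hx) hx' (fun i => ?_) (fun i => ?_) ?_⟩
  · rw [c.phi_smul t hx, hg, phi, phi, ← Circle.coe_mul]
    simp
  · rw [c.z_smul t hx, hg]; exact hu i
  · rw [c.y_smul t hx, h3]

theorem isFreePoint_iff {x : M} (hx : x ∈ c.chart.source) :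
    IsFreePoint k x ↔ ∀ i, c.z x i ≠ 0 := by
  classical
  refine ⟨fun h i hi => ?_, fun h t ht => ?_⟩
  -- When z_i = 0, the element −1 of the i-th circle fixes x.
  · set t := c.gens.symm ((1, Function.update (1 : Torus c.l) i (-1)) : Torus c.a × Torus c.l) with ht
    have hg : c.gens t = ((1, Function.update (1 : Torus c.l) i (-1)) : Torus c.a × Torus c.l) := c.gens.apply_symm_apply _
    have h1 : t = 1 := h t <| c.ext_of_mem (c.smul_mem t x hx) hx
      (fun j => by rw [c.phi_smul t hx, hg]; simp)
      (fun j => by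
        rw [c.z_smul t hx, hg]
        rcases eq_or_ne j i with rfl | hj
        · simp [hi]
        · simp [hj])
      (c.y_smul t hx)
    rw [h1, map_one] at hg
    have h2 : (1 : Circle) = -1 := by
      simpa using congrFun (congrArg Prod.snd hg) i
    have h3 : (1 : ℂ) = -1 := by simpa using congrArg (fun u : Circle => (u : ℂ)) h2
    norm_num at h3
  · have hg : c.gens t = 1 := by
      refine Prod.ext (funext fun i => Circle.ext ?_) (funext fun i => Circle.ext ?_)
      · have h1 := c.phi_smul t hx i
        rw [ht] at h1
        simpa using mul_right_cancel₀ (c.phi_ne_zero x i) ((one_mul _).trans h1).symm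
      · have h1 := c.z_smul t hx i
        rw [ht] at h1
        simpa using mul_right_cancel₀ (h i) ((one_mul _).trans h1).symm
    exact c.gens.injective (hg.trans (map_one c.gens).symm)

/-- Adding a small real ε to every z_i makes all of them non-zero for all but finitely many ε.
Density of free points is used throughout to extend identities by continuity. -/
theorem mem_closure_isFreePoint {x : M} (hx : x ∈ c.chart.source) {s : Set M} (hs : s ∈ 𝓝 x) :
    ∃ x' ∈ s, IsFreePoint k x' := by
  have h1 : Continuous fun ε : ℝ => c.param (c.angle x x, fun i => c.z x i + ε, c.y x) :=
    c.contMDiff_param.continuous.comp (by fun_prop)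
  have h2 : (fun ε : ℝ => c.param (c.angle x x, fun i => c.z x i + ε, c.y x)) ⁻¹' s ∈ 𝓝 (0 : ℝ) := by
    refine h1.continuousAt.preimage_mem_nhds ?_
    simpa [c.param_angle x hx] using hs
  have h3 : Dense ((range fun i => -(c.z x i).re)ᶜ : Set ℝ) :=
    (finite_range _).countable.dense_compl ℝ
  obtain ⟨ε, hε, hε'⟩ := h3.exists_mem_open isOpen_interior ⟨0, mem_interior_iff_mem_nhds.2 h2⟩
  refine ⟨_, (interior_subset hε' : ε ∈ _ ⁻¹' s), (c.isFreePoint_iff (c.param_mem _)).2 fun i hi => hε ⟨i, ?_⟩⟩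
  rw [z_param] at hi
  have h4 := congrArg Complex.re hi
  simp at h4
  linarith

/-! ### Cut-off functions -/

/-- The invariant function `|z|^2 + |y|^2`. -/
def normSq (x : M) : ℝ := ∑ i, ‖c.z x i‖ ^ 2 + ∑ j, c.y x j ^ 2

theorem contMDiffOn_normSq : ContMDiffOn (𝓡 n) 𝓘(ℝ, ℝ) ∞ c.normSq c.chart.source := by
  refine ContMDiffOn.add (contMDiffOn_finsetSum fun i _ => ?_) (contMDiffOn_finsetSum fun i _ => ?_)
  · exact contDiff_norm_sq_complex.contMDiff.comp_contMDiffOn (c.contMDiffOn_z_apply i)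
  · exact (c.contMDiffOn_y_apply i).pow 2

theorem normSq_smul (t : Torus k) {x : M} (hx : x ∈ c.chart.source) :
    c.normSq (t • x) = c.normSq x := by
  simp only [normSq, c.norm_z_smul t hx, c.y_smul t hx]

/-- The torus factor is compact and the condition bounds z and y. In a Hausdorff manifold the set is
then closed, so that functions supported in it may be extended by zero outside the chart. -/
theorem isCompact_normSq_le (C : ℝ) : IsCompact {x | x ∈ c.chart.source ∧ c.normSq x ≤ C} := by
  set K : Set ((Fin c.l → ℂ) × (Fin c.m → ℝ)) :=
    {p | ∑ i, ‖p.1 i‖ ^ 2 + ∑ j, p.2 j ^ 2 ≤ C} with hK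
  have hKc : IsCompact K := by
    refine Metric.isCompact_of_isClosed_isBounded (isClosed_le (by fun_prop) continuous_const) ?_
    refine (Metric.isBounded_closedBall (x := 0) (r := |C| + 1)).subset fun p hp => ?_
    rw [mem_closedBall_zero_iff]
    have hp' : ∑ i, ‖p.1 i‖ ^ 2 + ∑ j, p.2 j ^ 2 ≤ C := hp
    have h1 : ∀ i, ‖p.1 i‖ ^ 2 ≤ ∑ i, ‖p.1 i‖ ^ 2 := fun i =>
      Finset.single_le_sum (f := fun i => ‖p.1 i‖ ^ 2) (fun i _ => by positivity) (Finset.mem_univ i)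
    have h2 : ∀ j, p.2 j ^ 2 ≤ ∑ j, p.2 j ^ 2 := fun j =>
      Finset.single_le_sum (f := fun j => p.2 j ^ 2) (fun i _ => by positivity) (Finset.mem_univ j)
    have h3 : 0 ≤ ∑ i, ‖p.1 i‖ ^ 2 := Finset.sum_nonneg fun i _ => by positivity
    have h4 : 0 ≤ ∑ j, p.2 j ^ 2 := Finset.sum_nonneg fun i _ => by positivity
    have hC := le_abs_self C
    refine norm_prod_le_iff.2 ⟨(pi_norm_le_iff_of_nonneg (by positivity)).2 fun i => ?_,
      (pi_norm_le_iff_of_nonneg (by positivity)).2 fun j => ?_⟩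
    · have := h1 i
      nlinarith [norm_nonneg (p.1 i)]
    · have := h2 j
      rw [Real.norm_eq_abs]
      have h5 := sq_abs (p.2 j)
      nlinarith [abs_nonneg (p.2 j)]
  have h1 : {x | x ∈ c.chart.source ∧ c.normSq x ≤ C} = c.chart.symm '' (univ ×ˢ K) := by
    ext x
    refine ⟨fun ⟨hx, hxC⟩ => ⟨c.chart x, ⟨trivial, hxC⟩, c.chart.left_inv hx⟩, ?_⟩
    rintro ⟨p, ⟨-, hp⟩, rfl⟩
    have hpt : p ∈ c.chart.target := by rw [c.target_eq]; trivial
    refine ⟨c.chart.map_target hpt, ?_⟩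
    rw [normSq, z, y, c.chart.right_inv hpt]
    exact hp
  rw [h1]
  refine (isCompact_univ.prod hKc).image_of_continuousOn (c.chart.continuousOn_symm.mono ?_)
  rw [c.target_eq]; exact subset_univ _

open Classical in
/-- An invariant cut-off function, equal to one for `|z|^2 + |y|^2 ≤ C`. -/
def cut (C : ℝ) (x : M) : ℝ :=
  if x ∈ c.chart.source then 1 - Real.smoothTransition (c.normSq x - C) else 0

theorem cut_of_mem (C : ℝ) {x : M} (hx : x ∈ c.chart.source) :
    c.cut C x = 1 - Real.smoothTransition (c.normSq x - C) := if_pos hx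

theorem cut_of_notMem (C : ℝ) {x : M} (hx : x ∉ c.chart.source) : c.cut C x = 0 := if_neg hx

theorem cut_eq_one {C : ℝ} {x : M} (hx : x ∈ c.chart.source) (h : c.normSq x ≤ C) :
    c.cut C x = 1 := by
  rw [c.cut_of_mem C hx, Real.smoothTransition.zero_of_nonpos (by linarith), sub_zero]

/-- The cut-off drops from 1 to 0 between C and C + 1. Hence the one with constant C + 1 equals 1
wherever the one with constant C is non-zero; the nested constants C, C + 1, C + 1 + 1 used later
rely on this. -/
theorem mem_of_cut_ne_zero {C : ℝ} {x : M} (h : c.cut C x ≠ 0) :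
    x ∈ c.chart.source ∧ c.normSq x < C + 1 := by
  by_contra hcon
  apply h
  by_cases hx : x ∈ c.chart.source
  · have h1 : C + 1 ≤ c.normSq x := by
      by_contra h2
      exact hcon ⟨hx, not_le.1 h2⟩
    rw [c.cut_of_mem C hx, Real.smoothTransition.one_of_one_le (by linarith), sub_self]
  · exact c.cut_of_notMem C hx

theorem cut_nonneg (C : ℝ) (x : M) : 0 ≤ c.cut C x := by
  by_cases hx : x ∈ c.chart.source
  · rw [c.cut_of_mem C hx, sub_nonneg]
    exact Real.smoothTransition.le_one _
  · rw [c.cut_of_notMem C hx]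

theorem cut_smul (C : ℝ) (t : Torus k) (x : M) : c.cut C (t • x) = c.cut C x := by
  by_cases hx : x ∈ c.chart.source
  · rw [c.cut_of_mem C hx, c.cut_of_mem C (c.smul_mem t x hx), c.normSq_smul t hx]
  · rw [c.cut_of_notMem C hx, c.cut_of_notMem C (fun h => hx ((c.smul_mem_iff t x).1 h))]

theorem eventually_cut_eq_one {C : ℝ} {x : M} (hx : x ∈ c.chart.source) (h : c.normSq x < C) :
    ∀ᶠ x' in 𝓝 x, c.cut C x' = 1 := by
  have h1 : ContinuousAt c.normSq x :=
    c.contMDiffOn_normSq.continuousOn.continuousAt (c.isOpen_source.mem_nhds hx)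
  filter_upwards [h1.eventually (gt_mem_nhds h), c.isOpen_source.mem_nhds hx] with x' h2 h3
  exact c.cut_eq_one h3 h2.le

/-- Over the chart this is a product of smooth functions. A point mapped outside the chart has a
neighbourhood mapped into the complement of a compact sublevel set of `normSq`, where the cut-off is
zero. -/
theorem contMDiff_cut_mul [T2Space M] {E H : Type*} [NormedAddCommGroup E] [NormedSpace ℝ E]
    [TopologicalSpace H] {I : ModelWithCorners ℝ E H} {Q : Type*} [TopologicalSpace Q]
    [ChartedSpace H Q] {ρ : Q → M} (hρ : ContMDiff I (𝓡 n) ∞ ρ) {g : Q → ℝ}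
    (hg : ContMDiffOn I 𝓘(ℝ, ℝ) ∞ g (ρ ⁻¹' c.chart.source)) (C : ℝ) :
    ContMDiff I 𝓘(ℝ, ℝ) ∞ fun q => c.cut C (ρ q) * g q := by
  intro q
  by_cases hq : ρ q ∈ c.chart.source
  · have hO : ρ ⁻¹' c.chart.source ∈ 𝓝 q :=
      (c.isOpen_source.preimage hρ.continuous).mem_nhds hq
    have h1 : ContMDiffOn (𝓡 n) 𝓘(ℝ, ℝ) ∞ (fun x => 1 - Real.smoothTransition (c.normSq x - C))
        c.chart.source := by
      have h2 : ContDiff ℝ ∞ fun r : ℝ => 1 - Real.smoothTransition (r - C) :=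
        contDiff_const.sub (Real.smoothTransition.contDiff.comp (contDiff_id.sub contDiff_const))
      exact h2.contMDiff.comp_contMDiffOn c.contMDiffOn_normSq
    have h3 := ((h1.contMDiffAt (c.isOpen_source.mem_nhds hq)).comp q hρ.contMDiffAt).mul
      (hg.contMDiffAt hO)
    refine h3.congr_of_eventuallyEq ?_
    filter_upwards [hO] with q' hq'
    rw [c.cut_of_mem C hq']
    rfl
  · have h1 : IsOpen {x | x ∈ c.chart.source ∧ c.normSq x ≤ C + 1}ᶜ :=
      (c.isCompact_normSq_le (C + 1)).isClosed.isOpen_compl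
    have h2 : ∀ᶠ q' in 𝓝 q, c.cut C (ρ q') * g q' = 0 := by
      filter_upwards [(h1.preimage hρ.continuous).mem_nhds (fun h => hq h.1)] with q' hq'
      by_cases h3 : c.cut C (ρ q') = 0
      · rw [h3, zero_mul]
      · exact absurd ⟨(c.mem_of_cut_ne_zero h3).1, (c.mem_of_cut_ne_zero h3).2.le⟩ hq'
    exact (contMDiffAt_const (c := (0 : ℝ))).congr_of_eventuallyEq h2

/-- The product of a cut-off function and a function which is smooth on the domain of the chart. -/
def cutMul [T2Space M] (C : ℝ) (g : M → ℝ) (hg : ContMDiffOn (𝓡 n) 𝓘(ℝ, ℝ) ∞ g c.chart.source) :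
    SmoothFn n M :=
  ⟨fun x => c.cut C x * g x, c.contMDiff_cut_mul contMDiff_id hg C⟩

@[simp]
theorem cutMul_apply [T2Space M] (C : ℝ) (g : M → ℝ)
    (hg : ContMDiffOn (𝓡 n) 𝓘(ℝ, ℝ) ∞ g c.chart.source) (x : M) :
    c.cutMul C g hg x = c.cut C x * g x := rfl

/-! ### Invariant functions -/

/-- A function in the radial coordinates of a standard chart. -/
def radial (g : M → ℝ) (p : (Fin c.l → ℂ) × (Fin c.m → ℝ)) : ℝ := g (c.param (0, p))

theorem isRadial {g : M → ℝ} (hg : ContMDiffOn (𝓡 n) 𝓘(ℝ, ℝ) ∞ g c.chart.source)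
    (hinv : ∀ (t : Torus k), ∀ x ∈ c.chart.source, g (t • x) = g x) : IsRadial (c.radial g) := by
  constructor
  · rw [← contMDiff_iff_contDiff]
    refine hg.comp_contMDiff (c.contMDiff_param.comp ?_) fun p => c.param_mem _
    exact (contDiff_const.prodMk contDiff_id).contMDiff
  · intro z e
    obtain ⟨t, ht⟩ := c.exists_smul_eq (c.param_mem (0, (fun i => (‖z i‖ : ℂ)), e))
      (c.param_mem (0, z, e)) (fun i => by simp) (by simp)
    rw [radial, radial, ← ht, hinv _ _ (c.param_mem _)]

theorem eq_radial {g : M → ℝ} (hinv : ∀ (t : Torus k), ∀ x ∈ c.chart.source, g (t • x) = g x)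
    {x : M} (hx : x ∈ c.chart.source) : g x = c.radial g (c.z x, c.y x) := by
  obtain ⟨t, ht⟩ := c.exists_smul_eq hx (c.param_mem (0, c.z x, c.y x)) (fun i => by simp)
    (by simp)
  rw [radial, ← ht, hinv _ _ hx]

theorem contMDiffOn_of_radial {u : (Fin c.l → ℂ) × (Fin c.m → ℝ) → ℝ} (hu : ContDiff ℝ ∞ u) :
    ContMDiffOn (𝓡 n) 𝓘(ℝ, ℝ) ∞ (fun x => u (c.z x, c.y x)) c.chart.source :=
  hu.contMDiff.comp_contMDiffOn (c.contMDiffOn_z.prodMk_space c.contMDiffOn_y)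

theorem radialProduct_eq (x : M) : c.radialProduct x = ∏ i, ‖c.z x i‖ ^ 2 := rfl

theorem contMDiffOn_radialProduct :
    ContMDiffOn (𝓡 n) 𝓘(ℝ, ℝ) ∞ c.radialProduct c.chart.source :=
  contMDiffOn_finsetProd fun i _ =>
    contDiff_norm_sq_complex.contMDiff.comp_contMDiffOn (c.contMDiffOn_z_apply i)

theorem radialProduct_smul (t : Torus k) {x : M} (hx : x ∈ c.chart.source) :
    c.radialProduct (t • x) = c.radialProduct x := by
  simp only [radialProduct_eq, c.norm_z_smul t hx]

end StandardChart

/-- An invariant smooth function vanishing at all points with non-trivial stabilizer is in the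
elliptic divisor. -/
theorem mem_ellipticDivisor_of_invariant {f : SmoothFn n M}
    (hinv : ∀ (t : Torus k) (x : M), f (t • x) = f x)
    (h0 : ∀ x : M, ¬ IsFreePoint k x → f x = 0) : f ∈ ellipticDivisor k n M := by
  intro c
  have hr := c.isRadial f.contMDiff.contMDiffOn fun t x _ => hinv t x
  obtain ⟨g, hg, hfg⟩ := hr.exists_eq_prod_mul fun z e ⟨i, hi⟩ => h0 _ fun h =>
    (c.isFreePoint_iff (c.param_mem _)).1 h i (by simpa using hi)
  refine ⟨fun x => g (c.z x, c.y x), c.contMDiffOn_of_radial hg.contDiff, fun x hx => ?_⟩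
  rw [c.eq_radial (fun t x _ => hinv t x) hx, hfg]
  rfl

end ChartAction

/-! ## Vector fields given by curves -/

section CurveDerivations

variable {n : ℕ} {M : Type*} [TopologicalSpace M] [ChartedSpace (EuclideanSpace ℝ (Fin n)) M]

theorem LocalParam.contMDiffOn_deriv {x₀ : M} (p : LocalParam (𝓡 n) x₀) {Φ : ℝ → M → ℝ}
    (hΦ : ContDiff ℝ ∞ fun w : ℝ × p.V => Φ w.1 (p.r w.2)) :
    ContMDiffOn (𝓡 n) 𝓘(ℝ, ℝ) ∞ (fun x => deriv (fun t => Φ t x) 0) p.O := by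
  have h1 : ContDiff ℝ ∞ fun v : p.V =>
      fderiv ℝ (fun w : ℝ × p.V => Φ w.1 (p.r w.2)) (0, v) (1, 0) :=
    ((hΦ.fderiv_right (m := ∞) (by simp)).clm_apply contDiff_const).comp
      (contDiff_const.prodMk contDiff_id)
  refine (h1.contMDiff.comp_contMDiffOn p.s_smooth).congr fun x hx => ?_
  have h2 : HasDerivAt (fun t : ℝ => (t, p.s x)) ((1, 0) : ℝ × p.V) 0 :=
    (hasDerivAt_id (0 : ℝ)).prodMk (hasDerivAt_const _ _)
  have h3 := (((hΦ.differentiable (by simp)) (0, p.s x)).hasFDerivAt.comp_hasDerivAt (0 : ℝ) h2).deriv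
  simp only [Function.comp_def, p.r_s x hx] at h3
  exact h3

theorem LocalParam.differentiableAt {x₀ x : M} (p : LocalParam (𝓡 n) x₀) (hx : x ∈ p.O)
    {Φ : ℝ → M → ℝ} (hΦ : ContDiff ℝ ∞ fun w : ℝ × p.V => Φ w.1 (p.r w.2)) :
    DifferentiableAt ℝ (fun t => Φ t x) 0 := by
  have h2 : ContDiff ℝ ∞ fun t : ℝ => Φ t (p.r (p.s x)) :=
    hΦ.comp (f := fun t : ℝ => (t, p.s x)) (contDiff_id.prodMk contDiff_const)
  rw [p.r_s x hx] at h2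
  exact h2.differentiable (by simp) 0

/-- The derivation `f ↦ ψ(x) d/dt f(σ(t,x))` at `t = 0`. -/
def curveDerivation (σ : ℝ → M → M) (ψ : M → ℝ) (h0 : ∀ x, ψ x ≠ 0 → σ 0 x = x)
    (hd : ∀ (f : SmoothFn n M) (x : M), ψ x ≠ 0 → DifferentiableAt ℝ (fun t => f (σ t x)) 0)
    (hs : ∀ f : SmoothFn n M, ContMDiff (𝓡 n) 𝓘(ℝ, ℝ) ∞
      fun x => ψ x * deriv (fun t => f (σ t x)) 0) :
    Derivation ℝ (SmoothFn n M) (SmoothFn n M) :=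
  Derivation.mk'
    { toFun := fun f => ⟨fun x => ψ x * deriv (fun t => f (σ t x)) 0, hs f⟩
      map_add' := fun f g => by
        ext x
        change ψ x * deriv (fun t => f (σ t x) + g (σ t x)) 0 =
          ψ x * deriv (fun t => f (σ t x)) 0 + ψ x * deriv (fun t => g (σ t x)) 0
        by_cases hx : ψ x = 0
        · simp [hx]
        · rw [deriv_fun_add (hd f x hx) (hd g x hx), mul_add]
      map_smul' := fun c f => by
        ext x
        change ψ x * deriv (fun t => c * f (σ t x)) 0 = c * (ψ x * deriv (fun t => f (σ t x)) 0)
        rw [deriv_const_mul_field]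
        ring }
    (fun f g => by
      ext x
      change ψ x * deriv (fun t => f (σ t x) * g (σ t x)) 0 =
        f x * (ψ x * deriv (fun t => g (σ t x)) 0) + g x * (ψ x * deriv (fun t => f (σ t x)) 0)
      by_cases hx : ψ x = 0
      · simp [hx]
      · rw [deriv_fun_mul (hd f x hx) (hd g x hx), h0 x hx]
        ring)

end CurveDerivations

/-! ### Fundamental vector fields of the torus action -/

section FundamentalFields

variable {k n : ℕ} {M : Type*} [TopologicalSpace M] [ChartedSpace (EuclideanSpace ℝ (Fin n)) M]
  [MulAction (Torus k) M]

theorem torusExp_zero : torusExp (0 : Fin k → ℝ) = 1 := by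
  funext i; simp [torusExp]

theorem torusExp_add (θ θ' : Fin k → ℝ) : torusExp (θ + θ') = torusExp θ * torusExp θ' := by
  funext i; simp [torusExp, Circle.exp_add]

variable [SmoothTorusAction k n M]

theorem contMDiff_torusExp_smul {E H : Type*} [NormedAddCommGroup E] [NormedSpace ℝ E]
    [TopologicalSpace H] {I : ModelWithCorners ℝ E H} {Q : Type*} [TopologicalSpace Q]
    [ChartedSpace H Q] {s : Q → Fin k → ℝ} {g : Q → M} (hs : ContMDiff I 𝓘(ℝ, Fin k → ℝ) ∞ s)
    (hg : ContMDiff I (𝓡 n) ∞ g) : ContMDiff I (𝓡 n) ∞ fun q => torusExp (s q) • g q :=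
  (SmoothTorusAction.contMDiff_smul (k := k) (n := n) (M := M)).comp (hs.prodMk hg)

variable (hM : ∀ x : M, ∃ c : StandardChart k n M, x ∈ c.chart.source)

theorem contDiff_fund_curve {x₀ : M} (p : LocalParam (𝓡 n) x₀) (e : Fin k → ℝ) {U : Set M}
    {g : M → ℝ} (hg : ContMDiffOn (𝓡 n) 𝓘(ℝ, ℝ) ∞ g U)
    (hU : ∀ (t : Torus k) v, t • p.r v ∈ U) :
    ContDiff ℝ ∞ fun w : ℝ × p.V => g (torusExp (w.1 • e) • p.r w.2) := by
  rw [← contMDiff_iff_contDiff]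
  refine hg.comp_contMDiff (contMDiff_torusExp_smul ?_ (p.r_smooth.comp contDiff_snd.contMDiff))
    fun w => hU _ _
  exact (contDiff_fst.smul contDiff_const).contMDiff

include hM in
/-- The derivation given by the fundamental vector field of an element of the Lie algebra. -/
def fundDerivation (e : Fin k → ℝ) : Derivation ℝ (SmoothFn n M) (SmoothFn n M) :=
  curveDerivation (fun t x => torusExp (t • e) • x) (fun _ => 1)
    (fun x _ => by simp [torusExp_zero])
    (fun f x _ => by
      obtain ⟨c, hc⟩ := hM x
      exact (c.localParam hc).differentiableAt (c.localParam hc).mem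
        (Φ := fun t x => f (torusExp (t • e) • x))
        (contDiff_fund_curve _ e (U := univ) f.contMDiff.contMDiffOn fun _ _ => trivial))
    (fun f x => by
      obtain ⟨c, hc⟩ := hM x
      simp only [one_mul]
      exact ((c.localParam hc).contMDiffOn_deriv (Φ := fun t x => f (torusExp (t • e) • x))
        (contDiff_fund_curve _ e (U := univ) f.contMDiff.contMDiffOn fun _ _ => trivial)).contMDiffAt
        ((c.localParam hc).isOpen.mem_nhds (c.localParam hc).mem))

theorem fundDerivation_apply (e : Fin k → ℝ) (f : SmoothFn n M) (x : M) :
    fundDerivation hM e f x = deriv (fun t : ℝ => f (torusExp (t • e) • x)) 0 := one_mul _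

theorem hasFDerivAt_orbit (f : SmoothFn n M) (x : M) :
    DifferentiableAt ℝ (fun s : Fin k → ℝ => f (torusExp s • x)) 0 := by
  have h : ContDiff ℝ ∞ (fun s : Fin k → ℝ => f (torusExp s • x)) := by
    rw [← contMDiff_iff_contDiff]
    exact f.contMDiff.comp (contMDiff_torusExp_smul contMDiff_id contMDiff_const)
  exact h.differentiable (by simp) 0

theorem fundDerivation_apply_eq_fderiv (e : Fin k → ℝ) (f : SmoothFn n M) (x : M) :
    fundDerivation hM e f x = fderiv ℝ (fun s : Fin k → ℝ => f (torusExp s • x)) 0 e := by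
  rw [fundDerivation_apply]
  have h1 : HasDerivAt (fun t : ℝ => t • e) e 0 := by
    simpa using (hasDerivAt_id (0 : ℝ)).smul_const e
  have h2 := HasFDerivAt.comp_hasDerivAt (l := fun s : Fin k → ℝ => f (torusExp s • x)) (0 : ℝ)
    (by rw [zero_smul]; exact (hasFDerivAt_orbit f x).hasFDerivAt) h1
  exact h2.deriv

/-- The radial product is constant along orbits, so differentiating f = (radial product) · g along
an orbit differentiates only g. -/
theorem fundDerivation_mem (e : Fin k → ℝ) : fundDerivation hM e ∈ ellipticTangent k n M := by
  intro I hI f hf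
  obtain rfl : I = ellipticDivisor k n M := hI
  intro c
  obtain ⟨g, hg, hfg⟩ := hf c
  refine ⟨fun x => deriv (fun t : ℝ => g (torusExp (t • e) • x)) 0, fun x hx => ?_, fun x hx => ?_⟩
  · refine (((c.localParam hx).contMDiffOn_deriv (Φ := fun t x => g (torusExp (t • e) • x))
      (contDiff_fund_curve _ e hg fun t v => ?_)).contMDiffAt
        ((c.localParam hx).isOpen.mem_nhds (c.localParam hx).mem)).contMDiffWithinAt
    exact c.smul_mem t _ (c.param_mem v)
  · rw [fundDerivation_apply, ← deriv_const_mul_field]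
    congr 1
    funext t
    rw [hfg _ (c.smul_mem _ x hx), c.radialProduct_smul _ hx]

/-- The fundamental vector fields, as sections of the elliptic tangent bundle. -/
def fundField (e : Fin k → ℝ) : ellipticTangent k n M := ⟨fundDerivation hM e, fundDerivation_mem hM e⟩

theorem fundField_invariant (e : Fin k → ℝ) : IsInvariantSection (fundField hM e) := by
  intro t f
  ext x
  change fundDerivation hM e (translate t f) x = fundDerivation hM e f (t • x)
  rw [fundDerivation_apply, fundDerivation_apply]
  congr 1
  funext s
  change f (t • torusExp (s • e) • x) = f (torusExp (s • e) • t • x)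
  rw [smul_smul, smul_smul, mul_comm]

theorem fundField_apply_of_invariant (e : Fin k → ℝ) {f : SmoothFn n M}
    (hf : ∀ (t : Torus k) (x : M), f (t • x) = f x) : (fundField hM e).1 f = 0 := by
  ext x
  change fundDerivation hM e f x = 0
  rw [fundDerivation_apply]
  simp [hf]

theorem fundField_eq_sum (e : Fin k → ℝ) :
    fundField hM e = ∑ j, algebraMap ℝ (SmoothFn n M) (e j) • fundField hM (Pi.single j 1) := by
  apply Subtype.ext
  have h1 : ((∑ j, algebraMap ℝ (SmoothFn n M) (e j) • fundField hM (Pi.single j 1) :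
      ellipticTangent k n M) : Derivation ℝ (SmoothFn n M) (SmoothFn n M)) =
      ∑ j, algebraMap ℝ (SmoothFn n M) (e j) • fundDerivation hM (Pi.single j 1) :=
    map_sum (ellipticTangent k n M).toSubmodule.subtype _ _
  rw [h1]
  ext f x
  have h2 : (∑ j, algebraMap ℝ (SmoothFn n M) (e j) • fundDerivation hM (Pi.single j 1)) f x =
      ∑ j, e j * fundDerivation hM (Pi.single j 1) f x := by
    have h3 : ∀ s : Finset (Fin k), (∑ j ∈ s, algebraMap ℝ (SmoothFn n M) (e j) •
        fundDerivation hM (Pi.single j 1)) f x =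
        ∑ j ∈ s, e j * fundDerivation hM (Pi.single j 1) f x := by
      intro s
      induction s using Finset.induction_on with
      | empty => simp
      | insert a s ha ih =>
        rw [Finset.sum_insert ha, Finset.sum_insert ha, ← ih]
        rfl
    exact h3 _
  rw [h2]
  change fundDerivation hM e f x = _
  simp only [fundDerivation_apply_eq_fderiv]
  conv_lhs => rw [← Finset.univ_sum_single e, map_sum]
  refine Finset.sum_congr rfl fun j _ => ?_
  rw [← smul_eq_mul, ← map_smul]
  congr 1
  rw [← Pi.single_smul, smul_eq_mul, mul_one]

end FundamentalFields

namespace StandardChart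

variable {k n : ℕ} {M : Type*} [TopologicalSpace M] [ChartedSpace (EuclideanSpace ℝ (Fin n)) M]
  [MulAction (Torus k) M] (c : StandardChart k n M)

/-! ### The weights of the action in a chart -/

/-- The characters of the torus in the coordinates of a chart. -/
def character (i : Fin c.a ⊕ Fin c.l) (t : Torus k) : Circle :=
  Sum.elim (c.gens t).1 (c.gens t).2 i

theorem character_mul (i : Fin c.a ⊕ Fin c.l) (t t' : Torus k) :
    c.character i (t * t') = c.character i t * c.character i t' := by
  rcases i with i | i <;> simp [character]

theorem character_one (i : Fin c.a ⊕ Fin c.l) : c.character i 1 = 1 := by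
  rcases i with i | i <;> simp [character]

theorem eq_one_of_character {t : Torus k} (h : ∀ i, c.character i t = 1) : t = 1 := by
  have h1 : c.gens t = 1 := Prod.ext (funext fun i => h (Sum.inl i)) (funext fun i => h (Sum.inr i))
  exact c.gens.injective (h1.trans (map_one c.gens).symm)

variable [SmoothTorusAction k n M]

/-- `gens` is only a continuous isomorphism. Smoothness of the characters comes from the smooth
action: along the orbit of the point with all φ_i = z_i = 1 the coordinates of the chart are the
characters themselves. -/
theorem contDiff_character (i : Fin c.a ⊕ Fin c.l) :
    ContDiff ℝ ∞ fun s : Fin k → ℝ => (c.character i (torusExp s) : ℂ) := by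
  have h1 : ContMDiff 𝓘(ℝ, Fin k → ℝ) (𝓡 n) ∞ fun s : Fin k → ℝ =>
      torusExp s • c.param (0, fun _ => 1, 0) :=
    contMDiff_torusExp_smul contMDiff_id contMDiff_const
  rw [← contMDiff_iff_contDiff]
  rcases i with i | i
  · refine ((c.contMDiffOn_phi i).comp_contMDiff h1 fun s =>
      c.smul_mem _ _ (c.param_mem _)).congr fun s => ?_
    change _ = c.phi (torusExp s • c.param (0, fun _ => 1, 0)) i
    rw [c.phi_smul _ (c.param_mem _), phi_param]
    simp [character]
  · refine ((c.contMDiffOn_z_apply i).comp_contMDiff h1 fun s =>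
      c.smul_mem _ _ (c.param_mem _)).congr fun s => ?_
    change _ = c.z (torusExp s • c.param (0, fun _ => 1, 0)) i
    rw [c.z_smul _ (c.param_mem _), z_param]
    simp [character]

/-- The derivatives of the characters, as real numbers. -/
def weight : (Fin k → ℝ) →ₗ[ℝ] (Fin c.a ⊕ Fin c.l → ℝ) :=
  LinearMap.pi fun i => Complex.imCLM.toLinearMap ∘ₗ
    (fderiv ℝ (fun s : Fin k → ℝ => (c.character i (torusExp s) : ℂ)) 0).toLinearMap

theorem hasDerivAt_character (i : Fin c.a ⊕ Fin c.l) (e : Fin k → ℝ) :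
    HasDerivAt (fun t : ℝ => (c.character i (torusExp (t • e)) : ℂ)) (c.weight e i * Complex.I) 0 := by
  have h1 : HasDerivAt (fun t : ℝ => t • e) e 0 := by
    simpa using (hasDerivAt_id (0 : ℝ)).smul_const e
  have h2 := HasFDerivAt.comp_hasDerivAt
    (l := fun s : Fin k → ℝ => (c.character i (torusExp s) : ℂ)) (0 : ℝ)
    (by
      rw [zero_smul]
      exact ((c.contDiff_character i).differentiable (by simp) 0).hasFDerivAt) h1
  set D := fderiv ℝ (fun s : Fin k → ℝ => (c.character i (torusExp s) : ℂ)) 0 e with hD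
  -- The character has modulus one, so differentiating its squared norm at the identity gives twice
  -- the real part of D.
  have hre : D.re = 0 := by
    have h3 : HasDerivAt (fun t : ℝ => ‖(c.character i (torusExp (t • e)) : ℂ)‖ ^ 2) _ 0 :=
      h2.norm_sq
    have h4 : (fun t : ℝ => ‖(c.character i (torusExp (t • e)) : ℂ)‖ ^ 2) = fun _ => 1 := by
      funext t; rw [Circle.norm_coe, one_pow]
    rw [h4] at h3
    have h5 := h3.unique (hasDerivAt_const _ _)
    simp [torusExp_zero, character_one] at h5
    exact h5
  have h3 : D = c.weight e i * Complex.I := by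
    apply Complex.ext
    · simp [hre]
    · simp [weight, hD]
  rw [← h3]
  exact h2

/-- If all weights of e vanish, every character is constant along the one-parameter group of e, so
exp(te) = 1 for all t. For e_j ≠ 0 the time t = π/e_j gives −1 in the j-th circle, a contradiction.
-/
theorem weight_injective : Function.Injective c.weight := by
  rw [injective_iff_map_eq_zero]
  intro e he
  have h1 : ∀ (i : Fin c.a ⊕ Fin c.l) (t : ℝ), c.character i (torusExp (t • e)) = 1 := by
    intro i t
    have h2 : ∀ t : ℝ, HasDerivAt (fun t : ℝ => (c.character i (torusExp (t • e)) : ℂ)) 0 t := by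
      intro t
      have h3 := c.hasDerivAt_character i e
      rw [he] at h3
      simp only [Pi.zero_apply, Complex.ofReal_zero, zero_mul] at h3
      have h4 : HasDerivAt (fun s : ℝ => s - t) 1 t := (hasDerivAt_id t).sub_const t
      have h5 := HasDerivAt.scomp (g₁ := fun t : ℝ => (c.character i (torusExp (t • e)) : ℂ)) t
        (by rw [sub_self]; exact h3) h4
      have h6 := h5.const_mul (c.character i (torusExp (t • e)) : ℂ)
      simp only [smul_zero, mul_zero] at h6
      refine h6.congr_of_eventuallyEq (Eventually.of_forall fun s => ?_)
      simp only [Function.comp_apply]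
      rw [← Circle.coe_mul, ← character_mul, ← torusExp_add, ← add_smul, add_sub_cancel]
    have h3 := is_const_of_deriv_eq_zero (fun t => (h2 t).differentiableAt)
      (fun t => (h2 t).deriv) t 0
    refine Circle.ext ?_
    rw [h3]
    simp [torusExp_zero, character_one]
  have h2 : ∀ t : ℝ, torusExp (t • e) = 1 := fun t => c.eq_one_of_character fun i => h1 i t
  funext j
  by_contra hj
  have h3 := congrArg (fun u : Circle => (u : ℂ)) (congrFun (h2 (Real.pi / e j)) j)
  have h4 : Real.pi / e j * e j = Real.pi := div_mul_cancel₀ _ hj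
  simp only [torusExp, Pi.smul_apply, smul_eq_mul, h4, Circle.coe_exp, Complex.exp_pi_mul_I,
    Pi.one_apply, Circle.coe_one] at h3
  norm_num at h3

/-- An element of the Lie algebra rotating a single coordinate of the chart. -/
theorem exists_weight_eq (i : Fin c.a ⊕ Fin c.l) : ∃ e, c.weight e = Pi.single i 1 := by
  refine (LinearMap.injective_iff_surjective_of_finrank_eq_finrank ?_).1 c.weight_injective _
  simp [c.rank_eq]

end StandardChart

namespace StandardChart

variable {k n : ℕ} {M : Type*} [TopologicalSpace M] [ChartedSpace (EuclideanSpace ℝ (Fin n)) M]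
  [MulAction (Torus k) M] (c : StandardChart k n M)

/-! ### Point derivations in a chart -/

/-- The coordinate functionals on the model space. -/
def coordFun : Fin c.a ⊕ (Fin c.l ⊕ Fin c.l) ⊕ Fin c.m → c.Cover →L[ℝ] ℝ
  | .inl i => ContinuousLinearMap.proj i ∘L .fst ℝ _ _
  | .inr (.inl (.inl i)) =>
    Complex.reCLM ∘L ContinuousLinearMap.proj i ∘L .fst ℝ _ _ ∘L .snd ℝ _ _
  | .inr (.inl (.inr i)) =>
    Complex.imCLM ∘L ContinuousLinearMap.proj i ∘L .fst ℝ _ _ ∘L .snd ℝ _ _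
  | .inr (.inr j) => ContinuousLinearMap.proj j ∘L .snd ℝ _ _ ∘L .snd ℝ _ _

/-- The basis of the model space dual to the coordinate functionals. -/
def coordVec : Fin c.a ⊕ (Fin c.l ⊕ Fin c.l) ⊕ Fin c.m → c.Cover
  | .inl i => (Pi.single i 1, 0, 0)
  | .inr (.inl (.inl i)) => (0, Pi.single i 1, 0)
  | .inr (.inl (.inr i)) => (0, Pi.single i Complex.I, 0)
  | .inr (.inr j) => (0, 0, Pi.single j 1)

theorem eq_sum_coord (v : c.Cover) : v = ∑ i, c.coordFun i v • c.coordVec i := by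
  obtain ⟨θ, z, y⟩ := v
  simp only [Fintype.sum_sum_type, coordFun, coordVec]
  ext i
  · simp [Prod.fst_sum, Finset.sum_apply, Pi.single_apply]
  · simp [Prod.fst_sum, Prod.snd_sum, Finset.sum_apply, Pi.single_apply]
  · simp [Prod.fst_sum, Prod.snd_sum, Finset.sum_apply, Pi.single_apply]

/-- A point derivation vanishing on the coordinate functions of a chart is zero. -/
theorem pointDerivation_eq_zero [T2Space M] [IsManifold (𝓡 n) ∞ M] {x : M} (hx : x ∈ c.chart.source)
    {δ : SmoothFn n M →ₗ[ℝ] ℝ} (hδ : IsPointDerivation x δ)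
    (hφ : ∀ (i : Fin c.a) (w : ℂ →L[ℝ] ℝ) (g : SmoothFn n M),
      (∀ᶠ x' in 𝓝 x, g x' = w (c.phi x' i)) → δ g = 0)
    (hz : ∀ (i : Fin c.l) (w : ℂ →L[ℝ] ℝ) (g : SmoothFn n M),
      (∀ᶠ x' in 𝓝 x, g x' = w (c.z x' i)) → δ g = 0)
    (hy : ∀ (j : Fin c.m) (g : SmoothFn n M), (∀ᶠ x' in 𝓝 x, g x' = c.y x' j) → δ g = 0)
    (f : SmoothFn n M) : δ f = 0 := by
  have hO := c.isOpen_angleDomain x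
  have hmem := c.mem_angleDomain hx
  have hG : ContMDiffOn (𝓡 n) 𝓘(ℝ, c.Cover) ∞ (fun x' => (c.angle x x', c.z x', c.y x'))
      (c.angleDomain x) := (c.localParam hx).s_smooth
  have hg : ∀ i, ∃ g : SmoothFn n M, ∀ᶠ x' in 𝓝 x,
      g x' = c.coordFun i (c.angle x x', c.z x', c.y x') := fun i =>
    exists_smooth_extension hO hmem ((c.coordFun i).contDiff.contMDiff.comp_contMDiffOn hG)
  choose g hg using hg
  have hu : ContDiff ℝ ∞ fun v : c.Cover => f (c.param v) := by
    rw [← contMDiff_iff_contDiff]; exact f.contMDiff.comp c.contMDiff_param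
  rw [hδ.chain c.eq_sum_coord hu hO hmem hG (f := f) (g := g) ?_ hg]
  · refine Finset.sum_eq_zero fun i _ => ?_
    rcases i with i | (i | i) | j
    · suffices h : δ (g (Sum.inl i)) = 0 by rw [h, mul_zero]
      -- Angles are not linear functions of φ. The imaginary part of φ_i(x') times the conjugate of
      -- φ_i(x) is the sine of the difference of angles; its derivative in the angle at x is 1, so δ
      -- vanishes on the angle as well.
      set w : ℂ →L[ℝ] ℝ := Complex.imCLM ∘L
        (ContinuousLinearMap.mul ℝ ℂ (conj (c.phi x i))) with hw
      obtain ⟨s, hs⟩ := exists_smooth_extension (I := 𝓡 n) (q := x) c.isOpen_source hx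
        (w.contDiff.contMDiff.comp_contMDiffOn (c.contMDiffOn_phi i))
      have h1 : ∀ᶠ x' in 𝓝 x, s x' = Real.sin (g (Sum.inl i) x' - c.angle x x i) := by
        filter_upwards [hs, hg (Sum.inl i), hO.mem_nhds hmem] with x' h2 h3 h4
        rw [h2, h3]
        have h5 : c.phi x' i = Complex.exp (c.angle x x' i * Complex.I) := by
          conv_lhs => rw [← c.param_angle x h4.1]
          rw [c.phi_param]
        have h6 : c.phi x i = Complex.exp (c.angle x x i * Complex.I) := by
          conv_lhs => rw [← c.param_angle x hx]
          rw [c.phi_param]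
        simp only [Function.comp_apply, hw, ContinuousLinearMap.coe_comp,
          ContinuousLinearMap.mul_apply', Complex.imCLM_apply, coordFun,
          ContinuousLinearMap.proj_apply, ContinuousLinearMap.coe_fst']
        rw [h5, h6, ← Complex.exp_conj, ← Complex.exp_add, map_mul, Complex.conj_I,
          Complex.conj_ofReal]
        have h7 : (c.angle x x i : ℂ) * -Complex.I + c.angle x x' i * Complex.I =
            ((c.angle x x' i - c.angle x x i : ℝ) : ℂ) * Complex.I := by push_cast; ring
        rw [h7, Complex.exp_ofReal_mul_I_im]
      have h2 : δ s = 0 := hφ i w s hs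
      have h3 := hδ.chain (κ := Unit) (ℓ := fun _ => ContinuousLinearMap.id ℝ ℝ) (b := fun _ => 1)
        (by simp) (u := fun r => Real.sin (r - c.angle x x i))
        (Real.contDiff_sin.comp (contDiff_id.sub contDiff_const)) isOpen_univ (mem_univ x)
        (g (Sum.inl i)).contMDiff.contMDiffOn h1 (g := fun _ => g (Sum.inl i)) (by simp)
      have h4 : HasDerivAt (fun r : ℝ => Real.sin (r - c.angle x x i)) 1 (c.angle x x i) := by
        have h5 := ((hasDerivAt_id (c.angle x x i)).sub_const (c.angle x x i)).sin
        simpa using h5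
      have h5 : g (Sum.inl i) x = c.angle x x i := (hg (Sum.inl i)).self_of_nhds
      rw [h2, h5, h4.hasFDerivAt.fderiv] at h3
      simpa using h3.symm
    · rw [hz i Complex.reCLM _ (hg _), mul_zero]
    · rw [hz i Complex.imCLM _ (hg _), mul_zero]
    · rw [hy j _ (hg _), mul_zero]
  · filter_upwards [hO.mem_nhds hmem] with x' hx'
    rw [c.param_angle x hx'.1]

/-! ### Vector fields of a chart -/

/-- The flow which rescales the complex coordinates and translates the real ones. -/
def shift (η : Fin c.l → ℝ) (β : Fin c.m → ℝ) (t : ℝ) (x : M) : M :=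
  c.chart.symm ((c.chart x).1, fun i => ((1 + t * η i : ℝ) : ℂ) * c.z x i,
    fun j => c.y x j + t * β j)

variable (η : Fin c.l → ℝ) (β : Fin c.m → ℝ)

theorem shift_mem (t : ℝ) (x : M) : c.shift η β t x ∈ c.chart.source :=
  c.chart.map_target (by rw [c.target_eq]; trivial)

theorem chart_shift (t : ℝ) (x : M) : c.chart (c.shift η β t x) =
    ((c.chart x).1, fun i => ((1 + t * η i : ℝ) : ℂ) * c.z x i, fun j => c.y x j + t * β j) :=
  c.chart.right_inv (by rw [c.target_eq]; trivial)

theorem phi_shift (t : ℝ) (x : M) (i : Fin c.a) : c.phi (c.shift η β t x) i = c.phi x i := by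
  rw [phi, chart_shift]; rfl

theorem z_shift (t : ℝ) (x : M) (i : Fin c.l) :
    c.z (c.shift η β t x) i = ((1 + t * η i : ℝ) : ℂ) * c.z x i := by
  rw [z, chart_shift]

theorem y_shift (t : ℝ) (x : M) (j : Fin c.m) :
    c.y (c.shift η β t x) j = c.y x j + t * β j := by
  rw [y, chart_shift]

theorem shift_zero {x : M} (hx : x ∈ c.chart.source) : c.shift η β 0 x = x :=
  c.ext_of_mem (c.shift_mem _ _ _ _) hx (fun i => c.phi_shift η β 0 x i)
    (fun i => by rw [z_shift]; simp) (by ext j; rw [y_shift]; simp)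

theorem shift_smul (t : ℝ) (s : Torus k) {x : M} (hx : x ∈ c.chart.source) :
    c.shift η β t (s • x) = s • c.shift η β t x := by
  have h1 := c.smul_mem s _ (c.shift_mem η β t x)
  refine c.ext_of_mem (c.shift_mem _ _ _ _) h1 (fun i => ?_) (fun i => ?_) ?_
  · rw [phi_shift, phi_smul c s hx, phi_smul c s (c.shift_mem _ _ _ _), phi_shift]
  · rw [z_shift, z_smul c s hx, z_smul c s (c.shift_mem _ _ _ _), z_shift]; ring
  · ext j
    rw [y_shift, y_smul c s hx, y_smul c s (c.shift_mem _ _ _ _), y_shift]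

theorem shift_param (t : ℝ) (v : c.Cover) : c.shift η β t (c.param v) =
    c.param (v.1, fun i => ((1 + t * η i : ℝ) : ℂ) * v.2.1 i, fun j => v.2.2 j + t * β j) := by
  rw [shift, chart_param, z_param, y_param, param]

theorem contDiff_shift_param {g : M → ℝ} (hg : ContMDiffOn (𝓡 n) 𝓘(ℝ, ℝ) ∞ g c.chart.source) :
    ContDiff ℝ ∞ fun w : ℝ × c.Cover => g (c.shift η β w.1 (c.param w.2)) := by
  simp only [shift_param]
  rw [← contMDiff_iff_contDiff]
  refine hg.comp_contMDiff (c.contMDiff_param.comp ?_) fun w => c.param_mem _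
  rw [contMDiff_iff_contDiff]
  refine contDiff_snd.fst.prodMk (ContDiff.prodMk ?_ ?_)
  · rw [contDiff_pi]
    intro i
    exact (Complex.ofRealCLM.contDiff.comp
      (contDiff_const.add (contDiff_fst.mul contDiff_const))).mul
      ((contDiff_apply ℝ ℂ i).comp contDiff_snd.snd.fst)
  · rw [contDiff_pi]
    intro j
    exact ((contDiff_apply ℝ ℝ j).comp contDiff_snd.snd.snd).add
      (contDiff_fst.mul contDiff_const)

theorem contMDiffOn_deriv_shift {Φ : ℝ → M → ℝ}
    (hΦ : ContDiff ℝ ∞ fun w : ℝ × c.Cover => Φ w.1 (c.param w.2)) :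
    ContMDiffOn (𝓡 n) 𝓘(ℝ, ℝ) ∞ (fun x => deriv (fun t => Φ t x) 0) c.chart.source := fun _ hx =>
  (((c.localParam hx).contMDiffOn_deriv hΦ).contMDiffAt
    ((c.localParam hx).isOpen.mem_nhds (c.localParam hx).mem)).contMDiffWithinAt

variable [T2Space M]

/-- The derivation along the flow `shift`, multiplied by a cut-off function. -/
def shiftDerivation (C : ℝ) : Derivation ℝ (SmoothFn n M) (SmoothFn n M) :=
  curveDerivation (c.shift η β) (c.cut C)
    (fun _ hx => c.shift_zero η β (c.mem_of_cut_ne_zero hx).1)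
    (fun f _ hx => (c.localParam (c.mem_of_cut_ne_zero hx).1).differentiableAt
      (c.localParam (c.mem_of_cut_ne_zero hx).1).mem (Φ := fun t x => f (c.shift η β t x))
      (c.contDiff_shift_param η β f.contMDiff.contMDiffOn))
    (fun f => c.contMDiff_cut_mul contMDiff_id (c.contMDiffOn_deriv_shift
      (Φ := fun t x => f (c.shift η β t x))
      (c.contDiff_shift_param η β f.contMDiff.contMDiffOn)) C)

theorem shiftDerivation_apply (C : ℝ) (f : SmoothFn n M) (x : M) :
    c.shiftDerivation η β C f x = c.cut C x * deriv (fun t => f (c.shift η β t x)) 0 := rfl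

/-- Membership has to be tested in every chart, not only in `c`. The function is invariant and
vanishes at all non-free points, conditions that do not refer to a chart. -/
theorem cutMul_radialProduct_mem (C : ℝ) :
    c.cutMul C c.radialProduct c.contMDiffOn_radialProduct ∈ ellipticDivisor k n M := by
  refine mem_ellipticDivisor_of_invariant (fun t x => ?_) fun x hx => ?_
  · rw [cutMul_apply, cutMul_apply, cut_smul]
    by_cases hx : x ∈ c.chart.source
    · rw [c.radialProduct_smul t hx]
    · rw [c.cut_of_notMem C hx, zero_mul, zero_mul]
  · rw [cutMul_apply]
    by_cases hxs : x ∈ c.chart.source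
    · rw [c.isFreePoint_iff hxs] at hx
      push Not at hx
      obtain ⟨i, hi⟩ := hx
      rw [radialProduct_eq, Finset.prod_eq_zero (Finset.mem_univ i) (by rw [hi]; simp), mul_zero]
    · rw [c.cut_of_notMem C hxs, zero_mul]

/-- The flow multiplies the radial product by Π (1 + tη_i)², so differentiating f = (radial product)
· g along it leaves a multiple of the radial product. The larger cut-off C + 1 turns this into a
global multiple of an element of the divisor. -/
theorem shiftDerivation_mem (C : ℝ) : c.shiftDerivation η β C ∈ ellipticTangent k n M := by
  intro I hI f hf
  obtain rfl : I = ellipticDivisor k n M := hI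
  obtain ⟨g, hg, hfg⟩ := hf c
  set Φ : ℝ → M → ℝ := fun t x => (∏ i, (1 + t * η i) ^ 2) * g (c.shift η β t x) with hΦ
  have h1 : ContDiff ℝ ∞ fun w : ℝ × c.Cover => Φ w.1 (c.param w.2) :=
    (contDiff_prod fun i _ => (contDiff_const.add (contDiff_fst.mul contDiff_const)).pow 2).mul
      (c.contDiff_shift_param η β hg)
  have h2 : c.shiftDerivation η β C f =
      c.cutMul C (fun x => deriv (fun t => Φ t x) 0) (c.contMDiffOn_deriv_shift h1) *
        c.cutMul (C + 1) c.radialProduct c.contMDiffOn_radialProduct := by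
    ext x
    rw [ContMDiffMap.coe_mul, Pi.mul_apply, cutMul_apply, cutMul_apply, shiftDerivation_apply]
    by_cases hx : c.cut C x = 0
    · simp [hx]
    · obtain ⟨hxs, hxC⟩ := c.mem_of_cut_ne_zero hx
      rw [c.cut_eq_one hxs hxC.le, one_mul, mul_assoc, mul_comm (deriv _ _),
        ← deriv_const_mul_field (c.radialProduct x)]
      congr 2
      funext t
      rw [hfg _ (c.shift_mem _ _ _ _), radialProduct_eq, radialProduct_eq, hΦ]
      simp only [z_shift, norm_mul, mul_pow, Finset.prod_mul_distrib, Complex.norm_real,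
        Real.norm_eq_abs, sq_abs]
      ring
  rw [h2]
  exact Ideal.mul_mem_left _ _ (c.cutMul_radialProduct_mem _)

/-- The vector fields along the radial directions and the real coordinates of a chart. -/
def shiftField (C : ℝ) : ellipticTangent k n M :=
  ⟨c.shiftDerivation η β C, c.shiftDerivation_mem η β C⟩

theorem shiftField_apply (C : ℝ) (f : SmoothFn n M) (x : M) :
    (c.shiftField η β C).1 f x = c.cut C x * deriv (fun t => f (c.shift η β t x)) 0 := rfl

theorem shiftField_invariant [SmoothTorusAction k n M] (C : ℝ) :
    IsInvariantSection (c.shiftField η β C) := by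
  intro t f
  ext x
  change (c.shiftField η β C).1 (translate t f) x = (c.shiftField η β C).1 f (t • x)
  rw [shiftField_apply, shiftField_apply, cut_smul]
  by_cases hx : x ∈ c.chart.source
  · simp only [c.shift_smul η β _ t hx]
    rfl
  · rw [c.cut_of_notMem C hx, zero_mul, zero_mul]

/-- The derivative of a function known near the point. -/
theorem shiftField_apply_of_eventually {C : ℝ} {f : SmoothFn n M} {x : M} {u : M → ℝ}
    (h : ∀ᶠ x' in 𝓝 x, f x' = u x') {d : ℝ}
    (hd : x ∈ c.chart.source → HasDerivAt (fun t => u (c.shift η β t x)) d 0) :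
    (c.shiftField η β C).1 f x = c.cut C x * d := by
  rw [shiftField_apply]
  by_cases hx : x ∈ c.chart.source
  · congr 1
    have h1 : Continuous fun t : ℝ => c.shift η β t x := by
      have h2 : ∀ t, c.shift η β t x = c.param (c.angle x x,
          fun i => ((1 + t * η i : ℝ) : ℂ) * c.z x i, fun j => c.y x j + t * β j) := by
        intro t
        conv_lhs => rw [← c.param_angle x hx, shift_param]
      simp only [h2]
      refine c.contMDiff_param.continuous.comp (continuous_const.prodMk
        (Continuous.prodMk ?_ ?_)) <;> fun_prop
    have h2 : Tendsto (fun t : ℝ => c.shift η β t x) (𝓝 0) (𝓝 x) := by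
      have := h1.tendsto 0
      rwa [c.shift_zero η β hx] at this
    exact ((hd hx).congr_of_eventuallyEq (h2.eventually h)).deriv
  · rw [c.cut_of_notMem C hx, zero_mul, zero_mul]

theorem shiftField_apply_phi {C : ℝ} {x : M} (i : Fin c.a) (w : ℂ →L[ℝ] ℝ) {g : SmoothFn n M}
    (hg : ∀ᶠ x' in 𝓝 x, g x' = w (c.phi x' i)) : (c.shiftField η β C).1 g x = 0 := by
  rw [c.shiftField_apply_of_eventually η β hg (d := 0), mul_zero]
  intro _
  simp only [phi_shift]
  exact hasDerivAt_const _ _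

theorem shiftField_apply_z {C : ℝ} {x : M} (i : Fin c.l) (w : ℂ →L[ℝ] ℝ) {g : SmoothFn n M}
    (hg : ∀ᶠ x' in 𝓝 x, g x' = w (c.z x' i)) :
    (c.shiftField η β C).1 g x = c.cut C x * (η i * w (c.z x i)) := by
  refine c.shiftField_apply_of_eventually η β hg fun _ => ?_
  have h1 : ∀ t : ℝ, w (c.z (c.shift η β t x) i) = (1 + t * η i) * w (c.z x i) := by
    intro t
    rw [z_shift, ← Complex.real_smul, _root_.map_smul, smul_eq_mul]
  simp only [h1]
  simpa using (((hasDerivAt_id (0 : ℝ)).mul_const (η i)).const_add 1).mul_const (w (c.z x i))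

theorem shiftField_apply_y {C : ℝ} {x : M} (j : Fin c.m) {g : SmoothFn n M}
    (hg : ∀ᶠ x' in 𝓝 x, g x' = c.y x' j) :
    (c.shiftField η β C).1 g x = c.cut C x * β j := by
  refine c.shiftField_apply_of_eventually η β hg fun _ => ?_
  simp only [y_shift]
  simpa using ((hasDerivAt_id (0 : ℝ)).mul_const (β j)).const_add (c.y x j)

/-! ### The fundamental fields in coordinates -/

omit [T2Space M]
variable [SmoothTorusAction k n M] (hM : ∀ x : M, ∃ c : StandardChart k n M, x ∈ c.chart.source)

theorem fundField_apply_of_eventually (e : Fin k → ℝ) {f : SmoothFn n M} {x : M} {u : M → ℝ}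
    (h : ∀ᶠ x' in 𝓝 x, f x' = u x') {d : ℝ}
    (hd : HasDerivAt (fun t : ℝ => u (torusExp (t • e) • x)) d 0) :
    (fundField hM e).1 f x = d := by
  have h1 : Continuous fun t : ℝ => torusExp (t • e) • x :=
    (contMDiff_torusExp_smul (I := 𝓘(ℝ, ℝ)) (n := n) (s := fun t : ℝ => t • e)
      (contDiff_id.smul contDiff_const).contMDiff (contMDiff_const (c := x))).continuous
  have h2 : Tendsto (fun t : ℝ => torusExp (t • e) • x) (𝓝 0) (𝓝 x) := by
    have := h1.tendsto 0
    rwa [zero_smul, torusExp_zero, one_smul] at this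
  exact (fundDerivation_apply hM e f x).trans (hd.congr_of_eventuallyEq (h2.eventually h)).deriv

theorem fundField_apply_phi (e : Fin k → ℝ) {x : M} (hx : x ∈ c.chart.source) (i : Fin c.a)
    (w : ℂ →L[ℝ] ℝ) {g : SmoothFn n M} (hg : ∀ᶠ x' in 𝓝 x, g x' = w (c.phi x' i)) :
    (fundField hM e).1 g x = c.weight e (Sum.inl i) * w (Complex.I * c.phi x i) := by
  refine fundField_apply_of_eventually hM e hg ?_
  simp only [c.phi_smul _ hx]
  have h1 := w.hasFDerivAt.comp_hasDerivAt (0 : ℝ)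
    ((c.hasDerivAt_character (Sum.inl i) e).mul_const (c.phi x i))
  rw [mul_assoc, ← Complex.real_smul, _root_.map_smul] at h1
  exact h1

theorem fundField_apply_z (e : Fin k → ℝ) {x : M} (hx : x ∈ c.chart.source) (i : Fin c.l)
    (w : ℂ →L[ℝ] ℝ) {g : SmoothFn n M} (hg : ∀ᶠ x' in 𝓝 x, g x' = w (c.z x' i)) :
    (fundField hM e).1 g x = c.weight e (Sum.inr i) * w (Complex.I * c.z x i) := by
  refine fundField_apply_of_eventually hM e hg ?_
  simp only [c.z_smul _ hx]
  have h1 := w.hasFDerivAt.comp_hasDerivAt (0 : ℝ)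
    ((c.hasDerivAt_character (Sum.inr i) e).mul_const (c.z x i))
  rw [mul_assoc, ← Complex.real_smul, _root_.map_smul] at h1
  exact h1

theorem fundField_apply_y (e : Fin k → ℝ) {x : M} (hx : x ∈ c.chart.source) (j : Fin c.m)
    {g : SmoothFn n M} (hg : ∀ᶠ x' in 𝓝 x, g x' = c.y x' j) :
    (fundField hM e).1 g x = 0 := by
  refine fundField_apply_of_eventually hM e hg ?_
  simp only [c.y_smul _ hx]
  exact hasDerivAt_const _ _

end StandardChart

/-! ## Existence of coefficients in a local frame -/

/-- Two local quotients agree where ζ ≠ 0, which is dense, so they agree on overlaps by continuity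
and patch together. -/
theorem exists_contMDiffOn_of_local_division {E H : Type*} [NormedAddCommGroup E]
    [NormedSpace ℝ E] [TopologicalSpace H] {I : ModelWithCorners ℝ E H} {Q : Type*}
    [TopologicalSpace Q] [ChartedSpace H Q] {U : Set Q} {ζ w : Q → ℂ}
    (hd : ∀ q ∈ U, ∀ s ∈ 𝓝 q, ∃ q' ∈ s, ζ q' ≠ 0)
    (h : ∀ q ∈ U, ∃ (γ : Q → ℂ) (O : Set Q), IsOpen O ∧ q ∈ O ∧ O ⊆ U ∧
      ContMDiffOn I 𝓘(ℝ, ℂ) ∞ γ O ∧ ∀ p ∈ O, w p = ζ p * γ p) :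
    ∃ γ : Q → ℂ, ContMDiffOn I 𝓘(ℝ, ℂ) ∞ γ U ∧ ∀ p ∈ U, w p = ζ p * γ p := by
  classical
  choose! γ O hO hq hOU hγ hw using h
  -- Each point uses its own local quotient; near q it coincides with the quotient chosen at q.
  refine ⟨fun p => γ p p, fun q hqU => ?_, fun p hp => hw p hp p (hq p hp)⟩
  refine (((hγ q hqU).contMDiffAt ((hO q hqU).mem_nhds (hq q hqU))).congr_of_eventuallyEq
    ?_).contMDiffWithinAt
  filter_upwards [(hO q hqU).mem_nhds (hq q hqU)] with p hp
  have hpU := hOU q hqU hp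
  by_contra hne
  have h1 : ContinuousAt (fun p' => γ p p' - γ q p') p :=
    ((hγ p hpU).continuousOn.continuousAt ((hO p hpU).mem_nhds (hq p hpU))).sub
      ((hγ q hqU).continuousOn.continuousAt ((hO q hqU).mem_nhds hp))
  have h2 : ∀ᶠ p' in 𝓝 p, γ p p' - γ q p' ≠ 0 := h1.eventually_ne (sub_ne_zero.2 hne)
  obtain ⟨p', ⟨⟨h3, h4⟩, h5⟩, h6⟩ := hd p hpU _ ((h2.and ((hO p hpU).eventually_mem
    (hq p hpU))).and ((hO q hqU).eventually_mem hp))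
  apply h3
  rw [sub_eq_zero]
  refine mul_left_cancel₀ h6 ?_
  rw [← hw p hpU p' h4, ← hw q hqU p' h5]

section MapIdeal

variable {k n n' : ℕ} {M M' : Type*} [TopologicalSpace M]
  [ChartedSpace (EuclideanSpace ℝ (Fin n)) M] [TopologicalSpace M']
  [ChartedSpace (EuclideanSpace ℝ (Fin n')) M'] [MulAction (Torus k) M]

/-- Divisibility by the radial product over the chart is stable under sums and multiples, so only
the generating pull-backs matter. This turns membership in the extended ideal into a division
property on the product. -/
theorem exists_eq_radialProduct_mul_of_mem_map (c : StandardChart k n M)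
    {f : ProdSmoothFn n n' M M'} (hf : f ∈ (ellipticDivisor k n M).map pullFst) :
    ∃ h : M × M' → ℝ, ContMDiffOn ((𝓡 n).prod (𝓡 n')) 𝓘(ℝ, ℝ) ∞ h (Prod.fst ⁻¹' c.chart.source) ∧
      ∀ q ∈ Prod.fst ⁻¹' c.chart.source, f q = c.radialProduct q.1 * h q := by
  refine Submodule.span_induction (p := fun f _ => ∃ h : M × M' → ℝ,
    ContMDiffOn ((𝓡 n).prod (𝓡 n')) 𝓘(ℝ, ℝ) ∞ h (Prod.fst ⁻¹' c.chart.source) ∧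
      ∀ q ∈ Prod.fst ⁻¹' c.chart.source, f q = c.radialProduct q.1 * h q) ?_ ?_ ?_ ?_ hf
  · rintro _ ⟨g, hg, rfl⟩
    obtain ⟨h, hh, hgh⟩ := hg c
    exact ⟨fun q => h q.1, hh.comp contMDiff_fst.contMDiffOn (fun _ h => h), fun q hq => hgh _ hq⟩
  · exact ⟨fun _ => 0, contMDiffOn_const, fun _ _ => by simp⟩
  · rintro f g _ _ ⟨h, hh, hf⟩ ⟨h', hh', hg⟩
    refine ⟨fun q => h q + h' q, hh.add hh', fun q hq => ?_⟩
    rw [ContMDiffMap.coe_add, Pi.add_apply, hf q hq, hg q hq, mul_add]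
  · rintro a f _ ⟨h, hh, hf⟩
    refine ⟨fun q => a q * h q, a.contMDiff.contMDiffOn.mul hh, fun q hq => ?_⟩
    rw [smul_eq_mul, ContMDiffMap.coe_mul, Pi.mul_apply, hf q hq]
    ring

end MapIdeal

/-- A derivation along a map, at a point of the source. -/
theorem isPointDerivation_along {E H E' H' Q Q' : Type*} [NormedAddCommGroup E] [NormedSpace ℝ E]
    [TopologicalSpace H] {I : ModelWithCorners ℝ E H} [TopologicalSpace Q] [ChartedSpace H Q]
    [NormedAddCommGroup E'] [NormedSpace ℝ E'] [TopologicalSpace H']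
    {I' : ModelWithCorners ℝ E' H'} [TopologicalSpace Q'] [ChartedSpace H' Q']
    {ρ : C^∞⟮I, Q; 𝓘(ℝ, ℝ), ℝ⟯ →ₐ[ℝ] C^∞⟮I', Q'; 𝓘(ℝ, ℝ), ℝ⟯}
    {Y : C^∞⟮I, Q; 𝓘(ℝ, ℝ), ℝ⟯ →ₗ[ℝ] C^∞⟮I', Q'; 𝓘(ℝ, ℝ), ℝ⟯}
    (hY : ∀ f g, Y (f * g) = ρ f * Y g + ρ g * Y f) {q : Q} {q' : Q'} (hρ : ∀ f, ρ f q' = f q) :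
    IsPointDerivation q (evalDerivation q' Y) := by
  intro f g
  rw [evalDerivation_apply, hY, ← hρ f, ← hρ g]
  rfl

theorem IsPointDerivation.eq_apply_of_eventually {E H Q : Type*} [NormedAddCommGroup E]
    [NormedSpace ℝ E] [FiniteDimensional ℝ E] [TopologicalSpace H] {I : ModelWithCorners ℝ E H}
    [TopologicalSpace Q] [ChartedSpace H Q] [T2Space Q] [IsManifold I ∞ Q] {q : Q}
    {δ : C^∞⟮I, Q; 𝓘(ℝ, ℝ), ℝ⟯ →ₗ[ℝ] ℝ} (hδ : IsPointDerivation q δ) {ζ : Q → ℂ}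
    {f g h : C^∞⟮I, Q; 𝓘(ℝ, ℝ), ℝ⟯} (hf : ∀ᶠ p in 𝓝 q, f p = (ζ p).re)
    (hg : ∀ᶠ p in 𝓝 q, g p = (ζ p).im) (w : ℂ →L[ℝ] ℝ) (hh : ∀ᶠ p in 𝓝 q, h p = w (ζ p)) :
    δ h = w (δ f + δ g * Complex.I) := by
  have hw : ∀ z : ℂ, w z = z.re * w 1 + z.im * w Complex.I := by
    intro z
    conv_lhs => rw [← Complex.re_add_im z]
    rw [map_add, ← mul_one (z.re : ℂ), ← Complex.real_smul, ← Complex.real_smul, map_smul,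
      map_smul, smul_eq_mul, smul_eq_mul]
  have h1 : δ h = δ (w 1 • f + w Complex.I • g) := by
    refine hδ.congr ?_
    filter_upwards [hf, hg, hh] with p h2 h3 h4
    rw [h4, hw, ← h2, ← h3]
    change _ = w 1 * f p + w Complex.I * g p
    ring
  rw [h1, map_add, map_smul, map_smul, hw (_ + _)]
  simp [mul_comm]

/-! ### A local frame for the derivations preserving the elliptic divisor -/

section Frame

variable {k n n' : ℕ} {M M' : Type*} [TopologicalSpace M]
  [ChartedSpace (EuclideanSpace ℝ (Fin n)) M] [TopologicalSpace M']
  [ChartedSpace (EuclideanSpace ℝ (Fin n')) M'] [MulAction (Torus k) M]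
  [T2Space M] [SmoothTorusAction k n M]

namespace StandardChart

variable (c : StandardChart k n M) (C : ℝ)

/-- The part of a local frame given by the fields of a chart. -/
def frame (i : Fin c.l ⊕ Fin c.m) : ellipticTangent k n M :=
  Sum.elim (fun i => c.shiftField (Pi.single i 1) 0 (C + 1))
    (fun j => c.shiftField 0 (Pi.single j 1) (C + 1)) i

omit [T2Space M] [SmoothTorusAction k n M] in
theorem contMDiffOn_re_z (i : Fin c.l) (w : ℂ →L[ℝ] ℝ) :
    ContMDiffOn (𝓡 n) 𝓘(ℝ, ℝ) ∞ (fun x => w (c.z x i)) c.chart.source :=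
  w.contDiff.contMDiff.comp_contMDiffOn (c.contMDiffOn_z_apply i)

omit [T2Space M] [SmoothTorusAction k n M] in
theorem contMDiffOn_re_phi (i : Fin c.a) (w : ℂ →L[ℝ] ℝ) :
    ContMDiffOn (𝓡 n) 𝓘(ℝ, ℝ) ∞ (fun x => w (c.phi x i)) c.chart.source :=
  w.contDiff.contMDiff.comp_contMDiffOn (c.contMDiffOn_phi i)

omit [T2Space M] [SmoothTorusAction k n M] in
theorem cut_mul_eventuallyEq {x : M} (hx : x ∈ c.chart.source) (h : c.normSq x < C) (g : M → ℝ) :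
    ∀ᶠ x' in 𝓝 x, c.cut C x' * g x' = g x' := by
  filter_upwards [c.eventually_cut_eq_one hx h] with x' h'
  rw [h', one_mul]

omit [SmoothTorusAction k n M] in
/-- The components of a derivation along the complex coordinates of a chart are divisible. -/
theorem exists_division [IsManifold (𝓡 n) ∞ M] (hM' : ∀ y : M', Nonempty (LocalParam (𝓡 n') y))
    {Y : SmoothFn n M →ₗ[ℝ] ProdSmoothFn n n' M M'}
    (hY : ∀ f g, Y (f * g) = pullFst f * Y g + pullFst g * Y f)
    (hI : ∀ f ∈ ellipticDivisor k n M, Y f ∈ (ellipticDivisor k n M).map pullFst) (i : Fin c.l) :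
    ∃ γ : M × M' → ℂ, ContMDiffOn ((𝓡 n).prod (𝓡 n')) 𝓘(ℝ, ℂ) ∞ γ
        (Prod.fst ⁻¹' c.chart.source) ∧
      ∀ q ∈ Prod.fst ⁻¹' c.chart.source, (c.cut C q.1 : ℂ) *
        ((Y (c.cutMul (C + 1) _ (c.contMDiffOn_re_z i Complex.reCLM)) q : ℂ) +
          Y (c.cutMul (C + 1) _ (c.contMDiffOn_re_z i Complex.imCLM)) q * Complex.I) =
        c.z q.1 i * γ q := by
  set zr := fun i => c.cutMul (C + 1) _ (c.contMDiffOn_re_z i Complex.reCLM) with hzr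
  set zi := fun i => c.cutMul (C + 1) _ (c.contMDiffOn_re_z i Complex.imCLM) with hzi
  set w : Fin c.l → M × M' → ℂ := fun i q => c.cut C q.1 * ((Y (zr i) q : ℂ) +
    Y (zi i) q * Complex.I) with hw
  set R := c.cutMul (C + 1) c.radialProduct c.contMDiffOn_radialProduct with hR
  obtain ⟨h, hh, hRh⟩ := exists_eq_radialProduct_mul_of_mem_map (n' := n') (M' := M') c
    (hI R (c.cutMul_radialProduct_mem (C + 1)))
  have hcut : ContMDiff ((𝓡 n).prod (𝓡 n')) 𝓘(ℝ, ℝ) ∞ fun q : M × M' => c.cut C q.1 := by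
    have := c.contMDiff_cut_mul (I := (𝓡 n).prod (𝓡 n')) (ρ := (Prod.fst : M × M' → M))
      contMDiff_fst (g := fun _ => 1) contMDiffOn_const C
    simpa using this
  have hws : ∀ i, ContMDiff ((𝓡 n).prod (𝓡 n')) 𝓘(ℝ, ℂ) ∞ (w i) := by
    intro i
    have h1 : ContDiff ℝ ∞ fun v : ℝ × ℝ × ℝ => (v.1 : ℂ) * ((v.2.1 : ℂ) + v.2.2 * Complex.I) :=
      (Complex.ofRealCLM.contDiff.comp contDiff_fst).mul
        ((Complex.ofRealCLM.contDiff.comp contDiff_snd.fst).add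
          ((Complex.ofRealCLM.contDiff.comp contDiff_snd.snd).mul contDiff_const))
    exact h1.contMDiff.comp (hcut.prodMk_space
      ((Y (zr i)).contMDiff.prodMk_space (Y (zi i)).contMDiff))
  -- Since Y preserves the divisor, Y(Π|z_i|²) = h Π|z_i|², whereas the Leibniz rule gives Σ 2
  -- Re(z̄_i Y z_i) Π_{j≠i}|z_j|². After halving, this is the hypothesis of the division theorem.
  have hsum : ∀ q : M × M', q.1 ∈ c.chart.source →
      ∑ i, (conj (c.z q.1 i) * w i q).re * ∏ j ∈ Finset.univ.erase i, ‖c.z q.1 j‖ ^ 2 =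
        (c.cut C q.1 * h q / 2) * ∏ j, ‖c.z q.1 j‖ ^ 2 := by
    rintro ⟨x, y⟩ hx
    by_cases hC : c.cut C x = 0
    · simp [hw, hC]
    have hxC := (c.mem_of_cut_ne_zero hC).2
    have hδ := isPointDerivation_along hY (q := x) (q' := (x, y)) fun _ => rfl
    set δ := evalDerivation (x, y) Y with hδdef
    -- Point derivations only see germs, and near x all cut-offs involved equal one.
    have h1 : δ R = δ (∏ i, (zr i ^ 2 + zi i ^ 2)) := by
      refine hδ.congr ?_
      filter_upwards [c.eventually_cut_eq_one hx hxC] with x' hx'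
      have h2 : (∏ i, (zr i ^ 2 + zi i ^ 2)) x' = ∏ i, (zr i x' ^ 2 + zi i x' ^ 2) :=
        map_prod (ContMDiffMap.evalRingHom x' : SmoothFn n M →+* ℝ) _ _
      rw [h2]
      simp only [hR, hzr, hzi, cutMul_apply, hx', one_mul, radialProduct_eq, Complex.reCLM_apply,
        Complex.imCLM_apply]
      refine Finset.prod_congr rfl fun i _ => ?_
      rw [← Complex.normSq_eq_norm_sq, Complex.normSq_apply]
      ring
    have hx1 : c.cut (C + 1) x = 1 := c.cut_eq_one hx hxC.le
    have h2 : δ R = c.radialProduct x * h (x, y) := hRh (x, y) hx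
    have hval : ∀ j, (zr j ^ 2 + zi j ^ 2) x = ‖c.z x j‖ ^ 2 := by
      intro j
      change zr j x ^ 2 + zi j x ^ 2 = _
      simp only [hzr, hzi, cutMul_apply, hx1, one_mul, Complex.reCLM_apply, Complex.imCLM_apply]
      rw [← Complex.normSq_eq_norm_sq, Complex.normSq_apply]
      ring
    have hzrx : ∀ j, zr j x = (c.z x j).re := fun j => by simp [hzr, hx1]
    have hzix : ∀ j, zi j x = (c.z x j).im := fun j => by simp [hzi, hx1]
    rw [h1, hδ.map_prod] at h2
    simp only [hval, map_add, hδ.map_pow, hzrx, hzix] at h2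
    rw [radialProduct_eq] at h2
    simp only
    rw [mul_div_assoc, mul_assoc, mul_comm _ (∏ j, _), ← mul_div_assoc, ← h2, Finset.sum_div,
      Finset.mul_sum]
    refine Finset.sum_congr rfl fun i _ => ?_
    have h3 : (conj (c.z x i) * w i (x, y)).re = c.cut C x * ((c.z x i).re * δ (zr i) +
        (c.z x i).im * δ (zi i)) := by
      simp only [hw, hδdef, evalDerivation_apply]
      simp
      ring
    rw [h3]
    ring
  have hloc : ∀ q ∈ (Prod.fst ⁻¹' c.chart.source : Set (M × M')), ∃ (γ : M × M' → ℂ)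
      (O : Set (M × M')), IsOpen O ∧ q ∈ O ∧ O ⊆ Prod.fst ⁻¹' c.chart.source ∧
      ContMDiffOn ((𝓡 n).prod (𝓡 n')) 𝓘(ℝ, ℂ) ∞ γ O ∧ ∀ p ∈ O, w i p = c.z p.1 i * γ p := by
    rintro ⟨x₀, y₀⟩ hx₀
    obtain ⟨p'⟩ := hM' y₀
    have hr : ContMDiff 𝓘(ℝ, c.Cover × p'.V) ((𝓡 n).prod (𝓡 n')) ∞
        fun v : c.Cover × p'.V => (c.param v.1, p'.r v.2) :=
      (c.contMDiff_param.comp contDiff_fst.contMDiff).prodMk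
        (p'.r_smooth.comp contDiff_snd.contMDiff)
    -- On the universal cover of the model, times a parametrization of M', the z_j are linear
    -- coordinates, as the division theorem requires. The quotient is brought back by the local
    -- section of the parametrization.
    obtain ⟨γ, hγ, hwγ⟩ := exists_eq_coord_mul_of_sum (E := c.Cover × p'.V)
      (ζ := fun j : Fin c.l => ContinuousLinearMap.proj j ∘L .fst ℝ _ _ ∘L .snd ℝ _ _ ∘L
        .fst ℝ c.Cover p'.V)
      (j := fun j : Fin c.l => (ContinuousLinearMap.inl ℝ c.Cover p'.V) ∘L
        (ContinuousLinearMap.inr ℝ (Fin c.a → ℝ) ((Fin c.l → ℂ) × (Fin c.m → ℝ))) ∘L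
        (ContinuousLinearMap.inl ℝ (Fin c.l → ℂ) (Fin c.m → ℝ)) ∘L
        (ContinuousLinearMap.single ℝ (fun _ : Fin c.l => ℂ) j))
      (fun j j' a => by
        simp [Pi.single_apply])
      (w := fun j v => w j (c.param v.1, p'.r v.2))
      (fun j => by rw [← contMDiff_iff_contDiff]; exact (hws j).comp hr)
      (h := fun v => c.cut C (c.param v.1) * h (c.param v.1, p'.r v.2) / 2)
      (by
        rw [← contMDiff_iff_contDiff]
        exact ((hcut.comp hr).mul (hh.comp_contMDiff hr fun v => c.param_mem _)).div_const 2)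
      (fun v => by
        have := hsum (c.param v.1, p'.r v.2) (c.param_mem _)
        simp only [z_param] at this
        exact this) i
    refine ⟨fun q => γ ((c.angle x₀ q.1, c.z q.1, c.y q.1), p'.s q.2),
      c.angleDomain x₀ ×ˢ p'.O, (c.isOpen_angleDomain x₀).prod p'.isOpen,
      ⟨c.mem_angleDomain hx₀, p'.mem⟩, fun q hq => hq.1.1, ?_, fun q hq => ?_⟩
    · refine hγ.contMDiff.comp_contMDiffOn (ContMDiffOn.prodMk_space
        (((c.localParam hx₀).s_smooth).comp contMDiff_fst.contMDiffOn fun q hq => hq.1)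
        (p'.s_smooth.comp contMDiff_snd.contMDiffOn fun q hq => hq.2))
    · have h1 := hwγ ((c.angle x₀ q.1, c.z q.1, c.y q.1), p'.s q.2)
      simp only [c.param_angle x₀ hq.1.1, p'.r_s _ hq.2] at h1
      exact h1
  exact exists_contMDiffOn_of_local_division (ζ := fun q : M × M' => c.z q.1 i)
    (fun q hq s hs => by
      have h1 : (fun x : M => (x, q.2)) ⁻¹' s ∈ 𝓝 q.1 :=
        (Continuous.prodMk_left q.2).continuousAt hs
      obtain ⟨x', hx', hfree⟩ := c.mem_closure_isFreePoint hq (Filter.inter_mem h1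
        (c.isOpen_source.mem_nhds hq))
      exact ⟨(x', q.2), hx'.1, (c.isFreePoint_iff hx'.2).1 hfree i⟩) hloc

theorem smooth_of_complex {E H Q : Type*} [NormedAddCommGroup E] [NormedSpace ℝ E]
    [TopologicalSpace H] {I : ModelWithCorners ℝ E H} [TopologicalSpace Q] [ChartedSpace H Q]
    {s : Set Q} {γ : Q → ℂ} (hγ : ContMDiffOn I 𝓘(ℝ, ℂ) ∞ γ s) (w : ℂ →L[ℝ] ℝ) :
    ContMDiffOn I 𝓘(ℝ, ℝ) ∞ (fun q => w (γ q)) s :=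
  w.contDiff.contMDiff.comp_contMDiffOn hγ

/-- Derivations along the first projection which preserve the elliptic divisor are, after
multiplication by a cut-off function, combinations of a local frame. -/
theorem exists_coeff [IsManifold (𝓡 n) ∞ M] (hM' : ∀ y : M', Nonempty (LocalParam (𝓡 n') y))
    (hM : ∀ x : M, ∃ c : StandardChart k n M, x ∈ c.chart.source)
    {Y : SmoothFn n M →ₗ[ℝ] ProdSmoothFn n n' M M'}
    (hY : ∀ f g, Y (f * g) = pullFst f * Y g + pullFst g * Y f)
    (hI : ∀ f ∈ ellipticDivisor k n M, Y f ∈ (ellipticDivisor k n M).map pullFst) :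
    ∃ (b : Fin k → ProdSmoothFn n n' M M') (a : Fin c.l ⊕ Fin c.m → ProdSmoothFn n n' M M'),
      ∀ (g : SmoothFn n M) (q : M × M'), c.cut C q.1 * Y g q =
        ∑ j, b j q * (fundField hM (Pi.single j 1)).1 g q.1 +
          ∑ i, a i q * (c.frame C i).1 g q.1 := by
  set zr := fun i => c.cutMul (C + 1 + 1) _ (c.contMDiffOn_re_z i Complex.reCLM) with hzr
  set zi := fun i => c.cutMul (C + 1 + 1) _ (c.contMDiffOn_re_z i Complex.imCLM) with hzi
  set pr := fun i => c.cutMul (C + 1 + 1) _ (c.contMDiffOn_re_phi i Complex.reCLM) with hpr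
  set pi := fun i => c.cutMul (C + 1 + 1) _ (c.contMDiffOn_re_phi i Complex.imCLM) with hpi
  set yr := fun j => c.cutMul (C + 1 + 1) _ (c.contMDiffOn_y_apply j) with hyr
  choose γ hγ hwγ using c.exists_division (C + 1) hM' hY hI
  -- ε κ is the Lie algebra element rotating the coordinate κ alone; rotation speeds are converted
  -- into coefficients of the standard fundamental fields through its components.
  choose ε hε using c.exists_weight_eq
  have hfst : ContMDiff ((𝓡 n).prod (𝓡 n')) (𝓡 n) ∞ (Prod.fst : M × M' → M) := contMDiff_fst
  -- Since |φ_i| = 1, Yφ_i = iωφ_i with this real function ω.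
  have hω : ∀ i, ContMDiffOn ((𝓡 n).prod (𝓡 n')) 𝓘(ℝ, ℝ) ∞ (fun q : M × M' =>
      (c.phi q.1 i).re * Y (pi i) q - (c.phi q.1 i).im * Y (pr i) q)
      (Prod.fst ⁻¹' c.chart.source) := fun i =>
    (((c.contMDiffOn_re_phi i Complex.reCLM).comp hfst.contMDiffOn fun _ h => h).mul
      (Y (pi i)).contMDiff.contMDiffOn).sub
    (((c.contMDiffOn_re_phi i Complex.imCLM).comp hfst.contMDiffOn fun _ h => h).mul
      (Y (pr i)).contMDiff.contMDiffOn)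
  -- For a complex coordinate Y z_i = γ_i z_i by division: the imaginary part of γ_i is a rotation
  -- speed, its real part the coefficient of the radial field.
  set rot : Fin c.a ⊕ Fin c.l → ProdSmoothFn n n' M M' := Sum.elim
    (fun i => ⟨_, c.contMDiff_cut_mul hfst (hω i) C⟩)
    (fun i => ⟨_, c.contMDiff_cut_mul hfst (smooth_of_complex (hγ i) Complex.imCLM) C⟩) with hrot
  set b : Fin k → ProdSmoothFn n n' M M' := fun j => ∑ κ, (ε κ j) • rot κ with hb
  set a : Fin c.l ⊕ Fin c.m → ProdSmoothFn n n' M M' := Sum.elim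
    (fun i => ⟨_, c.contMDiff_cut_mul hfst (smooth_of_complex (hγ i) Complex.reCLM) C⟩)
    (fun j => ⟨_, c.contMDiff_cut_mul hfst (Y (yr j)).contMDiff.contMDiffOn C⟩) with ha
  have hbq : ∀ j q, b j q = ∑ κ, rot κ q * ε κ j := by
    intro j q
    have h1 : b j q = ∑ κ, (ε κ j • rot κ) q :=
      map_sum (ContMDiffMap.evalRingHom q : ProdSmoothFn n n' M M' →+* ℝ) _ _
    rw [h1]
    exact Finset.sum_congr rfl fun κ _ => mul_comm _ _
  refine ⟨b, a, fun g q => ?_⟩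
  obtain ⟨x, y⟩ := q
  by_cases hC : c.cut C x = 0
  · have h1 : ∀ κ, rot κ (x, y) = 0 := by
      rintro (i | i) <;> exact mul_eq_zero_of_left hC _
    have h2 : ∀ i, a i (x, y) = 0 := by
      rintro (i | i) <;> exact mul_eq_zero_of_left hC _
    simp only [hC, hbq, h1, h2, zero_mul, Finset.sum_const_zero, add_zero]
  obtain ⟨hx, hxC⟩ := c.mem_of_cut_ne_zero hC
  have hcut1 : c.cut (C + 1) x = 1 := c.cut_eq_one hx hxC.le
  have hδY := isPointDerivation_along hY (q := x) (q' := (x, y)) fun _ => rfl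
  set δY := evalDerivation (x, y) Y with hδYdef
  have hδX := fun X : ellipticTangent k n M => isPointDerivation_eval x X.1
  -- The difference of the two sides is a point derivation at x, hence zero as soon as it vanishes
  -- on the coordinate functions of the chart.
  set δ : SmoothFn n M →ₗ[ℝ] ℝ := c.cut C x • δY -
    (∑ j, b j (x, y) • evalDerivation x (fundField hM (Pi.single j 1)).1.toLinearMap +
      ∑ i, a i (x, y) • evalDerivation x (c.frame C i).1.toLinearMap) with hδdef
  have hδ : ∀ g, δ g = c.cut C x * Y g (x, y) -
      (∑ j, b j (x, y) * (fundField hM (Pi.single j 1)).1 g x +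
        ∑ i, a i (x, y) * (c.frame C i).1 g x) := by
    intro g
    simp only [hδdef, LinearMap.sub_apply, LinearMap.add_apply, LinearMap.smul_apply,
      LinearMap.sum_apply, smul_eq_mul]
    rfl
  have hder : IsPointDerivation x δ := by
    intro f g
    have h1 : ∀ j, (fundField hM (Pi.single j 1)).1 (f * g) x =
        f x * (fundField hM (Pi.single j 1)).1 g x + g x * (fundField hM (Pi.single j 1)).1 f x :=
      fun j => hδX (fundField hM (Pi.single j 1)) f g
    have h2 : ∀ i, (c.frame C i).1 (f * g) x =
        f x * (c.frame C i).1 g x + g x * (c.frame C i).1 f x := fun i => hδX (c.frame C i) f g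
    have h3 : Y (f * g) (x, y) = f x * Y g (x, y) + g x * Y f (x, y) := hδY f g
    simp only [hδ, h1, h2, h3, mul_add, Finset.sum_add_distrib, mul_sub, Finset.mul_sum]
    simp only [mul_left_comm (f x), mul_left_comm (g x)]
    ring
  have hwb : ∀ (κ) (r : ℝ), ∑ j, b j (x, y) * (c.weight (Pi.single j 1) κ * r) =
      rot κ (x, y) * r := by
    intro κ r
    have h1 : c.weight (fun j => b j (x, y)) κ = rot κ (x, y) := by
      have h2 : (fun j => b j (x, y)) = ∑ κ, rot κ (x, y) • ε κ := by
        funext j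
        rw [hbq, Finset.sum_apply]
        rfl
      rw [h2, _root_.map_sum, Finset.sum_apply]
      simp only [_root_.map_smul, hε, Pi.smul_apply, smul_eq_mul, Pi.single_apply]
      simp
    have h2 : c.weight (fun j => b j (x, y)) κ = ∑ j, b j (x, y) * c.weight (Pi.single j 1) κ := by
      conv_lhs => rw [← Finset.univ_sum_single (fun j => b j (x, y)), _root_.map_sum,
        Finset.sum_apply]
      refine Finset.sum_congr rfl fun j _ => ?_
      rw [← smul_eq_mul, ← Pi.smul_apply, ← _root_.map_smul]
      rw [← Pi.single_smul, smul_eq_mul, mul_one]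
    rw [← h1, h2, Finset.sum_mul]
    exact Finset.sum_congr rfl fun j _ => (mul_assoc _ _ _).symm
  have hxC2 : c.normSq x < C + 1 + 1 := by linarith
  have hcut2 : c.cut (C + 1 + 1) x = 1 := c.cut_eq_one hx hxC2.le
  have hzero : δ g = 0 := by
    refine c.pointDerivation_eq_zero hx hder (fun i w g hg => ?_) (fun i w g hg => ?_)
      (fun j g hg => ?_) g
    · have h1 := hδY.eq_apply_of_eventually
        (c.cut_mul_eventuallyEq (C + 1 + 1) hx hxC2 fun x => Complex.reCLM (c.phi x i))
        (c.cut_mul_eventuallyEq (C + 1 + 1) hx hxC2 fun x => Complex.imCLM (c.phi x i))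
        (f := pr i) (g := pi i) w hg
      -- Derivative of the constant |φ_i|² = 1: the component of Yφ_i in the direction of φ_i is
      -- zero.
      have h2 : (c.phi x i).re * δY (pr i) + (c.phi x i).im * δY (pi i) = 0 := by
        have h3 : δY (pr i ^ 2 + pi i ^ 2) = δY 1 := by
          refine hδY.congr ?_
          filter_upwards [c.eventually_cut_eq_one hx hxC2] with x' hx'
          change pr i x' ^ 2 + pi i x' ^ 2 = 1
          simp only [hpr, hpi, cutMul_apply, hx', one_mul, Complex.reCLM_apply,
            Complex.imCLM_apply]
          have h4 := c.norm_phi x' i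
          rw [← sq_eq_sq₀ (norm_nonneg _) zero_le_one, ← Complex.normSq_eq_norm_sq,
            Complex.normSq_apply] at h4
          linarith
        rw [hδY.map_one, map_add, hδY.map_pow, hδY.map_pow] at h3
        have h4 : pr i x = (c.phi x i).re := by simp [hpr, hcut2]
        have h5 : pi i x = (c.phi x i).im := by simp [hpi, hcut2]
        rw [h4, h5] at h3
        linarith
      have h3 : (δY (pr i) : ℂ) + δY (pi i) * Complex.I =
          ((c.phi x i).re * δY (pi i) - (c.phi x i).im * δY (pr i) : ℝ) •
            (Complex.I * c.phi x i) := by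
        have h4 := c.norm_phi x i
        rw [← sq_eq_sq₀ (norm_nonneg _) zero_le_one, ← Complex.normSq_eq_norm_sq,
          Complex.normSq_apply] at h4
        apply Complex.ext
        · simp
          linear_combination (-δY (pr i)) * h4 + (c.phi x i).re * h2
        · simp
          linear_combination (-δY (pi i)) * h4 + (c.phi x i).im * h2
      have h4 : ∀ i', (c.frame C i').1 g x = 0 := by
        rintro (i' | i') <;> exact c.shiftField_apply_phi _ _ i w hg
      rw [hδ]
      simp only [h4, mul_zero, Finset.sum_const_zero, add_zero,
        fun j => c.fundField_apply_phi hM (Pi.single j 1) hx i w hg, hwb]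
      change c.cut C x * δY g - _ = 0
      rw [h1, h3, _root_.map_smul, smul_eq_mul, ← mul_assoc]
      exact sub_self _
    · have h1 := hδY.eq_apply_of_eventually
        (c.cut_mul_eventuallyEq (C + 1 + 1) hx hxC2 fun x => Complex.reCLM (c.z x i))
        (c.cut_mul_eventuallyEq (C + 1 + 1) hx hxC2 fun x => Complex.imCLM (c.z x i))
        (f := zr i) (g := zi i) w hg
      have h2 := hwγ i (x, y) hx
      simp only [hcut1, Complex.ofReal_one, one_mul] at h2
      have h3 : (δY (zr i) : ℂ) + δY (zi i) * Complex.I = (γ i (x, y)).re • c.z x i +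
          (γ i (x, y)).im • (Complex.I * c.z x i) := by
        refine h2.trans ?_
        apply Complex.ext <;> simp <;> ring
      have h4 : ∑ i', a i' (x, y) * (c.frame C i').1 g x =
          c.cut C x * (γ i (x, y)).re * w (c.z x i) := by
        rw [Fintype.sum_sum_type]
        have h5 : ∀ i', (c.frame C (Sum.inl i')).1 g x = if i = i' then w (c.z x i) else 0 := by
          intro i'
          refine (c.shiftField_apply_z _ _ i w hg).trans ?_
          rw [hcut1, Pi.single_apply]
          split_ifs <;> simp
        have h6 : ∀ j, (c.frame C (Sum.inr j)).1 g x = 0 := by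
          intro j
          refine (c.shiftField_apply_z _ _ i w hg).trans ?_
          simp
        simp only [h5, h6, mul_zero, Finset.sum_const_zero, add_zero]
        simp only [mul_ite, mul_zero, Finset.sum_ite_eq, Finset.mem_univ, if_true]
        rfl
      rw [hδ, h4]
      simp only [fun j => c.fundField_apply_z hM (Pi.single j 1) hx i w hg, hwb]
      change c.cut C x * δY g - _ = 0
      rw [h1, h3, map_add, _root_.map_smul, _root_.map_smul, smul_eq_mul, smul_eq_mul]
      change _ - (c.cut C x * (γ i (x, y)).im * _ + _) = 0
      ring
    · have h1 : δY g = δY (yr j) := by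
        refine hδY.congr ?_
        filter_upwards [hg, c.cut_mul_eventuallyEq (C + 1 + 1) hx hxC2 fun x => c.y x j] with
          x' h2 h3
        rw [h2]
        exact h3.symm
      have h4 : ∑ i', a i' (x, y) * (c.frame C i').1 g x = c.cut C x * δY (yr j) := by
        rw [Fintype.sum_sum_type]
        have h5 : ∀ i', (c.frame C (Sum.inr i')).1 g x = if j = i' then 1 else 0 := by
          intro i'
          refine (c.shiftField_apply_y _ _ j hg).trans ?_
          rw [hcut1, Pi.single_apply]
          split_ifs <;> simp
        have h6 : ∀ i', (c.frame C (Sum.inl i')).1 g x = 0 := by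
          intro i'
          refine (c.shiftField_apply_y _ _ j hg).trans ?_
          simp
        simp only [h5, h6, mul_zero, Finset.sum_const_zero, zero_add]
        simp only [mul_ite, mul_zero, mul_one, Finset.sum_ite_eq, Finset.mem_univ, if_true]
        rfl
      rw [hδ, h4]
      simp only [fun j' => c.fundField_apply_y hM (Pi.single j' 1) hx j hg, mul_zero,
        Finset.sum_const_zero, zero_add]
      change c.cut C x * δY g - _ = 0
      rw [h1, sub_self]
  rw [hδ, sub_eq_zero] at hzero
  exact hzero

end StandardChart

end Frame

/-! ## Coefficients in a local frame -/

theorem sum_smul_derivation_apply {E H Q : Type*} [NormedAddCommGroup E] [NormedSpace ℝ E]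
    [TopologicalSpace H] {I : ModelWithCorners ℝ E H} [TopologicalSpace Q] [ChartedSpace H Q]
    {ι : Type*} (s : Finset ι) (f : ι → C^∞⟮I, Q; 𝓘(ℝ, ℝ), ℝ⟯)
    (D : ι → Derivation ℝ C^∞⟮I, Q; 𝓘(ℝ, ℝ), ℝ⟯ C^∞⟮I, Q; 𝓘(ℝ, ℝ), ℝ⟯)
    (g : C^∞⟮I, Q; 𝓘(ℝ, ℝ), ℝ⟯) (q : Q) :
    (∑ i ∈ s, f i • D i) g q = ∑ i ∈ s, f i q * D i g q := by
  classical
  induction s using Finset.induction_on with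
  | empty => simp
  | insert a s ha ih =>
    rw [Finset.sum_insert ha, Finset.sum_insert ha, ← ih]
    rfl

section Coefficients

variable {k n : ℕ} {M : Type*} [TopologicalSpace M] [ChartedSpace (EuclideanSpace ℝ (Fin n)) M]
  [MulAction (Torus k) M]

theorem coe_sum_smul_ellipticTangent {ι : Type*} (s : Finset ι) (f : ι → SmoothFn n M)
    (X : ι → ellipticTangent k n M) : (∑ i ∈ s, f i • X i).1 = ∑ i ∈ s, f i • (X i).1 :=
  map_sum (ellipticTangent k n M).toSubmodule.subtype _ _

theorem sum_smul_apply {ι : Type*} (s : Finset ι) (f : ι → SmoothFn n M)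
    (X : ι → ellipticTangent k n M) (g : SmoothFn n M) (x : M) :
    (∑ i ∈ s, f i • X i).1 g x = ∑ i ∈ s, f i x * (X i).1 g x := by
  rw [coe_sum_smul_ellipticTangent, sum_smul_derivation_apply]

theorem ellipticTangent_ext {X Y : ellipticTangent k n M} (h : ∀ g x, X.1 g x = Y.1 g x) :
    X = Y := by
  apply Subtype.ext
  ext g x
  exact h g x

variable [T2Space M] [SmoothTorusAction k n M]

namespace StandardChart

variable (c : StandardChart k n M) (C : ℝ)
  (hM : ∀ x : M, ∃ c : StandardChart k n M, x ∈ c.chart.source)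

/-- The index set of the local frame of a chart. -/
abbrev Idx := Fin k ⊕ (Fin c.l ⊕ Fin c.m)

/-- The local frame of a chart: the fundamental vector fields and the fields of the chart. -/
def basis (κ : c.Idx) : ellipticTangent k n M :=
  Sum.elim (fun j => fundField hM (Pi.single j 1)) (c.frame C) κ

theorem basis_invariant (κ : c.Idx) : IsInvariantSection (c.basis C hM κ) := by
  rcases κ with j | i | j
  · exact fundField_invariant hM _
  · exact c.shiftField_invariant _ _ _
  · exact c.shiftField_invariant _ _ _

/-- The cut-off function, as a smooth function. -/
def cutFn : SmoothFn n M := c.cutMul C (fun _ => 1) contMDiffOn_const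

omit [SmoothTorusAction k n M] in
@[simp]
theorem cutFn_apply (x : M) : c.cutFn C x = c.cut C x := mul_one _

omit [T2Space M] [SmoothTorusAction k n M] in
theorem weight_eq_sum (r : Fin k → ℝ) (i : Fin c.a ⊕ Fin c.l) :
    c.weight r i = ∑ j, r j * c.weight (Pi.single j 1) i := by
  conv_lhs => rw [← Finset.univ_sum_single r, _root_.map_sum, Finset.sum_apply]
  refine Finset.sum_congr rfl fun j _ => ?_
  rw [← smul_eq_mul, ← Pi.smul_apply, ← _root_.map_smul, ← Pi.single_smul, smul_eq_mul, mul_one]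

variable {C}

/-- Test on the real and imaginary parts of conj(z_i(x)) z_i: the imaginary part sees only the
rotations, the real part only the radial field, each with the factor |z_i(x)|², which is non-zero at
a free point. Injectivity of the weights then kills the coefficients of the fundamental fields. -/
theorem eq_zero_of_sum_basis_at {x : M} (hC : c.cut C x ≠ 0) (hfree : IsFreePoint k x)
    {r : c.Idx → ℝ} (hr : ∀ g, ∑ κ, r κ * (c.basis C hM κ).1 g x = 0) : r = 0 := by
  obtain ⟨hx, hxC⟩ := c.mem_of_cut_ne_zero hC
  have hxC2 : c.normSq x < C + 1 + 1 := by linarith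
  have hcut1 : c.cut (C + 1) x = 1 := c.cut_eq_one hx hxC.le
  have hz0 : ∀ i, c.z x i ≠ 0 := (c.isFreePoint_iff hx).1 hfree
  have hnorm : ∀ ζ : ℂ, (conj ζ * ζ).re = ‖ζ‖ ^ 2 := by
    intro ζ
    rw [← Complex.normSq_eq_norm_sq, Complex.normSq_apply]; simp
  have hnorm' : ∀ ζ : ℂ, (conj ζ * (Complex.I * ζ)).re = 0 := by
    intro ζ; simp; ring
  have hnorm2 : ∀ ζ : ℂ, (conj ζ * ζ).im = 0 := by
    intro ζ; simp; ring
  have hnorm3 : ∀ ζ : ℂ, (conj ζ * (Complex.I * ζ)).im = ‖ζ‖ ^ 2 := by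
    intro ζ
    rw [← Complex.normSq_eq_norm_sq, Complex.normSq_apply]; simp
  have hphi : ∀ (i : Fin c.a) (w : ℂ →L[ℝ] ℝ),
      c.weight (fun j => r (Sum.inl j)) (Sum.inl i) * w (Complex.I * c.phi x i) = 0 := by
    intro i w
    have hg : ∀ᶠ x' in 𝓝 x, c.cutMul (C + 1 + 1) _ (c.contMDiffOn_re_phi i w) x' = w (c.phi x' i) :=
      c.cut_mul_eventuallyEq (C + 1 + 1) hx hxC2 fun x => w (c.phi x i)
    have h1 := hr (c.cutMul (C + 1 + 1) _ (c.contMDiffOn_re_phi i w))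
    rw [Fintype.sum_sum_type] at h1
    have h2 : ∀ i', (c.frame C i').1 (c.cutMul (C + 1 + 1) _ (c.contMDiffOn_re_phi i w)) x = 0 := by
      rintro (i' | i') <;> exact c.shiftField_apply_phi _ _ i w hg
    simp only [basis, Sum.elim_inl, Sum.elim_inr, h2, mul_zero, Finset.sum_const_zero, add_zero,
      fun j => c.fundField_apply_phi hM (Pi.single j 1) hx i w hg] at h1
    rw [weight_eq_sum, Finset.sum_mul, ← h1]
    exact Finset.sum_congr rfl fun j _ => mul_assoc _ _ _
  have hz : ∀ (i : Fin c.l) (w : ℂ →L[ℝ] ℝ),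
      c.weight (fun j => r (Sum.inl j)) (Sum.inr i) * w (Complex.I * c.z x i) +
        r (Sum.inr (Sum.inl i)) * w (c.z x i) = 0 := by
    intro i w
    have hg : ∀ᶠ x' in 𝓝 x, c.cutMul (C + 1 + 1) _ (c.contMDiffOn_re_z i w) x' = w (c.z x' i) :=
      c.cut_mul_eventuallyEq (C + 1 + 1) hx hxC2 fun x => w (c.z x i)
    have h1 := hr (c.cutMul (C + 1 + 1) _ (c.contMDiffOn_re_z i w))
    rw [Fintype.sum_sum_type, Fintype.sum_sum_type] at h1
    have h5 : ∀ i', (c.frame C (Sum.inl i')).1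
        (c.cutMul (C + 1 + 1) _ (c.contMDiffOn_re_z i w)) x =
          if i = i' then w (c.z x i) else 0 := by
      intro i'
      refine (c.shiftField_apply_z _ _ i w hg).trans ?_
      rw [hcut1, Pi.single_apply]
      split_ifs <;> simp
    have h6 : ∀ j, (c.frame C (Sum.inr j)).1
        (c.cutMul (C + 1 + 1) _ (c.contMDiffOn_re_z i w)) x = 0 := by
      intro j
      refine (c.shiftField_apply_z _ _ i w hg).trans ?_
      simp
    simp only [basis, Sum.elim_inl, Sum.elim_inr, h5, h6, mul_zero, Finset.sum_const_zero,
      add_zero, fun j => c.fundField_apply_z hM (Pi.single j 1) hx i w hg, mul_ite,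
      Finset.sum_ite_eq, Finset.mem_univ, if_true] at h1
    rw [weight_eq_sum, Finset.sum_mul, ← h1]
    congr 1
    exact Finset.sum_congr rfl fun j _ => mul_assoc _ _ _
  have hy : ∀ j, r (Sum.inr (Sum.inr j)) = 0 := by
    intro j
    have hg : ∀ᶠ x' in 𝓝 x, c.cutMul (C + 1 + 1) _ (c.contMDiffOn_y_apply j) x' = c.y x' j :=
      c.cut_mul_eventuallyEq (C + 1 + 1) hx hxC2 fun x => c.y x j
    have h1 := hr (c.cutMul (C + 1 + 1) _ (c.contMDiffOn_y_apply j))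
    rw [Fintype.sum_sum_type, Fintype.sum_sum_type] at h1
    have h5 : ∀ i', (c.frame C (Sum.inr i')).1
        (c.cutMul (C + 1 + 1) _ (c.contMDiffOn_y_apply j)) x = if j = i' then 1 else 0 := by
      intro i'
      refine (c.shiftField_apply_y _ _ j hg).trans ?_
      rw [hcut1, Pi.single_apply]
      split_ifs <;> simp
    have h6 : ∀ i', (c.frame C (Sum.inl i')).1
        (c.cutMul (C + 1 + 1) _ (c.contMDiffOn_y_apply j)) x = 0 := by
      intro i'
      refine (c.shiftField_apply_y _ _ j hg).trans ?_
      simp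
    simpa only [basis, Sum.elim_inl, Sum.elim_inr, h5, h6, mul_zero, Finset.sum_const_zero,
      zero_add, fun j' => c.fundField_apply_y hM (Pi.single j' 1) hx j hg, mul_ite, mul_one,
      Finset.sum_ite_eq, Finset.mem_univ, if_true] using h1
  have hw0 : c.weight (fun j => r (Sum.inl j)) = 0 := by
    funext i
    rcases i with i | i
    · have h1 := hphi i (Complex.imCLM ∘L ContinuousLinearMap.mul ℝ ℂ (conj (c.phi x i)))
      simp only [ContinuousLinearMap.coe_comp, Function.comp_apply,
        ContinuousLinearMap.mul_apply', Complex.imCLM_apply, hnorm3, c.norm_phi] at h1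
      simpa using h1
    · have h1 := hz i (Complex.imCLM ∘L ContinuousLinearMap.mul ℝ ℂ (conj (c.z x i)))
      simp only [ContinuousLinearMap.coe_comp, Function.comp_apply,
        ContinuousLinearMap.mul_apply', Complex.imCLM_apply, hnorm3, hnorm2, mul_zero,
        add_zero] at h1
      simpa [hz0 i] using h1
  funext κ
  rcases κ with j | i | j
  · exact congrFun (c.weight_injective (hw0.trans (map_zero c.weight).symm)) j
  · have h1 := hz i (Complex.reCLM ∘L ContinuousLinearMap.mul ℝ ℂ (conj (c.z x i)))
    simp only [ContinuousLinearMap.coe_comp, Function.comp_apply,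
      ContinuousLinearMap.mul_apply', Complex.reCLM_apply, hnorm, hnorm', mul_zero,
      zero_add] at h1
    simpa [hz0 i] using h1
  · exact hy j

omit [SmoothTorusAction k n M] in
theorem continuous_cut : Continuous (c.cut C) := by
  have h := (c.cutFn C).contMDiff.continuous
  have e : (c.cutFn C : M → ℝ) = c.cut C := funext fun x => c.cutFn_apply C x
  rwa [e] at h

omit [SmoothTorusAction k n M] in
/-- Two continuous functions agreeing at free points agree on the domain of the chart. -/
theorem eq_zero_of_isFreePoint {f : M → ℝ} (hf : Continuous f)
    (h : ∀ x, c.cut C x ≠ 0 → IsFreePoint k x → f x = 0) {x : M} (hx : c.cut C x ≠ 0) :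
    f x = 0 := by
  by_contra hne
  obtain ⟨x', ⟨h1, h2⟩, h3⟩ := c.mem_closure_isFreePoint (c.mem_of_cut_ne_zero hx).1
    ((hf.continuousAt.eventually_ne hne).and (c.continuous_cut.continuousAt.eventually_ne hx))
  exact h1 (h x' h2 h3)

/-- At non-free points some of the fields vanish as vector fields, so coefficients cannot be
recovered pointwise there; continuous coefficients are nevertheless determined by their values at
free points. -/
theorem eq_zero_of_sum_basis {f : c.Idx → M → ℝ} (hf : ∀ κ, Continuous (f κ))
    (h : ∀ g x, c.cut C x ≠ 0 → ∑ κ, f κ x * (c.basis C hM κ).1 g x = 0) {x : M}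
    (hx : c.cut C x ≠ 0) (κ : c.Idx) : f κ x = 0 :=
  c.eq_zero_of_isFreePoint (hf κ) (fun x hx hfree =>
    congrFun (c.eq_zero_of_sum_basis_at hM hx hfree fun g => h g x hx) κ) hx

variable (C) [IsManifold (𝓡 n) ∞ M]

omit [SmoothTorusAction k n M] [T2Space M] [IsManifold (𝓡 n) ∞ M] in
include hM in
theorem nonempty_localParam (x : M) : Nonempty (LocalParam (𝓡 n) x) := by
  obtain ⟨c, hc⟩ := hM x
  exact ⟨c.localParam hc⟩

theorem exists_coeff_section (X : ellipticTangent k n M) :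
    ∃ f : c.Idx → SmoothFn n M, c.cutFn C • X = ∑ κ, f κ • c.basis C hM κ := by
  -- The decomposition on a product is applied with M itself as an auxiliary second factor and then
  -- restricted to the diagonal.
  obtain ⟨b, a, h⟩ := c.exists_coeff C (nonempty_localParam hM) hM
    (Y := pullFst.toLinearMap ∘ₗ X.1.toLinearMap) (n' := n) (M' := M)
    (fun f g => by
      change pullFst (X.1 (f * g)) = pullFst f * pullFst (X.1 g) + pullFst g * pullFst (X.1 f)
      rw [X.1.leibniz, map_add, smul_eq_mul, smul_eq_mul, map_mul, map_mul])
    (fun f hf => Ideal.mem_map_of_mem _ (X.2 _ rfl f hf))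
  set diag : ProdSmoothFn n n M M →ₐ[ℝ] SmoothFn n M :=
    pullback (fun x => (x, x)) (contMDiff_id.prodMk contMDiff_id)
  refine ⟨Sum.elim (fun j => diag (b j)) fun i => diag (a i), ellipticTangent_ext fun g x => ?_⟩
  rw [sum_smul_apply, Fintype.sum_sum_type]
  change c.cutFn C x * X.1 g x = _
  rw [cutFn_apply]
  exact h g (x, x)

theorem exists_coeff_section_apply (X : ellipticTangent k n M) :
    ∃ f : c.Idx → SmoothFn n M, ∀ g x,
      ∑ κ, f κ x * (c.basis C hM κ).1 g x = c.cut C x * X.1 g x := by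
  obtain ⟨f, hf⟩ := c.exists_coeff_section C hM X
  refine ⟨f, fun g x => ?_⟩
  rw [← sum_smul_apply, ← hf, ← cutFn_apply]
  rfl

/-- Coefficients in the local frame of a chart, determined on the support of the cut-off. -/
def preCoeff (X : ellipticTangent k n M) : c.Idx → SmoothFn n M :=
  (c.exists_coeff_section_apply C hM X).choose

theorem sum_preCoeff (X : ellipticTangent k n M) (g : SmoothFn n M) (x : M) :
    ∑ κ, c.preCoeff C hM X κ x * (c.basis C hM κ).1 g x = c.cut C x * X.1 g x :=
  (c.exists_coeff_section_apply C hM X).choose_spec g x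

theorem preCoeff_apply {X : ellipticTangent k n M} {f : c.Idx → M → ℝ}
    (hf : ∀ κ, Continuous (f κ))
    (h : ∀ g x, c.cut C x ≠ 0 → ∑ κ, f κ x * (c.basis C hM κ).1 g x = c.cut C x * X.1 g x) {x : M}
    (hx : c.cut C x ≠ 0) (κ : c.Idx) : c.preCoeff C hM X κ x = f κ x := by
  refine sub_eq_zero.1 (c.eq_zero_of_sum_basis hM (f := fun κ x => c.preCoeff C hM X κ x - f κ x)
    (fun κ => (c.preCoeff C hM X κ).contMDiff.continuous.sub (hf κ)) (fun u x hx => ?_) hx κ)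
  simp only [sub_mul, Finset.sum_sub_distrib]
  rw [sum_preCoeff, h u x hx, sub_self]

/-- The coefficients in the local frame of a chart. -/
def coeff (κ : c.Idx) : ellipticTangent k n M →ₗ[SmoothFn n M] SmoothFn n M where
  -- `preCoeff` is a choice, unspecified where the cut-off vanishes. The extra factor removes the
  -- ambiguity and makes the coefficient linear; it is the reason for the square of the cut-off in
  -- `sum_coeff_smul`.
  toFun X := c.cutFn C * c.preCoeff C hM X κ
  map_add' X Y := by
    ext x
    change c.cutFn C x * _ = c.cutFn C x * _ + c.cutFn C x * _
    rw [cutFn_apply]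
    by_cases hx : c.cut C x = 0
    · simp [hx]
    rw [c.preCoeff_apply C hM (f := fun κ x => c.preCoeff C hM X κ x + c.preCoeff C hM Y κ x)
      (fun κ => (c.preCoeff C hM X κ).contMDiff.continuous.add
        (c.preCoeff C hM Y κ).contMDiff.continuous) (fun u x _ => ?_) hx κ, mul_add]
    simp only [add_mul, Finset.sum_add_distrib, sum_preCoeff]
    exact (mul_add _ _ _).symm
  map_smul' a X := by
    ext x
    change c.cutFn C x * _ = a x * (c.cutFn C x * _)
    rw [cutFn_apply]
    by_cases hx : c.cut C x = 0
    · simp [hx]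
    rw [c.preCoeff_apply C hM (f := fun κ x => a x * c.preCoeff C hM X κ x)
      (fun κ => a.contMDiff.continuous.mul (c.preCoeff C hM X κ).contMDiff.continuous)
      (fun u x _ => ?_) hx κ, mul_left_comm]
    simp only [mul_assoc, ← Finset.mul_sum, sum_preCoeff]
    exact mul_left_comm _ _ _

theorem coeff_apply (κ : c.Idx) (X : ellipticTangent k n M) (x : M) :
    c.coeff C hM κ X x = c.cut C x * c.preCoeff C hM X κ x := by
  rw [← cutFn_apply]; rfl

theorem sum_coeff_smul (X : ellipticTangent k n M) :
    ∑ κ, c.coeff C hM κ X • c.basis C hM κ = (c.cutFn C * c.cutFn C) • X := by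
  refine ellipticTangent_ext fun g x => ?_
  rw [sum_smul_apply]
  simp only [coeff_apply, mul_assoc, ← Finset.mul_sum, sum_preCoeff]
  rw [← mul_assoc, ← cutFn_apply]
  rfl

theorem coeff_basis (κ κ' : c.Idx) :
    c.coeff C hM κ (c.basis C hM κ') = if κ = κ' then c.cutFn C * c.cutFn C else 0 := by
  ext x
  have h0 : (if κ = κ' then c.cutFn C * c.cutFn C else 0 : SmoothFn n M) x =
      c.cut C x * (if κ' = κ then c.cut C x else 0) := by
    by_cases h : κ = κ'
    · simp [h]
    · simp [h, Ne.symm h]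
  rw [h0, coeff_apply]
  by_cases hx : c.cut C x = 0
  · simp [hx]
  rw [c.preCoeff_apply C hM (f := fun κ x => if κ' = κ then c.cut C x else 0)
    (fun κ => by
      split_ifs
      · exact c.continuous_cut
      · exact continuous_const) (fun u x _ => ?_) hx κ]
  simp only [ite_mul, zero_mul, Finset.sum_ite_eq, Finset.mem_univ, if_true]

/-- Coefficients are determined where the cut-off function does not vanish. -/
theorem cutFn_mul_eq_coeff {s : SmoothFn n M} {X : ellipticTangent k n M}
    {f : c.Idx → SmoothFn n M} (h : s • X = ∑ κ, f κ • c.basis C hM κ) (κ : c.Idx) :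
    s * c.coeff C hM κ X = c.cutFn C * c.cutFn C * f κ := by
  have h1 := congrArg (c.coeff C hM κ) h
  rw [_root_.map_smul, _root_.map_sum, smul_eq_mul] at h1
  rw [h1]
  simp only [_root_.map_smul, coeff_basis, smul_eq_mul, mul_ite, mul_zero, Finset.sum_ite_eq,
    Finset.mem_univ, if_true]
  ring

/-- The frame and the cut-off are invariant, so translated coefficients decompose the translated
section, and coefficients are unique. -/
theorem coeff_translate {t : Torus k} {X' X : ellipticTangent k n M} (h : IsTranslate t X' X)
    (κ : c.Idx) : c.coeff C hM κ X' = translate t (c.coeff C hM κ X) := by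
  ext x
  change c.coeff C hM κ X' x = c.coeff C hM κ X (t • x)
  rw [coeff_apply, coeff_apply, cut_smul]
  by_cases hx : c.cut C x = 0
  · simp [hx]
  rw [c.preCoeff_apply C hM (f := fun κ x => c.preCoeff C hM X κ (t • x))
    (fun κ => (c.preCoeff C hM X κ).contMDiff.continuous.comp
      (contMDiff_torus_smul (n := n) t).continuous) (fun u x _ => ?_) hx κ]
  obtain ⟨u, rfl⟩ : ∃ u', u = translate t u' := by
    refine ⟨translate t⁻¹ u, ?_⟩
    ext x
    change u x = u (t⁻¹ • t • x)
    rw [inv_smul_smul]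
  have h2 : ∀ κ, (c.basis C hM κ).1 (translate t u) x = (c.basis C hM κ).1 u (t • x) :=
    fun κ => congrArg (fun F : SmoothFn n M => F x) (c.basis_invariant C hM κ t u)
  simp only [h2]
  rw [sum_preCoeff, h u, cut_smul]
  rfl

/-! ### Test functions -/

variable {B : Type*} [TopologicalSpace B] {CB : Subalgebra ℝ (B → ℝ)} {π : M → B}
  (hπ : IsStandardQuotient k n CB π)

omit [T2Space M] [IsManifold (𝓡 n) ∞ M] in
theorem _root_.EllipticTDuality.exists_basePullback_eq (g : SmoothFn n M)
    (hg : ∀ (t : Torus k) (x : M), g (t • x) = g x) : ∃ f : CB, basePullback hπ f = g :=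
  exists_descend hπ g fun t => by ext x; exact hg t x

/-- The squares of the radii and the real coordinates of a chart. -/
def quotCoord (x : M) (i : Fin c.l ⊕ Fin c.m) : ℝ :=
  Sum.elim (fun i => ‖c.z x i‖ ^ 2) (c.y x) i

omit [T2Space M] [IsManifold (𝓡 n) ∞ M] [SmoothTorusAction k n M] in
theorem contMDiffOn_quotCoord (i : Fin c.l ⊕ Fin c.m) :
    ContMDiffOn (𝓡 n) 𝓘(ℝ, ℝ) ∞ (fun x => c.quotCoord x i) c.chart.source := by
  rcases i with i | j
  · exact contDiff_norm_sq_complex.contMDiff.comp_contMDiffOn (c.contMDiffOn_z_apply i)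
  · exact c.contMDiffOn_y_apply j

omit [IsManifold (𝓡 n) ∞ M] in
theorem exists_testFn (i : Fin c.l ⊕ Fin c.m) : ∃ f : CB,
    basePullback hπ f = c.cutMul (C + 1 + 1) _ (c.contMDiffOn_quotCoord i) := by
  refine exists_basePullback_eq hπ _ fun t x => ?_
  rw [cutMul_apply, cutMul_apply, cut_smul]
  by_cases hx : x ∈ c.chart.source
  · congr 1
    rcases i with i | j
    · exact congrArg (· ^ 2) (c.norm_z_smul t hx i)
    · exact congrFun (c.y_smul t hx) j
  · rw [c.cut_of_notMem _ hx, zero_mul, zero_mul]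

/-- The coordinate functions of the quotient, multiplied by a cut-off function. -/
def testFn (i : Fin c.l ⊕ Fin c.m) : CB := (c.exists_testFn C hπ i).choose

omit [IsManifold (𝓡 n) ∞ M] in
theorem testFn_apply (i : Fin c.l ⊕ Fin c.m) (x : M) :
    (c.testFn C hπ i).1 (π x) = c.cut (C + 1 + 1) x * c.quotCoord x i :=
  congrArg (fun F : SmoothFn n M => F x) (c.exists_testFn C hπ i).choose_spec

omit [IsManifold (𝓡 n) ∞ M] [SmoothTorusAction k n M] in
theorem frame_apply (i : Fin c.l ⊕ Fin c.m) (g : SmoothFn n M) (x : M) (i' : Fin c.l ⊕ Fin c.m)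
    (hg : ∀ᶠ x' in 𝓝 x, g x' = c.quotCoord x' i') : (c.frame C i).1 g x =
      if i = i' then c.cut (C + 1) x * Sum.elim (fun i => 2 * ‖c.z x i‖ ^ 2) (fun _ => 1) i
      else 0 := by
  have h1 : ∀ (η β), (c.shiftField η β (C + 1)).1 g x = c.cut (C + 1) x *
      Sum.elim (fun i => 2 * η i * ‖c.z x i‖ ^ 2) β i' := by
    intro η β
    refine c.shiftField_apply_of_eventually η β hg fun _ => ?_
    rcases i' with i' | j'
    · simp only [quotCoord, Sum.elim_inl, z_shift, norm_mul, mul_pow, Complex.norm_real,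
        Real.norm_eq_abs, sq_abs]
      have h2 := ((((hasDerivAt_id (0 : ℝ)).mul_const (η i')).const_add 1).pow 2).mul_const
        (‖c.z x i'‖ ^ 2)
      simpa using h2
    · simp only [quotCoord, Sum.elim_inr, y_shift]
      simpa using ((hasDerivAt_id (0 : ℝ)).mul_const (β j')).const_add (c.y x j')
  rcases i with i | j
  · refine (h1 _ _).trans ?_
    rcases i' with i' | j'
    · by_cases h : i = i'
      · subst h; simp
      · simp [h, Ne.symm h]
    · simp
  · refine (h1 _ _).trans ?_
    rcases i' with i' | j'
    · simp
    · by_cases h : j = j'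
      · subst h; simp
      · simp [h, Ne.symm h]

omit [IsManifold (𝓡 n) ∞ M] in
-- The test functions carry the cut-off C + 2, which is one wherever the fields are non-zero, so it
-- is not differentiated. The diagonal factor 2|z_i|² vanishes only at non-free points, which lets
-- these functions detect the coefficients of the frame.
theorem frame_testFn (i i' : Fin c.l ⊕ Fin c.m) (x : M) :
    (c.frame C i).1 (basePullback hπ (c.testFn C hπ i')) x =
      if i = i' then c.cut (C + 1) x * Sum.elim (fun i => 2 * ‖c.z x i‖ ^ 2) (fun _ => 1) i
      else 0 := by
  by_cases hx : c.cut (C + 1) x = 0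
  · rw [hx]
    rcases i with i | i <;>
    · refine (c.shiftField_apply _ _ _ _ _).trans ?_
      simp [hx]
  · obtain ⟨h1, h2⟩ := c.mem_of_cut_ne_zero hx
    refine c.frame_apply C i _ x i' ?_
    filter_upwards [c.eventually_cut_eq_one h1 h2] with x' h3
    refine (c.testFn_apply C hπ i' x').trans ?_
    rw [h3, one_mul]

end StandardChart

end Coefficients

/-! ## Derivations on the quotient -/

/-- A zero of a non-negative function is a minimum, hence a critical point. Applied to boundary
defining functions of B, this is tangency to the boundary. -/
theorem IsPointDerivation.eq_zero_of_nonneg {n : ℕ} {M : Type*} [TopologicalSpace M]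
    [ChartedSpace (EuclideanSpace ℝ (Fin n)) M] [T2Space M] [IsManifold (𝓡 n) ∞ M] {x : M}
    {δ : SmoothFn n M →ₗ[ℝ] ℝ} (hδ : IsPointDerivation x δ) (p : LocalParam (𝓡 n) x)
    {g : SmoothFn n M} (h0 : ∀ x', 0 ≤ g x') (hx : g x = 0) : δ g = 0 := by
  set b := Module.finBasis ℝ p.V
  have hb : ∀ v, v = ∑ i, (b.coord i).toContinuousLinearMap v • b i := fun v => (b.sum_repr v).symm
  have hs : ∀ i, ∃ g : SmoothFn n M, ∀ᶠ x' in 𝓝 x, g x' = (b.coord i).toContinuousLinearMap (p.s x') :=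
    fun i => exists_smooth_extension p.isOpen p.mem
      ((b.coord i).toContinuousLinearMap.contDiff.contMDiff.comp_contMDiffOn p.s_smooth)
  choose g' hg' using hs
  have hu : ContDiff ℝ ∞ fun v : p.V => g (p.r v) := by
    rw [← contMDiff_iff_contDiff]; exact g.contMDiff.comp p.r_smooth
  rw [hδ.chain hb hu p.isOpen p.mem p.s_smooth (f := g) (g := g') ?_ hg']
  · have h1 : fderiv ℝ (fun v : p.V => g (p.r v)) (p.s x) = 0 := by
      refine IsLocalMin.fderiv_eq_zero (Eventually.of_forall fun v => ?_)
      simp only [p.r_s x p.mem, hx]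
      exact h0 _
    simp [h1]
  · filter_upwards [p.isOpen.mem_nhds p.mem] with x' hx'
    rw [p.r_s x' hx']

section Quotient

variable {k n n' : ℕ} {M M' : Type*} [TopologicalSpace M]
  [ChartedSpace (EuclideanSpace ℝ (Fin n)) M] [TopologicalSpace M']
  [ChartedSpace (EuclideanSpace ℝ (Fin n')) M'] [MulAction (Torus k) M] [MulAction (Torus k) M']
  [SmoothTorusAction k n M] [SmoothTorusAction k n' M']
  {B : Type*} [TopologicalSpace B] {CB : Subalgebra ℝ (B → ℝ)} {π : M → B} {π' : M' → B}
  (hπ : IsStandardQuotient k n CB π) (hπ' : IsStandardQuotient k n' CB π')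

include hπ in
theorem IsStandardQuotient.isOpenMap : IsOpenMap π := by
  intro U hU
  rw [← hπ.isQuotientMap.isOpen_preimage]
  have h : π ⁻¹' (π '' U) = ⋃ t : Torus k, (fun x => t • x) ⁻¹' U := by
    ext x
    simp only [mem_preimage, mem_image, mem_iUnion]
    constructor
    · rintro ⟨x', hx', h⟩
      obtain ⟨t, ht⟩ := (hπ.eq_iff_orbit x x').1 h.symm
      exact ⟨t, ht ▸ hx'⟩
    · rintro ⟨t, ht⟩
      exact ⟨_, ht, ((hπ.eq_iff_orbit x (t • x)).2 ⟨t, rfl⟩).symm⟩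
  rw [h]
  exact isOpen_iUnion fun t => hU.preimage (contMDiff_torus_smul (n := n) t).continuous

omit [SmoothTorusAction k n M] in
include hπ in
theorem IsStandardQuotient.continuous : Continuous π := hπ.isQuotientMap.continuous

include hπ in
theorem IsStandardQuotient.eventually_nhds {x : M} {P : B → Prop} (h : ∀ᶠ x' in 𝓝 x, P (π x')) :
    ∀ᶠ b in 𝓝 (π x), P b :=
  hπ.isOpenMap.nhds_le x h

omit [SmoothTorusAction k n M] in
include hπ in
theorem IsStandardQuotient.smul_eq (t : Torus k) (x : M) : π (t • x) = π x :=
  ((hπ.eq_iff_orbit x (t • x)).2 ⟨t, rfl⟩).symm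

omit [SmoothTorusAction k n M] in
include hπ in
/-- Free points are dense. -/
theorem IsStandardQuotient.exists_isFreePoint {x : M} {s : Set M} (hs : s ∈ 𝓝 x) :
    ∃ x' ∈ s, IsFreePoint k x' := by
  obtain ⟨c, hc⟩ := hπ.exists_chart x
  exact c.mem_closure_isFreePoint hc hs

omit [SmoothTorusAction k n M] in
@[simp]
theorem basePullback_apply (f : CB) (x : M) : basePullback hπ f x = f.1 (π x) := rfl

variable [T2Space M] [T2Space M']

namespace StandardChart

variable (c : StandardChart k n M)

include hπ in
/-- Logarithmic coordinates of the quotient near a free orbit, and a section in terms of them. -/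
theorem exists_logCoord {x : M} (hx : x ∈ c.chart.source) (hfree : IsFreePoint k x) :
    ∃ (u : Fin c.l ⊕ Fin c.m → CB) (Ψ : (Fin c.l ⊕ Fin c.m → ℝ) → M),
      ContMDiff 𝓘(ℝ, Fin c.l ⊕ Fin c.m → ℝ) (𝓡 n) ∞ Ψ ∧
      (∀ᶠ b in 𝓝 (π x), π (Ψ fun i => (u i).1 b) = b) ∧
      (∀ᶠ x' in 𝓝 x, ∀ i, c.quotCoord x' i =
        Sum.elim (fun i => Real.exp (2 * (u (Sum.inl i)).1 (π x')))
          (fun j => (u (Sum.inr j)).1 (π x')) i) ∧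
      (∀ᶠ x' in 𝓝 x, (∀ i, c.phi x' i = c.phi x i) →
        (∀ i, ∃ r : ℝ, 0 < r ∧ c.z x' i = (r : ℂ) * c.z x i) → Ψ (fun i => (u i).1 (π x')) = x') := by
  have hz0 : ∀ i, c.z x i ≠ 0 := (c.isFreePoint_iff hx).1 hfree
  -- The logarithm is smooth only on the positive reals; a global smooth function agreeing with
  -- log/2 near |z_i(x)|² is enough, and applied to |z_i|² it gives log |z_i|.
  have hlog : ∀ i : Fin c.l, ∃ ℓ : C^∞⟮𝓘(ℝ, ℝ), ℝ; 𝓘(ℝ, ℝ), ℝ⟯,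
      ∀ᶠ r in 𝓝 (‖c.z x i‖ ^ 2), ℓ r = Real.log r / 2 := fun i =>
    exists_smooth_extension isOpen_Ioi (show 0 < ‖c.z x i‖ ^ 2 from by
      have := norm_pos_iff.2 (hz0 i); positivity)
      (ContDiffOn.contMDiffOn ((Real.contDiffOn_log.mono fun r (hr : 0 < r) => hr.ne').div_const 2))
  choose L hL using hlog
  set C := c.normSq x + 1 with hCdef
  have hxC : c.normSq x < C := by linarith
  set v : Fin c.l ⊕ Fin c.m → M → ℝ := Sum.elim (fun i x' => L i (‖c.z x' i‖ ^ 2))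
    (fun j x' => c.y x' j) with hv
  have hvs : ∀ i, ContMDiffOn (𝓡 n) 𝓘(ℝ, ℝ) ∞ (v i) c.chart.source := by
    rintro (i | j)
    · exact (L i).contMDiff.comp_contMDiffOn (c.contMDiffOn_quotCoord (Sum.inl i))
    · exact c.contMDiffOn_y_apply j
  have hu : ∀ i, ∃ u : CB, basePullback hπ u = c.cutMul C (v i) (hvs i) := by
    intro i
    refine exists_basePullback_eq hπ _ fun t x => ?_
    rw [cutMul_apply, cutMul_apply, cut_smul]
    by_cases hx : x ∈ c.chart.source
    · congr 1
      rcases i with i | j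
      · exact congrArg (fun r => L i (r ^ 2)) (c.norm_z_smul t hx i)
      · exact congrFun (c.y_smul t hx) j
    · rw [c.cut_of_notMem _ hx, zero_mul, zero_mul]
  choose u hu using hu
  have huv : ∀ᶠ x' in 𝓝 x, ∀ i, (u i).1 (π x') = v i x' := by
    filter_upwards [c.eventually_cut_eq_one hx hxC] with x' hx' i
    have h1 := congrArg (fun F : SmoothFn n M => F x') (hu i)
    simp only [cutMul_apply, hx', one_mul] at h1
    exact h1
  have hLx : ∀ᶠ x' in 𝓝 x, ∀ i : Fin c.l, L i (‖c.z x' i‖ ^ 2) = Real.log (‖c.z x' i‖ ^ 2) / 2 := by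
    rw [eventually_all]
    intro i
    have h1 : ContinuousAt (fun x' => ‖c.z x' i‖ ^ 2) x :=
      (c.contMDiffOn_quotCoord (Sum.inl i)).continuousOn.continuousAt (c.isOpen_source.mem_nhds hx)
    exact h1.eventually (hL i)
  have hzx : ∀ᶠ x' in 𝓝 x, ∀ i : Fin c.l, c.z x' i ≠ 0 := by
    rw [eventually_all]
    intro i
    exact ((c.contMDiffOn_z_apply i).continuousOn.continuousAt
      (c.isOpen_source.mem_nhds hx)).eventually_ne (hz0 i)
  have hexp : ∀ᶠ x' in 𝓝 x, ∀ i : Fin c.l, Real.exp ((u (Sum.inl i)).1 (π x')) = ‖c.z x' i‖ := by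
    filter_upwards [huv, hLx, hzx] with x' h1 h2 h3 i
    have h4 := norm_pos_iff.2 (h3 i)
    rw [h1, hv]
    simp only [Sum.elim_inl]
    rw [h2, Real.log_pow, Nat.cast_ofNat, mul_div_cancel_left₀ _ two_ne_zero, Real.exp_log h4]
  -- The section keeps the angles of φ and the phases z_i/|z_i| of the base point x, so it inverts
  -- the coordinates on the slice of points with these angles and phases.
  set Ψ : (Fin c.l ⊕ Fin c.m → ℝ) → M := fun w => c.param (c.angle x x,
    fun i => (Real.exp (w (Sum.inl i)) : ℂ) * (c.z x i / ‖c.z x i‖), fun j => w (Sum.inr j)) with hΨ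
  refine ⟨u, Ψ, ?_, ?_, ?_, ?_⟩
  · refine c.contMDiff_param.comp (ContDiff.contMDiff ?_)
    refine contDiff_const.prodMk (ContDiff.prodMk ?_ ?_)
    · rw [contDiff_pi]
      intro i
      exact (Complex.ofRealCLM.contDiff.comp (Real.contDiff_exp.comp
        (contDiff_apply ℝ ℝ (Sum.inl i)))).mul contDiff_const
    · rw [contDiff_pi]
      intro j
      exact contDiff_apply ℝ ℝ (Sum.inr j)
  · refine hπ.eventually_nhds ?_
    filter_upwards [huv, hexp, c.isOpen_source.mem_nhds hx] with x' h1 h2 h3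
    obtain ⟨t, ht⟩ := c.exists_smul_eq (c.param_mem (c.angle x x,
      (fun i => (Real.exp ((u (Sum.inl i)).1 (π x')) : ℂ) * (c.z x i / ‖c.z x i‖)),
      fun j => (u (Sum.inr j)).1 (π x'))) h3 (fun i => by
        rw [z_param, norm_mul, norm_div, Complex.norm_real, Complex.norm_real, norm_norm,
          div_self (norm_ne_zero_iff.2 (hz0 i)), mul_one, h2, norm_norm])
      (by
        rw [y_param]
        funext j
        exact h1 (Sum.inr j))
    exact (hπ.eq_iff_orbit _ _).2 ⟨t, ht⟩
  · filter_upwards [huv, hexp] with x' h1 h2 i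
    rcases i with i | j
    · simp only [quotCoord, Sum.elim_inl]
      rw [← h2, sq, ← Real.exp_add, two_mul]
    · exact (h1 (Sum.inr j)).symm
  · filter_upwards [huv, hexp, c.isOpen_source.mem_nhds hx] with x' h1 h2 h3 h4 h5
    refine c.ext_of_mem (c.param_mem _) h3 (fun i => ?_) (fun i => ?_) ?_
    · rw [h4, hΨ, c.phi_param]
      conv_rhs => rw [← c.param_angle x hx]
      rw [c.phi_param]
    · rw [hΨ, z_param]
      obtain ⟨r, hr, hr'⟩ := h5 i
      simp only
      rw [h2, hr', norm_mul, Complex.norm_real, Real.norm_of_nonneg hr.le]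
      have := norm_ne_zero_iff.2 (hz0 i)
      have h6 : (‖c.z x i‖ : ℂ) ≠ 0 := by exact_mod_cast this
      push_cast
      field_simp
    · rw [hΨ, y_param]
      funext j
      exact h1 (Sum.inr j)

variable [IsManifold (𝓡 n) ∞ M] [IsManifold (𝓡 n') ∞ M']

omit [SmoothTorusAction k n M] [SmoothTorusAction k n' M'] [T2Space M] [IsManifold (𝓡 n) ∞ M] in
/-- The chain rule for functions on the quotient near a free orbit. -/
theorem chain_base [SmoothTorusAction k n' M'] {u : Fin c.l ⊕ Fin c.m → CB} {x' : M'}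
    {δ' : SmoothFn n' M' →ₗ[ℝ] ℝ} (hδ' : IsPointDerivation x' δ') {U : (Fin c.l ⊕ Fin c.m → ℝ) → ℝ}
    (hU : ContDiff ℝ ∞ U) {f : CB} (hf : ∀ᶠ b in 𝓝 (π' x'), f.1 b = U fun i => (u i).1 b) :
    δ' (basePullback hπ' f) = ∑ i, fderiv ℝ U (fun i => (u i).1 (π' x')) (Pi.single i 1) *
      δ' (basePullback hπ' (u i)) := by
  refine hδ'.chain (ℓ := fun i => ContinuousLinearMap.proj i) (b := fun i => Pi.single i 1)
    (fun v => ?_) hU isOpen_univ (mem_univ x') (G := fun y i => (u i).1 (π' y)) ?_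
    (hπ'.continuous.continuousAt.eventually hf) fun i => Eventually.of_forall fun y => rfl
  · conv_lhs => rw [← Finset.univ_sum_single v]
    refine Finset.sum_congr rfl fun i _ => ?_
    rw [← Pi.single_smul, smul_eq_mul, mul_one]
    rfl
  · rw [contMDiffOn_univ, contMDiff_pi_space]
    exact fun i => (basePullback hπ' (u i)).contMDiff

/-- Point derivations over the same free orbit which agree on the coordinates of the quotient agree
on all functions of the quotient. -/
theorem pointDerivation_transfer {C : ℝ} {x : M} (hC : c.cut C x ≠ 0) (hfree : IsFreePoint k x)
    {δ : SmoothFn n M →ₗ[ℝ] ℝ} (hδ : IsPointDerivation x δ) {x' : M'} (hxx' : π x = π' x')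
    {δ' : SmoothFn n' M' →ₗ[ℝ] ℝ} (hδ' : IsPointDerivation x' δ')
    (h : ∀ i, δ (basePullback hπ (c.testFn C hπ i)) = δ' (basePullback hπ' (c.testFn C hπ i)))
    (f : CB) : δ (basePullback hπ f) = δ' (basePullback hπ' f) := by
  obtain ⟨hx, hxC⟩ := c.mem_of_cut_ne_zero hC
  have hxC2 : c.normSq x < C + 1 + 1 := by linarith
  obtain ⟨u, Ψ, hΨ, hΨπ, hq, -⟩ := c.exists_logCoord hπ hx hfree
  have htest : ∀ i, ∀ᶠ b in 𝓝 (π x), (c.testFn C hπ i).1 b =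
      Sum.elim (fun i => Real.exp (2 * (u (Sum.inl i)).1 b)) (fun j => (u (Sum.inr j)).1 b) i := by
    intro i
    refine hπ.eventually_nhds ?_
    filter_upwards [hq, c.eventually_cut_eq_one hx hxC2] with x'' h1 h2
    rw [testFn_apply, h2, one_mul, h1]
  -- Near π x the test functions are exp(2u_i) and u_j; the derivative of the exponential is
  -- non-zero, so agreement on test functions passes to the logarithmic coordinates.
  have hui : ∀ i, δ (basePullback hπ (u i)) = δ' (basePullback hπ' (u i)) := by
    rintro (i | j)
    · have hd : ∀ w : Fin c.l ⊕ Fin c.m → ℝ, HasFDerivAt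
          (fun w : Fin c.l ⊕ Fin c.m → ℝ => Real.exp (2 * w (Sum.inl i)))
          (Real.exp (2 * w (Sum.inl i)) • ((2 : ℝ) • (ContinuousLinearMap.proj (Sum.inl i) :
            (Fin c.l ⊕ Fin c.m → ℝ) →L[ℝ] ℝ))) w := fun w =>
        (((ContinuousLinearMap.proj (Sum.inl i) :
            (Fin c.l ⊕ Fin c.m → ℝ) →L[ℝ] ℝ).hasFDerivAt).const_mul (2 : ℝ)).exp
      have hU : ContDiff ℝ ∞ fun w : Fin c.l ⊕ Fin c.m → ℝ => Real.exp (2 * w (Sum.inl i)) :=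
        Real.contDiff_exp.comp (contDiff_const.mul (contDiff_apply ℝ ℝ (Sum.inl i)))
      have h1 := c.chain_base hπ hδ hU (u := u) (htest (Sum.inl i))
      have h2 := c.chain_base hπ' hδ' hU (u := u) (f := c.testFn C hπ (Sum.inl i))
        (by rw [← hxx']; exact htest (Sum.inl i))
      have h3 := h (Sum.inl i)
      rw [h1, h2, ← hxx'] at h3
      simp only [(hd _).fderiv, smul_apply,
        ContinuousLinearMap.proj_apply, Pi.single_apply, smul_eq_mul, mul_ite, mul_one, mul_zero,
        ite_mul, zero_mul, Finset.sum_ite_eq, Finset.mem_univ, if_true] at h3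
      refine mul_left_cancel₀ ?_ h3
      positivity
    · have h1 : δ (basePullback hπ (u (Sum.inr j))) =
          δ (basePullback hπ (c.testFn C hπ (Sum.inr j))) := hδ.congr
        (hπ.continuous.continuousAt.eventually ((htest (Sum.inr j)).mono fun b hb => hb.symm))
      have h2 : δ' (basePullback hπ' (u (Sum.inr j))) =
          δ' (basePullback hπ' (c.testFn C hπ (Sum.inr j))) := hδ'.congr
        (hπ'.continuous.continuousAt.eventually (by
          rw [← hxx']; exact ((htest (Sum.inr j)).mono fun b hb => hb.symm)))
      rw [h1, h2, h]
  have hU : ContDiff ℝ ∞ fun w => f.1 (π (Ψ w)) := by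
    rw [← contMDiff_iff_contDiff]
    exact (basePullback hπ f).contMDiff.comp hΨ
  have hf : ∀ᶠ b in 𝓝 (π x), f.1 b = f.1 (π (Ψ fun i => (u i).1 b)) :=
    hΨπ.mono fun b hb => by rw [hb]
  rw [c.chain_base hπ hδ hU hf, c.chain_base hπ' hδ' hU (by rw [← hxx']; exact hf), ← hxx']
  simp only [hui]

/-! ### Lifting derivations of the quotient -/

/-- A derivation of the functions on the quotient which is the anchor of a section over another
manifold is a combination of the fields of a chart, after multiplication by a cut-off function. -/
theorem exists_lift (C : ℝ) {X' : ellipticTangent k n' M'} {D : CB → CB}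
    (hD : ∀ f, basePullback hπ' (D f) = X'.1 (basePullback hπ' f)) :
    ∃ h : Fin c.l ⊕ Fin c.m → CB, ∀ (f : CB) (x : M), c.cut C x * (D f).1 (π x) =
      ∑ i, (h i).1 (π x) * (c.frame C i).1 (basePullback hπ f) x := by
  have hDx : ∀ (f : CB) (x' : M'), (D f).1 (π' x') = X'.1 (basePullback hπ' f) x' := fun f x' =>
    congrArg (fun F : SmoothFn n' M' => F x') (hD f)
  -- This uses that D is induced by a vector field on M': the pull-back of f has a minimum at each
  -- point over b.
  have hpos : ∀ (f : CB) (b : B), (∀ b, 0 ≤ f.1 b) → f.1 b = 0 → (D f).1 b = 0 := by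
    intro f b h0 hb
    obtain ⟨x', rfl⟩ := hπ'.isQuotientMap.surjective b
    obtain ⟨p⟩ := nonempty_localParam hπ'.exists_chart x'
    rw [hDx]
    exact (isPointDerivation_eval x' X'.1).eq_zero_of_nonneg p (g := basePullback hπ' f)
      (fun _ => h0 _) hb
  set G : Fin c.l ⊕ Fin c.m → SmoothFn n M := fun i =>
    c.cutFn C * basePullback hπ (D (c.testFn C hπ i)) with hG
  have hGinv : ∀ i (t : Torus k) (x : M), G i (t • x) = G i x := by
    intro i t x
    change c.cutFn C (t • x) * (D (c.testFn C hπ i)).1 (π (t • x)) = c.cutFn C x * _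
    rw [hπ.smul_eq, cutFn_apply, cutFn_apply, cut_smul]
    rfl
  have hGapp : ∀ i x, G i x = c.cut C x * (D (c.testFn C hπ i)).1 (π x) := by
    intro i x
    change c.cutFn C x * _ = _
    rw [cutFn_apply]
    rfl
  -- D of the test function |z_i|² vanishes on z_i = 0 by `hpos`, and it is invariant, so it is a
  -- multiple of |z_i|² with a smooth radial quotient.
  have hrad : ∀ i : Fin c.l, ∃ g, IsRadial g ∧ ∀ z e, c.radial (G (Sum.inl i)) (z, e) =
      ‖z i‖ ^ 2 * g (z, e) := by
    intro i
    have h1 := c.isRadial (G (Sum.inl i)).contMDiff.contMDiffOn fun t x _ => hGinv _ t x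
    obtain ⟨g, hg, hg'⟩ := h1.exists_eq_norm_sq_mul (i := i) fun z e hz => by
      rw [radial, hGapp, hpos, mul_zero]
      · intro b
        obtain ⟨x, rfl⟩ := hπ.isQuotientMap.surjective b
        rw [testFn_apply]
        exact mul_nonneg (c.cut_nonneg _ _) (by simp only [quotCoord, Sum.elim_inl]; positivity)
      · rw [testFn_apply]
        simp [quotCoord, hz]
    exact ⟨g, hg, hg'⟩
  choose r hr hGr using hrad
  -- The quotient is halved because the radial field sends |z_i|² to 2|z_i|².
  have hh : ∀ i, ∃ h : CB, ∀ x, h.1 (π x) = Sum.elim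
      (fun i => c.cut (C + 1) x * (r i (c.z x, c.y x) / 2)) (fun j => G (Sum.inr j) x) i := by
    rintro (i | j)
    · obtain ⟨h, hh⟩ := exists_basePullback_eq hπ (c.cutMul (C + 1)
        (fun x => r i (c.z x, c.y x) / 2) ((c.contMDiffOn_of_radial (hr i).contDiff).div_const 2))
        (fun t x => by
          rw [cutMul_apply, cutMul_apply, cut_smul]
          by_cases hx : x ∈ c.chart.source
          · rw [(hr i).eq_norm, (hr i).eq_norm (c.z x), c.y_smul t hx]
            simp only [c.norm_z_smul t hx]
          · rw [c.cut_of_notMem _ hx, zero_mul, zero_mul])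
      exact ⟨h, fun x => congrArg (fun F : SmoothFn n M => F x) hh⟩
    · obtain ⟨h, hh⟩ := exists_basePullback_eq hπ (G (Sum.inr j)) (hGinv _)
      exact ⟨h, fun x => congrArg (fun F : SmoothFn n M => F x) hh⟩
  choose h hh using hh
  have hGz : ∀ (i : Fin c.l) x, x ∈ c.chart.source →
      G (Sum.inl i) x = ‖c.z x i‖ ^ 2 * r i (c.z x, c.y x) := by
    intro i x hx
    rw [c.eq_radial (fun t x _ => hGinv (Sum.inl i) t x) hx, hGr]
  refine ⟨h, fun f x => ?_⟩
  have hcont : Continuous fun x => c.cut C x * (D f).1 (π x) -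
      ∑ i, (h i).1 (π x) * (c.frame C i).1 (basePullback hπ f) x :=
    (c.continuous_cut.mul (basePullback hπ (D f)).contMDiff.continuous).sub
      (continuous_finsetSum _ fun i _ => (basePullback hπ (h i)).contMDiff.continuous.mul
        ((c.frame C i).1 (basePullback hπ f)).contMDiff.continuous)
  rw [← sub_eq_zero]
  by_contra hne
  obtain ⟨x₁, hx₁, hfree⟩ := hπ.exists_isFreePoint (hcont.continuousAt.eventually_ne hne)
  apply hx₁
  by_cases hC1 : c.cut (C + 1) x₁ = 0
  · have h1 : ∀ i, (c.frame C i).1 (basePullback hπ f) x₁ = 0 := by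
      rintro (i | i) <;> exact mul_eq_zero_of_left hC1 _
    have h2 : c.cut C x₁ = 0 := by
      by_contra h3
      obtain ⟨h4, h5⟩ := c.mem_of_cut_ne_zero h3
      rw [c.cut_eq_one h4 h5.le] at hC1
      exact one_ne_zero hC1
    simp [h1, h2]
  obtain ⟨hxs, -⟩ := c.mem_of_cut_ne_zero hC1
  have hz0 := (c.isFreePoint_iff hxs).1 hfree
  by_cases hC : c.cut C x₁ = 0
  -- Off the support of the cut-off the radial coefficients vanish too: at a free point |z_i|² ≠ 0
  -- can be cancelled from G = 0.
  · have h1 : ∀ i, (h i).1 (π x₁) = 0 := by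
      rintro (i | j)
      · rw [hh]
        have h2 := hGz i x₁ hxs
        rw [hGapp, hC, zero_mul] at h2
        have h3 := (mul_eq_zero.1 h2.symm).resolve_left (pow_ne_zero 2 (norm_ne_zero_iff.2 (hz0 i)))
        simp [h3]
      · rw [hh]
        simp [hGapp, hC]
    simp [h1, hC]
  obtain ⟨x', hx'⟩ := hπ'.isQuotientMap.surjective (π x₁)
  have hxC := (c.mem_of_cut_ne_zero hC).2
  have hcut1 : c.cut (C + 1) x₁ = 1 := c.cut_eq_one hxs hxC.le
  have hδ' : IsPointDerivation x' (c.cut C x₁ • evalDerivation x' X'.1.toLinearMap) := by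
    intro f g
    have := isPointDerivation_eval x' X'.1 f g
    rw [LinearMap.smul_apply, this]
    simp only [LinearMap.smul_apply, smul_eq_mul]
    ring
  have hδ : IsPointDerivation x₁
      (∑ i, (h i).1 (π x₁) • evalDerivation x₁ (c.frame C i).1.toLinearMap) := by
    intro f g
    simp only [LinearMap.sum_apply, LinearMap.smul_apply, smul_eq_mul, Finset.mul_sum,
      ← Finset.sum_add_distrib]
    refine Finset.sum_congr rfl fun i _ => ?_
    rw [isPointDerivation_eval x₁ (c.frame C i).1 f g]
    ring
  have key := c.pointDerivation_transfer hπ hπ' hC hfree hδ hx'.symm hδ' (fun i => ?_) f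
  · simp only [LinearMap.sum_apply, LinearMap.smul_apply, smul_eq_mul] at key
    change ∑ i, (h i).1 (π x₁) * (c.frame C i).1 (basePullback hπ f) x₁ =
      c.cut C x₁ * X'.1 (basePullback hπ' f) x' at key
    rw [key, ← hDx, hx', sub_self]
  · simp only [LinearMap.sum_apply, LinearMap.smul_apply, smul_eq_mul]
    change ∑ i', (h i').1 (π x₁) * (c.frame C i').1 (basePullback hπ (c.testFn C hπ i)) x₁ =
      c.cut C x₁ * X'.1 (basePullback hπ' (c.testFn C hπ i)) x'
    rw [← hDx, hx', ← hGapp]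
    simp only [frame_testFn, mul_ite, mul_zero, Finset.sum_ite_eq', Finset.mem_univ, if_true, hh,
      hcut1, one_mul]
    rcases i with i | j
    · simp only [Sum.elim_inl]
      rw [hGz i x₁ hxs]
      ring
    · simp

end StandardChart

end Quotient

/-! ## Vector fields on the product -/

theorem derivation_mem_map {A P : Type*} [CommRing A] [Algebra ℝ A] [CommRing P] [Algebra ℝ P]
    {I : Ideal A} {p : A →ₐ[ℝ] P} {D : Derivation ℝ P P} (h : ∀ f ∈ I, D (p f) ∈ I.map p) :
    ∀ f ∈ I.map p, D f ∈ I.map p := by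
  intro f hf
  refine Submodule.span_induction (p := fun f _ => D f ∈ I.map p) ?_ ?_ ?_ ?_ hf
  · rintro _ ⟨g, hg, rfl⟩
    exact h g hg
  · rw [map_zero]; exact Ideal.zero_mem _
  · intro f g _ _ hf hg
    rw [map_add]; exact Ideal.add_mem _ hf hg
  · intro a f hf' hf
    rw [smul_eq_mul, D.leibniz, smul_eq_mul, smul_eq_mul]
    exact Ideal.add_mem _ (Ideal.mul_mem_left _ _ hf) (Ideal.mul_mem_right _ _ hf')

section Box

variable {k n n' : ℕ} {M M' : Type*} [TopologicalSpace M]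
  [ChartedSpace (EuclideanSpace ℝ (Fin n)) M] [TopologicalSpace M']
  [ChartedSpace (EuclideanSpace ℝ (Fin n')) M']
  [T2Space M] [IsManifold (𝓡 n) ∞ M] [T2Space M'] [IsManifold (𝓡 n') ∞ M']
  (hM : ∀ x : M, Nonempty (LocalParam (𝓡 n) x)) (hM' : ∀ y : M', Nonempty (LocalParam (𝓡 n') y))

/-- The vector field `(X, 0)` on `M × M'`. -/
def boxFst (X : Derivation ℝ (SmoothFn n M) (SmoothFn n M)) :
    Derivation ℝ (ProdSmoothFn n n' M M') (ProdSmoothFn n n' M M') :=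
  Derivation.mk'
    { toFun := fun f => ⟨fun q => X (restrictFst q.2 f) q.1, contMDiff_derivation_slice hM hM' X f⟩
      map_add' := fun f g => by
        ext q
        change X (restrictFst q.2 (f + g)) q.1 = X (restrictFst q.2 f) q.1 + X (restrictFst q.2 g) q.1
        rw [map_add, map_add]
        rfl
      map_smul' := fun a f => by
        ext q
        change X (restrictFst q.2 (a • f)) q.1 = a * X (restrictFst q.2 f) q.1
        rw [map_smul, X.map_smul]
        rfl }
    (fun f g => by
      ext q
      change X (restrictFst q.2 (f * g)) q.1 =
        f q * X (restrictFst q.2 g) q.1 + g q * X (restrictFst q.2 f) q.1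
      rw [map_mul, X.leibniz]
      rfl)

/-- The exchange of the factors. -/
def swapFn : ProdSmoothFn n n' M M' →ₐ[ℝ] ProdSmoothFn n' n M' M :=
  pullback Prod.swap (contMDiff_snd.prodMk contMDiff_fst)

/-- The vector field `(0, X')` on `M × M'`. -/
def boxSnd (X' : Derivation ℝ (SmoothFn n' M') (SmoothFn n' M')) :
    Derivation ℝ (ProdSmoothFn n n' M M') (ProdSmoothFn n n' M M') :=
  Derivation.mk' (swapFn.toLinearMap ∘ₗ (boxFst hM' hM X').toLinearMap ∘ₗ swapFn.toLinearMap)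
    (fun f g => by
      change swapFn (boxFst hM' hM X' (swapFn (f * g))) = _
      rw [map_mul, Derivation.leibniz, map_add]
      rfl)

theorem boxFst_pullSnd (X : Derivation ℝ (SmoothFn n M) (SmoothFn n M)) (f : SmoothFn n' M') :
    boxFst hM hM' X (pullSnd f) = 0 := by
  ext q
  change X (algebraMap ℝ (SmoothFn n M) (f q.2)) q.1 = 0
  rw [X.map_algebraMap]
  rfl

theorem boxSnd_pullFst (X' : Derivation ℝ (SmoothFn n' M') (SmoothFn n' M')) (f : SmoothFn n M) :
    boxSnd hM hM' X' (pullFst f) = 0 := by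
  ext q
  change X' (algebraMap ℝ (SmoothFn n' M') (f q.1)) q.2 = 0
  rw [X'.map_algebraMap]
  rfl

include hM hM' in
/-- A vector field on the product is determined by its values on the functions of each factor. -/
theorem prod_derivation_eq_zero {D : Derivation ℝ (ProdSmoothFn n n' M M') (ProdSmoothFn n n' M M')}
    (h : ∀ f : SmoothFn n M, D (pullFst f) = 0) (h' : ∀ f : SmoothFn n' M', D (pullSnd f) = 0) :
    D = 0 := by
  ext f q
  obtain ⟨x, y⟩ := q
  obtain ⟨p⟩ := hM x
  obtain ⟨p'⟩ := hM' y
  set b := Module.finBasis ℝ p.V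
  set b' := Module.finBasis ℝ p'.V
  have hg : ∀ i, ∃ g : SmoothFn n M, ∀ᶠ x' in 𝓝 x,
      g x' = (b.coord i).toContinuousLinearMap (p.s x') := fun i =>
    exists_smooth_extension p.isOpen p.mem
      ((b.coord i).toContinuousLinearMap.contDiff.contMDiff.comp_contMDiffOn p.s_smooth)
  have hg' : ∀ i, ∃ g : SmoothFn n' M', ∀ᶠ x' in 𝓝 y,
      g x' = (b'.coord i).toContinuousLinearMap (p'.s x') := fun i =>
    exists_smooth_extension p'.isOpen p'.mem
      ((b'.coord i).toContinuousLinearMap.contDiff.contMDiff.comp_contMDiffOn p'.s_smooth)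
  choose g hg using hg
  choose g' hg' using hg'
  have hδ := isPointDerivation_eval (x, y) D
  have hO : IsOpen (p.O ×ˢ p'.O) := p.isOpen.prod p'.isOpen
  have hu : ContDiff ℝ ∞ fun v : p.V × p'.V => f (p.r v.1, p'.r v.2) := by
    rw [← contMDiff_iff_contDiff]
    exact f.contMDiff.comp ((p.r_smooth.comp contDiff_fst.contMDiff).prodMk
      (p'.r_smooth.comp contDiff_snd.contMDiff))
  have hfst : ContMDiff ((𝓡 n).prod (𝓡 n')) (𝓡 n) ∞ (Prod.fst : M × M' → M) := contMDiff_fst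
  have hsnd : ContMDiff ((𝓡 n).prod (𝓡 n')) (𝓡 n') ∞ (Prod.snd : M × M' → M') := contMDiff_snd
  have key := hδ.chain (κ := Fin (Module.finrank ℝ p.V) ⊕ Fin (Module.finrank ℝ p'.V))
    (ℓ := Sum.elim (fun i => (b.coord i).toContinuousLinearMap ∘L .fst ℝ _ _)
      (fun i => (b'.coord i).toContinuousLinearMap ∘L .snd ℝ _ _))
    (b := Sum.elim (fun i => (b i, 0)) (fun i => (0, b' i)))
    (fun v => by
      rw [Fintype.sum_sum_type]
      refine Prod.ext ?_ ?_
      · simp only [Prod.fst_add, Prod.fst_sum, Sum.elim_inl, Sum.elim_inr, Prod.smul_fst, smul_zero,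
          Finset.sum_const_zero, add_zero]
        exact (b.sum_repr v.1).symm
      · simp only [Prod.snd_add, Prod.snd_sum, Sum.elim_inl, Sum.elim_inr, Prod.smul_snd, smul_zero,
          Finset.sum_const_zero, zero_add]
        exact (b'.sum_repr v.2).symm)
    hu hO ⟨p.mem, p'.mem⟩ (G := fun q => (p.s q.1, p'.s q.2))
    ((p.s_smooth.comp hfst.contMDiffOn fun q hq => hq.1).prodMk_space
      (p'.s_smooth.comp hsnd.contMDiffOn fun q hq => hq.2)) (f := f)
    (by
      filter_upwards [hO.mem_nhds ⟨p.mem, p'.mem⟩] with q hq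
      rw [p.r_s _ hq.1, p'.r_s _ hq.2])
    (g := Sum.elim (fun i => pullFst (g i)) (fun i => pullSnd (g' i)))
    (by
      rintro (i | i)
      · exact (continuous_fst.tendsto (x, y)).eventually (hg i)
      · exact (continuous_snd.tendsto (x, y)).eventually (hg' i))
  refine key.trans (Finset.sum_eq_zero fun i _ => ?_)
  rcases i with i | i
  · change _ * D (pullFst (g i)) (x, y) = 0
    rw [h, ContMDiffMap.coe_zero, Pi.zero_apply, mul_zero]
  · change _ * D (pullSnd (g' i)) (x, y) = 0
    rw [h', ContMDiffMap.coe_zero, Pi.zero_apply, mul_zero]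

variable [MulAction (Torus k) M] [MulAction (Torus k) M']

theorem boxFst_mem {X : Derivation ℝ (SmoothFn n M) (SmoothFn n M)}
    (hX : X ∈ ellipticTangent k n M) : boxFst hM hM' X ∈ boxTangent k n n' M M' := by
  intro I hI
  rcases hI with rfl | rfl
  · exact derivation_mem_map fun f hf => Ideal.mem_map_of_mem pullFst (hX _ rfl f hf)
  · exact derivation_mem_map fun f hf => by rw [boxFst_pullSnd]; exact Ideal.zero_mem _

theorem boxSnd_mem {X : Derivation ℝ (SmoothFn n' M') (SmoothFn n' M')}
    (hX : X ∈ ellipticTangent k n' M') : boxSnd hM hM' X ∈ boxTangent k n n' M M' := by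
  intro I hI
  rcases hI with rfl | rfl
  · exact derivation_mem_map fun f hf => by rw [boxSnd_pullFst]; exact Ideal.zero_mem _
  · exact derivation_mem_map fun f hf => Ideal.mem_map_of_mem pullSnd (hX _ rfl f hf)

end Box

/-! ### Pairs of sections with equal anchor and tangency to the correspondence space -/

section Corr

variable {k n n' : ℕ} {M M' : Type*} [TopologicalSpace M]
  [ChartedSpace (EuclideanSpace ℝ (Fin n)) M] [TopologicalSpace M']
  [ChartedSpace (EuclideanSpace ℝ (Fin n')) M'] [MulAction (Torus k) M] [MulAction (Torus k) M']
  {B : Type*} [TopologicalSpace B] {CB : Subalgebra ℝ (B → ℝ)} {π : M → B} {π' : M' → B}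
  (hπ : IsStandardQuotient k n CB π) (hπ' : IsStandardQuotient k n' CB π')

include hπ in
theorem IsStandardQuotient.nonempty_localParam (x : M) : Nonempty (LocalParam (𝓡 n) x) := by
  obtain ⟨c, hc⟩ := hπ.exists_chart x
  exact ⟨c.localParam hc⟩

/-- Sections of the elliptic tangent bundles with the same anchor. -/
def Related (X : ellipticTangent k n M) (X' : ellipticTangent k n' M') : Prop :=
  ∀ (f : CB) (q : Corr π π'), X.1 (basePullback hπ f) q.1.1 = X'.1 (basePullback hπ' f) q.1.2

theorem StandardChart.tendsto_shift (c : StandardChart k n M) (η β) {x : M}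
    (hx : x ∈ c.chart.source) : Tendsto (fun t : ℝ => c.shift η β t x) (𝓝 0) (𝓝 x) := by
  have h1 : Continuous fun t : ℝ => c.shift η β t x := by
    have h2 : ∀ t, c.shift η β t x = c.param (c.angle x x,
        fun i => ((1 + t * η i : ℝ) : ℂ) * c.z x i, fun j => c.y x j + t * β j) := by
      intro t
      conv_lhs => rw [← c.param_angle x hx, c.shift_param]
    simp only [h2]
    refine c.contMDiff_param.continuous.comp (continuous_const.prodMk
      (Continuous.prodMk ?_ ?_)) <;> fun_prop
  have := h1.tendsto 0
  rwa [c.shift_zero η β hx] at this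

variable [T2Space M] [IsManifold (𝓡 n) ∞ M] [T2Space M'] [IsManifold (𝓡 n') ∞ M']
  [SmoothTorusAction k n M] [SmoothTorusAction k n' M']

omit [T2Space M] [IsManifold (𝓡 n) ∞ M] [T2Space M'] [IsManifold (𝓡 n') ∞ M'] in
include hπ hπ' in
/-- Points of the correspondence space over free points of the first factor are dense. -/
theorem exists_corr_isFreePoint (q : Corr π π') {s : Set (M × M')} (hs : s ∈ 𝓝 q.1) :
    ∃ q' : Corr π π', q'.1 ∈ s ∧ IsFreePoint k q'.1.1 := by
  obtain ⟨O, hO, O', hO', hOs⟩ := mem_nhds_prod_iff.1 hs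
  -- As π' is open, every x close to the first component lies under some y close to the second one,
  -- so density of free points in M is enough.
  have h1 : π ⁻¹' (π' '' O') ∈ 𝓝 q.1.1 := by
    refine hπ.continuous.continuousAt ?_
    rw [q.2]
    exact hπ'.isOpenMap.image_mem_nhds hO'
  obtain ⟨x, ⟨hx, ⟨y, hy, hxy⟩⟩, hfree⟩ := hπ.exists_isFreePoint (Filter.inter_mem hO h1)
  exact ⟨⟨(x, y), hxy.symm⟩, hOs ⟨hx, hy⟩, hfree⟩

/-- At a free point, the value of a vector field on a function vanishing on the orbit only depends
on the restriction of the function to a section of the quotient map. -/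
theorem apply_eq_of_section {c : StandardChart k n M} {x : M} (hx : x ∈ c.chart.source)
    (X : ellipticTangent k n M) {u : Fin c.l ⊕ Fin c.m → CB}
    {Ψ : (Fin c.l ⊕ Fin c.m → ℝ) → M}
    (hΨ : ∀ᶠ x' in 𝓝 x, (∀ i, c.phi x' i = c.phi x i) →
        (∀ i, ∃ r : ℝ, 0 < r ∧ c.z x' i = (r : ℂ) * c.z x i) → Ψ (fun i => (u i).1 (π x')) = x')
    {h : SmoothFn n M} (h0 : ∀ t : Torus k, h (t • x) = 0) {H : CB}
    (hH : ∀ b, H.1 b = h (Ψ fun i => (u i).1 b)) :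
    X.1 h x = X.1 (basePullback hπ H) x := by
  set C := c.normSq x with hC
  have hcut : c.cut C x = 1 := c.cut_eq_one hx le_rfl
  -- Expanding X in the frame reduces the claim to the frame fields. The fundamental ones kill both
  -- functions, since h vanishes on the orbit; the others move x along the slice on which Ψ inverts
  -- the coordinates, where the two functions agree.
  have h1 : ∀ g, X.1 g x = ∑ κ, c.coeff C hπ.exists_chart κ X x *
      (c.basis C hπ.exists_chart κ).1 g x := by
    intro g
    rw [← sum_smul_apply, c.sum_coeff_smul C hπ.exists_chart X]
    change _ = (c.cutFn C x * c.cutFn C x) * X.1 g x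
    rw [c.cutFn_apply, hcut]
    ring
  rw [h1, h1]
  refine Finset.sum_congr rfl fun κ _ => ?_
  congr 1
  have hshift : ∀ η β, (c.shiftField η β (C + 1)).1 h x =
      (c.shiftField η β (C + 1)).1 (basePullback hπ H) x := by
    intro η β
    rw [c.shiftField_apply, c.shiftField_apply]
    congr 1
    refine Filter.EventuallyEq.deriv_eq ?_
    have hpos : ∀ᶠ t in 𝓝 (0 : ℝ), ∀ i, 0 < 1 + t * η i := by
      rw [eventually_all]
      intro i
      have : ContinuousAt (fun t : ℝ => 1 + t * η i) 0 := by fun_prop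
      exact this.eventually (lt_mem_nhds (by simp))
    filter_upwards [(c.tendsto_shift η β hx).eventually hΨ, hpos] with t h2 h3
    rw [basePullback_apply, hH, h2 (fun i => c.phi_shift _ _ _ _ _)
      fun i => ⟨_, h3 i, c.z_shift _ _ _ _ _⟩]
  rcases κ with j | i | j
  · change (fundField _ _).1 h x = (fundField _ _).1 (basePullback hπ H) x
    rw [fundField_apply_of_invariant (f := basePullback hπ H) _ _
      fun t x => congrArg H.1 (hπ.smul_eq t x)]
    refine (fundDerivation_apply hπ.exists_chart _ _ _).trans ?_
    simp only [h0, deriv_const]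
    rfl
  · exact hshift _ _
  · exact hshift _ _

/-- The sum of two sections with the same anchor is tangent to the correspondence space. -/
theorem boxSum_apply_eq_zero {X : ellipticTangent k n M} {X' : ellipticTangent k n' M'}
    (hXX' : Related hπ hπ' X X') {f : ProdSmoothFn n n' M M'} (hf : f ∈ corrIdeal n n' π π')
    (q : Corr π π') (hfree : IsFreePoint k q.1.1) :
    X.1 (restrictFst q.1.2 f) q.1.1 + X'.1 (restrictSnd q.1.1 f) q.1.2 = 0 := by
  obtain ⟨⟨x, y⟩, hq⟩ := q
  simp only at hq hfree ⊢
  obtain ⟨c, hx⟩ := hπ.exists_chart x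
  obtain ⟨u, Ψ, hΨ, hΨπ, -, hΨx⟩ := c.exists_logCoord hπ hx hfree
  have hHs : (fun b => f (Ψ (fun i => (u i).1 b), y)) ∈ CB := by
    rw [hπ.mem_iff_smooth]
    refine (restrictFst y f).contMDiff.comp (hΨ.comp ?_)
    rw [contMDiff_pi_space]
    exact fun i => (basePullback hπ (u i)).contMDiff
  set H : CB := ⟨_, hHs⟩ with hH
  -- f(·, y) vanishes on the orbit of x, so the first term depends only on its restriction to the
  -- section Ψ, that is, on H; equality of anchors moves the derivative from M to M'.
  have h1 : X.1 (restrictFst y f) x = X'.1 (basePullback hπ' H) y := by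
    rw [apply_eq_of_section hπ hx X hΨx (h := restrictFst y f) (H := H) (fun t => ?_)
      fun b => rfl]
    · exact hXX' H ⟨(x, y), hq⟩
    · exact hf ⟨(t • x, y), (hπ.smul_eq t x).trans hq⟩
  rw [h1]
  obtain ⟨p⟩ := hπ'.nonempty_localParam y
  have hδ := isPointDerivation_eval y X'.1
  set G : M' → (Fin c.l ⊕ Fin c.m → ℝ) × p.V := fun y' => (fun i => (u i).1 (π' y'), p.s y') with hGdef
  have hG : ContMDiffOn (𝓡 n') 𝓘(ℝ, (Fin c.l ⊕ Fin c.m → ℝ) × p.V) ∞ G p.O := by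
    refine ContMDiffOn.prodMk_space (ContMDiff.contMDiffOn ?_) p.s_smooth
    rw [contMDiff_pi_space]
    exact fun i => (basePullback hπ' (u i)).contMDiff
  set b := Module.finBasis ℝ ((Fin c.l ⊕ Fin c.m → ℝ) × p.V)
  have hb : ∀ v, v = ∑ i, (b.coord i).toContinuousLinearMap v • b i := fun v => (b.sum_repr v).symm
  have hg : ∀ i, ∃ g : SmoothFn n' M', ∀ᶠ x' in 𝓝 y,
      g x' = (b.coord i).toContinuousLinearMap (G x') := fun i =>
    exists_smooth_extension p.isOpen p.mem
      ((b.coord i).toContinuousLinearMap.contDiff.contMDiff.comp_contMDiffOn hG)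
  choose g hg using hg
  set Φ : (Fin c.l ⊕ Fin c.m → ℝ) × p.V → ℝ := fun w => f (Ψ w.1, p.r w.2) with hΦdef
  have hΦ : ContDiff ℝ ∞ Φ := by
    rw [← contMDiff_iff_contDiff]
    exact f.contMDiff.comp ((hΨ.comp contDiff_fst.contMDiff).prodMk
      (p.r_smooth.comp contDiff_snd.contMDiff))
  have hy : (fun i => (u i).1 (π x)) = (G y).1 := by rw [hGdef]; simp only [hq]
  have hΦ1 : ContDiff ℝ ∞ fun w : (Fin c.l ⊕ Fin c.m → ℝ) × p.V => Φ (w.1, (G y).2) :=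
    hΦ.comp (contDiff_fst.prodMk contDiff_const)
  have hΦ2 : ContDiff ℝ ∞ fun w : (Fin c.l ⊕ Fin c.m → ℝ) × p.V => Φ ((G y).1, w.2) :=
    hΦ.comp (contDiff_const.prodMk contDiff_snd)
  have hΨy : Ψ (G y).1 = x := by
    rw [← hy]
    exact hΨx.self_of_nhds (fun _ => rfl) fun i => ⟨1, one_pos, by simp⟩
  -- Both terms are now derivatives along X' in the variable y'. The function f(Ψ(u(π' y')), y') is
  -- zero near y because its argument lies in N; `e0` is its total derivative, `e1` and `e2` are the
  -- contributions of the two arguments.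
  have e0 := hδ.chain hb hΦ p.isOpen p.mem hG (f := 0) (g := g) (by
    filter_upwards [p.isOpen.mem_nhds p.mem, hπ'.continuous.continuousAt.eventually
      (by rw [← hq]; exact hΨπ)] with y' h2 h3
    rw [hΦdef, hGdef]
    simp only [p.r_s y' h2]
    exact (hf ⟨(_, y'), h3⟩).symm) hg
  have e1 := hδ.chain hb hΦ1 p.isOpen p.mem hG (f := basePullback hπ' H) (g := g) (by
    refine Eventually.of_forall fun y' => ?_
    rw [hΦdef, hGdef]
    simp only [p.r_s y p.mem]
    rfl) hg
  have e2 := hδ.chain hb hΦ2 p.isOpen p.mem hG (f := restrictSnd x f) (g := g) (by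
    filter_upwards [p.isOpen.mem_nhds p.mem] with y' h2
    rw [hΦdef]
    simp only [hΨy]
    rw [hGdef]
    simp only [p.r_s y' h2]
    rfl) hg
  have hsum : ∀ v, fderiv ℝ (fun w : (Fin c.l ⊕ Fin c.m → ℝ) × p.V => Φ (w.1, (G y).2)) (G y) v +
      fderiv ℝ (fun w : (Fin c.l ⊕ Fin c.m → ℝ) × p.V => Φ ((G y).1, w.2)) (G y) v = fderiv ℝ Φ (G y) v := by
    intro v
    have hD := (hΦ.differentiable (by simp) (G y)).hasFDerivAt
    have d1 : HasFDerivAt (fun w : (Fin c.l ⊕ Fin c.m → ℝ) × p.V => Φ (w.1, (G y).2)) _ (G y) :=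
      HasFDerivAt.comp (G y) (f := fun w : (Fin c.l ⊕ Fin c.m → ℝ) × p.V => (w.1, (G y).2)) hD
        (hasFDerivAt_fst.prodMk (hasFDerivAt_const _ _))
    have d2 : HasFDerivAt (fun w : (Fin c.l ⊕ Fin c.m → ℝ) × p.V => Φ ((G y).1, w.2)) _ (G y) :=
      HasFDerivAt.comp (G y) (f := fun w : (Fin c.l ⊕ Fin c.m → ℝ) × p.V => ((G y).1, w.2)) hD
        ((hasFDerivAt_const _ _).prodMk hasFDerivAt_snd)
    rw [d1.fderiv, d2.fderiv]
    simp only [ContinuousLinearMap.coe_comp, Function.comp_apply]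
    rw [← map_add]
    congr 1
    simp
  rw [map_zero] at e0
  change evalDerivation y X'.1.toLinearMap _ + evalDerivation y X'.1.toLinearMap _ = 0
  rw [e1, e2, e0, ← Finset.sum_add_distrib]
  refine Finset.sum_congr rfl fun i _ => ?_
  rw [← add_mul, hsum]

/-- The section `(X, X')` of the Lie algebroid on the correspondence space. -/
def boxSum (X : ellipticTangent k n M) (X' : ellipticTangent k n' M')
    (h : Related hπ hπ' X X') : corrTangent k n n' π π' :=
  ⟨boxFst hπ.nonempty_localParam hπ'.nonempty_localParam X.1 +
    boxSnd hπ.nonempty_localParam hπ'.nonempty_localParam X'.1, by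
    have hbox := (boxTangent k n n' M M').add_mem
      (boxFst_mem hπ.nonempty_localParam hπ'.nonempty_localParam X.2)
      (boxSnd_mem hπ.nonempty_localParam hπ'.nonempty_localParam X'.2)
    rintro I (rfl | rfl | rfl)
    · exact hbox _ (by simp)
    · exact hbox _ (by simp)
    · intro f hf q
      -- Tangency to N holds over free points and extends to all of N because they are dense and the
      -- derivative of f is continuous.
      by_contra hne
      obtain ⟨q', h1, h2⟩ := exists_corr_isFreePoint hπ hπ' q (((boxFst hπ.nonempty_localParam
        hπ'.nonempty_localParam X.1 + boxSnd hπ.nonempty_localParam hπ'.nonempty_localParam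
        X'.1) f).contMDiff.continuous.continuousAt.eventually_ne hne)
      exact h1 (boxSum_apply_eq_zero hπ hπ' h hf q' h2)⟩

variable {hπ hπ'}

theorem pushFst_boxSum {X : ellipticTangent k n M} {X' : ellipticTangent k n' M'}
    (h : Related hπ hπ' X X') (y : M') : pushFst y (boxSum hπ hπ' X X' h) = X := by
  refine ellipticTangent_ext fun g x => ?_
  change X.1 g x + boxSnd hπ.nonempty_localParam hπ'.nonempty_localParam X'.1 (pullFst g) (x, y) = _
  rw [boxSnd_pullFst]
  exact add_zero _

theorem pushSnd_boxSum {X : ellipticTangent k n M} {X' : ellipticTangent k n' M'}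
    (h : Related hπ hπ' X X') (x : M) : pushSnd x (boxSum hπ hπ' X X' h) = X' := by
  refine ellipticTangent_ext fun g y => ?_
  change boxFst hπ.nonempty_localParam hπ'.nonempty_localParam X.1 (pullSnd g) (x, y) + X'.1 g y = _
  rw [boxFst_pullSnd]
  exact zero_add _

theorem boxSum_isProdTranslate {X : ellipticTangent k n M} {X' : ellipticTangent k n' M'}
    (h : Related hπ hπ' X X') (hX : IsInvariantSection X) (hX' : IsInvariantSection X')
    (s t : Torus k) : IsProdTranslate s t (boxSum hπ hπ' X X' h) (boxSum hπ hπ' X X' h) := by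
  intro f
  ext ⟨x, y⟩
  change X.1 (translate s (restrictFst (t • y) f)) x + X'.1 (translate t (restrictSnd (s • x) f)) y =
    X.1 (restrictFst (t • y) f) (s • x) + X'.1 (restrictSnd (s • x) f) (t • y)
  rw [hX s, hX' t]
  rfl

omit [T2Space M] [IsManifold (𝓡 n) ∞ M] [T2Space M'] [IsManifold (𝓡 n') ∞ M']
  [SmoothTorusAction k n M] [SmoothTorusAction k n' M'] in
theorem Related.add {X Y : ellipticTangent k n M} {X' Y' : ellipticTangent k n' M'}
    (h : Related hπ hπ' X X') (h' : Related hπ hπ' Y Y') : Related hπ hπ' (X + Y) (X' + Y') :=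
  fun f q => congrArg₂ (· + ·) (h f q) (h' f q)

omit [T2Space M] [IsManifold (𝓡 n) ∞ M] [T2Space M'] [IsManifold (𝓡 n') ∞ M']
  [SmoothTorusAction k n M] [SmoothTorusAction k n' M'] in
theorem Related.smul {X : ellipticTangent k n M} {X' : ellipticTangent k n' M'} (g : CB)
    (h : Related hπ hπ' X X') :
    Related hπ hπ' (basePullback hπ g • X) (basePullback hπ' g • X') := fun f q => by
  change g.1 (π q.1.1) * X.1 _ q.1.1 = g.1 (π' q.1.2) * X'.1 _ q.1.2
  rw [h f q, q.2]

omit [T2Space M] [IsManifold (𝓡 n) ∞ M] [T2Space M'] [IsManifold (𝓡 n') ∞ M']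
  [SmoothTorusAction k n M] [SmoothTorusAction k n' M'] in
theorem Related.neg {X : ellipticTangent k n M} {X' : ellipticTangent k n' M'}
    (h : Related hπ hπ' X X') : Related hπ hπ' (-X) (-X') := fun f q => by
  change -(X.1 _ q.1.1) = -(X'.1 _ q.1.2)
  rw [h f q]

omit [T2Space M] [IsManifold (𝓡 n) ∞ M] [T2Space M'] [IsManifold (𝓡 n') ∞ M']
  [SmoothTorusAction k n M] [SmoothTorusAction k n' M'] in
theorem Related.zero : Related hπ hπ' 0 0 := fun _ _ => rfl

theorem boxSum_add {X Y : ellipticTangent k n M} {X' Y' : ellipticTangent k n' M'}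
    (h : Related hπ hπ' X X') (h' : Related hπ hπ' Y Y') :
    boxSum hπ hπ' (X + Y) (X' + Y') (h.add h') = boxSum hπ hπ' X X' h + boxSum hπ hπ' Y Y' h' := by
  apply Subtype.ext
  ext f q
  change X.1 _ q.1 + Y.1 _ q.1 + (X'.1 _ q.2 + Y'.1 _ q.2) =
    X.1 _ q.1 + X'.1 _ q.2 + (Y.1 _ q.1 + Y'.1 _ q.2)
  ring

end Corr

/-! ## Invariant two-forms on the correspondence space -/

section CorrForms

variable {k n n' : ℕ} {M M' : Type*} [TopologicalSpace M]
  [ChartedSpace (EuclideanSpace ℝ (Fin n)) M] [TopologicalSpace M']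
  [ChartedSpace (EuclideanSpace ℝ (Fin n')) M'] [MulAction (Torus k) M] [MulAction (Torus k) M']
  {B : Type*} [TopologicalSpace B] {CB : Subalgebra ℝ (B → ℝ)} {π : M → B} {π' : M' → B}

namespace CorrTwoForm

variable (F : CorrTwoForm k n n' π π') (q : Corr π π')

/-- The value at a point of the correspondence space of a two-form on two sections. -/
def ev (X Y : corrTangent k n n' π π') : ℝ := corrEval q (F.toForm ![X, Y])

variable {F q}

theorem _root_.EllipticTDuality.corrEval_mk (f : ProdSmoothFn n n' M M') :
    corrEval q (Ideal.Quotient.mk (corrIdeal n n' π π') f) = f q.1 := rfl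

theorem _root_.EllipticTDuality.corrEval_smul (g : ProdSmoothFn n n' M M')
    (f : CorrFn n n' π π') : corrEval q (g • f) = g q.1 * corrEval q f := by
  obtain ⟨f, rfl⟩ := Ideal.Quotient.mk_surjective f
  rfl

theorem _root_.EllipticTDuality.corrFn_ext {f g : CorrFn n n' π π'}
    (h : ∀ q, corrEval q f = corrEval q g) : f = g := by
  obtain ⟨f, rfl⟩ := Ideal.Quotient.mk_surjective f
  obtain ⟨g, rfl⟩ := Ideal.Quotient.mk_surjective g
  rw [Ideal.Quotient.eq]
  intro q
  have := h q
  rw [corrEval_mk, corrEval_mk] at this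
  rw [ContMDiffMap.coe_sub, Pi.sub_apply, this, sub_self]

theorem ev_add_left (X Y Z : corrTangent k n n' π π') :
    F.ev q (X + Y) Z = F.ev q X Z + F.ev q Y Z := by
  rw [ev, F.toForm.map_vecCons_add, map_add]
  rfl

theorem ev_smul_left (g : ProdSmoothFn n n' M M') (X Z : corrTangent k n n' π π') :
    F.ev q (g • X) Z = g q.1 * F.ev q X Z := by
  rw [ev, F.toForm.map_vecCons_smul, corrEval_smul]
  rfl

theorem ev_swap (X Y : corrTangent k n n' π π') : F.ev q X Y = -F.ev q Y X := by
  have h := F.toForm.map_swap ![Y, X] (i := 0) (j := 1) (by simp)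
  have e : ![Y, X] ∘ Equiv.swap (0 : Fin 2) 1 = ![X, Y] := by
    funext i; fin_cases i <;> rfl
  rw [e] at h
  rw [ev, h, map_neg]
  rfl

theorem ev_zero_left (Z : corrTangent k n n' π π') : F.ev q 0 Z = 0 := by
  have h := F.ev_smul_left (q := q) 0 0 Z
  rwa [smul_zero, ContMDiffMap.coe_zero, Pi.zero_apply, zero_mul] at h

theorem ev_neg_left (X Z : corrTangent k n n' π π') : F.ev q (-X) Z = -F.ev q X Z := by
  have h := F.ev_add_left (q := q) X (-X) Z
  rw [add_neg_cancel, ev_zero_left] at h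
  linarith

theorem ev_sub_left (X Y Z : corrTangent k n n' π π') :
    F.ev q (X - Y) Z = F.ev q X Z - F.ev q Y Z := by
  rw [sub_eq_add_neg, ev_add_left, ev_neg_left, sub_eq_add_neg]

theorem ev_sum_left {ι : Type*} (s : Finset ι) (X : ι → corrTangent k n n' π π')
    (Z : corrTangent k n n' π π') : F.ev q (∑ i ∈ s, X i) Z = ∑ i ∈ s, F.ev q (X i) Z := by
  classical
  induction s using Finset.induction_on with
  | empty => simpa using F.ev_zero_left Z
  | insert a s ha ih => rw [Finset.sum_insert ha, Finset.sum_insert ha, ev_add_left, ih]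

theorem ev_eq_zero {X : corrTangent k n n' π π'}
    (h : X.1 ∈ corrIdeal n n' π π' • (boxTangent k n n' M M').toSubmodule)
    (Z : corrTangent k n n' π π') : F.ev q X Z = 0 := by
  rw [ev, F.eq_zero X Z h, map_zero]

/-- Sections whose values at a point are multiples of sections with the same restriction. -/
theorem ev_congr {X Y : corrTangent k n n' π π'}
    (h : (X - Y).1 ∈ corrIdeal n n' π π' • (boxTangent k n n' M M').toSubmodule)
    (Z : corrTangent k n n' π π') : F.ev q X Z = F.ev q Y Z := by
  rw [← sub_eq_zero, ← ev_sub_left, ev_eq_zero h]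

end CorrTwoForm

variable [SmoothTorusAction k n M] [SmoothTorusAction k n' M']
  (hπ : IsStandardQuotient k n CB π) (hπ' : IsStandardQuotient k n' CB π')

/-! ### Invariant functions on the correspondence space -/

include hπ hπ' in
/-- Near a point of the base, the points in a real slice of a chart are in a given fibre. -/
theorem StandardChart.eventually_real_slice [T2Space M'] (c : StandardChart k n' M') {y : M'}
    (hy : y ∈ c.chart.source) :
    ∀ᶠ b in 𝓝 (π' y), ∀ ε : Fin c.l → ℤˣ, π' (c.param (0,
      (fun i => (((((ε i : ℤ) : ℝ) *
        √((c.testFn (c.normSq y) hπ' (Sum.inl i)).1 b) : ℝ)) : ℂ)),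
      fun j => (c.testFn (c.normSq y) hπ' (Sum.inr j)).1 b)) = b := by
  refine hπ'.eventually_nhds ?_
  filter_upwards [c.eventually_cut_eq_one (C := c.normSq y + 1 + 1) hy (by linarith),
    c.isOpen_source.mem_nhds hy] with y' h1 h2 ε
  obtain ⟨t, ht⟩ := c.exists_smul_eq (c.param_mem (0,
      (fun i => (((((ε i : ℤ) : ℝ) *
        √((c.testFn (c.normSq y) hπ' (Sum.inl i)).1 (π' y')) : ℝ)) : ℂ)),
      fun j => (c.testFn (c.normSq y) hπ' (Sum.inr j)).1 (π' y'))) h2 (fun i => by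
        rw [z_param, Complex.norm_real, norm_mul, testFn_apply, h1, one_mul]
        have h3 : ‖((ε i : ℤ) : ℝ)‖ = 1 := by
          rcases Int.units_eq_one_or (ε i) with h | h <;> rw [h] <;> simp
        rw [h3, one_mul]
        simp only [quotCoord, Sum.elim_inl]
        rw [Real.sqrt_sq (norm_nonneg _), norm_norm])
    (by
      rw [y_param]
      funext j
      simp only
      rw [testFn_apply, h1, one_mul]
      rfl)
  exact (hπ'.eq_iff_orbit _ _).2 ⟨t, ht⟩

include hπ hπ' in
/-- Invariant smooth functions on the correspondence space are functions on the base. -/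
theorem exists_descend_corr [T2Space M'] {f : ProdSmoothFn n n' M M'}
    (hf : ∀ (s t : Torus k) (q r : Corr π π'), r.1 = (s • q.1.1, t • q.1.2) → f q.1 = f r.1) :
    ∃ g : CB, ∀ q : Corr π π', g.1 (π q.1.1) = f q.1 := by
  have hs := hπ.isQuotientMap.surjective
  have hs' := hπ'.isQuotientMap.surjective
  set g : B → ℝ := fun b => f (Function.surjInv hs b, Function.surjInv hs' b) with hg
  have hgf : ∀ q : Corr π π', g (π q.1.1) = f q.1 := by
    intro q
    obtain ⟨s, hs1⟩ := (hπ.eq_iff_orbit q.1.1 _).1 (Function.surjInv_eq hs (π q.1.1)).symm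
    obtain ⟨t, ht1⟩ := (hπ'.eq_iff_orbit q.1.2 _).1
      (q.2.symm.trans (Function.surjInv_eq hs' (π q.1.1)).symm)
    refine (hf s t q ⟨(_, _), ?_⟩ (Prod.ext hs1.symm ht1.symm)).symm
    exact (Function.surjInv_eq hs _).trans (Function.surjInv_eq hs' _).symm
  refine ⟨⟨g, (hπ.mem_iff_smooth g).2 fun x => ?_⟩, hgf⟩
  obtain ⟨y, hy⟩ := hs' (π x)
  obtain ⟨c, hc⟩ := hπ'.exists_chart y
  obtain ⟨p⟩ := hπ.nonempty_localParam x
  set C := c.normSq y with hC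
  have ht : ∀ i, ContDiff ℝ ∞ fun v : p.V => (c.testFn C hπ' i).1 (π (p.r v)) := by
    intro i
    rw [← contMDiff_iff_contDiff]
    exact (basePullback hπ (c.testFn C hπ' i)).contMDiff.comp p.r_smooth
  -- Over a point near x, a point of the fibre of π' can be taken in the real slice z'_i = ±√t_i of
  -- a chart of M'. The roots are not smooth, but f has the value g for every choice of signs, so g
  -- is the average over the signs, which is smooth in the t_i.
  have h1 : ContDiff ℝ ∞ fun w : p.V × (Fin c.l → ℝ) => f (p.r w.1, c.param (0,
      (fun i => ((w.2 i : ℝ) : ℂ)), fun j => (c.testFn C hπ' (Sum.inr j)).1 (π (p.r w.1)))) := by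
    rw [← contMDiff_iff_contDiff]
    refine f.contMDiff.comp ((p.r_smooth.comp contDiff_fst.contMDiff).prodMk
      (c.contMDiff_param.comp (ContDiff.contMDiff ?_)))
    refine contDiff_const.prodMk (ContDiff.prodMk ?_ ?_)
    · rw [contDiff_pi]
      exact fun i => Complex.ofRealCLM.contDiff.comp ((contDiff_apply ℝ ℝ i).comp contDiff_snd)
    · rw [contDiff_pi]
      exact fun j => (ht (Sum.inr j)).comp contDiff_fst
  have h2 := contDiff_sum_signs_sqrt h1 (t := fun i v => (c.testFn C hπ' (Sum.inl i)).1 (π (p.r v)))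
    (fun i => ht (Sum.inl i)) (fun i v => by
      obtain ⟨y', hy'⟩ := hs' (π (p.r v))
      rw [← hy', c.testFn_apply]
      exact mul_nonneg (c.cut_nonneg _ _) (by
        simp only [StandardChart.quotCoord, Sum.elim_inl]; positivity))
  set N : ℝ := (Fintype.card (Fin c.l → ℤˣ) : ℝ) with hN
  have hN0 : N ≠ 0 := by rw [hN]; exact_mod_cast Fintype.card_ne_zero
  have h3 := ((h2.div_const N).contMDiff.comp_contMDiffOn p.s_smooth).contMDiffAt
    (p.isOpen.mem_nhds p.mem)
  refine h3.congr_of_eventuallyEq ?_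
  have h4 := c.eventually_real_slice hπ hπ' hc
  rw [hy] at h4
  filter_upwards [p.isOpen.mem_nhds p.mem, hπ.continuous.continuousAt.eventually h4] with x' h5 h6
  simp only [Function.comp_apply, p.r_s x' h5]
  rw [eq_div_iff hN0]
  have h7 : ∀ ε : Fin c.l → ℤˣ, f (x', c.param (0,
      (fun i => (((((ε i : ℤ) : ℝ) * √((c.testFn C hπ' (Sum.inl i)).1 (π x')) : ℝ)) : ℂ)),
      fun j => (c.testFn C hπ' (Sum.inr j)).1 (π x'))) = g (π x') := fun ε =>
    (hgf ⟨(x', _), (h6 ε).symm⟩).symm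
  rw [Finset.sum_congr rfl fun ε _ => h7 ε, Finset.sum_const, Finset.card_univ, nsmul_eq_mul,
    mul_comm]

/-! ### The pairing of invariant sections with the same anchor -/

/-- Pairs of invariant sections with the same anchor. -/
def relPairsSubgroup : AddSubgroup (ellipticTangent k n M × ellipticTangent k n' M') where
  carrier := {p | IsInvariantSection p.1 ∧ IsInvariantSection p.2 ∧ Related hπ hπ' p.1 p.2}
  zero_mem' := ⟨fun t f => by simp, fun t f => by simp, Related.zero⟩
  add_mem' := by
    rintro p p' ⟨h1, h2, h3⟩ ⟨h1', h2', h3'⟩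
    refine ⟨fun t f => ?_, fun t f => ?_, h3.add h3'⟩
    · change p.1.1 _ + p'.1.1 _ = translate t (p.1.1 f + p'.1.1 f)
      rw [h1 t, h1' t, map_add]
    · change p.2.1 _ + p'.2.1 _ = translate t (p.2.1 f + p'.2.1 f)
      rw [h2 t, h2' t, map_add]
  neg_mem' := by
    rintro p ⟨h1, h2, h3⟩
    refine ⟨fun t f => ?_, fun t f => ?_, h3.neg⟩
    · change -(p.1.1 _) = translate t (-(p.1.1 f))
      rw [h1 t, map_neg]
    · change -(p.2.1 _) = translate t (-(p.2.1 f))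
      rw [h2 t, map_neg]

/-- The module over the functions of the base of pairs of invariant sections with the same
anchor. -/
def relPairs : Type _ := relPairsSubgroup hπ hπ'

instance : AddCommGroup (relPairs hπ hπ') :=
  inferInstanceAs (AddCommGroup (relPairsSubgroup hπ hπ'))

variable {hπ hπ'}

theorem relPairs_ext {p p' : relPairs hπ hπ'} (h : p.1.1 = p'.1.1) (h' : p.1.2 = p'.1.2) :
    p = p' := Subtype.ext (Prod.ext h h')

theorem isInvariantSection_smul (g : CB) {X : ellipticTangent k n M} (hX : IsInvariantSection X) :
    IsInvariantSection (basePullback hπ g • X) := fun t f => by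
  change basePullback hπ g * X.1 _ = translate t (basePullback hπ g * X.1 f)
  rw [hX t, map_mul, translate_basePullback]

instance : SMul CB (relPairs hπ hπ') where
  smul g p := ⟨(basePullback hπ g • p.1.1, basePullback hπ' g • p.1.2),
    isInvariantSection_smul g p.2.1, isInvariantSection_smul g p.2.2.1, p.2.2.2.smul g⟩

@[simp]
theorem relPairs_smul_fst (g : CB) (p : relPairs hπ hπ') :
    (g • p).1.1 = basePullback hπ g • p.1.1 := rfl

@[simp]
theorem relPairs_smul_snd (g : CB) (p : relPairs hπ hπ') :
    (g • p).1.2 = basePullback hπ' g • p.1.2 := rfl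

instance : Module CB (relPairs hπ hπ') where
  one_smul p := relPairs_ext (by rw [relPairs_smul_fst, map_one, one_smul])
    (by rw [relPairs_smul_snd, map_one, one_smul])
  mul_smul f g p := relPairs_ext (by simp only [relPairs_smul_fst, map_mul, mul_smul])
    (by simp only [relPairs_smul_snd, map_mul, mul_smul])
  smul_zero f := relPairs_ext (smul_zero (basePullback hπ f)) (smul_zero (basePullback hπ' f))
  smul_add f p p' := relPairs_ext (smul_add (basePullback hπ f) p.1.1 p'.1.1)
    (smul_add (basePullback hπ' f) p.1.2 p'.1.2)
  add_smul f g p := relPairs_ext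
    (by rw [relPairs_smul_fst, map_add, add_smul]; rfl)
    (by rw [relPairs_smul_snd, map_add, add_smul]; rfl)
  zero_smul p := relPairs_ext
    (by rw [relPairs_smul_fst, map_zero, zero_smul]; rfl)
    (by rw [relPairs_smul_snd, map_zero, zero_smul]; rfl)

variable [T2Space M] [IsManifold (𝓡 n) ∞ M] [T2Space M'] [IsManifold (𝓡 n') ∞ M']

/-- The section over the correspondence space given by a pair of sections with the same anchor. -/
def relBox (p : relPairs hπ hπ') : corrTangent k n n' π π' :=
  boxSum hπ hπ' p.1.1 p.1.2 p.2.2.2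

theorem relBox_add (p p' : relPairs hπ hπ') : relBox (p + p') = relBox p + relBox p' :=
  boxSum_add _ _

variable {F : CorrTwoForm k n n' π π'}

/-- Multiplying a pair by g multiplies its components by π^*g and π'^*g, which are different
functions on M × M'. They agree on N, so the result differs from π^*g times the section by an
element of I_N · Γ(𝒜 ⊠ 𝒜'), and F ignores it. -/
theorem ev_relBox_smul (g : CB) (p : relPairs hπ hπ') (q : Corr π π')
    (Z : corrTangent k n n' π π') : F.ev q (relBox (g • p)) Z = g.1 (π q.1.1) * F.ev q (relBox p) Z := by
  rw [F.ev_congr (Y := (pullFst (basePullback hπ g) : ProdSmoothFn n n' M M') • relBox p), F.ev_smul_left]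
  · rfl
  · have e : (relBox (g • p) - (pullFst (basePullback hπ g) : ProdSmoothFn n n' M M') • relBox p).1 =
        (pullSnd (basePullback hπ' g) - pullFst (basePullback hπ g)) •
          boxSnd hπ.nonempty_localParam hπ'.nonempty_localParam p.1.2.1 := by
      ext f ⟨x, y⟩
      change g.1 (π x) * p.1.1.1 (restrictFst y f) x + g.1 (π' y) * p.1.2.1 (restrictSnd x f) y -
        g.1 (π x) * (p.1.1.1 (restrictFst y f) x + p.1.2.1 (restrictSnd x f) y) =
        (g.1 (π' y) - g.1 (π x)) * p.1.2.1 (restrictSnd x f) y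
      ring
    rw [e]
    refine Submodule.smul_mem_smul (fun q => ?_) (boxSnd_mem _ _ p.1.2.2)
    change g.1 (π' q.1.2) - g.1 (π q.1.1) = 0
    rw [q.2, sub_self]

/-- Sections given by invariant pairs are T^{2k}-invariant, hence so is the function obtained from
the invariant form F, and it descends to B. -/
theorem exists_relPairing (hF : F.IsInvariant) (p p' : relPairs hπ hπ') :
    ∃ g : CB, ∀ q : Corr π π', g.1 (π q.1.1) = F.ev q (relBox p) (relBox p') := by
  obtain ⟨f, hf⟩ := Ideal.Quotient.mk_surjective (F.toForm ![relBox p, relBox p'])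
  obtain ⟨g, hg⟩ := exists_descend_corr hπ hπ' (f := f) (fun s t q r hr => by
    have h := hF s t (relBox p) (relBox p') (relBox p) (relBox p')
      (boxSum_isProdTranslate _ p.2.1 p.2.2.1 s t) (boxSum_isProdTranslate _ p'.2.1 p'.2.2.1 s t)
      q r hr
    rw [← hf] at h
    exact h)
  refine ⟨g, fun q => ?_⟩
  rw [hg, CorrTwoForm.ev, ← hf]
  rfl

end CorrForms

/-! ## Non-degeneracy -/

section Nondegeneracy

variable {k n n' : ℕ} {M M' : Type*} [TopologicalSpace M]
  [ChartedSpace (EuclideanSpace ℝ (Fin n)) M] [TopologicalSpace M']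
  [ChartedSpace (EuclideanSpace ℝ (Fin n')) M'] [MulAction (Torus k) M] [MulAction (Torus k) M']
  {B : Type*} [TopologicalSpace B] {CB : Subalgebra ℝ (B → ℝ)} {π : M → B} {π' : M' → B}
  [SmoothTorusAction k n M] [SmoothTorusAction k n' M']
  [T2Space M] [IsManifold (𝓡 n) ∞ M] [T2Space M'] [IsManifold (𝓡 n') ∞ M']

theorem VanishesAt.coeff_eq_zero (c : StandardChart k n M) (C : ℝ)
    (hM : ∀ x : M, ∃ c : StandardChart k n M, x ∈ c.chart.source)
    {X : ellipticTangent k n M} {x : M} (h : VanishesAt X x) (κ : c.Idx) :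
    c.coeff C hM κ X x = 0 := by
  refine Submodule.smul_induction_on h (p := fun X => c.coeff C hM κ X x = 0) ?_ ?_
  · intro f hf X _
    rw [map_smul]
    change f x * _ = 0
    rw [show f x = 0 from hf, zero_mul]
  · intro X Y hX hY
    rw [map_add]
    change c.coeff C hM κ X x + c.coeff C hM κ Y x = 0
    rw [hX, hY, add_zero]

/-- The fundamental fields are part of a frame of the elliptic tangent bundle, so they do not vanish
in its fibres even where the action has fixed directions. -/
theorem eq_zero_of_vanishesAt_fundField
    (hM : ∀ x : M, ∃ c : StandardChart k n M, x ∈ c.chart.source) {e : Fin k → ℝ} {x : M}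
    (h : VanishesAt (fundField hM e) x) : e = 0 := by
  obtain ⟨c, hx⟩ := hM x
  have hcut : c.cut (c.normSq x) x = 1 := c.cut_eq_one hx le_rfl
  funext j
  have h1 := h.coeff_eq_zero c (c.normSq x) hM (Sum.inl j)
  rw [fundField_eq_sum, map_sum] at h1
  have h2 : ∀ j', c.coeff (c.normSq x) hM (Sum.inl j)
      (algebraMap ℝ (SmoothFn n M) (e j') • fundField hM (Pi.single j' 1)) =
      if j = j' then algebraMap ℝ (SmoothFn n M) (e j') *
        (c.cutFn (c.normSq x) * c.cutFn (c.normSq x)) else 0 := by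
    intro j'
    have h3 := c.coeff_basis (c.normSq x) hM (Sum.inl j) (Sum.inl j')
    rw [map_smul]
    change _ • c.coeff (c.normSq x) hM (Sum.inl j) (c.basis (c.normSq x) hM (Sum.inl j')) = _
    rw [h3]
    by_cases hj : j = j' <;> simp [hj]
  simp only [h2, Finset.sum_ite_eq, Finset.mem_univ, if_true] at h1
  change e j * (c.cutFn _ x * c.cutFn _ x) = 0 at h1
  simpa [hcut] using h1

namespace StandardChart

theorem exists_coeff_fst (c : StandardChart k n M) (C : ℝ)
    (hM : ∀ x : M, ∃ c : StandardChart k n M, x ∈ c.chart.source)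
    (hM' : ∀ y : M', Nonempty (LocalParam (𝓡 n') y))
    {D : Derivation ℝ (ProdSmoothFn n n' M M') (ProdSmoothFn n n' M M')}
    (hD : ∀ f ∈ (ellipticDivisor k n M).map pullFst, D f ∈ (ellipticDivisor k n M).map pullFst) :
    ∃ b : c.Idx → ProdSmoothFn n n' M M', ∀ (g : SmoothFn n M) (q : M × M'),
      c.cut C q.1 * D (pullFst g) q = ∑ κ, b κ q * (c.basis C hM κ).1 g q.1 := by
  obtain ⟨b, a, h⟩ := c.exists_coeff C hM' hM (Y := D.toLinearMap ∘ₗ pullFst.toLinearMap)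
    (fun f g => by
      change D (pullFst (f * g)) = pullFst f * D (pullFst g) + pullFst g * D (pullFst f)
      rw [map_mul, D.leibniz]
      rfl)
    (fun f hf => hD _ (Ideal.mem_map_of_mem pullFst hf))
  refine ⟨Sum.elim b a, fun g q => ?_⟩
  rw [Fintype.sum_sum_type]
  exact h g q

theorem exists_coeff_snd (c : StandardChart k n' M') (C : ℝ)
    (hM : ∀ x : M, Nonempty (LocalParam (𝓡 n) x))
    (hM' : ∀ x : M', ∃ c : StandardChart k n' M', x ∈ c.chart.source)
    {D : Derivation ℝ (ProdSmoothFn n n' M M') (ProdSmoothFn n n' M M')}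
    (hD : ∀ f ∈ (ellipticDivisor k n' M').map pullSnd,
      D f ∈ (ellipticDivisor k n' M').map pullSnd) :
    ∃ b : c.Idx → ProdSmoothFn n n' M M', ∀ (g : SmoothFn n' M') (q : M × M'),
      c.cut C q.2 * D (pullSnd g) q = ∑ κ, b κ q * (c.basis C hM' κ).1 g q.2 := by
  have hle : (ellipticDivisor k n' M').map (pullSnd : SmoothFn n' M' →ₐ[ℝ] ProdSmoothFn n n' M M') ≤
      ((ellipticDivisor k n' M').map
        (pullFst : SmoothFn n' M' →ₐ[ℝ] ProdSmoothFn n' n M' M)).comap swapFn :=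
    Ideal.map_le_iff_le_comap.2 fun g hg => Ideal.mem_map_of_mem pullFst hg
  obtain ⟨b, a, h⟩ := c.exists_coeff C hM hM' (n' := n) (M' := M)
    (Y := swapFn.toLinearMap ∘ₗ D.toLinearMap ∘ₗ pullSnd.toLinearMap)
    (fun f g => by
      change swapFn (D (pullSnd (f * g))) =
        pullFst f * swapFn (D (pullSnd g)) + pullFst g * swapFn (D (pullSnd f))
      rw [map_mul, D.leibniz, map_add]
      rfl)
    (fun f hf => hle (hD _ (Ideal.mem_map_of_mem pullSnd hf)))
  refine ⟨Sum.elim (fun j => swapFn (b j)) fun i => swapFn (a i), fun g q => ?_⟩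
  rw [Fintype.sum_sum_type]
  exact h g q.swap

end StandardChart

variable (hπ : IsStandardQuotient k n CB π) (hπ' : IsStandardQuotient k n' CB π')

theorem fundField_basePullback (e : Fin k → ℝ) (f : CB) :
    (fundField hπ.exists_chart e).1 (basePullback hπ f) = 0 :=
  fundField_apply_of_invariant _ _ fun t x => congrArg f.1 (hπ.smul_eq t x)

/-- The fundamental fields of the first factor. -/
def vertFst (e : Fin k → ℝ) : relPairs hπ hπ' :=
  ⟨(fundField hπ.exists_chart e, 0), fundField_invariant _ _, fun t f => by simp, fun f q => by
    simp [fundField_basePullback]⟩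

/-- The fundamental fields of the second factor. -/
def vertSnd (e : Fin k → ℝ) : relPairs hπ hπ' :=
  ⟨(0, fundField hπ'.exists_chart e), fun t f => by simp, fundField_invariant _ _, fun f q => by
    simp [fundField_basePullback]⟩

theorem exists_anchor {X : ellipticTangent k n M} (hX : IsInvariantSection X) (f : CB) :
    ∃ g : CB, basePullback hπ g = X.1 (basePullback hπ f) :=
  exists_descend hπ _ fun t => by rw [← hX t, translate_basePullback]

include hπ in
theorem exists_cut_base (c : StandardChart k n M) (C : ℝ) :
    ∃ χ : CB, ∀ x, χ.1 (π x) = c.cut C x := by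
  obtain ⟨χ, hχ⟩ := exists_basePullback_eq hπ (c.cutFn C)
    (fun t x => by rw [c.cutFn_apply, c.cutFn_apply, c.cut_smul])
  exact ⟨χ, fun x => (congrArg (fun F : SmoothFn n M => F x) hχ).trans (c.cutFn_apply C x)⟩

/-- Local lifts of invariant sections over one manifold to the other one, along the fields of a
chart. -/
theorem exists_lift_pair (c : StandardChart k n M) (C : ℝ) {χ : CB}
    (hχ : ∀ x, χ.1 (π x) = c.cut C x) {X' : ellipticTangent k n' M'}
    (hX' : IsInvariantSection X') :
    ∃ h : Fin c.l ⊕ Fin c.m → CB, ∃ p : relPairs hπ hπ',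
      p.1 = (∑ i, basePullback hπ (h i) • c.frame C i, basePullback hπ' χ • X') := by
  choose D hD using exists_anchor hπ' hX'
  obtain ⟨h, hh⟩ := c.exists_lift hπ hπ' C hD
  refine ⟨h, ⟨(∑ i, basePullback hπ (h i) • c.frame C i, basePullback hπ' χ • X'),
    ?_, isInvariantSection_smul χ hX', fun f q => ?_⟩, rfl⟩
  · intro t f
    ext x
    change (∑ i, basePullback hπ (h i) • c.frame C i).1 (translate t f) x =
      (∑ i, basePullback hπ (h i) • c.frame C i).1 f (t • x)
    rw [sum_smul_apply, sum_smul_apply]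
    refine Finset.sum_congr rfl fun i _ => ?_
    rw [basePullback_apply, basePullback_apply, hπ.smul_eq]
    congr 1
    exact congrArg (fun F : SmoothFn n M => F x)
      (c.basis_invariant C hπ.exists_chart (Sum.inr i) t f)
  · simp only
    rw [sum_smul_apply]
    change ∑ i, (h i).1 (π q.1.1) * _ = χ.1 (π' q.1.2) * X'.1 (basePullback hπ' f) q.1.2
    rw [← hh, ← hD, ← q.2, hχ, basePullback_apply, q.2]

variable {hπ hπ'} {F : CorrTwoForm k n n' π π'}

theorem coe_sum_corrTangent {ι : Type*} (s : Finset ι) (f : ι → ProdSmoothFn n n' M M')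
    (X : ι → corrTangent k n n' π π') (g : ProdSmoothFn n n' M M') (q : M × M') :
    (∑ i ∈ s, f i • X i).1 g q = ∑ i ∈ s, f i q * (X i).1 g q := by
  have h : (∑ i ∈ s, f i • X i).1 = ∑ i ∈ s, f i • (X i).1 :=
    map_sum (corrTangent k n n' π π').toSubmodule.subtype _ _
  rw [h, sum_smul_derivation_apply]

theorem CorrTwoForm.ev_sum_smul_left {ι : Type*} (s : Finset ι) (f : ι → ProdSmoothFn n n' M M')
    (X : ι → corrTangent k n n' π π') (q : Corr π π') (Z : corrTangent k n n' π π') :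
    F.ev q (∑ i ∈ s, f i • X i) Z = ∑ i ∈ s, f i q.1 * F.ev q (X i) Z := by
  rw [ev_sum_left]
  exact Finset.sum_congr rfl fun i _ => ev_smul_left _ _ _

variable (hπ hπ') in
set_option maxHeartbeats 1600000 in
/-- The values of a two-form on a section whose second component vanishes at a point are
determined by its values on the fundamental fields of the first factor. -/
theorem exists_ev_eq_sum (q : Corr π π') (X : corrTangent k n n' π π')
    (hX : VanishesAt (pushSnd q.1.1 X) q.1.2) :
    ∃ r : Fin k → ℝ, ∀ Z, F.ev q X Z =
      ∑ j, r j * F.ev q (relBox (vertFst hπ hπ' (Pi.single j 1))) Z := by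
  obtain ⟨⟨x, y⟩, hq⟩ := q
  simp only at hX hq
  obtain ⟨c, hx⟩ := hπ.exists_chart x
  obtain ⟨c', hy⟩ := hπ'.exists_chart y
  set C := c.normSq x with hC
  set C' := c'.normSq y with hC'
  have hcut : c.cut C x = 1 := c.cut_eq_one hx le_rfl
  have hcut' : c'.cut C' y = 1 := c'.cut_eq_one hy le_rfl
  obtain ⟨b, hb⟩ := c.exists_coeff_fst C hπ.exists_chart hπ'.nonempty_localParam (D := X.1)
    (X.2 _ (by simp))
  obtain ⟨b', hb'⟩ := c'.exists_coeff_snd C' hπ.nonempty_localParam hπ'.exists_chart (D := X.1)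
    (X.2 _ (by simp))
  obtain ⟨χ, hχ⟩ := exists_cut_base hπ c C
  choose h p hp using fun κ : c'.Idx => exists_lift_pair hπ hπ' c C hχ
    (c'.basis_invariant C' hπ'.exists_chart κ)
  set s : ProdSmoothFn n n' M M' := pullFst (c.cutFn C) with hs
  set s' : ProdSmoothFn n n' M M' := pullSnd (c'.cutFn C') with hs'
  set χ' : ProdSmoothFn n n' M M' := pullSnd (basePullback hπ' χ) with hχ'
  have hsq : ∀ q, s q = c.cut C q.1 := fun q => c.cutFn_apply C q.1
  have hsq' : ∀ q, s' q = c'.cut C' q.2 := fun q => c'.cutFn_apply C' q.2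
  have hχq : ∀ q : Corr π π', χ' q.1 = c.cut C q.1.1 := by
    intro q
    change χ.1 (π' q.1.2) = _
    rw [← q.2, hχ]
  -- These are the coefficients, along the radial and real fields of M, that remain after the lifts
  -- of the M'-component have been subtracted.
  set w : Fin c.l ⊕ Fin c.m → ProdSmoothFn n n' M M' := fun i =>
    χ' * s' * b (Sum.inr i) - ∑ κ, s * b' κ * pullFst (basePullback hπ (h κ i)) with hw
  have hwq : ∀ i q, w i q = χ' q * s' q * b (Sum.inr i) q -
      ∑ κ, s q * b' κ q * (h κ i).1 (π q.1) := by
    intro i q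
    have h1 : (∑ κ, s * b' κ * pullFst (basePullback hπ (h κ i)) : ProdSmoothFn n n' M M') q =
        ∑ κ, s q * b' κ q * (h κ i).1 (π q.1) :=
      map_sum (ContMDiffMap.evalRingHom q : ProdSmoothFn n n' M M' →+* ℝ) _ _
    rw [← h1]
    rfl
  -- Subtracting from X, up to cut-offs, its vertical part on M and the lifts of its M'-component
  -- leaves a section without M'-component, namely Σ w_i (frame_i, 0). All three terms are tangent
  -- to N, so W is.
  set W : corrTangent k n n' π π' := (χ' * s * s') • X -
    (∑ j, (χ' * s' * b (Sum.inl j)) • relBox (vertFst hπ hπ' (Pi.single j 1)) +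
      ∑ κ, (s * b' κ) • relBox (p κ)) with hW
  have hWapp : ∀ g q, W.1 g q = χ' q * s q * s' q * X.1 g q -
      (∑ j, χ' q * s' q * b (Sum.inl j) q * (relBox (vertFst hπ hπ' (Pi.single j 1))).1 g q +
        ∑ κ, s q * b' κ q * (relBox (p κ)).1 g q) := by
    intro g q
    have e1 : ∀ j, χ' q * s' q * b (Sum.inl j) q = (χ' * s' * b (Sum.inl j)) q := fun _ => rfl
    have e2 : ∀ κ, s q * b' κ q = (s * b' κ) q := fun _ => rfl
    simp only [e1, e2]
    rw [← coe_sum_corrTangent, ← coe_sum_corrTangent]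
    rfl
  have hWsum : W.1 = ∑ i, w i • boxFst hπ.nonempty_localParam hπ'.nonempty_localParam
      (c.frame C i).1 := by
    rw [← sub_eq_zero]
    refine prod_derivation_eq_zero hπ.nonempty_localParam hπ'.nonempty_localParam
      (fun g => ?_) (fun g => ?_)
    · ext q
      change W.1 (pullFst g) q - (∑ i, w i • boxFst hπ.nonempty_localParam
        hπ'.nonempty_localParam (c.frame C i).1) (pullFst g) q = 0
      rw [sum_smul_derivation_apply, hWapp]
      have e1 : ∀ j, (relBox (vertFst hπ hπ' (Pi.single j 1))).1 (pullFst g) q =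
          (fundField hπ.exists_chart (Pi.single j 1)).1 g q.1 := fun j => add_zero _
      have e2 : ∀ κ, (relBox (p κ)).1 (pullFst g) q =
          ∑ i, (h κ i).1 (π q.1) * (c.frame C i).1 g q.1 := by
        intro κ
        have : (relBox (p κ)).1 (pullFst g) q = (p κ).1.1.1 g q.1 + boxSnd
            hπ.nonempty_localParam hπ'.nonempty_localParam (p κ).1.2.1 (pullFst g) q := rfl
        rw [this, boxSnd_pullFst, hp, sum_smul_apply]
        exact add_zero _
      have e3 : ∀ i, boxFst hπ.nonempty_localParam hπ'.nonempty_localParam (c.frame C i).1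
          (pullFst g) q = (c.frame C i).1 g q.1 := fun i => rfl
      have e4 : χ' q * s q * s' q * X.1 (pullFst g) q = χ' q * s' q *
          ∑ κ, b κ q * (c.basis C hπ.exists_chart κ).1 g q.1 := by
        rw [← hb, hsq]; ring
      rw [e4, Fintype.sum_sum_type]
      simp only [e1, e2, e3, hwq, sub_mul, Finset.sum_sub_distrib, StandardChart.basis,
        Sum.elim_inl, Sum.elim_inr, mul_add, Finset.mul_sum, Finset.sum_mul]
      rw [Finset.sum_comm (s := (Finset.univ : Finset (Fin c.l ⊕ Fin c.m)))]
      simp only [mul_assoc]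
      ring
    · ext q
      change W.1 (pullSnd g) q - (∑ i, w i • boxFst hπ.nonempty_localParam
        hπ'.nonempty_localParam (c.frame C i).1) (pullSnd g) q = 0
      rw [sum_smul_derivation_apply, hWapp]
      have e1 : ∀ j, (relBox (vertFst hπ hπ' (Pi.single j 1))).1 (pullSnd g) q = 0 := by
        intro j
        have : (relBox (vertFst hπ hπ' (Pi.single j 1))).1 (pullSnd g) q =
          boxFst hπ.nonempty_localParam hπ'.nonempty_localParam
            (fundField hπ.exists_chart (Pi.single j 1)).1 (pullSnd g) q + 0 := rfl
        rw [this, boxFst_pullSnd]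
        exact add_zero _
      have e2 : ∀ κ, (relBox (p κ)).1 (pullSnd g) q =
          χ' q * (c'.basis C' hπ'.exists_chart κ).1 g q.2 := by
        intro κ
        have : (relBox (p κ)).1 (pullSnd g) q = boxFst hπ.nonempty_localParam
            hπ'.nonempty_localParam (p κ).1.1.1 (pullSnd g) q + (p κ).1.2.1 g q.2 := rfl
        rw [this, boxFst_pullSnd, hp]
        exact zero_add _
      have e4 : χ' q * s q * s' q * X.1 (pullSnd g) q = χ' q * s q *
          ∑ κ, b' κ q * (c'.basis C' hπ'.exists_chart κ).1 g q.2 := by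
        rw [← hb', hsq']; ring
      have e5 : ∀ i, w i q * boxFst hπ.nonempty_localParam hπ'.nonempty_localParam
          (c.frame C i).1 (pullSnd g) q = 0 := by
        intro i
        rw [boxFst_pullSnd]
        exact mul_zero _
      rw [e4]
      simp only [e1, e2, e5, mul_zero, Finset.sum_const_zero, zero_add, sub_zero, Finset.mul_sum]
      rw [← Finset.sum_sub_distrib]
      refine Finset.sum_eq_zero fun κ _ => ?_
      ring
  -- W annihilates π^*t_i − π'^*t_i along N, which isolates w_i with a factor that is non-zero at
  -- free points; so s w_i vanishes on N by density, and F does not see s W.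
  have hw0 : ∀ i, s * w i ∈ corrIdeal n n' π π' := by
    intro i q
    by_contra hne
    obtain ⟨q', h1, hfree⟩ := exists_corr_isFreePoint hπ hπ' q
      ((s * w i).contMDiff.continuous.continuousAt.eventually_ne hne)
    apply h1
    change s q'.1 * w i q'.1 = 0
    rw [hsq]
    by_cases hC0 : c.cut C q'.1.1 = 0
    · rw [hC0, zero_mul]
    obtain ⟨hx', hxC'⟩ := c.mem_of_cut_ne_zero hC0
    have h2 := W.2 (corrIdeal n n' π π') (by simp)
      (pullFst (basePullback hπ (c.testFn C hπ i)) - pullSnd (basePullback hπ' (c.testFn C hπ i)))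
      (fun q => by
        change (c.testFn C hπ i).1 (π q.1.1) - (c.testFn C hπ i).1 (π' q.1.2) = 0
        rw [q.2, sub_self]) q'
    rw [hWsum, sum_smul_derivation_apply] at h2
    have h3 : ∀ i', boxFst hπ.nonempty_localParam hπ'.nonempty_localParam (c.frame C i').1
        (pullFst (basePullback hπ (c.testFn C hπ i)) -
          pullSnd (basePullback hπ' (c.testFn C hπ i))) q'.1 =
        (c.frame C i').1 (basePullback hπ (c.testFn C hπ i)) q'.1.1 := by
      intro i'
      rw [map_sub, boxFst_pullSnd, sub_zero]
      rfl
    simp only [h3, c.frame_testFn, c.cut_eq_one hx' hxC'.le, mul_ite, mul_zero,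
      Finset.sum_ite_eq', Finset.mem_univ, if_true, one_mul] at h2
    have h4 : Sum.elim (fun i => 2 * ‖c.z q'.1.1 i‖ ^ 2) (fun _ => 1) i ≠ (0 : ℝ) := by
      rcases i with i | j
      · have := norm_ne_zero_iff.2 ((c.isFreePoint_iff hx').1 hfree i)
        simpa using this
      · simp
    rw [(mul_eq_zero.1 h2).resolve_right h4, mul_zero]
  set q : Corr π π' := ⟨(x, y), hq⟩ with hqdef
  have hs1 : s q.1 = 1 := (hsq _).trans hcut
  have hs1' : s' q.1 = 1 := (hsq' _).trans hcut'
  have hχ1 : χ' q.1 = 1 := (hχq _).trans hcut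
  have hWev : ∀ Z, F.ev q W Z = 0 := by
    intro Z
    have h1 : F.ev q (s • W) Z = 0 := by
      refine F.ev_eq_zero ?_ Z
      have h2 : (s • W).1 = ∑ i, (s * w i) • boxFst hπ.nonempty_localParam
          hπ'.nonempty_localParam (c.frame C i).1 := by
        change s • W.1 = _
        rw [hWsum, Finset.smul_sum]
        exact Finset.sum_congr rfl fun i _ => (mul_smul _ _ _).symm
      rw [h2]
      exact Submodule.sum_mem _ fun i _ =>
        Submodule.smul_mem_smul (hw0 i) (boxFst_mem _ _ (c.frame C i).2)
    rwa [F.ev_smul_left, hs1, one_mul] at h1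
  -- The M'-component of X is zero in the fibre at y, so its coefficients in the frame vanish there
  -- and the lifts do not contribute at q.
  have hb'0 : ∀ κ, b' κ q.1 = 0 := by
    intro κ
    have h1 : c'.cutFn C' • pushSnd x X =
        ∑ κ, restrictSnd x (b' κ) • c'.basis C' hπ'.exists_chart κ := by
      refine ellipticTangent_ext fun g y' => ?_
      rw [sum_smul_apply]
      change c'.cutFn C' y' * X.1 (pullSnd g) (x, y') = _
      rw [c'.cutFn_apply]
      exact hb' g (x, y')
    have h2 := congrArg (fun f : SmoothFn n' M' => f y)
      (c'.cutFn_mul_eq_coeff C' hπ'.exists_chart h1 κ)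
    change c'.cutFn C' y * c'.coeff C' _ κ (pushSnd x X) y =
      c'.cutFn C' y * c'.cutFn C' y * b' κ (x, y) at h2
    rw [hX.coeff_eq_zero, mul_zero, c'.cutFn_apply, hcut', one_mul, one_mul] at h2
    exact h2.symm
  refine ⟨fun j => b (Sum.inl j) q.1, fun Z => ?_⟩
  have h1 := hWev Z
  rw [hW, F.ev_sub_left, F.ev_add_left, F.ev_smul_left, CorrTwoForm.ev_sum_smul_left,
    CorrTwoForm.ev_sum_smul_left] at h1
  change χ' q.1 * s q.1 * s' q.1 * F.ev q X Z - (∑ j, χ' q.1 * s' q.1 * b (Sum.inl j) q.1 * _ +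
    ∑ κ, s q.1 * b' κ q.1 * _) = 0 at h1
  simp only [hs1, hs1', hχ1, hb'0, one_mul, mul_one, zero_mul, Finset.sum_const_zero,
    add_zero] at h1
  exact sub_eq_zero.1 h1

/-- Non-degeneracy of the pairing of the fundamental fields of the two factors. -/
theorem eq_zero_of_ev_vert (hF : F.IsNondegenerate) (q : Corr π π') {e : Fin k → ℝ}
    (h : ∀ j, F.ev q (relBox (vertFst hπ hπ' (Pi.single j 1))) (relBox (vertSnd hπ hπ' e)) = 0) :
    e = 0 := by
  have h1 := (hF q).2 (relBox (vertSnd hπ hπ' e)) ?_ fun X hX => ?_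
  · rw [relBox, pushSnd_boxSum] at h1
    exact eq_zero_of_vanishesAt_fundField _ h1
  · rw [relBox, pushFst_boxSum]
    exact Submodule.zero_mem _
  · obtain ⟨r, hr⟩ := exists_ev_eq_sum hπ hπ' (F := F) q X hX
    have h2 := hr (relBox (vertSnd hπ hπ' e))
    simp only [h, mul_zero, Finset.sum_const_zero] at h2
    exact h2

end Nondegeneracy

/-! ## Gluing -/

section Gluing

variable {k n : ℕ} {M : Type*} [TopologicalSpace M] [ChartedSpace (EuclideanSpace ℝ (Fin n)) M]
  {ι : Type*} {s : ι → SmoothFn n M} (hs : ∀ x, ∃ i, s i x ≠ 0)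

include hs

theorem smoothFn_ext_of_cover {f g : SmoothFn n M} (h : ∀ i, s i * f = s i * g) : f = g := by
  ext x
  obtain ⟨i, hi⟩ := hs x
  exact mul_left_cancel₀ hi (congrArg (fun f : SmoothFn n M => f x) (h i))

/-- The compatibility condition says that the quotients f_i/s_i agree where they are defined, so
they form one smooth function; division replaces a partition of unity. -/
theorem exists_glue_smoothFn {f : ι → SmoothFn n M} (h : ∀ i j, s i * f j = s j * f i) :
    ∃ g : SmoothFn n M, ∀ i, s i * g = f i := by
  choose i hi using hs
  have h1 : ∀ j x, s j x * (f (i x) x / s (i x) x) = f j x := by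
    intro j x
    have := congrArg (fun f : SmoothFn n M => f x) (h j (i x))
    change s j x * f (i x) x = s (i x) x * f j x at this
    rw [mul_div_assoc', this, mul_div_cancel_left₀ _ (hi x)]
  refine ⟨⟨fun x => f (i x) x / s (i x) x, fun x => ?_⟩, fun j => by ext x; exact h1 j x⟩
  have h2 : ContMDiffAt (𝓡 n) 𝓘(ℝ, ℝ) ∞ (fun x' => f (i x) x' / s (i x) x') x :=
    (f (i x)).contMDiff.contMDiffAt.div₀ (s (i x)).contMDiff.contMDiffAt (hi x)
  refine h2.congr_of_eventuallyEq ?_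
  filter_upwards [(s (i x)).contMDiff.continuous.continuousAt.eventually_ne (hi x)] with x' hx'
  rw [eq_div_iff hx', mul_comm, h1]

variable [MulAction (Torus k) M]

/-- Near a point with s_i ≠ 0 the quotient of f by the radial product is g/s_i. The radial product
is non-zero at free points, which are dense, so these local quotients patch. -/
theorem mem_ellipticDivisor_of_cover {f : SmoothFn n M}
    (h : ∀ i, s i * f ∈ ellipticDivisor k n M) : f ∈ ellipticDivisor k n M := by
  intro c
  have hd : ∀ x ∈ c.chart.source, ∀ t ∈ 𝓝 x, ∃ x' ∈ t, ((c.radialProduct x' : ℝ) : ℂ) ≠ 0 := by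
    intro x hx t ht
    obtain ⟨x', h1, h2⟩ := c.mem_closure_isFreePoint hx (inter_mem ht (c.isOpen_source.mem_nhds hx))
    refine ⟨x', h1.1, ?_⟩
    rw [Complex.ofReal_ne_zero, StandardChart.radialProduct]
    exact Finset.prod_ne_zero_iff.2 fun i _ =>
      pow_ne_zero 2 (norm_ne_zero_iff.2 ((c.isFreePoint_iff h1.2).1 h2 i))
  obtain ⟨γ, hγ, hf⟩ := exists_contMDiffOn_of_local_division (I := 𝓡 n)
    (w := fun x => ((f x : ℝ) : ℂ)) hd fun x hx => by
      obtain ⟨i, hi⟩ := hs x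
      obtain ⟨g, hg, hfg⟩ := h i c
      refine ⟨fun x => ((g x / s i x : ℝ) : ℂ), c.chart.source ∩ {x | s i x ≠ 0},
        c.isOpen_source.inter ((s i).contMDiff.continuous.isOpen_preimage _ isOpen_ne), ⟨hx, hi⟩,
        inter_subset_left, ?_, fun p hp => ?_⟩
      · exact Complex.ofRealCLM.contDiff.contMDiff.comp_contMDiffOn
          ((hg.mono inter_subset_left).div₀ (s i).contMDiff.contMDiffOn fun p hp => hp.2)
      · have h1 : s i p * f p = _ := hfg p hp.1
        rw [← Complex.ofReal_mul, mul_div_assoc', ← h1, mul_div_cancel_left₀ _ hp.2]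
  refine ⟨fun x => (γ x).re, StandardChart.smooth_of_complex hγ Complex.reCLM, fun x hx => ?_⟩
  have := congrArg Complex.re (hf x hx)
  simpa using this

theorem exists_glue_section {X : ι → ellipticTangent k n M} (h : ∀ i j, s i • X j = s j • X i) :
    ∃ Y : ellipticTangent k n M, ∀ i, s i • Y = X i := by
  choose D hD using fun g => exists_glue_smoothFn hs (f := fun i => (X i).1 g) fun i j =>
    congrArg (fun X : ellipticTangent k n M => X.1 g) (h i j)
  refine ⟨⟨Derivation.mk' { toFun := D, map_add' := fun f g => ?_, map_smul' := fun a f => ?_ }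
    fun f g => ?_, ?_⟩, fun i => ?_⟩
  · refine smoothFn_ext_of_cover hs fun i => ?_
    rw [mul_add, hD, hD, hD, map_add]
  · refine smoothFn_ext_of_cover hs fun i => ?_
    rw [RingHom.id_apply, mul_smul_comm, hD, hD, Derivation.map_smul]
  · refine smoothFn_ext_of_cover hs fun i => ?_
    change s i * D (f * g) = s i * (f * D g + g * D f)
    rw [mul_add, mul_left_comm, mul_left_comm (s i) g, hD, hD, hD, Derivation.leibniz]
    rfl
  · rintro I rfl f hf
    refine mem_ellipticDivisor_of_cover hs fun i => ?_
    change s i * D f ∈ _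
    rw [hD]
    exact (X i).2 _ (by simp) f hf
  · refine ellipticTangent_ext fun g x => ?_
    exact congrArg (fun f : SmoothFn n M => f x) (hD g i)

theorem exists_glue_dual {ξ : ι → EllipticDual k n M} (h : ∀ i j, s i • ξ j = s j • ξ i) :
    ∃ η : EllipticDual k n M, ∀ i, s i • η = ξ i := by
  choose D hD using fun X => exists_glue_smoothFn hs (f := fun i => ξ i X) fun i j =>
    congrArg (fun ξ : EllipticDual k n M => ξ X) (h i j)
  refine ⟨{ toFun := D, map_add' := fun X Y => ?_, map_smul' := fun f X => ?_ }, fun i => ?_⟩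
  · refine smoothFn_ext_of_cover hs fun i => ?_
    rw [mul_add, hD, hD, hD, map_add]
  · refine smoothFn_ext_of_cover hs fun i => ?_
    rw [RingHom.id_apply, smul_eq_mul, mul_left_comm, hD, hD, map_smul, smul_eq_mul]
  · ext1 X
    exact hD X i

end Gluing

/-! ## Pairings of pairs of sections -/

section RelPairing

variable {k n n' : ℕ} {M M' : Type*} [TopologicalSpace M]
  [ChartedSpace (EuclideanSpace ℝ (Fin n)) M] [TopologicalSpace M']
  [ChartedSpace (EuclideanSpace ℝ (Fin n')) M'] [MulAction (Torus k) M] [MulAction (Torus k) M']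
  {B : Type*} [TopologicalSpace B] {CB : Subalgebra ℝ (B → ℝ)} {π : M → B} {π' : M' → B}
  [SmoothTorusAction k n M] [SmoothTorusAction k n' M']
  {hπ : IsStandardQuotient k n CB π} {hπ' : IsStandardQuotient k n' CB π'}

/-- Exchange of the two factors. -/
def relSwap : relPairs hπ hπ' →ₗ[CB] relPairs hπ' hπ where
  toFun p := ⟨(p.1.2, p.1.1), p.2.2.1, p.2.1, fun f q =>
    (p.2.2.2 f ⟨(q.1.2, q.1.1), q.2.symm⟩).symm⟩
  map_add' _ _ := rfl
  map_smul' _ _ := rfl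

theorem relPairs_sum_fst {ι : Type*} (t : Finset ι) (p : ι → relPairs hπ hπ') :
    (∑ i ∈ t, p i).1.1 = ∑ i ∈ t, (p i).1.1 :=
  map_sum ((AddMonoidHom.fst _ _).comp (relPairsSubgroup hπ hπ').subtype) _ _

theorem relPairs_sum_snd {ι : Type*} (t : Finset ι) (p : ι → relPairs hπ hπ') :
    (∑ i ∈ t, p i).1.2 = ∑ i ∈ t, (p i).1.2 :=
  map_sum ((AddMonoidHom.snd _ _).comp (relPairsSubgroup hπ hπ').subtype) _ _

theorem dual_smul (ξ : EllipticDual k n M) (f : SmoothFn n M) (X : ellipticTangent k n M) :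
    ξ (f • X) = f * ξ X := by
  rw [map_smul, smul_eq_mul]

theorem translate_apply_of_invariant {ξ : EllipticDual k n M} (hξ : IsInvariantDual ξ)
    {X : ellipticTangent k n M} (hX : IsInvariantSection X) (t : Torus k) :
    translate t (ξ X) = ξ X := (hξ t X X (hX t)).symm

variable (hπ hπ') in
/-- The pairing of an invariant one-form of the first factor with pairs of sections. -/
def dualFst {ξ : EllipticDual k n M} (hξ : IsInvariantDual ξ) : relPairs hπ hπ' →ₗ[CB] CB where
  toFun p := descend hπ (ξ p.1.1) (translate_apply_of_invariant hξ p.2.1)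
  map_add' p p' := basePullback_injective hπ (by
    have h : ξ (p + p').1.1 = ξ p.1.1 + ξ p'.1.1 := ξ.map_add p.1.1 p'.1.1
    rw [map_add, basePullback_descend, basePullback_descend, basePullback_descend, h])
  map_smul' f p := basePullback_injective hπ (by
    have h : ξ (f • p).1.1 = basePullback hπ f * ξ p.1.1 := by
      rw [relPairs_smul_fst, dual_smul]
    refine ((basePullback_descend hπ _ _).trans h).trans ?_
    exact (congrArg (basePullback hπ f * ·) (basePullback_descend hπ (ξ p.1.1)
      (translate_apply_of_invariant hξ p.2.1)).symm).trans (map_mul (basePullback hπ) f _).symm)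

theorem basePullback_dualFst {ξ : EllipticDual k n M} (hξ : IsInvariantDual ξ)
    (p : relPairs hπ hπ') : basePullback hπ (dualFst hπ hπ' hξ p) = ξ p.1.1 :=
  basePullback_descend _ _ (translate_apply_of_invariant hξ p.2.1)

variable (hπ hπ') in
/-- The pairing of an invariant one-form of the second factor with pairs of sections. -/
def dualSnd {ξ : EllipticDual k n' M'} (hξ : IsInvariantDual ξ) : relPairs hπ hπ' →ₗ[CB] CB :=
  dualFst hπ' hπ hξ ∘ₗ relSwap

theorem basePullback_dualSnd {ξ : EllipticDual k n' M'} (hξ : IsInvariantDual ξ)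
    (p : relPairs hπ hπ') : basePullback hπ' (dualSnd hπ hπ' hξ p) = ξ p.1.2 :=
  basePullback_dualFst hξ (relSwap p)

variable [T2Space M] [IsManifold (𝓡 n) ∞ M] [T2Space M'] [IsManifold (𝓡 n') ∞ M']

theorem vertSnd_eq_sum (e : Fin k → ℝ) :
    vertSnd hπ hπ' e = ∑ j, algebraMap ℝ CB (e j) • vertSnd hπ hπ' (Pi.single j 1) := by
  refine relPairs_ext ?_ ?_
  · rw [relPairs_sum_fst]
    refine (Finset.sum_eq_zero fun j _ => ?_).symm
    exact smul_zero (basePullback hπ _)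
  · rw [relPairs_sum_snd]
    exact fundField_eq_sum _ _

theorem isUnit_of_ne_zero (hπ : IsStandardQuotient k n CB π) {g : CB} (hg : ∀ b, g.1 b ≠ 0) :
    IsUnit g := by
  have h : (fun b => (g.1 b)⁻¹) ∈ CB := (hπ.mem_iff_smooth _).2
    (((hπ.mem_iff_smooth _).1 g.2).inv₀ fun x => hg (π x))
  refine IsUnit.of_mul_eq_one ⟨_, h⟩ (Subtype.ext (funext fun b => ?_))
  exact mul_inv_cancel₀ (hg b)

variable (hπ hπ') in
/-- Alternating pairings of pairs of sections with the same anchor, which are non-degenerate on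
the fundamental fields of the two factors. -/
structure RelPairing where
  form : relPairs hπ hπ' →ₗ[CB] relPairs hπ hπ' →ₗ[CB] CB
  swap : ∀ p p', form p p' = -form p' p
  isUnit : IsUnit (Matrix.of fun i j =>
    form (vertFst hπ hπ' (Pi.single i 1)) (vertSnd hπ hπ' (Pi.single j 1)))

/-- The opposite pairing, with the roles of the two factors exchanged. -/
def RelPairing.symm (φ : RelPairing hπ hπ') : RelPairing hπ' hπ where
  form := (φ.form.compl₁₂ relSwap relSwap).flip
  swap p p' := φ.swap _ _
  isUnit := by
    rw [← Matrix.isUnit_transpose]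
    convert φ.isUnit using 1
    ext1 i j
    rfl

/-- The pairing defined by an invariant non-degenerate two-form on the correspondence space. -/
theorem CorrTwoForm.exists_relPairing {F : CorrTwoForm k n n' π π'} (hF : F.IsInvariant)
    (hF' : F.IsNondegenerate) : ∃ φ : RelPairing hπ hπ', ∀ (p p' : relPairs hπ hπ')
      (q : Corr π π'), (φ.form p p').1 (π q.1.1) = F.ev q (relBox p) (relBox p') := by
  choose φ hφ using EllipticTDuality.exists_relPairing (hπ := hπ) (hπ' := hπ') hF
  have hs := hπ.isQuotientMap.surjective
  have hs' := hπ'.isQuotientMap.surjective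
  have hext : ∀ {f g : CB}, (∀ q : Corr π π', f.1 (π q.1.1) = g.1 (π q.1.1)) → f = g := by
    intro f g h
    apply Subtype.ext
    funext b
    obtain ⟨x, rfl⟩ := hs b
    obtain ⟨y, hy⟩ := hs' (π x)
    exact h ⟨(x, y), hy.symm⟩
  have hswap : ∀ p p', φ p p' = -φ p' p := fun p p' => hext fun q => by
    change _ = -(φ p' p).1 _
    rw [hφ, hφ, F.ev_swap]
  have hadd : ∀ p p' z, φ (p + p') z = φ p z + φ p' z := fun p p' z => hext fun q => by
    change _ = (φ p z).1 _ + (φ p' z).1 _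
    rw [hφ, hφ, hφ, relBox_add, F.ev_add_left]
  have hsmul : ∀ (g : CB) p z, φ (g • p) z = g • φ p z := fun g p z => hext fun q => by
    change _ = g.1 _ * (φ p z).1 _
    rw [hφ, hφ, ev_relBox_smul]
  refine ⟨⟨LinearMap.mk₂ CB φ hadd hsmul (fun p z z' => ?_) (fun g p z => ?_), hswap, ?_⟩, hφ⟩
  · rw [hswap, hadd, hswap z, hswap z', neg_add, neg_neg, neg_neg]
  · rw [hswap, hsmul, hswap z, smul_neg, neg_neg]
  -- A nowhere vanishing function on B is a unit, so the determinant is tested pointwise. A kernel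
  -- vector v of the matrix at a point would be a fundamental field of the second factor pairing
  -- there to zero with all those of the first, contradicting non-degeneracy.
  · rw [Matrix.isUnit_iff_isUnit_det]
    refine isUnit_of_ne_zero hπ fun b hb => ?_
    obtain ⟨x, rfl⟩ := hs b
    obtain ⟨y, hy⟩ := hs' (π x)
    set q : Corr π π' := ⟨(x, y), hy.symm⟩ with hq
    set ε : CB →+* ℝ := (Pi.evalRingHom (fun _ : B => ℝ) (π x)).comp CB.val.toRingHom with hε
    change ε _ = 0 at hb
    rw [RingHom.map_det] at hb
    obtain ⟨v, hv, hv0⟩ := Matrix.exists_mulVec_eq_zero_iff.2 hb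
    refine hv (eq_zero_of_ev_vert (hπ := hπ) (hπ' := hπ') hF' q fun j => ?_)
    have h := congrFun hv0 j
    have hlin : φ (vertSnd hπ hπ' v) (vertFst hπ hπ' (Pi.single j 1)) = -∑ j', algebraMap ℝ CB (v j') •
        φ (vertFst hπ hπ' (Pi.single j 1)) (vertSnd hπ hπ' (Pi.single j' 1)) := by
      have := map_sum (AddMonoidHom.mk' (fun p => φ p (vertFst hπ hπ' (Pi.single j 1)))
        fun p p' => hadd p p' _) (fun j' => algebraMap ℝ CB (v j') • vertSnd hπ hπ' (Pi.single j' 1))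
        Finset.univ
      rw [vertSnd_eq_sum, ← Finset.sum_neg_distrib]
      refine this.trans (Finset.sum_congr rfl fun j' _ => ?_)
      change φ (algebraMap ℝ CB (v j') • _) _ = _
      rw [hsmul, hswap, smul_neg]
    rw [F.ev_swap, ← hφ, hlin]
    change -ε (-_) = 0
    rw [map_neg, neg_neg, map_sum]
    refine Eq.trans ?_ h
    refine Finset.sum_congr rfl fun j' _ => ?_
    rw [smul_eq_mul, map_mul, mul_comm]
    rfl

end RelPairing

/-! ### Sections with prescribed anchor and prescribed pairing with vertical fields -/

section Existence

variable {k n n' : ℕ} {M M' : Type*} [TopologicalSpace M]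
  [ChartedSpace (EuclideanSpace ℝ (Fin n)) M] [TopologicalSpace M']
  [ChartedSpace (EuclideanSpace ℝ (Fin n')) M'] [MulAction (Torus k) M] [MulAction (Torus k) M']
  {B : Type*} [TopologicalSpace B] {CB : Subalgebra ℝ (B → ℝ)} {π : M → B} {π' : M' → B}
  [SmoothTorusAction k n M] [SmoothTorusAction k n' M']
  {hπ : IsStandardQuotient k n CB π} {hπ' : IsStandardQuotient k n' CB π'}
  [T2Space M] [IsManifold (𝓡 n) ∞ M] [T2Space M'] [IsManifold (𝓡 n') ∞ M']

set_option maxHeartbeats 800000 in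
/-- Invariant sections with trivial anchor are locally combinations of fundamental fields. -/
theorem exists_smul_eq_sum_vertSnd {p : relPairs hπ hπ'} (hp : p.1.1 = 0) (y : M') :
    ∃ (s : CB) (d : Fin k → CB), s.1 (π' y) = 1 ∧
      s • p = ∑ j, d j • vertSnd hπ hπ' (Pi.single j 1) := by
  obtain ⟨c, hy⟩ := hπ'.exists_chart y
  set C := c.normSq y with hC
  have hcut : c.cut C y = 1 := c.cut_eq_one hy le_rfl
  obtain ⟨χ, hχ⟩ := exists_cut_base hπ' c C
  have hχ' : basePullback hπ' χ = c.cutFn C := by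
    ext y
    rw [basePullback_apply, hχ, c.cutFn_apply]
  -- Coefficients of an invariant section are invariant, so they descend to B after multiplication
  -- by an invariant cut-off.
  choose d hd using fun κ : c.Idx => exists_descend hπ'
    (c.cutFn C * c.coeff C hπ'.exists_chart κ p.1.2) fun t => by
      rw [← hχ', map_mul, translate_basePullback, ← c.coeff_translate C _ (p.2.2.1 t)]
  have hanchor : ∀ (f : CB) (y : M'), p.1.2.1 (basePullback hπ' f) y = 0 := by
    intro f y
    obtain ⟨x, hx⟩ := hπ.isQuotientMap.surjective (π' y)
    have := p.2.2.2 f ⟨(x, y), hx⟩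
    rw [hp] at this
    exact this.symm
  have hsum := c.sum_coeff_smul C hπ'.exists_chart p.1.2
  -- The anchor is zero, so applying the section to the test functions kills the radial and real
  -- coefficients at free points, hence everywhere.
  have h0 : ∀ i, d (Sum.inr i) = 0 := by
    intro i
    apply basePullback_injective hπ'
    rw [hd, map_zero]
    ext y
    change c.cutFn C y * c.coeff C hπ'.exists_chart (Sum.inr i) p.1.2 y = 0
    rw [c.cutFn_apply]
    by_cases hy0 : c.cut C y = 0
    · rw [hy0, zero_mul]
    refine mul_eq_zero_of_right _ (c.eq_zero_of_isFreePoint (C := C)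
      (c.coeff C hπ'.exists_chart (Sum.inr i) p.1.2).contMDiff.continuous (fun y hy hfree => ?_) hy0)
    have h1 := congrArg (fun X : ellipticTangent k n' M' =>
      X.1 (basePullback hπ' (c.testFn C hπ' i)) y) hsum
    beta_reduce at h1
    have h2 : ((c.cutFn C * c.cutFn C) • p.1.2).1 (basePullback hπ' (c.testFn C hπ' i)) y = 0 :=
      mul_eq_zero_of_right _ (hanchor _ y)
    have h3 : ∀ j, (c.basis C hπ'.exists_chart (Sum.inl j)).1
        (basePullback hπ' (c.testFn C hπ' i)) y = 0 := fun j =>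
      congrArg (fun F : SmoothFn n' M' => F y) (fundField_basePullback hπ' _ _)
    have h4 : ∀ i', (c.basis C hπ'.exists_chart (Sum.inr i')).1
        (basePullback hπ' (c.testFn C hπ' i)) y = _ := fun i' => c.frame_testFn C hπ' i' i y
    obtain ⟨hyc, hyC⟩ := c.mem_of_cut_ne_zero hy
    rw [h2] at h1
    rw [sum_smul_apply, Fintype.sum_sum_type] at h1
    simp only [h3, h4, mul_zero, Finset.sum_const_zero,
      zero_add, mul_ite, Finset.sum_ite_eq', Finset.mem_univ, if_true,
      c.cut_eq_one hyc hyC.le, one_mul] at h1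
    refine (mul_eq_zero.1 h1).resolve_right ?_
    rcases i with i | j
    · have := norm_ne_zero_iff.2 ((c.isFreePoint_iff hyc).1 hfree i)
      simpa using this
    · simp
  have h2 : ∀ κ, c.cutFn C • c.coeff C hπ'.exists_chart κ p.1.2 •
      c.basis C hπ'.exists_chart κ = basePullback hπ' (d κ) • c.basis C hπ'.exists_chart κ :=
    fun κ => by rw [hd, mul_smul]
  have key : (c.cutFn C * c.cutFn C * c.cutFn C) • p.1.2 = ∑ j, basePullback hπ' (d (Sum.inl j)) •
      c.basis C hπ'.exists_chart (Sum.inl j) := by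
    rw [mul_comm, mul_smul, ← hsum, Finset.smul_sum, Finset.sum_congr rfl fun κ _ => h2 κ,
      Fintype.sum_sum_type, add_eq_left]
    refine Finset.sum_eq_zero fun i _ => ?_
    rw [h0, map_zero, zero_smul]
  -- Two factors come from `sum_coeff_smul`, the third from making the coefficients functions on B.
  refine ⟨χ * χ * χ, fun j => d (Sum.inl j), ?_, ?_⟩
  · change χ.1 _ * χ.1 _ * χ.1 _ = 1
    rw [hχ, hcut, mul_one, mul_one]
  · refine relPairs_ext ?_ ?_
    · rw [relPairs_smul_fst, hp, smul_zero, relPairs_sum_fst]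
      exact (Finset.sum_eq_zero fun j _ => smul_zero (basePullback hπ _)).symm
    · have h3 : basePullback hπ' (χ * χ * χ) = c.cutFn C * c.cutFn C * c.cutFn C := by
        rw [map_mul, map_mul, hχ']
      have h4 := relPairs_sum_snd Finset.univ
        fun j => d (Sum.inl j) • vertSnd hπ hπ' (Pi.single j 1)
      rw [h4, relPairs_smul_snd, h3]
      exact key

namespace RelPairing

variable (φ : RelPairing hπ hπ')

/-- The matrix of the pairing between the fundamental fields. -/
def matrix : Matrix (Fin k) (Fin k) CB := Matrix.of fun i j =>
  φ.form (vertFst hπ hπ' (Pi.single i 1)) (vertSnd hπ hπ' (Pi.single j 1))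

theorem form_sum_vertSnd (d : Fin k → CB) (i : Fin k) :
    φ.form (∑ j, d j • vertSnd hπ hπ' (Pi.single j 1)) (vertFst hπ hπ' (Pi.single i 1)) =
      -(φ.matrix.mulVec d i) := by
  rw [map_sum, LinearMap.sum_apply, Matrix.mulVec, dotProduct, ← Finset.sum_neg_distrib]
  refine Finset.sum_congr rfl fun j _ => ?_
  rw [map_smul, LinearMap.smul_apply, φ.swap, smul_neg, smul_eq_mul, mul_comm]
  rfl

/-- Having no first component, p is locally a combination of vertical fields of M', and the
invertible matrix of the pairing forces its coefficients to vanish. This uniqueness allows local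
solutions to be glued. -/
theorem eq_zero_of_form_vertFst {p : relPairs hπ hπ'} (hp : p.1.1 = 0)
    (h : ∀ i, φ.form p (vertFst hπ hπ' (Pi.single i 1)) = 0) : p = 0 := by
  refine relPairs_ext hp (ellipticTangent_ext fun g y => ?_)
  obtain ⟨s, d, hs, hsum⟩ := exists_smul_eq_sum_vertSnd hp y
  have hd : d = 0 := by
    have hinj := Matrix.mulVec_injective_of_isUnit φ.isUnit
    apply hinj
    rw [Matrix.mulVec_zero]
    funext i
    have h1 := φ.form_sum_vertSnd d i
    rw [← hsum, map_smul, LinearMap.smul_apply, h, smul_zero] at h1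
    exact neg_eq_zero.1 h1.symm
  have h2 : (s • p).1.2.1 g y = 0 := by
    rw [hsum, hd]
    simp only [Pi.zero_apply, zero_smul, Finset.sum_const_zero]
    rfl
  change s.1 (π' y) * p.1.2.1 g y = 0 at h2
  rwa [hs, one_mul] at h2

/-- Local sections of the second factor with prescribed anchor and pairings. -/
theorem exists_local_section {X : ellipticTangent k n M} (hX : IsInvariantSection X)
    (u : Fin k → CB) (y : M') : ∃ (s : CB) (p : relPairs hπ hπ'), s.1 (π' y) = 1 ∧
      p.1.1 = basePullback hπ s • X ∧
      ∀ i, φ.form p (vertFst hπ hπ' (Pi.single i 1)) = s * u i := by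
  obtain ⟨c, hy⟩ := hπ'.exists_chart y
  obtain ⟨χ, hχ⟩ := exists_cut_base hπ' c (c.normSq y)
  obtain ⟨h, p, hp⟩ := exists_lift_pair hπ' hπ c (c.normSq y) hχ hX
  obtain ⟨N, hN⟩ := φ.isUnit.exists_right_inv
  -- A local lift of X is corrected by vertical fields of M', which do not change its anchor. Their
  -- pairings with those of M are minus the matrix applied to d, so d solves a linear system with
  -- invertible matrix.
  set d : Fin k → CB := N.mulVec fun i =>
    φ.form (relSwap p) (vertFst hπ hπ' (Pi.single i 1)) - χ * u i with hd
  have hd' : φ.matrix.mulVec d = fun i =>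
      φ.form (relSwap p) (vertFst hπ hπ' (Pi.single i 1)) - χ * u i := by
    rw [hd, Matrix.mulVec_mulVec]
    erw [hN]
    rw [Matrix.one_mulVec]
  refine ⟨χ, relSwap p + ∑ j, d j • vertSnd hπ hπ' (Pi.single j 1), ?_, ?_, fun i => ?_⟩
  · rw [hχ, c.cut_eq_one hy le_rfl]
  · have h1 : (∑ j, d j • vertSnd hπ hπ' (Pi.single j 1)).1.1 = 0 := by
      rw [relPairs_sum_fst]
      exact Finset.sum_eq_zero fun j _ => smul_zero (basePullback hπ _)
    refine (congrArg (p.1.2 + ·) h1).trans ((add_zero _).trans ?_)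
    rw [hp]
  · rw [map_add, LinearMap.add_apply, form_sum_vertSnd, hd']
    ring

/-- Sections of the second factor with prescribed anchor and pairings. -/
theorem exists_section {X : ellipticTangent k n M} (hX : IsInvariantSection X)
    (u : Fin k → CB) : ∃ p : relPairs hπ hπ', p.1.1 = X ∧
      ∀ i, φ.form p (vertFst hπ hπ' (Pi.single i 1)) = u i := by
  choose s p hs hp hu using φ.exists_local_section hX u
  have hcover : ∀ y, ∃ i, basePullback hπ' (s i) y ≠ 0 := fun y => ⟨y, by
    rw [basePullback_apply, hs]; exact one_ne_zero⟩
  -- Both sides have the same first component and the same pairings with the vertical fields of M,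
  -- hence coincide.
  have hcompat : ∀ i j, s i • p j = s j • p i := by
    intro i j
    rw [← sub_eq_zero]
    refine φ.eq_zero_of_form_vertFst ?_ fun l => ?_
    · change basePullback hπ (s i) • (p j).1.1 - basePullback hπ (s j) • (p i).1.1 = 0
      rw [hp, hp, smul_smul, smul_smul, mul_comm, sub_self]
    · rw [map_sub, map_smul, map_smul, LinearMap.sub_apply, LinearMap.smul_apply,
        LinearMap.smul_apply, hu, hu, smul_eq_mul, smul_eq_mul]
      ring
  obtain ⟨Y, hY⟩ := exists_glue_section hcover (X := fun i => (p i).1.2) fun i j =>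
    congrArg (fun p : relPairs hπ hπ' => p.1.2) (hcompat i j)
  have hYinv : IsInvariantSection Y := by
    intro t f
    refine smoothFn_ext_of_cover hcover fun i => ?_
    have h1 := (p i).2.2.1 t f
    rw [← hY i] at h1
    change basePullback hπ' (s i) * Y.1 (translate t f) =
      translate t (basePullback hπ' (s i) * Y.1 f) at h1
    rw [h1, map_mul, translate_basePullback]
  have hYrel : Related hπ hπ' X Y := by
    intro f q
    have h1 := (p q.1.2).2.2.2 f q
    rw [hp, ← hY] at h1
    change (s q.1.2).1 (π q.1.1) * X.1 _ q.1.1 = (s q.1.2).1 (π' q.1.2) * Y.1 _ q.1.2 at h1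
    rwa [q.2, hs, one_mul, one_mul] at h1
  set z : relPairs hπ hπ' := ⟨(X, Y), hX, hYinv, hYrel⟩ with hz
  refine ⟨z, rfl, fun i => ?_⟩
  apply Subtype.ext
  funext b
  obtain ⟨y, rfl⟩ := hπ'.isQuotientMap.surjective b
  have h1 : s y • z = p y :=
    relPairs_ext (hp y).symm (hY y)
  have h2 := hu y i
  rw [← h1, map_smul, LinearMap.smul_apply] at h2
  have h3 := congrFun (congrArg Subtype.val h2) (π' y)
  change (s y).1 (π' y) * _ = (s y).1 (π' y) * _ at h3
  rwa [hs, one_mul, one_mul] at h3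

end RelPairing

end Existence

/-! ### The relation between the two Courant algebroids is a bijection -/

section Relation

variable {k n n' : ℕ} {M M' : Type*} [TopologicalSpace M]
  [ChartedSpace (EuclideanSpace ℝ (Fin n)) M] [TopologicalSpace M']
  [ChartedSpace (EuclideanSpace ℝ (Fin n')) M'] [MulAction (Torus k) M] [MulAction (Torus k) M']
  {B : Type*} [TopologicalSpace B] {CB : Subalgebra ℝ (B → ℝ)} {π : M → B} {π' : M' → B}
  [SmoothTorusAction k n M] [SmoothTorusAction k n' M']
  {hπ : IsStandardQuotient k n CB π} {hπ' : IsStandardQuotient k n' CB π'}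
  [T2Space M] [IsManifold (𝓡 n) ∞ M] [T2Space M'] [IsManifold (𝓡 n') ∞ M']

theorem exists_smul_eq_sum_vertFst {p : relPairs hπ hπ'} (hp : p.1.2 = 0) (x : M) :
    ∃ (s : CB) (d : Fin k → CB), s.1 (π x) = 1 ∧
      s • p = ∑ j, d j • vertFst hπ hπ' (Pi.single j 1) := by
  obtain ⟨s, d, hs, h⟩ := exists_smul_eq_sum_vertSnd (p := relSwap p) hp x
  refine ⟨s, d, hs, ?_⟩
  have h1 := congrArg (relSwap (hπ := hπ') (hπ' := hπ)) h
  rw [map_smul, map_sum] at h1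
  simp only [map_smul] at h1
  exact h1

theorem base_ext {f g : CB} (hπ : IsStandardQuotient k n CB π)
    (h : ∀ x, f.1 (π x) = g.1 (π x)) : f = g :=
  basePullback_injective hπ (ContMDiffMap.ext h)

theorem dualSnd_eq_zero {ξ : EllipticDual k n' M'} (hξ : IsInvariantDual ξ)
    {p : relPairs hπ hπ'} (hp : p.1.2 = 0) : dualSnd hπ hπ' hξ p = 0 := by
  apply basePullback_injective hπ'
  rw [basePullback_dualSnd, hp, map_zero, map_zero]

namespace RelPairing

variable (φ : RelPairing hπ hπ')

include φ in
-- Existence for the opposite pairing, with arbitrary prescribed values, here 0: only the lift of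
-- the anchor matters.
theorem exists_lift {Y : ellipticTangent k n' M'} (hY : IsInvariantSection Y) :
    ∃ z : relPairs hπ hπ', z.1.2 = Y := by
  obtain ⟨p, hp, -⟩ := φ.symm.exists_section hY 0
  exact ⟨relSwap p, hp⟩

include φ in
-- The frame fields of M' are invariant, so they occur as second components of pairs, and a one-form
-- is determined by its values on local frames.
theorem dual_ext {η η' : EllipticDual k n' M'}
    (h : ∀ z : relPairs hπ hπ', η z.1.2 = η' z.1.2) : η = η' := by
  ext1 Y
  ext y
  obtain ⟨c, hy⟩ := hπ'.exists_chart y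
  have hcut : c.cut (c.normSq y) y = 1 := c.cut_eq_one hy le_rfl
  have hb : ∀ κ, η (c.basis (c.normSq y) hπ'.exists_chart κ) =
      η' (c.basis (c.normSq y) hπ'.exists_chart κ) := by
    intro κ
    obtain ⟨z, hz⟩ := φ.exists_lift (c.basis_invariant (c.normSq y) hπ'.exists_chart κ)
    rw [← hz, h]
  have h1 : ∀ η : EllipticDual k n' M', c.cutFn (c.normSq y) * c.cutFn (c.normSq y) * η Y =
      ∑ κ, c.coeff (c.normSq y) hπ'.exists_chart κ Y *
        η (c.basis (c.normSq y) hπ'.exists_chart κ) := by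
    intro η
    rw [← dual_smul, ← c.sum_coeff_smul (c.normSq y) hπ'.exists_chart, map_sum]
    exact Finset.sum_congr rfl fun κ _ => dual_smul _ _ _
  have h2 := (h1 η).trans ((Finset.sum_congr rfl fun κ _ => by rw [hb]).trans (h1 η').symm)
  have h3 := congrArg (fun f : SmoothFn n' M' => f y) h2
  change c.cutFn _ y * c.cutFn _ y * η Y y = c.cutFn _ y * c.cutFn _ y * η' Y y at h3
  rwa [c.cutFn_apply, hcut, one_mul, one_mul, one_mul] at h3

include φ in
-- The one-form is defined on the frame of a chart by the values of θ on lifts of the frame fields.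
-- It does not depend on the lifts, because two lifts differ by a pair without second component,
-- which θ kills. The factor s = χ² comes from `sum_coeff_smul`.
theorem exists_local_dual {θ : relPairs hπ hπ' →ₗ[CB] CB} (hθ : ∀ z, z.1.2 = 0 → θ z = 0)
    (y : M') : ∃ (s : CB) (η : EllipticDual k n' M'), s.1 (π' y) = 1 ∧ IsInvariantDual η ∧
      ∀ z : relPairs hπ hπ', η z.1.2 = basePullback hπ' (s * θ z) := by
  obtain ⟨c, hy⟩ := hπ'.exists_chart y
  set C := c.normSq y with hC
  have hcut : c.cut C y = 1 := c.cut_eq_one hy le_rfl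
  obtain ⟨χ, hχ⟩ := exists_cut_base hπ' c C
  have hχ' : basePullback hπ' χ = c.cutFn C := by
    ext y
    rw [basePullback_apply, hχ, c.cutFn_apply]
  choose w hw using fun κ => φ.exists_lift (c.basis_invariant C hπ'.exists_chart κ)
  have hη : ∀ X, (∑ κ, basePullback hπ' (θ (w κ)) • c.coeff C hπ'.exists_chart κ) X =
      ∑ κ, basePullback hπ' (θ (w κ)) * c.coeff C hπ'.exists_chart κ X := by
    intro X
    rw [LinearMap.sum_apply]
    rfl
  refine ⟨χ * χ, ∑ κ, basePullback hπ' (θ (w κ)) • c.coeff C hπ'.exists_chart κ, ?_, ?_, ?_⟩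
  · change χ.1 _ * χ.1 _ = 1
    rw [hχ, hcut, mul_one]
  · intro t X' X hX
    rw [hη, hη, map_sum]
    refine Finset.sum_congr rfl fun κ _ => ?_
    rw [map_mul, translate_basePullback, c.coeff_translate C _ hX]
  · intro z
    choose a ha using fun κ : c.Idx => exists_descend hπ'
      (c.coeff C hπ'.exists_chart κ z.1.2) fun t => (c.coeff_translate C _ (z.2.2.1 t) κ).symm
    have h1 : (∑ κ, a κ • w κ).1.2 = ((χ * χ) • z).1.2 := by
      have h3 := relPairs_sum_snd Finset.univ fun κ => a κ • w κ
      rw [h3, relPairs_smul_snd, map_mul, hχ', ← c.sum_coeff_smul C hπ'.exists_chart]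
      exact Finset.sum_congr rfl fun κ _ => by rw [relPairs_smul_snd, hw, ha]
    have h2 := hθ (∑ κ, a κ • w κ - (χ * χ) • z) (sub_eq_zero.2 h1)
    rw [map_sub, map_sum, map_smul, sub_eq_zero, smul_eq_mul] at h2
    rw [hη, ← h2, map_sum]
    refine Finset.sum_congr rfl fun κ _ => ?_
    rw [map_smul, smul_eq_mul, map_mul, ha, mul_comm]

include φ in
/-- Forms on pairs of sections which vanish on vertical sections of the first factor are invariant
one-forms of the second factor. -/
theorem exists_dualSnd_eq {θ : relPairs hπ hπ' →ₗ[CB] CB} (hθ : ∀ z, z.1.2 = 0 → θ z = 0) :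
    ∃ (η : EllipticDual k n' M') (hη : IsInvariantDual η), ∀ z, dualSnd hπ hπ' hη z = θ z := by
  choose s η hs hη hηθ using φ.exists_local_dual hθ
  have hcover : ∀ y, ∃ i, basePullback hπ' (s i) y ≠ 0 := fun y => ⟨y, by
    rw [basePullback_apply, hs]; exact one_ne_zero⟩
  obtain ⟨ζ, hζ⟩ := exists_glue_dual hcover (ξ := η) fun i j => φ.dual_ext fun z => by
    change basePullback hπ' (s i) * η j z.1.2 = basePullback hπ' (s j) * η i z.1.2
    rw [hηθ, hηθ, map_mul, map_mul, mul_left_comm]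
  have hζ' : ∀ i X, basePullback hπ' (s i) * ζ X = η i X := fun i X => by
    rw [← hζ]; rfl
  have hinv : IsInvariantDual ζ := fun t X' X hX => smoothFn_ext_of_cover hcover fun i => by
    rw [hζ', hη i t X' X hX, ← hζ', map_mul, translate_basePullback]
  refine ⟨ζ, hinv, fun z => basePullback_injective hπ' ?_⟩
  refine smoothFn_ext_of_cover hcover fun i => ?_
  rw [basePullback_dualSnd, hζ', hηθ, map_mul]

/-- The relation between invariant sections of the two Courant algebroids defined by a pairing. -/
def Rel (e : ReducedSections hπ) (e' : ReducedSections hπ') : Prop :=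
  ∃ p : relPairs hπ hπ', p.1 = (e.1.1, e'.1.1) ∧
    ∀ z, dualFst hπ hπ' e.2.2 z - dualSnd hπ hπ' e'.2.2 z = φ.form p z

variable {φ}

theorem Rel.symm {e : ReducedSections hπ} {e' : ReducedSections hπ'} (h : φ.Rel e e') :
    φ.symm.Rel e' e := by
  obtain ⟨p, hp, h⟩ := h
  refine ⟨relSwap p, Prod.ext (congrArg Prod.snd hp) (congrArg Prod.fst hp), fun z => ?_⟩
  change dualSnd hπ hπ' e'.2.2 (relSwap z) - dualFst hπ hπ' e.2.2 (relSwap z) =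
    φ.form (relSwap z) p
  rw [φ.swap, ← h, neg_sub]

variable (φ) in
-- Non-degeneracy provides a lift p of X whose contraction with φ agrees with ξ on the vertical
-- fields of M. Then ξ − φ(p, ·) vanishes on all pairs without second component, since these are
-- locally combinations of such fields, and so it comes from a one-form on M'.
theorem exists_rel (e : ReducedSections hπ) : ∃ e' : ReducedSections hπ', φ.Rel e e' := by
  obtain ⟨p, hp, hp'⟩ := φ.exists_section (hπ' := hπ') e.2.1 fun i =>
    dualFst hπ hπ' e.2.2 (vertFst hπ hπ' (Pi.single i 1))
  obtain ⟨η, hη, h⟩ := φ.exists_dualSnd_eq (θ := dualFst hπ hπ' e.2.2 - φ.form p) fun z hz => by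
    refine base_ext hπ fun x => ?_
    obtain ⟨s, d, hs, h⟩ := exists_smul_eq_sum_vertFst hz x
    have h1 : (dualFst hπ hπ' e.2.2 - φ.form p) (s • z) = 0 := by
      rw [h, map_sum]
      refine Finset.sum_eq_zero fun j _ => ?_
      rw [map_smul, LinearMap.sub_apply, hp', sub_self, smul_zero]
    rw [map_smul, smul_eq_mul] at h1
    have h2 := congrFun (congrArg Subtype.val h1) (π x)
    change s.1 (π x) * _ = 0 at h2
    rwa [hs, one_mul] at h2
  refine ⟨⟨(p.1.2, η), p.2.2.1, hη⟩, p, Prod.ext hp rfl, fun z => ?_⟩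
  change _ - dualSnd hπ hπ' hη z = _
  rw [h, LinearMap.sub_apply, sub_sub_cancel]

/-- Forms of M' do not see the vertical fields of M, so the relation fixes the pairings of p with
these; together with the first component they determine p, hence X', and then ξ'. -/
theorem Rel.unique {e : ReducedSections hπ} {e₁ e₂ : ReducedSections hπ'} (h₁ : φ.Rel e e₁)
    (h₂ : φ.Rel e e₂) : e₁ = e₂ := by
  obtain ⟨p₁, hp₁, h₁⟩ := h₁
  obtain ⟨p₂, hp₂, h₂⟩ := h₂
  have h : p₁ = p₂ := by
    rw [← sub_eq_zero]
    refine φ.eq_zero_of_form_vertFst ?_ fun i => ?_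
    · refine sub_eq_zero.2 (?_ : p₁.1.1 = p₂.1.1)
      rw [hp₁, hp₂]
    · rw [map_sub, LinearMap.sub_apply, ← h₁, ← h₂, dualSnd_eq_zero _ rfl, dualSnd_eq_zero _ rfl,
        sub_self]
  have hX : e₁.1.1 = e₂.1.1 := by
    have := hp₁.symm.trans ((congrArg Subtype.val h).trans hp₂)
    exact congrArg Prod.snd this
  have hξ : e₁.1.2 = e₂.1.2 := φ.dual_ext fun z => by
    have h3 := (h₁ z).trans ((congrArg (fun p => φ.form p z) h).trans (h₂ z).symm)
    have h4 := sub_right_injective h3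
    rw [← basePullback_dualSnd e₁.2.2, ← basePullback_dualSnd e₂.2.2, h4]
  exact Subtype.ext (Prod.ext hX hξ)

end RelPairing

end Relation

/-! ### Compatibility with pairings, anchors and brackets -/

section Isomorphism

variable {k n n' : ℕ} {M M' : Type*} [TopologicalSpace M]
  [ChartedSpace (EuclideanSpace ℝ (Fin n)) M] [TopologicalSpace M']
  [ChartedSpace (EuclideanSpace ℝ (Fin n')) M'] [MulAction (Torus k) M] [MulAction (Torus k) M']
  {B : Type*} [TopologicalSpace B] {CB : Subalgebra ℝ (B → ℝ)} {π : M → B} {π' : M' → B}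
  [SmoothTorusAction k n M] [SmoothTorusAction k n' M']
  {hπ : IsStandardQuotient k n CB π} {hπ' : IsStandardQuotient k n' CB π'}
  [T2Space M] [IsManifold (𝓡 n) ∞ M] [T2Space M'] [IsManifold (𝓡 n') ∞ M']

/-! ### Brackets of pairs of sections -/

theorem Related.exists_anchor {X : ellipticTangent k n M} {X' : ellipticTangent k n' M'}
    (h : Related hπ hπ' X X') (hX : IsInvariantSection X) (f : CB) :
    ∃ g : CB, X.1 (basePullback hπ f) = basePullback hπ g ∧
      X'.1 (basePullback hπ' f) = basePullback hπ' g := by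
  obtain ⟨g, hg⟩ := EllipticTDuality.exists_anchor hπ hX f
  refine ⟨g, hg.symm, ?_⟩
  ext y
  obtain ⟨x, hx⟩ := hπ.isQuotientMap.surjective (π' y)
  rw [← h f ⟨(x, y), hx⟩, ← hg, basePullback_apply, basePullback_apply]
  exact congrArg g.1 hx

/-- Invariance lets X(π^*f) be again a pull-back from B, so the equality of anchors can be applied
twice. -/
theorem Related.lie {X Y : ellipticTangent k n M} {X' Y' : ellipticTangent k n' M'}
    (hX : Related hπ hπ' X X') (hY : Related hπ hπ' Y Y') (hX' : IsInvariantSection X)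
    (hY' : IsInvariantSection Y) : Related hπ hπ' ⁅X, Y⁆ ⁅X', Y'⁆ := by
  intro f q
  obtain ⟨g, hg, hg'⟩ := hX.exists_anchor hX' f
  obtain ⟨h, hh, hh'⟩ := hY.exists_anchor hY' f
  change X.1 (Y.1 (basePullback hπ f)) q.1.1 - Y.1 (X.1 (basePullback hπ f)) q.1.1 =
    X'.1 (Y'.1 (basePullback hπ' f)) q.1.2 - Y'.1 (X'.1 (basePullback hπ' f)) q.1.2
  rw [hg, hg', hh, hh', hX, hY]

instance : Bracket (relPairs hπ hπ') (relPairs hπ hπ') where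
  bracket p p' := ⟨(⁅p.1.1, p'.1.1⁆, ⁅p.1.2, p'.1.2⁆), fun t => (p.2.1 t).lie (p'.2.1 t),
    fun t => (p.2.2.1 t).lie (p'.2.2.1 t), p.2.2.2.lie p'.2.2.2 p.2.1 p'.2.1⟩

theorem relBox_pullFst (p : relPairs hπ hπ') (g : SmoothFn n M) :
    (relBox p).1 (pullFst g) = pullFst (p.1.1.1 g) := by
  ext q
  change p.1.1.1 g q.1 + boxSnd hπ.nonempty_localParam hπ'.nonempty_localParam p.1.2.1
    (pullFst g) q = _
  rw [boxSnd_pullFst]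
  exact add_zero _

theorem relBox_pullSnd (p : relPairs hπ hπ') (g : SmoothFn n' M') :
    (relBox p).1 (pullSnd g) = pullSnd (p.1.2.1 g) := by
  ext q
  change boxFst hπ.nonempty_localParam hπ'.nonempty_localParam p.1.1.1
    (pullSnd g) q + p.1.2.1 g q.2 = _
  rw [boxFst_pullSnd]
  exact zero_add _

theorem relBox_lie (p p' : relPairs hπ hπ') : relBox ⁅p, p'⁆ = ⁅relBox p, relBox p'⁆ := by
  apply Subtype.ext
  rw [← sub_eq_zero]
  refine prod_derivation_eq_zero hπ.nonempty_localParam hπ'.nonempty_localParam (fun g => ?_)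
    (fun g => ?_)
  · change (relBox ⁅p, p'⁆).1 (pullFst g) - ((relBox p).1 ((relBox p').1 (pullFst g)) -
      (relBox p').1 ((relBox p).1 (pullFst g))) = 0
    simp only [relBox_pullFst]
    exact sub_self _
  · change (relBox ⁅p, p'⁆).1 (pullSnd g) - ((relBox p).1 ((relBox p').1 (pullSnd g)) -
      (relBox p').1 ((relBox p).1 (pullSnd g))) = 0
    simp only [relBox_pullSnd]
    exact sub_self _

/-- The equation `H - H' = dF` for pairs of invariant sections. -/
theorem CorrTwoForm.IsPrimitive.apply_relPairs {F : CorrTwoForm k n n' π π'}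
    {H : EllipticForm k n M 3} {H' : EllipticForm k n' M' 3} (hF : F.IsPrimitive H H')
    {φ : RelPairing hπ hπ'} (hφ : ∀ (p p' : relPairs hπ hπ') (q : Corr π π'),
      (φ.form p p').1 (π q.1.1) = F.ev q (relBox p) (relBox p'))
    (X Y Z : relPairs hπ hπ') (q : Corr π π') :
    H ![X.1.1, Y.1.1, Z.1.1] q.1.1 - H' ![X.1.2, Y.1.2, Z.1.2] q.1.2 =
      X.1.1.1 (basePullback hπ (φ.form Y Z)) q.1.1 - Y.1.1.1 (basePullback hπ (φ.form X Z)) q.1.1 +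
      Z.1.1.1 (basePullback hπ (φ.form X Y)) q.1.1 - (φ.form ⁅X, Y⁆ Z).1 (π q.1.1) +
      (φ.form ⁅X, Z⁆ Y).1 (π q.1.1) - (φ.form ⁅Y, Z⁆ X).1 (π q.1.1) := by
  have h1 := hF (relBox X) (relBox Y) (relBox Z) q
  have hfst : ∀ p : relPairs hπ hπ', pushFst q.1.2 (relBox p) = p.1.1 := fun p =>
    pushFst_boxSum _ _
  have hsnd : ∀ p : relPairs hπ hπ', pushSnd q.1.1 (relBox p) = p.1.2 := fun p =>
    pushSnd_boxSum _ _
  have hmk : ∀ p p' : relPairs hπ hπ', F.toForm ![relBox p, relBox p'] =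
      Ideal.Quotient.mk _ (pullFst (basePullback hπ (φ.form p p'))) := fun p p' =>
    corrFn_ext fun q => (hφ p p' q).symm
  have hder : ∀ p p' p'' : relPairs hπ hπ', corrEval q ⁅relBox p, F.toForm ![relBox p', relBox p'']⁆ =
      p.1.1.1 (basePullback hπ (φ.form p' p'')) q.1.1 := by
    intro p p' p''
    rw [hmk]
    change (relBox p).1 (pullFst (basePullback hπ (φ.form p' p''))) q.1 = _
    rw [relBox_pullFst]
    rfl
  have hlie : ∀ p p' p'' : relPairs hπ hπ', corrEval q (F.toForm ![⁅relBox p, relBox p'⁆, relBox p'']) =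
      (φ.form ⁅p, p'⁆ p'').1 (π q.1.1) := by
    intro p p' p''
    rw [hφ, relBox_lie]
    rfl
  rw [hfst, hfst, hfst, hsnd, hsnd, hsnd] at h1
  rw [h1]
  simp only [extD2, map_sub, map_add, hder, hlie]

namespace RelPairing

variable {φ : RelPairing hπ hπ'}

set_option maxHeartbeats 1000000 in
theorem Rel.add {e₁ e₂ : ReducedSections hπ} {e₁' e₂' : ReducedSections hπ'}
    (h₁ : φ.Rel e₁ e₁') (h₂ : φ.Rel e₂ e₂') : φ.Rel (e₁ + e₂) (e₁' + e₂') := by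
  obtain ⟨p₁, hp₁, h₁⟩ := h₁
  obtain ⟨p₂, hp₂, h₂⟩ := h₂
  refine ⟨p₁ + p₂, (congrArg₂ (· + ·) hp₁ hp₂ :), fun z => ?_⟩
  have hadd : dualFst hπ hπ' (e₁ + e₂).2.2 z = dualFst hπ hπ' e₁.2.2 z + dualFst hπ hπ' e₂.2.2 z :=
    basePullback_injective hπ (by
      rw [map_add, basePullback_dualFst, basePullback_dualFst, basePullback_dualFst]; rfl)
  have hadd' : dualSnd hπ hπ' (e₁' + e₂').2.2 z =
      dualSnd hπ hπ' e₁'.2.2 z + dualSnd hπ hπ' e₂'.2.2 z :=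
    basePullback_injective hπ' (by
      rw [map_add, basePullback_dualSnd, basePullback_dualSnd, basePullback_dualSnd]; rfl)
  rw [hadd, hadd', map_add, LinearMap.add_apply, ← h₁, ← h₂]
  ring

theorem Rel.smul {e : ReducedSections hπ} {e' : ReducedSections hπ'} (g : CB)
    (h : φ.Rel e e') : φ.Rel (g • e) (g • e') := by
  obtain ⟨p, hp, h⟩ := h
  refine ⟨g • p, ?_, fun z => ?_⟩
  · exact Prod.ext (congrArg (fun p => basePullback hπ g • Prod.fst p) hp)
      (congrArg (fun p => basePullback hπ' g • Prod.snd p) hp)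
  have hsmul : dualFst hπ hπ' (g • e).2.2 z = g * dualFst hπ hπ' e.2.2 z :=
    basePullback_injective hπ (by
      rw [map_mul, basePullback_dualFst, basePullback_dualFst]; rfl)
  have hsmul' : dualSnd hπ hπ' (g • e').2.2 z = g * dualSnd hπ hπ' e'.2.2 z :=
    basePullback_injective hπ' (by
      rw [map_mul, basePullback_dualSnd, basePullback_dualSnd]; rfl)
  rw [hsmul, hsmul', map_smul, LinearMap.smul_apply, ← h, smul_eq_mul, mul_sub]

theorem Rel.apply {e : ReducedSections hπ} {e' : ReducedSections hπ'} {p : relPairs hπ hπ'}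
    (h : ∀ z, dualFst hπ hπ' e.2.2 z - dualSnd hπ hπ' e'.2.2 z = φ.form p z)
    (z : relPairs hπ hπ') (q : Corr π π') :
    e.1.2 z.1.1 q.1.1 - e'.1.2 z.1.2 q.1.2 = (φ.form p z).1 (π q.1.1) := by
  rw [← h, ← basePullback_dualFst e.2.2, ← basePullback_dualSnd e'.2.2, basePullback_apply,
    basePullback_apply, ← q.2]
  rfl

/-- The action of a pair of sections on a difference of functions. -/
theorem Rel.derivation_apply {e : ReducedSections hπ} {e' : ReducedSections hπ'}
    {p : relPairs hπ hπ'}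
    (h : ∀ z, dualFst hπ hπ' e.2.2 z - dualSnd hπ hπ' e'.2.2 z = φ.form p z)
    (w z : relPairs hπ hπ') (q : Corr π π') :
    w.1.1.1 (e.1.2 z.1.1) q.1.1 - w.1.2.1 (e'.1.2 z.1.2) q.1.2 =
      w.1.1.1 (basePullback hπ (φ.form p z)) q.1.1 := by
  rw [← h, map_sub, map_sub, basePullback_dualFst, ← basePullback_dualSnd e'.2.2,
    ← w.2.2.2 _ q]
  rfl

/-- Evaluating the relation of each section on the pair of the other one, the two pairings differ by
φ(p₁, p₂) + φ(p₂, p₁) = 0, up to the factor 1/2. -/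
theorem Rel.pairing {H : EllipticForm k n M 3} {H' : EllipticForm k n' M' 3}
    (hH : IsInvariantForm H) (hH' : IsInvariantForm H')
    {e₁ e₂ : ReducedSections hπ} {e₁' e₂' : ReducedSections hπ'}
    (h₁ : φ.Rel e₁ e₁') (h₂ : φ.Rel e₂ e₂') :
    (reducedCourant hπ' H' hH').pairing e₁' e₂' = (reducedCourant hπ H hH).pairing e₁ e₂ := by
  obtain ⟨p₁, hp₁, h₁⟩ := h₁
  obtain ⟨p₂, hp₂, h₂⟩ := h₂
  refine base_ext hπ' fun y => ?_
  obtain ⟨x, hx⟩ := hπ.isQuotientMap.surjective (π' y)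
  set q : Corr π π' := ⟨(x, y), hx⟩ with hq
  have ha : (reducedCourant hπ H hH).pairing e₁ e₂ =
      descend hπ _ (courantPairing_invariant e₁.2 e₂.2) := rfl
  have hb : (reducedCourant hπ' H' hH').pairing e₁' e₂' =
      descend hπ' _ (courantPairing_invariant e₁'.2 e₂'.2) := rfl
  rw [← basePullback_apply (hπ := hπ'), ← hx, ← basePullback_apply (hπ := hπ), ha, hb,
    basePullback_descend, basePullback_descend]
  have e1 := Rel.apply h₂ p₁ q
  have e2 := Rel.apply h₁ p₂ q
  rw [φ.swap, hp₁] at e1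
  rw [hp₂] at e2
  change (1 / 2 : ℝ) * (e₂'.1.2 e₁'.1.1 y + e₁'.1.2 e₂'.1.1 y) =
    (1 / 2 : ℝ) * (e₂.1.2 e₁.1.1 x + e₁.1.2 e₂.1.1 x)
  change e₂.1.2 e₁.1.1 x - e₂'.1.2 e₁'.1.1 y = -(φ.form p₁ p₂).1 (π x) at e1
  change e₁.1.2 e₂.1.1 x - e₁'.1.2 e₂'.1.1 y = (φ.form p₁ p₂).1 (π x) at e2
  linarith

theorem Rel.anchor {H : EllipticForm k n M 3} {H' : EllipticForm k n' M' 3}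
    (hH : IsInvariantForm H) (hH' : IsInvariantForm H')
    {e : ReducedSections hπ} {e' : ReducedSections hπ'} (h : φ.Rel e e') :
    (reducedCourant hπ' H' hH').anchor e' = (reducedCourant hπ H hH).anchor e := by
  obtain ⟨p, hp, h⟩ := h
  ext1 f
  refine base_ext hπ' fun y => ?_
  obtain ⟨x, hx⟩ := hπ.isQuotientMap.surjective (π' y)
  have ha : (reducedCourant hπ H hH).anchor e f = descend hπ _ (anchor_invariant hπ e f) := rfl
  have hb : (reducedCourant hπ' H' hH').anchor e' f = descend hπ' _ (anchor_invariant hπ' e' f) := rfl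
  rw [← basePullback_apply (hπ := hπ'), ← hx, ← basePullback_apply (hπ := hπ), ha, hb,
    basePullback_descend, basePullback_descend]
  have h1 := p.2.2.2 f ⟨(x, y), hx⟩
  rw [hp] at h1
  exact h1.symm

set_option maxHeartbeats 1000000 in
-- Evaluate both Dorfman brackets on a pair z. By the two relations, each difference of a term over
-- M and the corresponding term over M' becomes a term in φ, and the difference of the H-terms is
-- dF. All terms of dF cancel except φ([p₁, p₂], z), which is the relation for the brackets.
theorem Rel.bracket {F : CorrTwoForm k n n' π π'} {H : EllipticForm k n M 3}
    {H' : EllipticForm k n' M' 3} (hF : F.IsPrimitive H H')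
    (hφ : ∀ (p p' : relPairs hπ hπ') (q : Corr π π'),
      (φ.form p p').1 (π q.1.1) = F.ev q (relBox p) (relBox p'))
    (hH : IsInvariantForm H) (hH' : IsInvariantForm H')
    {e₁ e₂ : ReducedSections hπ} {e₁' e₂' : ReducedSections hπ'}
    (h₁ : φ.Rel e₁ e₁') (h₂ : φ.Rel e₂ e₂') :
    φ.Rel ((reducedCourant hπ H hH).bracket e₁ e₂)
      ((reducedCourant hπ' H' hH').bracket e₁' e₂') := by
  obtain ⟨p₁, hp₁, h₁⟩ := h₁
  obtain ⟨p₂, hp₂, h₂⟩ := h₂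
  have hfst₁ : e₁.1.1 = p₁.1.1 := (congrArg Prod.fst hp₁).symm
  have hsnd₁ : e₁'.1.1 = p₁.1.2 := (congrArg Prod.snd hp₁).symm
  have hfst₂ : e₂.1.1 = p₂.1.1 := (congrArg Prod.fst hp₂).symm
  have hsnd₂ : e₂'.1.1 = p₂.1.2 := (congrArg Prod.snd hp₂).symm
  refine ⟨⁅p₁, p₂⁆, Prod.ext (congrArg₂ (fun X Y => ⁅X, Y⁆) hfst₁ hfst₂).symm
    (congrArg₂ (fun X Y => ⁅X, Y⁆) hsnd₁ hsnd₂).symm, fun z => base_ext hπ fun x => ?_⟩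
  obtain ⟨y, hy⟩ := hπ'.isQuotientMap.surjective (π x)
  set q : Corr π π' := ⟨(x, y), hy.symm⟩ with hq
  have ha : (dualFst hπ hπ' ((reducedCourant hπ H hH).bracket e₁ e₂).2.2 z).1 (π x) =
      dorfmanForm H p₁.1.1 e₁.1.2 p₂.1.1 e₂.1.2 z.1.1 x := by
    rw [← hfst₁, ← hfst₂]
    exact congrArg (fun F : SmoothFn n M => F x) (basePullback_dualFst _ z)
  have hb : (dualSnd hπ hπ' ((reducedCourant hπ' H' hH').bracket e₁' e₂').2.2 z).1 (π x) =
      dorfmanForm H' p₁.1.2 e₁'.1.2 p₂.1.2 e₂'.1.2 z.1.2 y := by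
    rw [← hsnd₁, ← hsnd₂, ← hy]
    exact congrArg (fun F : SmoothFn n' M' => F y) (basePullback_dualSnd _ z)
  change (dualFst hπ hπ' _ z).1 (π x) - (dualSnd hπ hπ' _ z).1 (π x) = _
  rw [ha, hb]
  have d1 := Rel.derivation_apply h₂ p₁ z q
  have d2 := Rel.derivation_apply h₁ p₂ z q
  have d3 := Rel.derivation_apply h₁ z p₂ q
  have a1 := Rel.apply h₂ ⁅p₁, z⁆ q
  have a2 := Rel.apply h₁ ⁅p₂, z⁆ q
  -- The order p₂, p₁, z reflects ι_X ι_Y H = H(Y, X, ·) in the bracket.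
  have hd := hF.apply_relPairs hφ p₂ p₁ z q
  have hs : φ.form p₂ p₁ = -φ.form p₁ p₂ := φ.swap _ _
  have s1 : φ.form ⁅p₂, z⁆ p₁ = -φ.form p₁ ⁅p₂, z⁆ := φ.swap _ _
  have s2 : φ.form ⁅p₁, z⁆ p₂ = -φ.form p₂ ⁅p₁, z⁆ := φ.swap _ _
  have s3 : ⁅p₂, p₁⁆ = -⁅p₁, p₂⁆ := relPairs_ext (lie_skew _ _).symm (lie_skew _ _).symm
  rw [hs, s1, s2, s3, map_neg, map_neg, map_neg, LinearMap.neg_apply] at hd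
  change (p₁.1.1.1 (e₂.1.2 z.1.1) x - e₂.1.2 ⁅p₁.1.1, z.1.1⁆ x) -
      (p₂.1.1.1 (e₁.1.2 z.1.1) x - z.1.1.1 (e₁.1.2 p₂.1.1) x - e₁.1.2 ⁅p₂.1.1, z.1.1⁆ x) +
      H ![p₂.1.1, p₁.1.1, z.1.1] x -
    ((p₁.1.2.1 (e₂'.1.2 z.1.2) y - e₂'.1.2 ⁅p₁.1.2, z.1.2⁆ y) -
      (p₂.1.2.1 (e₁'.1.2 z.1.2) y - z.1.2.1 (e₁'.1.2 p₂.1.2) y - e₁'.1.2 ⁅p₂.1.2, z.1.2⁆ y) +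
      H' ![p₂.1.2, p₁.1.2, z.1.2] y) = (φ.form ⁅p₁, p₂⁆ z).1 (π x)
  change p₁.1.1.1 (e₂.1.2 z.1.1) x - p₁.1.2.1 (e₂'.1.2 z.1.2) y =
    p₁.1.1.1 (basePullback hπ (φ.form p₂ z)) x at d1
  change p₂.1.1.1 (e₁.1.2 z.1.1) x - p₂.1.2.1 (e₁'.1.2 z.1.2) y =
    p₂.1.1.1 (basePullback hπ (φ.form p₁ z)) x at d2
  change z.1.1.1 (e₁.1.2 p₂.1.1) x - z.1.2.1 (e₁'.1.2 p₂.1.2) y =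
    z.1.1.1 (basePullback hπ (φ.form p₁ p₂)) x at d3
  change e₂.1.2 ⁅p₁.1.1, z.1.1⁆ x - e₂'.1.2 ⁅p₁.1.2, z.1.2⁆ y = (φ.form p₂ ⁅p₁, z⁆).1 (π x) at a1
  change e₁.1.2 ⁅p₂.1.1, z.1.1⁆ x - e₁'.1.2 ⁅p₂.1.2, z.1.2⁆ y = (φ.form p₁ ⁅p₂, z⁆).1 (π x) at a2
  change H ![p₂.1.1, p₁.1.1, z.1.1] x - H' ![p₂.1.2, p₁.1.2, z.1.2] y =
    p₂.1.1.1 (basePullback hπ (φ.form p₁ z)) x - p₁.1.1.1 (basePullback hπ (φ.form p₂ z)) x +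
    -z.1.1.1 (basePullback hπ (φ.form p₁ p₂)) x - -(φ.form ⁅p₁, p₂⁆ z).1 (π x) +
    -(φ.form p₁ ⁅p₂, z⁆).1 (π x) - -(φ.form p₂ ⁅p₁, z⁆).1 (π x) at hd
  linarith

variable (φ) in
/-- The isomorphism of modules of sections defined by a pairing. -/
theorem exists_linearEquiv : ∃ f : ReducedSections hπ ≃ₗ[CB] ReducedSections hπ',
    ∀ e, φ.Rel e (f e) := by
  choose f hf using φ.exists_rel
  choose g hg using φ.symm.exists_rel
  have hg' : ∀ e', φ.Rel (g e') e' := fun e' => (hg e').symm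
  exact ⟨{ toFun := f
           map_add' := fun e₁ e₂ => (hf _).unique ((hf e₁).add (hf e₂))
           map_smul' := fun a e => (hf _).unique ((hf e).smul a)
           invFun := g
           left_inv := fun e => (hg (f e)).unique (hf e).symm
           right_inv := fun e' => (hf _).unique (hg' e') }, hf⟩

end RelPairing

theorem IsTDual.nonempty_courantIso {H : EllipticForm k n M 3} {H' : EllipticForm k n' M' 3}
    (hT : IsTDual π π' H H') (hπ : IsStandardQuotient k n CB π)
    (hπ' : IsStandardQuotient k n' CB π') (hH : IsInvariantForm H) (hH' : IsInvariantForm H') :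
    Nonempty (CourantIso (reducedCourant hπ H hH) (reducedCourant hπ' H' hH')) := by
  obtain ⟨F, hF, hF', hF''⟩ := hT
  obtain ⟨φ, hφ⟩ := CorrTwoForm.exists_relPairing (hπ := hπ) (hπ' := hπ') hF hF''
  obtain ⟨f, hf⟩ := φ.exists_linearEquiv
  exact ⟨{ f with
    map_pairing := fun e₁ e₂ => (hf e₁).pairing hH hH' (hf e₂)
    map_bracket := fun e₁ e₂ => (hf _).unique ((hf e₁).bracket hF' hφ hH hH' (hf e₂))
    map_anchor := fun e => (hf e).anchor hH hH' }⟩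

end Isomorphism

end

end EllipticTDuality

theorem mainTheorem1 {k n n' : ℕ} {M M' B : Type*}
    [TopologicalSpace M] [T2Space M] [SecondCountableTopology M]
    [ChartedSpace (EuclideanSpace ℝ (Fin n)) M] [IsManifold (𝓡 n) ∞ M]
    [TopologicalSpace M'] [T2Space M'] [SecondCountableTopology M']
    [ChartedSpace (EuclideanSpace ℝ (Fin n')) M'] [IsManifold (𝓡 n') ∞ M']
    [MulAction (Torus k) M] [SmoothTorusAction k n M]
    [MulAction (Torus k) M'] [SmoothTorusAction k n' M']
    [TopologicalSpace B] (CB : Subalgebra ℝ (B → ℝ)) (π : M → B) (π' : M' → B)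
    (hπ : IsStandardQuotient k n CB π) (hπ' : IsStandardQuotient k n' CB π')
    (H : EllipticForm k n M 3) (H' : EllipticForm k n' M' 3)
    (hH : IsClosedForm H) (hH' : IsClosedForm H')
    (hHinv : IsInvariantForm H) (hHinv' : IsInvariantForm H')
    (hT : IsTDual π π' H H') :
    Nonempty (CourantIso (reducedCourant hπ H hHinv) (reducedCourant hπ' H' hHinv')) := by
  exact hT.nonempty_courantIso hπ hπ' hHinv hHinv'
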